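/- We work over $\mathbb{C}$. A generalized pair $(X,B+M)$ with data $X'\xrightarrow{f}X\to Z$ and $M'=\sum_j\mu_jM_j'$ consists of a normal variety $X$ with a projective morphism $X\to Z$, an $\mathbb{R}$-divisor $B\ge 0$, a projective birational morphism $f:X'\to X$ from a normal variety, and finitely many divisors $M_j'$ on $X'$ that are b-Cartier ($\mathbb{Q}$-Cartier, with Cartier pullback to some birational model) and nef over $Z$, with real numbers $\mu_j\ge 0$, such that $K_X+B+M$ is $\mathbb{R}$-Cartier, where $M=f_*M'$. For a prime divisor $E$ on a birational model $Y\to X$ factoring through $X'$, write $K_Y+B_Y+M_Y=g^*(K_X+B+M)$, where $g:Y\to X$ and $M_Y$ is the pullback of $M'$; the generalized log discrepancy is $a(E,X,B+M)=1-\operatorname{mult}_EB_Y$, and $(X,B+M)$ is generalized $\epsilon$-lc if all of these are $\ge\epsilon$ (generalized lc if $\epsilon=0$). Let $z\in Z$ be a (not necessarily closed) point. With $f$, $M_j'$ fixed, and $M^{+\prime}=\sum_j\mu_j^+M_j'$: * $(X/Z\ni z,B^++M^+)$ is an $(\epsilon,\mathbb{R})$-complement of $(X/Z\ni z,B+M)$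 if, over a neighbourhood of $z$, $(X,B^++M^+)$ is a generalized lc and generalized $\epsilon$-lc generalized pair, $B^+\ge B$, $\mu_j^+\ge\mu_j$ for all $j$, and $K_X+B^++M^+\equiv 0$. If one exists, $(X/Z\ni z,B+M)$ is called $(\epsilon,\mathbb{R})$-complementary. * It is an $(\epsilon,n)$-complement if, over a neighbourhood of $z$, $(X,B^++M^+)$ is a generalized lc and generalized $\epsilon$-lc generalized pair, $n(K_X+B^++M^+)\sim 0$, $nB^+\ge n\lfloor B\rfloor+\lfloor (n+1)\{B\}\rfloor$, $n\mu_j^+\ge n\lfloor\mu_j\rfloor+\lfloor(n+1)\{\mu_j\}\rfloor$ for all $j$, and $nM^{+\prime}$ is b-Cartier. It is monotonic if moreover $B^+\ge B$ over a neighbourhood of $z$ and $\mu_j^+\ge\mu_j$ for all $j$. * Let $\bm{\epsilon}=\{\epsilon_i\}$ be a finite set of non-negative real numbers, $n$ a positive integer and $\Gamma_0\subseteq(0,1]$ a finite set. An $(\epsilon,\mathbb{R})$-complement $(X/Z\ni z,B^++M^+)$ is $(\bm\epsilon,n,\Gamma_0)$-decomposable if there are finitely many $a_i\in\Gamma_0$,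 $\epsilon_i\in\bm\epsilon$, boundaries $B_i^+$ and nef parts $M_i^{+\prime}=\sum_j\mu_{ij}^+M_j'$ with $\sum a_i=1$, $\sum a_i\epsilon_i\ge\epsilon$, $B^+=\sum a_iB_i^+$, $\mu_j^+=\sum_ia_i\mu_{ij}^+$ for all $j$, such that $(X/Z\ni z,B_i^++M_i^+)$ is an $(\epsilon_i,n)$-complement of itself for every $i$. Let $d$ be a positive integer, $\epsilon\ge 0$ a real number and $\Gamma\subseteq[0,1]$ a set satisfying the descending chain condition. Let $\mathcal{G}(d,\Gamma)$ be the class of generalized pairs as above such that $\dim X=d$, $X\to Z$ is a contraction with $X$ of Fano type over $Z$, the coefficients of $B$ lie in $\Gamma$, and every $\mu_j\in\Gamma$. Denote by $\bar\Gamma$ the closure of $\Gamma$ in $\mathbb{R}$. **Conjecture A$(d,\epsilon,\Gamma)$.** There are a positive integer $n$, a finite set $\bm\epsilon$ of non-negative real numbers and a finite set $\Gamma_0\subseteq(0,1]$ such that for every $(X,B+M)\in\mathcal{G}(d,\Gamma)$ for which $(X/Z\ni z',B+M)$ is $(\epsilon,\mathbb{R})$-complementary for every $z'\in Z$, and for every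 point $z\in Z$, there is an $(\bm\epsilon,n,\Gamma_0)$-decomposable $(\epsilon,\mathbb{R})$-complement $(X/Z\ni z,B^++M^+)$ of $(X/Z\ni z,B+M)$. Moreover, if $\bar\Gamma\subseteq\mathbb{Q}$, then we may pick $\Gamma_0=\{1\}$ and $(X/Z\ni z,B^++M^+)$ to be a monotonic $(\epsilon,n)$-complement of $(X/Z\ni z,B+M)$. **Conjecture B$(d,p,\epsilon,\Gamma)$** ($p$ a positive integer). There is a positive integer $n$ divisible by $p$ such that for every $(X,B+M)\in\mathcal{G}(d,\Gamma)$ and every point $z\in Z$ such that $(X/Z\ni z,B+M)$ is $(\epsilon,\mathbb{R})$-complementary, there is an $(\epsilon,n)$-complement $(X/Z\ni z,B^++M^+)$ of $(X/Z\ni z,B+M)$. Moreover, if $\operatorname{Span}_{\mathbb{Q}_{\ge0}}\big((\bar\Gamma\cup\{\epsilon\})\setminus\mathbb{Q}\big)\cap(\mathbb{Q}\setminus\{0\})=\emptyset$, then we may pick it monotonic. **Proposition.** For all $d$, $\epsilon\ge 0$ and $\Gamma$ as above: if Conjecture A$(d,\epsilon,\Gamma)$ holds, then Conjecture B$(d,p,\epsilon,\Gamma)$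 holds for every positive integer $p$. -/

import Mathlib

open CategoryTheory CategoryTheory.Limits AlgebraicGeometry TopologicalSpace
open scoped NNRat

noncomputable section

namespace GenPair

/-! ### Complex varieties -/

/-- A (complex) variety: an integral separated scheme of finite type over `ℂ`. -/
structure Variety : Type 1 where
  sch : Scheme.{0}
  str : sch ⟶ Spec (CommRingCat.of ℂ)
  [isIntegral : IsIntegral sch]
  [isSeparated : IsSeparated str]
  [locallyOfFiniteType : LocallyOfFiniteType str]
  [quasiCompact : QuasiCompact str]

attribute [instance] Variety.isIntegral Variety.isSeparated Variety.locallyOfFiniteType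
  Variety.quasiCompact

instance (X : Variety) : IsLocallyNoetherian X.sch :=
  LocallyOfFiniteType.isLocallyNoetherian X.str

/-- The function field of a variety. -/
abbrev Variety.K (X : Variety) : Type := X.sch.functionField

/-- The function field is a `ℂ`-algebra through the structure morphism. -/
instance (X : Variety) : Algebra ℂ X.K :=
  haveI : Nonempty (⊤ : X.sch.Opens) := ⟨⟨genericPoint X.sch, trivial⟩⟩
  ((Scheme.ΓSpecIso (CommRingCat.of ℂ)).inv ≫ X.str.appTop ≫
    X.sch.germToFunctionField ⊤).hom.toAlgebra

/-- All local rings are integrally closed. -/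
def Variety.IsNormal (X : Variety) : Prop :=
  ∀ x : X.sch, IsIntegrallyClosed (X.sch.presheaf.stalk x)

/-- The dimension of a variety. -/
def Variety.dim (X : Variety) : ℕ :=
  ((topologicalKrullDim X.sch).unbotD 0).toNat

/-- `g` is a morphism of varieties over `ℂ`. -/
def IsOverC {Y X : Variety} (g : Y.sch ⟶ X.sch) : Prop := g ≫ X.str = Y.str

/-- Projective `n`-space over `ℤ`. -/
def projectiveSpaceInt (n : ℕ) : Scheme.{0} :=
  letI : GradedAlgebra (MvPolynomial.homogeneousSubmodule (Fin (n + 1)) ℤ) :=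
    MvPolynomial.gradedAlgebra
  Proj (MvPolynomial.homogeneousSubmodule (Fin (n + 1)) ℤ)

/-- `g : Y ⟶ X` is projective: it is a closed immersion into some `ℙⁿ_X = ℙⁿ_ℤ × X`, followed by
the projection to `X`. -/
def IsProjective {Y X : Scheme.{0}} (g : Y ⟶ X) : Prop :=
  ∃ (n : ℕ) (i : Y ⟶ pullback (terminal.from (projectiveSpaceInt n)) (terminal.from X)),
    IsClosedImmersion i ∧ i ≫ pullback.snd _ _ = g

/-- `g : Y ⟶ X` is birational: an isomorphism over a nonempty open subset of `X`. -/
def IsBirational {Y X : Variety} (g : Y.sch ⟶ X.sch) : Prop :=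
  ∃ V : X.sch.Opens, (V : Set X.sch).Nonempty ∧ IsIso (g ∣_ V)

/-- `π : X ⟶ Z` is a contraction: `π` is a projective morphism over `ℂ` and `π_* 𝒪_X = 𝒪_Z`. -/
def IsContraction {X Z : Variety} (π : X.sch ⟶ Z.sch) : Prop :=
  IsOverC π ∧ IsProjective π ∧ ∀ U : Z.sch.Opens, Function.Bijective (π.app U).hom

/-- A (proper, normal) birational model `g : Y ⟶ X` of `X`. -/
structure IsModel {Y X : Variety} (g : Y.sch ⟶ X.sch) : Prop where
  normal : Y.IsNormal
  isOverC : IsOverC g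
  proper : IsProper g
  birational : IsBirational g

/-! ### Function fields and pull back -/

/-- Pull back of rational functions along a dominant morphism `g : Y ⟶ X`; dominance is expressed
by saying that the image of the generic point of `Y` specializes to the generic point of `X`. -/
def pullHom {Y X : Variety} (g : Y.sch ⟶ X.sch)
    (h : g (genericPoint Y.sch) ⤳ genericPoint X.sch) : X.K →+* Y.K :=
  (X.sch.presheaf.stalkSpecializes h ≫ g.stalkMap (genericPoint Y.sch)).hom

/-- Pull back of rational functions along a dominant morphism (and `0` if `g` is not dominant,
a case that does not occur below). -/
def pullFun {Y X : Variety} (g : Y.sch ⟶ X.sch) (φ : X.K) : Y.K :=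
  open Classical in
  if h : g (genericPoint Y.sch) ⤳ genericPoint X.sch then pullHom g h φ else 0

/-- The image of the local ring of `Y` at `y` in the function field. -/
def localSubring (Y : Variety) (y : Y.sch) : Subring Y.K :=
  (algebraMap (Y.sch.presheaf.stalk y) Y.K).range

/-- The ring of rational functions on `X` which are regular at `y` when pulled back along the
dominant morphism `g`. -/
def regularAt {Y X : Variety} (g : Y.sch ⟶ X.sch) (y : Y.sch) : Subring X.K :=
  open Classical in
  if h : g (genericPoint Y.sch) ⤳ genericPoint X.sch then
    (localSubring Y y).comap (pullHom g h)
  else ⊤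

/-! ### Divisors -/

/-- Prime divisors, given by their generic points: the points of codimension one. -/
abbrev PrimeDivisor (X : Variety) : Type := {x : X.sch // Order.coheight x = 1}

/-- `ℝ`-divisors: finite formal `ℝ`-linear combinations of prime divisors. -/
abbrev RDivisor (X : Variety) : Type := PrimeDivisor X →₀ ℝ

/-- The order of a rational function along a prime divisor. -/
def ordAt {X : Variety} (P : PrimeDivisor X) (φ : X.K) : ℤ := X.sch.ord φ P.1

/-- The rational function `φ` is a local equation of the integral Weil divisor `A` at `x`. -/
def IsLocalEq {X : Variety} (A : PrimeDivisor X → ℤ) (x : X.sch) (φ : X.K) : Prop :=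
  φ ≠ 0 ∧ ∃ U : X.sch.Opens, x ∈ U ∧ ∀ P : PrimeDivisor X, P.1 ∈ U → A P = ordAt P φ

/-- The integral Weil divisor `A` is Cartier on the open subset `V`. -/
def IsCartierOn {X : Variety} (V : X.sch.Opens) (A : PrimeDivisor X → ℤ) : Prop :=
  ∀ x ∈ V, ∃ φ : X.K, IsLocalEq A x φ

/-- `D = ∑ r_i A_i` on `V`, where `A_1, …, A_m` are Cartier on `V`. -/
def IsCartierDecomp {X : Variety} (V : X.sch.Opens) (D : PrimeDivisor X → ℝ) {m : ℕ}
    (r : Fin m → ℝ) (A : Fin m → PrimeDivisor X → ℤ) : Prop :=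
  (∀ i, IsCartierOn V (A i)) ∧
    ∀ P : PrimeDivisor X, P.1 ∈ V → D P = ∑ i, r i * (A i P : ℝ)

/-- `D` is `ℝ`-Cartier on `V`. -/
def IsRCartierOn {X : Variety} (V : X.sch.Opens) (D : PrimeDivisor X → ℝ) : Prop :=
  ∃ (m : ℕ) (r : Fin m → ℝ) (A : Fin m → PrimeDivisor X → ℤ), IsCartierDecomp V D r A

/-- `D` is `ℚ`-Cartier on `V`: some positive multiple is an integral Cartier divisor on `V`. -/
def IsQCartierOn {X : Variety} (V : X.sch.Opens) (D : PrimeDivisor X → ℝ) : Prop :=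
  ∃ (m : ℕ) (A : PrimeDivisor X → ℤ), 0 < m ∧ IsCartierOn V A ∧
    ∀ P : PrimeDivisor X, P.1 ∈ V → (m : ℝ) * D P = A P

/-- `D ∼ 0` on `V`: there `D` is the divisor of a rational function. -/
def IsPrincipalOn {X : Variety} (V : X.sch.Opens) (D : PrimeDivisor X → ℝ) : Prop :=
  ∃ φ : X.K, φ ≠ 0 ∧ ∀ P : PrimeDivisor X, P.1 ∈ V → D P = ordAt P φ

/-- `t` is the coefficient of `g^* D` at the prime divisor `E` of `Y`: locally at the image of the
generic point of `E`, one has `D = ∑ r_k div(φ_k)`, and `t = ∑ r_k ord_E(g^* φ_k)`. -/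
def HasPullCoeff {Y X : Variety} (g : Y.sch ⟶ X.sch) (D : PrimeDivisor X → ℝ)
    (E : PrimeDivisor Y) (t : ℝ) : Prop :=
  ∃ (m : ℕ) (r : Fin m → ℝ) (φ : Fin m → X.K) (U : X.sch.Opens),
    (∀ k, φ k ≠ 0) ∧ g E.1 ∈ U ∧
    (∀ P : PrimeDivisor X, P.1 ∈ U → D P = ∑ k, r k * (ordAt P (φ k) : ℝ)) ∧
    t = ∑ k, r k * (ordAt E (pullFun g (φ k)) : ℝ)

/-- The coefficient of `g^* D` at `E` (used only where `D` is `ℝ`-Cartier near the image of `E`;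
the value `0` elsewhere is a placeholder). -/
def pullCoeff {Y X : Variety} (g : Y.sch ⟶ X.sch) (D : PrimeDivisor X → ℝ)
    (E : PrimeDivisor Y) : ℝ :=
  open Classical in
  if h : ∃ t, HasPullCoeff g D E t then h.choose else 0

/-- The coefficient at `P` of the strict transform `f_* D` of a divisor `D` on a birational
model. -/
def pushCoeff {Y X : Variety} (f : Y.sch ⟶ X.sch) (D : RDivisor Y) (P : PrimeDivisor X) : ℝ :=
  ∑ᶠ (Q : PrimeDivisor Y) (_ : f Q.1 = P.1), D Q

/-- `D` is b-Cartier on `V`: it is `ℚ`-Cartier there, and its pull back to some birational model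
is (integral and) Cartier over `V`. -/
def IsBCartierOn {X : Variety} (V : X.sch.Opens) (D : RDivisor X) : Prop :=
  IsQCartierOn V D ∧
  ∃ (Y : Variety) (g : Y.sch ⟶ X.sch) (A : PrimeDivisor Y → ℤ), IsModel g ∧
    IsCartierOn (g ⁻¹ᵁ V) A ∧
    ∀ E : PrimeDivisor Y, E.1 ∈ g ⁻¹ᵁ V → pullCoeff g D E = A E

/-! ### Intersection with curves, nefness -/

/-- A smooth projective curve with a morphism to `X`. -/
structure CurveTo (X : Variety) : Type 1 where
  C : Variety
  normal : C.IsNormal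
  dim_eq : topologicalKrullDim C.sch = 1
  proper : IsProper C.str
  ν : C.sch ⟶ X.sch
  isOverC : IsOverC ν

/-- The degree of `ν^* 𝒪_X(A)` on the curve is `n`, where `A` is Cartier near the image of the
curve. Let `ξ` be the image of the generic point, and `ψ` a local equation of `A` at `ξ`. At each
closed point `c` the divisor `A` has a local equation `s_c ψ` with `s_c` a unit of `𝒪_{X,ξ}`, and
`n = ∑_c ord_c(ν^* s_c)`. -/
def CurveTo.HasDegree {X : Variety} (c : CurveTo X) (A : PrimeDivisor X → ℤ) (n : ℤ) : Prop :=
  ∃ (ψ : X.K) (s : PrimeDivisor c.C → X.sch.presheaf.stalk (c.ν (genericPoint c.C.sch))),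
    IsLocalEq A (c.ν (genericPoint c.C.sch)) ψ ∧
    (∀ Q, IsUnit (s Q) ∧ IsLocalEq A (c.ν Q.1) (algebraMap _ X.K (s Q) * ψ)) ∧
    n = ∑ᶠ Q : PrimeDivisor c.C,
      ordAt Q ((c.ν.stalkMap (genericPoint c.C.sch)).hom (s Q) : c.C.K)

/-- The intersection number of the `ℝ`-Cartier divisor `D` with the curve is `t`. -/
def CurveTo.HasIntersection {X : Variety} (c : CurveTo X) (D : PrimeDivisor X → ℝ) (t : ℝ) :
    Prop :=
  ∃ (V : X.sch.Opens) (m : ℕ) (r : Fin m → ℝ) (A : Fin m → PrimeDivisor X → ℤ) (n : Fin m → ℤ),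
    (∀ y, c.ν y ∈ V) ∧ IsCartierDecomp V D r A ∧ (∀ i, c.HasDegree (A i) (n i)) ∧
    t = ∑ i, r i * (n i : ℝ)

/-- The curve is contracted by `q : X ⟶ Z` to a point of `W`. -/
def CurveTo.IsContractedIn {X Z : Variety} (c : CurveTo X) (q : X.sch ⟶ Z.sch) (W : Z.sch.Opens) :
    Prop :=
  ∃ z ∈ W, ∀ y, q (c.ν y) = z

/-- `D` is nef over the open subset `W` of `Z`. -/
def IsNefOver {X Z : Variety} (q : X.sch ⟶ Z.sch) (W : Z.sch.Opens) (D : PrimeDivisor X → ℝ) :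
    Prop :=
  IsRCartierOn (q ⁻¹ᵁ W) D ∧
    ∀ c : CurveTo X, c.IsContractedIn q W → ∀ t, c.HasIntersection D t → 0 ≤ t

/-- `D ≡ 0` over the open subset `W` of `Z`. -/
def IsNumTrivialOver {X Z : Variety} (q : X.sch ⟶ Z.sch) (W : Z.sch.Opens)
    (D : PrimeDivisor X → ℝ) : Prop :=
  IsRCartierOn (q ⁻¹ᵁ W) D ∧
    ∀ c : CurveTo X, c.IsContractedIn q W → ∀ t, c.HasIntersection D t → t = 0

/-- `D` is big over `Z`: on the generic fibre `F` of `q`, the dimension over `K(Z)` of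
`H⁰(F, 𝒪_F(⌊m D⌋))` is at least `c m ^ dim F` for some `c > 0` and infinitely many `m`. -/
def IsBigOver {X Z : Variety} (q : X.sch ⟶ Z.sch) (D : PrimeDivisor X → ℝ) : Prop :=
  ∃ c : ℝ, 0 < c ∧ ∃ᶠ m : ℕ in Filter.atTop, ∃ (k : ℕ) (s : Fin k → X.K),
    c * (m : ℝ) ^ (X.dim - Z.dim) ≤ k ∧
    (∀ i, s i ≠ 0 ∧ ∀ P : PrimeDivisor X, q P.1 = genericPoint Z.sch →
      0 ≤ ordAt P (s i) + ⌊(m : ℝ) * D P⌋) ∧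
    ∀ b : Fin k → Z.K, ∑ i, pullFun q (b i) * s i = 0 → ∀ i, b i = 0

/-! ### Canonical divisors -/

/-- Rational differential forms of top degree. -/
abbrev TopForm (X : Variety) : Type := ⋀[X.K]^(X.dim) (Ω[X.K⁄ℂ])

/-- For a birational `g : Y ⟶ X`, the order along the prime divisor `E` of `Y` of the form `g^* ω`.
Writing `𝒪` for the local ring at `E`, a subring of `K(X) = K(Y)`, and `d = dim X`: the `𝒪`-module
generated by the forms `da_1 ∧ ⋯ ∧ da_d`, `a_i ∈ 𝒪`, is free of rank one, and `g^* ω` has order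
`ord_E(φ)` if `ω` generates `φ` times this module. -/
def formOrd {Y X : Variety} (g : Y.sch ⟶ X.sch) (ω : TopForm X) (E : PrimeDivisor Y) : ℤ :=
  open Classical in
  let S : Subring X.K := regularAt g E.1
  if h : ∃ φ : X.K, φ ≠ 0 ∧
      Submodule.span S {ω} = Submodule.span S (Set.range fun a : Fin X.dim → S =>
        φ • exteriorPower.ιMulti X.K X.dim
          (fun i => KaehlerDifferential.D ℂ X.K (a i : X.K)))
  then ordAt E (pullFun g h.choose) else 0

/-- The canonical divisor `K_X = div(ω)` of a nonzero rational top form. -/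
def canonicalCoeff {X : Variety} (ω : TopForm X) (P : PrimeDivisor X) : ℤ :=
  formOrd (𝟙 X.sch) ω P

/-! ### Fano type -/

/-- `X` is of Fano type over `Z`: `X ⟶ Z` is a contraction, `(X, C)` is klt and `-(K_X + C)` is
nef and big over `Z` for some boundary `C`. -/
def IsFanoType {X Z : Variety} (π : X.sch ⟶ Z.sch) : Prop :=
  IsContraction π ∧ X.IsNormal ∧
  ∃ (ω : TopForm X) (C : RDivisor X), ω ≠ 0 ∧ (∀ P, 0 ≤ C P ∧ C P ≤ 1) ∧
    IsRCartierOn ⊤ (fun P => canonicalCoeff ω P + C P) ∧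
    (∀ (Y : Variety) (g : Y.sch ⟶ X.sch), IsModel g → ∀ E : PrimeDivisor Y,
      0 < 1 + (formOrd g ω E : ℝ) - pullCoeff g (fun P => canonicalCoeff ω P + C P) E) ∧
    IsNefOver π ⊤ (fun P => -(canonicalCoeff ω P + C P)) ∧
    IsBigOver π (fun P => -(canonicalCoeff ω P + C P))

/-! ### Generalized pairs -/

/-- The data `X' ⟶ X ⟶ Z`, `M'_1, …, M'_J` on which generalized pairs `(X, B + M)` with
`M' = ∑ μ_j M'_j` are built, together with the choice of a canonical divisor `K_X = div(ω)`. -/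
structure Data : Type 1 where
  Z : Variety
  X : Variety
  X' : Variety
  π : X.sch ⟶ Z.sch
  f : X'.sch ⟶ X.sch
  X_normal : X.IsNormal
  π_over : IsOverC π
  π_projective : IsProjective π
  f_model : IsModel f
  f_projective : IsProjective f
  J : ℕ
  M' : Fin J → RDivisor X'
  ω : TopForm X
  ω_ne_zero : ω ≠ 0

namespace Data

variable (𝒟 : Data)

/-- The morphism `X' ⟶ Z`. -/
def πf : 𝒟.X'.sch ⟶ 𝒟.Z.sch := 𝒟.f ≫ 𝒟.π

/-- The nef part `M' = ∑ μ_j M'_j` on `X'`. -/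
def nefPart (μ : Fin 𝒟.J → ℝ) : RDivisor 𝒟.X' := ∑ j, μ j • 𝒟.M' j

/-- The divisor `K_X + B + M`, where `M = f_* M'`. -/
def adjoint (B : RDivisor 𝒟.X) (μ : Fin 𝒟.J → ℝ) (P : PrimeDivisor 𝒟.X) : ℝ :=
  canonicalCoeff 𝒟.ω P + B P + pushCoeff 𝒟.f (𝒟.nefPart μ) P

/-- Every `M'_j` is a b-Cartier divisor which is nef over `Z`. -/
def HasBCartierNefParts : Prop :=
  ∀ j, IsBCartierOn ⊤ (𝒟.M' j) ∧ IsNefOver 𝒟.πf ⊤ (𝒟.M' j)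

/-- Over the open subset `W` of `Z`, `(X, B + M)` with `M' = ∑ μ_j M'_j`, `μ_j ≥ 0`, is a
generalized pair. -/
def IsGenPairOver (W : 𝒟.Z.sch.Opens) (B : RDivisor 𝒟.X) (μ : Fin 𝒟.J → ℝ) : Prop :=
  (∀ P : PrimeDivisor 𝒟.X, 𝒟.π P.1 ∈ W → 0 ≤ B P) ∧ (∀ j, 0 ≤ μ j) ∧
  IsNefOver 𝒟.πf W (𝒟.nefPart μ) ∧ IsRCartierOn (𝒟.π ⁻¹ᵁ W) (𝒟.adjoint B μ)

/-- The generalized log discrepancy `a(E, X, B + M)` of a prime divisor `E` on a model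
`h : Y ⟶ X'`, that is, `1 - mult_E B_Y` where `K_Y + B_Y + h^* M' = (f h)^* (K_X + B + M)`. -/
def logDiscrepancy (B : RDivisor 𝒟.X) (μ : Fin 𝒟.J → ℝ) {Y : Variety} (h : Y.sch ⟶ 𝒟.X'.sch)
    (E : PrimeDivisor Y) : ℝ :=
  1 + (formOrd (h ≫ 𝒟.f) 𝒟.ω E : ℝ) + pullCoeff h (𝒟.nefPart μ) E
    - pullCoeff (h ≫ 𝒟.f) (𝒟.adjoint B μ) E

/-- Over the open subset `W` of `Z`, `(X, B + M)` is generalized `ε`-lc. -/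
def IsGenEpsLCOver (W : 𝒟.Z.sch.Opens) (ε : ℝ) (B : RDivisor 𝒟.X) (μ : Fin 𝒟.J → ℝ) : Prop :=
  𝒟.IsGenPairOver W B μ ∧
  ∀ (Y : Variety) (h : Y.sch ⟶ 𝒟.X'.sch), IsModel h → ∀ E : PrimeDivisor Y,
    𝒟.πf (h E.1) ∈ W → ε ≤ 𝒟.logDiscrepancy B μ h E

/-- `(X/Z ∋ z, B⁺ + M⁺)` is an `(ε, ℝ)`-complement of `(X/Z ∋ z, B + M)`. -/
def IsRComplement (z : 𝒟.Z.sch) (ε : ℝ) (B : RDivisor 𝒟.X) (μ : Fin 𝒟.J → ℝ)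
    (Bp : RDivisor 𝒟.X) (μp : Fin 𝒟.J → ℝ) : Prop :=
  ∃ W : 𝒟.Z.sch.Opens, z ∈ W ∧
    𝒟.IsGenEpsLCOver W 0 Bp μp ∧ 𝒟.IsGenEpsLCOver W ε Bp μp ∧
    (∀ P : PrimeDivisor 𝒟.X, 𝒟.π P.1 ∈ W → B P ≤ Bp P) ∧ (∀ j, μ j ≤ μp j) ∧
    IsNumTrivialOver 𝒟.π W (𝒟.adjoint Bp μp)

/-- `(X/Z ∋ z, B + M)` is `(ε, ℝ)`-complementary. -/
def IsRComplementary (z : 𝒟.Z.sch) (ε : ℝ) (B : RDivisor 𝒟.X) (μ : Fin 𝒟.J → ℝ) : Prop :=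
  ∃ (Bp : RDivisor 𝒟.X) (μp : Fin 𝒟.J → ℝ), 𝒟.IsRComplement z ε B μ Bp μp

/-- The inequality `n b⁺ ≥ n ⌊b⌋ + ⌊(n + 1) {b}⌋` between coefficients. -/
def CoeffIneq (n : ℕ) (b bp : ℝ) : Prop :=
  (n : ℝ) * ⌊b⌋ + ⌊((n : ℝ) + 1) * Int.fract b⌋ ≤ n * bp

/-- `(X/Z ∋ z, B⁺ + M⁺)` is an `(ε, n)`-complement of `(X/Z ∋ z, B + M)`. -/
def IsNComplement (z : 𝒟.Z.sch) (ε : ℝ) (n : ℕ) (B : RDivisor 𝒟.X) (μ : Fin 𝒟.J → ℝ)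
    (Bp : RDivisor 𝒟.X) (μp : Fin 𝒟.J → ℝ) : Prop :=
  ∃ W : 𝒟.Z.sch.Opens, z ∈ W ∧
    𝒟.IsGenEpsLCOver W 0 Bp μp ∧ 𝒟.IsGenEpsLCOver W ε Bp μp ∧
    IsPrincipalOn (𝒟.π ⁻¹ᵁ W) (fun P => (n : ℝ) * 𝒟.adjoint Bp μp P) ∧
    (∀ P : PrimeDivisor 𝒟.X, 𝒟.π P.1 ∈ W → CoeffIneq n (B P) (Bp P)) ∧
    (∀ j, CoeffIneq n (μ j) (μp j)) ∧
    IsBCartierOn (𝒟.πf ⁻¹ᵁ W) ((n : ℝ) • 𝒟.nefPart μp)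

/-- `B⁺ ≥ B` over a neighbourhood of `z`, and `μ⁺_j ≥ μ_j` for all `j`. -/
def IsMonotonic (z : 𝒟.Z.sch) (B : RDivisor 𝒟.X) (μ : Fin 𝒟.J → ℝ)
    (Bp : RDivisor 𝒟.X) (μp : Fin 𝒟.J → ℝ) : Prop :=
  (∃ W : 𝒟.Z.sch.Opens, z ∈ W ∧ ∀ P : PrimeDivisor 𝒟.X, 𝒟.π P.1 ∈ W → B P ≤ Bp P) ∧
    ∀ j, μ j ≤ μp j

/-- `(X/Z ∋ z, B⁺ + M⁺)` is an `(𝛆, n, Γ₀)`-decomposable `(ε, ℝ)`-complement of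
`(X/Z ∋ z, B + M)`, where `S` is the finite set of the numbers `ε_i` that may be used. -/
def IsDecomposableRComplement (z : 𝒟.Z.sch) (ε : ℝ) (S : Finset ℝ) (n : ℕ) (Γ₀ : Finset ℝ)
    (B : RDivisor 𝒟.X) (μ : Fin 𝒟.J → ℝ) (Bp : RDivisor 𝒟.X) (μp : Fin 𝒟.J → ℝ) : Prop :=
  𝒟.IsRComplement z ε B μ Bp μp ∧
  ∃ (k : ℕ) (a e : Fin k → ℝ) (Bi : Fin k → RDivisor 𝒟.X) (μi : Fin k → Fin 𝒟.J → ℝ),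
    (∀ i, a i ∈ Γ₀) ∧ (∀ i, e i ∈ S) ∧ ∑ i, a i = 1 ∧ ε ≤ ∑ i, a i * e i ∧
    (∀ i P, 0 ≤ Bi i P ∧ Bi i P ≤ 1) ∧
    Bp = ∑ i, a i • Bi i ∧ μp = ∑ i, a i • μi i ∧
    ∀ i, 𝒟.IsNComplement z (e i) n (Bi i) (μi i) (Bi i) (μi i)

/-- `(X, B + M)` is a generalized pair with `dim X = d`, `X` of Fano type over `Z`, the
coefficients of `B` and the `μ_j` in `Γ`, and `M'_j` b-Cartier and nef over `Z`. -/
def IsFanoTypePair (d : ℕ) (Γ : Set ℝ) (B : RDivisor 𝒟.X) (μ : Fin 𝒟.J → ℝ) : Prop :=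
  topologicalKrullDim 𝒟.X.sch = d ∧ IsFanoType 𝒟.π ∧ 𝒟.IsGenPairOver ⊤ B μ ∧
  (∀ P, B P ≠ 0 → B P ∈ Γ) ∧ 𝒟.HasBCartierNefParts ∧ ∀ j, μ j ∈ Γ

end Data

/-! ### The two conjectures, for fixed parameters -/

/-- Existence of decomposable `(ε, ℝ)`-complements in dimension `d` with coefficients in `Γ`. -/
def DecomposableComplementConjecture (d : ℕ) (ε : ℝ) (Γ : Set ℝ) : Prop :=
  ∃ (n : ℕ) (S Γ₀ : Finset ℝ), 0 < n ∧ (∀ e ∈ S, 0 ≤ e) ∧ (∀ a ∈ Γ₀, 0 < a ∧ a ≤ 1) ∧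
    (closure Γ ⊆ Set.range ((↑) : ℚ → ℝ) → Γ₀ = {1}) ∧
    ∀ (𝒟 : Data) (B : RDivisor 𝒟.X) (μ : Fin 𝒟.J → ℝ), 𝒟.IsFanoTypePair d Γ B μ →
      (∀ z, 𝒟.IsRComplementary z ε B μ) →
      ∀ z, ∃ (Bp : RDivisor 𝒟.X) (μp : Fin 𝒟.J → ℝ),
        𝒟.IsDecomposableRComplement z ε S n Γ₀ B μ Bp μp ∧
        (closure Γ ⊆ Set.range ((↑) : ℚ → ℝ) →
          𝒟.IsNComplement z ε n B μ Bp μp ∧ 𝒟.IsMonotonic z B μ Bp μp)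

/-- The condition `Span_{ℚ≥0}((closure Γ ∪ {ε}) \ ℚ) ∩ (ℚ \ {0}) = ∅`. -/
def SpanCondition (ε : ℝ) (Γ : Set ℝ) : Prop :=
  (Submodule.span ℚ≥0 ((closure Γ ∪ {ε}) \ Set.range ((↑) : ℚ → ℝ)) : Set ℝ) ∩
    (Set.range ((↑) : ℚ → ℝ) \ {0}) = ∅

/-- Existence of `(ε, n)`-complements, `p ∣ n`, in dimension `d` with coefficients in `Γ`. -/
def ComplementConjecture (d p : ℕ) (ε : ℝ) (Γ : Set ℝ) : Prop :=
  ∃ n : ℕ, 0 < n ∧ p ∣ n ∧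
    ∀ (𝒟 : Data) (B : RDivisor 𝒟.X) (μ : Fin 𝒟.J → ℝ), 𝒟.IsFanoTypePair d Γ B μ →
      ∀ z, 𝒟.IsRComplementary z ε B μ →
      ∃ (Bp : RDivisor 𝒟.X) (μp : Fin 𝒟.J → ℝ), 𝒟.IsNComplement z ε n B μ Bp μp ∧
        (SpanCondition ε Γ → 𝒟.IsMonotonic z B μ Bp μp)

end GenPair

end

noncomputable section

namespace GenPair

section

/-! ### Intersection of the localizations at primes of height one -/

section Hartogs

open IsLocalRing

/-! Conjecture A writes a complement as a convex combination, with real weights `a i` from a finite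
set `Γ₀`, of pieces that are complements of themselves of a fixed index `n₀`. Multiplied by `n₀`,
the log discrepancies of the pieces and their boundary coefficients near `z` are natural numbers,
and the nef coefficients can be arranged to be so. Hence every quantity that matters has the form `∑
a i * x i` with `n₀ * x i` a natural number. It suffices to replace the weights by rational weights
`β (a i)`, with `n * β (a i)` a multiple of `n₀` and with sum one, where `n` and `β` are chosen once
for all pairs. Then `n` times the new adjoint divisor is an integral combination of the principal
divisors `n₀ (K + B i + M i)`, so it is principal, and only inequalities between real numbers
remain.

The arithmetic is `exists_coefficients`. The value `∑ a i * x i` depends only on the sums of the `n₀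
* x i` over equal weights, so only finitely many values lie below a given bound. Values above it are
harmless, because `β α ≥ α / 2` on `Γ₀`. The map `β` is `ℚ`-linear and fixes `1`, hence all
rationals, and it moves the finitely many remaining values by less than `δ / n`. A value strictly
above `ε` stays above it, and the rounding inequality tolerates such an error. What must not
decrease at all is a value equal to `ε` and, for monotonicity, a value in the closure of `Γ`:
outside the closure there is a gap below the value that contains no element of `Γ`. A simultaneous
approximation from above of irrational numbers exists when no nontrivial combination of them with
nonnegative rational coefficients is rational. Gordan's theorem gives the direction and Kronecker's
theorem the approximation (`exists_linearMap_near`). For multiples of `ε` alone the condition is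
automatic, and in the monotonic case it follows from the span condition.

Three geometric points remain. First, Conjecture A asks for complements at every point of the base,
while only one point `z` is given. The given complement lives over a neighbourhood `W` and is a
complement at every point of `W`, so the conjecture is applied to the restriction over `W`. The
definitions quantify over proper models, so valuations on models of an open subvariety must be
realized on proper models of the whole variety; this is `exists_isModel_regularAt_eq`, proved by
normalizing a projective space over `X` at a generic point and using the valuative criterion.

Secondly, `n₀ M i'` being b-Cartier does not make the numbers `n₀ * μ i j` integral, since the `M'
j` may be dependent or trivial. Adding principal divisors to the `M' j` changes no log discrepancy.
Weak approximation lets one choose them so that the `M' j` have the identity as matrix of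
coefficients along `J` prime divisors over every neighbourhood of `z`, which forces integrality. If
there are fewer than `J` such prime divisors, all `M' j` are made zero near `z` instead, and all nef
coefficients may be set to `1` (`Data.exists_twist`).

Thirdly, pull backs and intersection numbers are given by choices of local equations. They are
additive and independent of the choices because real relations between divisors reduce to integral
ones (`linearCombination_eq_zero_of_forall`), and a function without zeros or poles through a point
of a normal variety is a unit there. -/

theorem height_eq_one_of_forall_mem_iff_aux {R : Type*} [CommRing R] [IsDomain R]
    [IsNoetherianRing R] [IsIntegrallyClosed R] {b y : R} (hb : b ≠ 0) {P : Ideal R} [P.IsPrime]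
    (hP : ∀ r, r ∈ P ↔ b ∣ r * y) (A : Type*) [CommRing A] [IsDomain A] [IsLocalRing A] [Algebra R A]
    [IsLocalization.AtPrime A P] (K : Type*) [Field K] [Algebra A K] [IsFractionRing A K] :
    P.height = 1 := by
  have : IsIntegrallyClosed A :=
    isIntegrallyClosed_of_isLocalization A _ P.primeCompl_le_nonZeroDivisors
  have : IsNoetherianRing A := IsLocalization.isNoetherianRing P.primeCompl A inferInstance
  have hinj : Function.Injective (algebraMap R A) :=
    IsLocalization.injective A P.primeCompl_le_nonZeroDivisors
  have hbA : algebraMap R A b ≠ 0 := by simpa using hinj.ne hb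
  have hyb : ¬ algebraMap R A b ∣ algebraMap R A y := by
    rintro ⟨c, hc⟩
    obtain ⟨⟨r, s⟩, hrs⟩ := IsLocalization.surj P.primeCompl c
    have h1 : s.1 * y = b * r := hinj <| by
      simp only [map_mul]
      rw [hc, ← hrs]; ring
    exact s.2 ((hP _).2 ⟨r, h1⟩)
  have hm : ∀ m ∈ maximalIdeal A, ∃ a, algebraMap R A y * m = algebraMap R A b * a := by
    intro m hm
    obtain ⟨⟨r, s⟩, hrs⟩ := IsLocalization.surj P.primeCompl m
    have hr : r ∈ P := by
      rw [← IsLocalization.AtPrime.to_map_mem_maximal_iff A P, ← hrs]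
      exact Ideal.mul_mem_right _ _ hm
    obtain ⟨c, hc⟩ := (hP r).1 hr
    refine ⟨IsLocalization.mk' A c s, ?_⟩
    have hs : IsUnit (algebraMap R A s) := IsLocalization.map_units A s
    apply hs.mul_left_injective
    dsimp only
    rw [mul_assoc, hrs, mul_assoc, IsLocalization.mk'_spec, ← map_mul, ← map_mul, mul_comm y, hc]
  choose a ha using hm
  have hPne : P ≠ ⊥ := by
    rintro rfl
    exact hb ((Submodule.mem_bot _).1 ((hP b).2 (Dvd.intro _ rfl)))
  have hle : P.height ≤ 1 := by
    have key : (maximalIdeal A).IsPrincipal := by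
      -- The element `y / b` maps the maximal ideal into `A`. If it maps it into itself, it is
      -- integral over `A`, hence in `A`, which contradicts `hyb`. Otherwise some `m` is sent to a
      -- unit and generates the maximal ideal, and Krull's principal ideal theorem bounds the
      -- height.
      by_cases h : ∀ m hm, a m hm ∈ maximalIdeal A
      · exfalso
        have hbK : algebraMap A K (algebraMap R A b) ≠ 0 := by simpa using hbA
        let z : K := algebraMap A K (algebraMap R A y) / algebraMap A K (algebraMap R A b)
        have hz : IsIntegral A z := by
          refine isIntegral_of_smul_mem_submodule
            (Submodule.map (Algebra.linearMap A K) (maximalIdeal A)) ?_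
            ((IsNoetherian.noetherian (maximalIdeal A)).map _) z ?_
          · intro h0
            replace h0 : maximalIdeal A = ⊥ := (Submodule.eq_bot_iff _).2 fun m hm => by
              have := (Submodule.eq_bot_iff _).1 h0 _ ⟨m, hm, rfl⟩
              exact IsFractionRing.injective A K (by simpa using this)
            apply hPne
            rw [← IsLocalization.AtPrime.under_maximalIdeal A P, h0]
            ext r; simp [Ideal.mem_comap, map_eq_zero_iff _ hinj]
          · rintro _ ⟨m, hm, rfl⟩
            refine ⟨a m hm, h m hm, ?_⟩
            have := congrArg (algebraMap A K) (ha m hm)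
            simp only [map_mul] at this
            simp only [Algebra.linearMap_apply, smul_eq_mul, z]
            rw [div_mul_eq_mul_div, this, mul_div_cancel_left₀ _ hbK]
        obtain ⟨c, hc⟩ := IsIntegrallyClosed.isIntegral_iff.1 hz
        apply hyb
        refine ⟨c, IsFractionRing.injective A K ?_⟩
        rw [map_mul, hc, mul_div_cancel₀ _ hbK]
      · push Not at h
        obtain ⟨m, hm, ham⟩ := h
        have hu : IsUnit (a m hm) := by simpa using ham
        refine ⟨m, le_antisymm (fun m' hm' => ?_) ((Submodule.span_singleton_le_iff_mem _ _).2 hm)⟩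
        rw [Submodule.mem_span_singleton]
        obtain ⟨u, hu⟩ := hu
        refine ⟨a m' hm' * ↑u⁻¹, ?_⟩
        have e1 : a m hm * m' = a m' hm' * m := by
          apply mul_left_cancel₀ hbA
          rw [← mul_assoc, ← ha, ← mul_assoc, ← ha]; ring
        rw [smul_eq_mul, mul_right_comm, ← e1, ← hu, mul_right_comm, Units.mul_inv, one_mul]
    have h1 := Ideal.height_le_one_of_isPrincipal_of_mem_minimalPrimes (maximalIdeal A)
      (maximalIdeal A) (by simp [Ideal.minimalPrimes_eq_subsingleton_self])
    rwa [← IsLocalization.height_under P.primeCompl,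
      IsLocalization.AtPrime.under_maximalIdeal A P] at h1
  refine le_antisymm hle (Order.one_le_iff_ne_zero.2 fun h0 => hPne ?_)
  rw [Ideal.height_eq_zero_iff, IsDomain.minimalPrimes_eq_singleton_bot] at h0
  simpa using h0

theorem height_eq_one_of_forall_mem_iff {R : Type*} [CommRing R] [IsDomain R]
    [IsNoetherianRing R] [IsIntegrallyClosed R] {b y : R} (hb : b ≠ 0) {P : Ideal R} [P.IsPrime]
    (hP : ∀ r, r ∈ P ↔ b ∣ r * y) : P.height = 1 :=
  haveI : IsDomain (Localization.AtPrime P) :=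
    IsLocalization.isDomain_localization P.primeCompl_le_nonZeroDivisors
  have h (A : Type _) [CommRing A] [IsDomain A] [IsLocalRing A] [Algebra R A]
    [IsLocalization.AtPrime A P] : P.height = 1 :=
    height_eq_one_of_forall_mem_iff_aux hb hP A (FractionRing A)
  h (Localization.AtPrime P)

/-- In a noetherian integrally closed domain, an element of the fraction field which belongs to the
localizations at all primes of height one belongs to the ring. -/
theorem exists_algebraMap_eq_of_forall_height_eq_one {R K : Type*} [CommRing R] [IsDomain R]
    [IsNoetherianRing R] [IsIntegrallyClosed R] [Field K] [Algebra R K] [IsFractionRing R K]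
    (φ : K) (h : ∀ P : Ideal R, P.IsPrime → P.height = 1 →
      ∃ s ∉ P, ∃ r, algebraMap R K s * φ = algebraMap R K r) : ∃ r, algebraMap R K r = φ := by
  obtain ⟨a, b, hb, rfl⟩ := IsFractionRing.div_surjective (A := R) φ
  have hb0 : b ≠ 0 := nonZeroDivisors.ne_zero hb
  have hbK : algebraMap R K b ≠ 0 := by simpa using hb0
  by_contra hc
  have hab : Ideal.Quotient.mk (Ideal.span {b}) a ≠ 0 := by
    rw [Ne, Ideal.Quotient.eq_zero_iff_mem, Ideal.mem_span_singleton]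
    rintro ⟨c, rfl⟩
    exact hc ⟨c, by rw [map_mul, mul_div_cancel_left₀ _ hbK]⟩
  -- The annihilator of the class of `a` modulo `b` is the ideal of denominators of `a / b`. It lies
  -- in an associated prime `P` of `R / b`, which has height one, so the denominator `s` outside `P`
  -- given by the hypothesis is impossible.
  obtain ⟨P, hP, hle⟩ := exists_le_isAssociatedPrime_of_isNoetherianRing R _ hab
  obtain ⟨hPp, y', hy'⟩ := (isAssociatedPrime_iff).1 hP
  obtain ⟨y, rfl⟩ := Ideal.Quotient.mk_surjective y'
  have hmem : ∀ r, r ∈ P ↔ b ∣ r * y := fun r => by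
    rw [hy', Submodule.mem_colon_singleton, Submodule.mem_bot, ← Ideal.mem_span_singleton,
      ← Ideal.Quotient.eq_zero_iff_mem, map_mul]
    rfl
  obtain ⟨s, hs, r, hr⟩ := h P hPp (height_eq_one_of_forall_mem_iff hb0 hmem)
  apply hs
  apply hle
  rw [Submodule.mem_colon_singleton, Submodule.mem_bot]
  change Ideal.Quotient.mk (Ideal.span {b}) (s * a) = 0
  rw [Ideal.Quotient.eq_zero_iff_mem, Ideal.mem_span_singleton]
  refine ⟨r, IsFractionRing.injective R K ?_⟩
  rw [map_mul, map_mul, ← hr]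
  field_simp

end Hartogs

end

/-! ### Local rings of a variety in its function field -/

theorem exists_isAffineOpen_mem (X : Variety) (x : X.sch) : ∃ U : X.sch.Opens, IsAffineOpen U ∧ x ∈ U := by
  obtain ⟨_, ⟨U, hU, rfl⟩, hx, -⟩ :=
    X.sch.isBasis_affineOpens.exists_subset_of_mem_open (Set.mem_univ x) isOpen_univ
  exact ⟨U, hU, hx⟩

theorem mem_localSubring_iff {X : Variety} {U : X.sch.Opens} (hU : IsAffineOpen U) [Nonempty U]
    {x : X.sch} (hx : x ∈ U) {φ : X.K} : φ ∈ localSubring X x ↔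
      ∃ s r : Γ(X.sch, U), IsUnit (X.sch.presheaf.germ U x hx s) ∧
        X.sch.germToFunctionField U s * φ = X.sch.germToFunctionField U r := by
  let := (X.sch.presheaf.germ U x hx).hom.toAlgebra
  have := hU.isLocalization_stalk ⟨x, hx⟩
  constructor
  · rintro ⟨a, rfl⟩
    obtain ⟨⟨r, s⟩, hrs⟩ := IsLocalization.surj (hU.primeIdealOf ⟨x, hx⟩).asIdeal.primeCompl a
    refine ⟨s, r, IsLocalization.map_units (M := (hU.primeIdealOf ⟨x, hx⟩).asIdeal.primeCompl)
      (X.sch.presheaf.stalk x) s, ?_⟩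
    rw [← Scheme.algebraMap_germ_eq_germToFunctionField _ hx,
      ← Scheme.algebraMap_germ_eq_germToFunctionField _ hx, ← map_mul, mul_comm]
    exact congrArg _ hrs
  · rintro ⟨s, r, hs, h⟩
    obtain ⟨u, hu⟩ := hs
    refine ⟨↑u⁻¹ * X.sch.presheaf.germ U x hx r, ?_⟩
    rw [map_mul, Scheme.algebraMap_germ_eq_germToFunctionField, ← h,
      ← Scheme.algebraMap_germ_eq_germToFunctionField _ hx, ← hu, ← mul_assoc, ← map_mul,
      Units.inv_mul, map_one, one_mul]

theorem exists_opens_of_mem_localSubring {X : Variety} {x : X.sch} {φ : X.K}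
    (h : φ ∈ localSubring X x) :
    ∃ U : X.sch.Opens, x ∈ U ∧ ∀ y ∈ U, φ ∈ localSubring X y := by
  obtain ⟨a, rfl⟩ := h
  obtain ⟨U, hU, s, rfl⟩ := X.sch.presheaf.exists_germ_eq a
  refine ⟨U, hU, fun y hy => ⟨X.sch.presheaf.germ U y hy s, ?_⟩⟩
  have : Nonempty U := ⟨⟨x, hU⟩⟩
  rw [Scheme.algebraMap_germ_eq_germToFunctionField, Scheme.algebraMap_germ_eq_germToFunctionField]

instance isNoetherianRing_stalk (X : Variety) (x : X.sch) :
    IsNoetherianRing (X.sch.presheaf.stalk x) := inferInstance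

/-- Algebraic Hartogs, in geometric form. A height-one prime of the stalk at `x` contracts to a
prime of an affine chart, that is, to a point specializing to `x`; its codimension is the height of
the prime, so it is a prime divisor through `x`. -/
theorem mem_localSubring_of_forall_primeDivisor {X : Variety} (hX : X.IsNormal) {x : X.sch}
    {φ : X.K} (h : ∀ P : PrimeDivisor X, P.1 ⤳ x → φ ∈ localSubring X P.1) :
    φ ∈ localSubring X x := by
  obtain ⟨U, hU, hx⟩ := exists_isAffineOpen_mem X x
  have : Nonempty U := ⟨⟨x, hx⟩⟩
  have := hX x
  let := (X.sch.presheaf.germ U x hx).hom.toAlgebra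
  have := hU.isLocalization_stalk ⟨x, hx⟩
  refine exists_algebraMap_eq_of_forall_height_eq_one (R := X.sch.presheaf.stalk x) φ
    fun P hP hPh => ?_
  let q : PrimeSpectrum Γ(X.sch, U) := ⟨P.comap (algebraMap _ _), inferInstance⟩
  let y : X.sch := hU.fromSpec q
  have hyU : y ∈ U := by
    have : y ∈ Set.range hU.fromSpec := ⟨q, rfl⟩
    rwa [hU.range_fromSpec] at this
  have hq : hU.primeIdealOf ⟨y, hyU⟩ = q := hU.fromSpec.isOpenEmbedding.injective
    (hU.fromSpec_primeIdealOf ⟨y, hyU⟩)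
  have hyx : y ⤳ x := by
    have hx' := hU.fromSpec_primeIdealOf ⟨x, hx⟩
    dsimp only at hx'
    suffices y ⤳ hU.fromSpec (hU.primeIdealOf ⟨x, hx⟩) by rwa [hx'] at this
    refine Specializes.map ((PrimeSpectrum.le_iff_specializes q _).1 fun a ha => ?_)
      hU.fromSpec.continuous
    by_contra hc
    exact hP.ne_top (Ideal.eq_top_of_isUnit_mem _ ha (IsLocalization.map_units
      (M := (hU.primeIdealOf ⟨x, hx⟩).asIdeal.primeCompl) (X.sch.presheaf.stalk x) ⟨a, hc⟩))
  have hy1 : Order.coheight y = 1 := by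
    have h1 := ringKrullDim_stalk_eq_coheight y
    let := (X.sch.presheaf.germ U y hyU).hom.toAlgebra
    have := hU.isLocalization_stalk ⟨y, hyU⟩
    rw [IsLocalization.AtPrime.ringKrullDim_eq_height (hU.primeIdealOf ⟨y, hyU⟩).asIdeal, hq] at h1
    have h2 : q.asIdeal.height = 1 := by
      rw [← hPh]
      exact IsLocalization.height_under (hU.primeIdealOf ⟨x, hx⟩).asIdeal.primeCompl P
    rw [h2] at h1
    exact_mod_cast h1.symm
  obtain ⟨s, r, hs, hsr⟩ := (mem_localSubring_iff hU hyU).1 (h ⟨y, hy1⟩ hyx)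
  refine ⟨X.sch.presheaf.germ U x hx s, ?_, X.sch.presheaf.germ U x hx r, ?_⟩
  · intro hsP
    have := hU.isLocalization_stalk ⟨y, hyU⟩
    let := (X.sch.presheaf.germ U y hyU).hom.toAlgebra
    have h3 := (IsLocalization.AtPrime.isUnit_to_map_iff (X.sch.presheaf.stalk y)
      (hU.primeIdealOf ⟨y, hyU⟩).asIdeal s).1 hs
    rw [hq] at h3
    exact h3 hsP
  · rw [Scheme.algebraMap_germ_eq_germToFunctionField, Scheme.algebraMap_germ_eq_germToFunctionField]
    exact hsr

/-! ### Orders along prime divisors -/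

instance (X : Variety) : CompactSpace X.sch :=
  (quasiCompact_iff_compactSpace X.str).1 inferInstance

instance (X : Variety) : IsNoetherian X.sch where

theorem PrimeDivisor.eq_or_eq_genericPoint {X : Variety} (P : PrimeDivisor X) {y : X.sch}
    (h : y ⤳ P.1) : y = P.1 ∨ y = genericPoint X.sch := by
  by_cases hy : P.1 ⤳ y
  · exact Or.inl (h.antisymm hy).eq
  · right
    have hlt : P.1 < y := lt_of_le_not_ge h hy
    have h0 : Order.coheight y = 0 := by
      have := Order.coheight_le_coe_iff.1 P.2.le y hlt
      simpa using this
    exact (Specializes.antisymm (Order.coheight_eq_zero.1 h0 (genericPoint_specializes y))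
      (genericPoint_specializes y)).eq

theorem PrimeDivisor.ne_genericPoint {X : Variety} (P : PrimeDivisor X) :
    P.1 ≠ genericPoint X.sch := by
  intro h
  have h1 := P.2
  rw [h, Order.coheight_eq_zero.2 (fun y _ => genericPoint_specializes y)] at h1
  exact zero_ne_one h1

theorem PrimeDivisor.eq_of_specializes {X : Variety} {P Q : PrimeDivisor X} (h : P.1 ⤳ Q.1) :
    P = Q :=
  Subtype.ext ((Q.eq_or_eq_genericPoint h).resolve_right P.ne_genericPoint)

/-- The only proper generalization of a prime divisor is the generic point, which lies in `U`. So a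
prime divisor outside `U` is the generic point of a component of the complement, and a noetherian
space has finitely many components. -/
theorem finite_primeDivisor_notMem {X : Variety} {U : X.sch.Opens} (hU : (U : Set X.sch).Nonempty) :
    {P : PrimeDivisor X | P.1 ∉ U}.Finite := by
  obtain ⟨S, hS, hSi, hSU⟩ := NoetherianSpace.exists_finite_set_closeds_irreducible
    (⟨(U : Set X.sch)ᶜ, U.isOpen.isClosed_compl⟩ : Closeds X.sch)
  have hgen : genericPoint X.sch ∈ U := by
    obtain ⟨x, hx⟩ := hU
    exact (genericPoint_specializes x).mem_open U.isOpen hx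
  refine Set.Finite.of_finite_image (f := Subtype.val) ?_ Subtype.val_injective.injOn
  have h2 := hS.dependent_image (F := fun t ht => (hSi t ht).genericPoint)
  refine Set.Finite.subset h2 ?_
  rintro _ ⟨P, hP, rfl⟩
  have hP' : P.1 ∈ (⟨(U : Set X.sch)ᶜ, U.isOpen.isClosed_compl⟩ : Closeds X.sch) := hP
  rw [hSU, ← hS.coe_toFinset, ← Finset.sup_id_eq_sSup, ← SetLike.mem_coe, Closeds.coe_finset_sup,
    Finset.sup_eq_iSup] at hP'
  simp only [Set.iSup_eq_iUnion, Set.mem_iUnion, Set.Finite.mem_toFinset] at hP'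
  obtain ⟨t, ht, hPt⟩ := hP'
  refine ⟨t, ht, ?_⟩
  have hcl : closure {(hSi t ht).genericPoint} = (t : Set X.sch) :=
    ((hSi t ht).isGenericPoint_genericPoint_closure).trans t.isClosed.closure_eq
  have hsp : (hSi t ht).genericPoint ⤳ P.1 := by
    rw [specializes_iff_mem_closure, hcl]; exact hPt
  refine (P.eq_or_eq_genericPoint hsp).resolve_right fun h => ?_
  have h3 : (hSi t ht).genericPoint ∈ (t : Set X.sch) :=
    (Set.ext_iff.1 hcl _).1 (subset_closure (Set.mem_singleton _))
  have h4 : t ≤ ⟨(U : Set X.sch)ᶜ, U.isOpen.isClosed_compl⟩ := hSU ▸ le_sSup ht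
  exact h4 h3 (h ▸ hgen)

theorem finite_ordAt_ne_zero {X : Variety} (φ : X.K) :
    {P : PrimeDivisor X | ordAt P φ ≠ 0}.Finite := by
  by_cases hφ : φ = 0
  · simp [ordAt, hφ]
  obtain ⟨U, hU, f, hne, rfl, hf⟩ := exists_isUnit_germ_eq X.sch φ hφ
  refine (finite_primeDivisor_notMem (U := U) (hne.elim fun x => ⟨x.1, x.2⟩)).subset
    fun P hP hPU => hP ?_
  exact Scheme.ord_of_isUnit hf hPU

theorem ordAt_mul {X : Variety} (P : PrimeDivisor X) {φ ψ : X.K} (hφ : φ ≠ 0) (hψ : ψ ≠ 0) :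
    ordAt P (φ * ψ) = ordAt P φ + ordAt P ψ :=
  Scheme.ord_mul hφ hψ

@[simp] theorem ordAt_one {X : Variety} (P : PrimeDivisor X) : ordAt P (1 : X.K) = 0 := by
  have := ordAt_mul P (one_ne_zero (α := X.K)) one_ne_zero
  rw [one_mul] at this
  omega

/-- The order along a prime divisor, as a homomorphism on nonzero rational functions. -/
def ordHom {X : Variety} (P : PrimeDivisor X) : X.Kˣ →* Multiplicative ℤ where
  toFun φ := Multiplicative.ofAdd (ordAt P (φ : X.K))
  map_one' := by simp
  map_mul' φ ψ := by simp [ordAt_mul P φ.ne_zero ψ.ne_zero]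

theorem isDiscreteValuationRing_stalk {X : Variety} (hX : X.IsNormal) (P : PrimeDivisor X) :
    IsDiscreteValuationRing (X.sch.presheaf.stalk P.1) := by
  have h1 := ringKrullDim_stalk_eq_coheight P.1
  rw [P.2] at h1
  have := hX P.1
  have : Ring.KrullDimLE 1 (X.sch.presheaf.stalk P.1) := krullDimLE_of_coheight_le P.2.le
  have hf : ¬ IsField (X.sch.presheaf.stalk P.1) := by
    intro hf
    rw [ringKrullDim_eq_zero_of_isField hf] at h1
    exact absurd h1 (by decide)
  have h03 := (IsDiscreteValuationRing.TFAE _ hf).out 0 3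
  rw [h03]
  refine ⟨inferInstance,
    IsLocalRing.maximalIdeal _, ⟨?_, inferInstance⟩, ?_⟩
  · exact fun h => hf (IsLocalRing.isField_iff_maximalIdeal_eq.2 h)
  · rintro Q ⟨hQ, hQp⟩
    exact IsLocalRing.eq_maximalIdeal (hQp.isMaximal_of_ne_bot hQ)

theorem ordAt_nonneg_iff {X : Variety} (hX : X.IsNormal) (P : PrimeDivisor X) {φ : X.K}
    (hφ : φ ≠ 0) : 0 ≤ ordAt P φ ↔ φ ∈ localSubring X P.1 := by
  have := isDiscreteValuationRing_stalk hX P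
  have : Ring.KrullDimLE 1 (X.sch.presheaf.stalk P.1) := krullDimLE_of_coheight_le P.2.le
  rw [ordAt, Scheme.le_ord_iff P.2 hφ]
  change 1 ≤ Ring.ordFrac (X.sch.presheaf.stalk P.1) φ ↔ _
  rw [Ring.ordFrac_eq_valuation_inv, one_le_inv₀ (by simpa [zero_lt_iff] using hφ)]
  constructor
  · intro h
    obtain ⟨a, ha⟩ := IsDiscreteValuationRing.exists_lift_of_le_one h
    exact ⟨a, ha⟩
  · rintro ⟨a, rfl⟩
    exact IsDedekindDomain.HeightOneSpectrum.valuation_le_one _ a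

theorem exists_ordAt_eq_one {X : Variety} (hX : X.IsNormal) (P : PrimeDivisor X) :
    ∃ φ : X.K, φ ≠ 0 ∧ ordAt P φ = 1 := by
  have := isDiscreteValuationRing_stalk hX P
  obtain ⟨π, hπ⟩ := IsDiscreteValuationRing.exists_irreducible (X.sch.presheaf.stalk P.1)
  have : Ring.KrullDimLE 1 (X.sch.presheaf.stalk P.1) := krullDimLE_of_coheight_le P.2.le
  have h0 : algebraMap (X.sch.presheaf.stalk P.1) X.K π ≠ 0 := by
    simpa using hπ.ne_zero
  refine ⟨_, h0, ?_⟩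
  rw [ordAt, Scheme.ord_eq_iff P.2 h0]
  exact Ring.ordFrac_irreducible hπ

theorem ordAt_add {X : Variety} (hX : X.IsNormal) (P : PrimeDivisor X) {φ ψ : X.K}
    (h : φ + ψ ≠ 0) : min (ordAt P φ) (ordAt P ψ) ≤ ordAt P (φ + ψ) :=
  have := isDiscreteValuationRing_stalk hX P
  Scheme.ord_add h

theorem ordAt_inv {X : Variety} (P : PrimeDivisor X) (φ : X.K) : ordAt P φ⁻¹ = - ordAt P φ := by
  by_cases hφ : φ = 0
  · simp [ordAt, hφ]
  have := ordAt_mul P hφ (inv_ne_zero hφ)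
  rw [mul_inv_cancel₀ hφ, ordAt_one] at this
  omega

/-! ### Dominant morphisms and function fields -/

/-- `g` maps the generic point to the generic point. -/
def IsDom {Y X : Variety} (g : Y.sch ⟶ X.sch) : Prop :=
  g (genericPoint Y.sch) ⤳ genericPoint X.sch

theorem IsDom.eq {Y X : Variety} {g : Y.sch ⟶ X.sch} (h : IsDom g) :
    g (genericPoint Y.sch) = genericPoint X.sch :=
  (h.antisymm (genericPoint_specializes _)).eq

theorem IsDom.comp {Y X W : Variety} {g : Y.sch ⟶ X.sch} {f : X.sch ⟶ W.sch} (hg : IsDom g)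
    (hf : IsDom f) : IsDom (g ≫ f) := by
  unfold IsDom
  rw [Scheme.Hom.comp_apply, hg.eq]
  exact hf

theorem IsDom.id (X : Variety) : IsDom (𝟙 X.sch) := by
  simp [IsDom, specializes_rfl]

theorem pullFun_eq {Y X : Variety} {g : Y.sch ⟶ X.sch} (h : IsDom g) (φ : X.K) :
    pullFun g φ = pullHom g h φ :=
  dif_pos h

theorem regularAt_eq {Y X : Variety} {g : Y.sch ⟶ X.sch} (h : IsDom g) (y : Y.sch) :
    regularAt g y = (localSubring Y y).comap (pullHom g h) :=
  dif_pos h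

theorem pullHom_algebraMap {Y X : Variety} {g : Y.sch ⟶ X.sch} (h : IsDom g) (y : Y.sch)
    (a : X.sch.presheaf.stalk (g y)) :
    pullHom g h (algebraMap _ X.K a) = algebraMap _ Y.K ((g.stalkMap y).hom a) := by
  have h1 : genericPoint Y.sch ⤳ y := genericPoint_specializes y
  have h2 := Scheme.Hom.stalkSpecializes_stalkMap g _ _ h1
  have h3 : X.sch.presheaf.stalkSpecializes (genericPoint_specializes (g y)) ≫
      X.sch.presheaf.stalkSpecializes h = X.sch.presheaf.stalkSpecializes (h1.map g.continuous) :=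
    X.sch.presheaf.stalkSpecializes_comp _ _
  simp only [RingHom.algebraMap_toAlgebra]
  change (X.sch.presheaf.stalkSpecializes _ ≫ X.sch.presheaf.stalkSpecializes h ≫
    g.stalkMap (genericPoint Y.sch)).hom a = (g.stalkMap y ≫ Y.sch.presheaf.stalkSpecializes h1).hom a
  rw [← h2, ← h3, Category.assoc]

theorem pullHom_comp {Y X W : Variety} {g : Y.sch ⟶ X.sch} {f : X.sch ⟶ W.sch} (hg : IsDom g)
    (hf : IsDom f) (φ : W.K) :
    pullHom (g ≫ f) (hg.comp hf) φ = pullHom g hg (pullHom f hf φ) := by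
  obtain ⟨a, rfl⟩ : ∃ a : W.sch.presheaf.stalk (f (g (genericPoint Y.sch))), algebraMap _ W.K a = φ := by
    have h1 : f (g (genericPoint Y.sch)) ⤳ genericPoint W.sch := hg.comp hf
    refine ⟨W.sch.presheaf.stalkSpecializes h1 φ, ?_⟩
    simp only [RingHom.algebraMap_toAlgebra]
    have := W.sch.presheaf.stalkSpecializes_comp_apply (genericPoint_specializes _) h1 φ
    refine Eq.trans this ?_
    simp
  rw [pullHom_algebraMap hf, pullHom_algebraMap hg]
  have := pullHom_algebraMap (hg.comp hf) (genericPoint Y.sch) a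
  refine this.trans ?_
  congr 1
  rw [Scheme.Hom.stalkMap_comp]
  rfl

theorem pullHom_id {X : Variety} (φ : X.K) : pullHom (𝟙 X.sch) (IsDom.id X) φ = φ := by
  -- Functoriality makes this homomorphism idempotent, and an injective idempotent map is the
  -- identity. No computation with stalks is needed.
  have h : pullHom (𝟙 X.sch) (IsDom.id X) (pullHom (𝟙 X.sch) (IsDom.id X) φ) =
      pullHom (𝟙 X.sch) (IsDom.id X) φ := by
    rw [← pullHom_comp]
    simp only [Category.comp_id]
  exact (pullHom (𝟙 X.sch) (IsDom.id X)).injective h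

theorem pullHom_congr {Y X : Variety} {g g' : Y.sch ⟶ X.sch} (e : g = g') (h : IsDom g)
    (h' : IsDom g') (φ : X.K) : pullHom g h φ = pullHom g' h' φ := by
  subst e; rfl

theorem pullHom_mem_localSubring {Y X : Variety} {g : Y.sch ⟶ X.sch} (h : IsDom g) {y : Y.sch}
    {φ : X.K} (hφ : φ ∈ localSubring X (g y)) : pullHom g h φ ∈ localSubring Y y := by
  obtain ⟨a, rfl⟩ := hφ
  exact ⟨_, (pullHom_algebraMap h y a).symm⟩

theorem localSubring_le_regularAt {Y X : Variety} {g : Y.sch ⟶ X.sch} (h : IsDom g) (y : Y.sch) :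
    localSubring X (g y) ≤ regularAt g y := by
  rw [regularAt_eq h]
  exact fun φ hφ => pullHom_mem_localSubring h hφ

/-- A birational morphism from a normal variety, not necessarily proper. -/
structure IsWeakModel {Y X : Variety} (g : Y.sch ⟶ X.sch) : Prop where
  normal : Y.IsNormal
  isOverC : IsOverC g
  dom : IsDom g
  bij : Function.Bijective (pullHom g dom)

theorem IsWeakModel.comp {Y X W : Variety} {g : Y.sch ⟶ X.sch} {f : X.sch ⟶ W.sch}
    (hg : IsWeakModel g) (hf : IsWeakModel f) : IsWeakModel (g ≫ f) where
  normal := hg.normal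
  isOverC := by rw [IsOverC, Category.assoc, hf.isOverC, hg.isOverC]
  dom := hg.dom.comp hf.dom
  bij := by
    have : ⇑(pullHom (g ≫ f) (hg.dom.comp hf.dom)) = pullHom g hg.dom ∘ pullHom f hf.dom :=
      funext fun φ => pullHom_comp hg.dom hf.dom φ
    rw [this]
    exact hg.bij.comp hf.bij

theorem IsWeakModel.id {X : Variety} (hX : X.IsNormal) : IsWeakModel (𝟙 X.sch) where
  normal := hX
  isOverC := Category.id_comp _
  dom := IsDom.id X
  bij := by
    have : ⇑(pullHom (𝟙 X.sch) (IsDom.id X)) = _root_.id := funext pullHom_id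
    rw [this]; exact Function.bijective_id

/-- A homomorphism to `ℤ` from the units of a field is determined by its ring of elements of
nonnegative value, if it is onto. -/
theorem eq_of_nonneg_iff {K : Type*} [Field K] {v w : K → ℤ}
    (hv : ∀ a b, a ≠ 0 → b ≠ 0 → v (a * b) = v a + v b)
    (hw : ∀ a b, a ≠ 0 → b ≠ 0 → w (a * b) = w a + w b)
    (h : ∀ a, a ≠ 0 → (0 ≤ v a ↔ 0 ≤ w a)) (hv1 : ∃ a, a ≠ 0 ∧ v a = 1)
    (hw1 : ∃ a, a ≠ 0 ∧ w a = 1) {a : K} (ha : a ≠ 0) : v a = w a := by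
  have zp (u : K → ℤ) (hu : ∀ a b, a ≠ 0 → b ≠ 0 → u (a * b) = u a + u b) {x : K} (hx : x ≠ 0)
      (n : ℤ) : u (x ^ n) = n * u x := by
    let U : Kˣ →* Multiplicative ℤ := MonoidHom.mk' (fun x => Multiplicative.ofAdd (u x))
      fun x y => congrArg Multiplicative.ofAdd (hu x y x.ne_zero y.ne_zero)
    have := map_zpow U (Units.mk0 x hx) n
    have h2 := congrArg Multiplicative.toAdd this
    simpa [U] using h2
  have h0 (x : K) (hx : x ≠ 0) : v x = 0 ↔ w x = 0 := by
    have e1 := zp v hv hx (-1)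
    have e2 := zp w hw hx (-1)
    have e3 := h x hx
    have e4 := h _ (zpow_ne_zero (-1) hx)
    omega
  obtain ⟨π, hπ, hπ1⟩ := hv1
  obtain ⟨ρ, hρ, hρ1⟩ := hw1
  -- Dividing `x` by a power of the uniformizer `π` of `v` gives an element of value `0` for `v`,
  -- hence for `w` too. So `w` is a multiple of `v`, and surjectivity makes the factor equal to `1`.
  have key (x : K) (hx : x ≠ 0) : w x = v x * w π := by
    have h1 : v (x * π ^ (-(v x))) = 0 := by
      rw [hv _ _ hx (zpow_ne_zero _ hπ), zp v hv hπ, hπ1]; ring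
    rw [h0 _ (mul_ne_zero hx (zpow_ne_zero _ hπ)), hw _ _ hx (zpow_ne_zero _ hπ), zp w hw hπ] at h1
    linarith
  have h1 : 0 ≤ w π := (h π hπ).1 (by omega)
  have h2 := key ρ hρ
  rw [hρ1] at h2
  have h3 : w π = 1 := by
    have : w π ∣ 1 := ⟨v ρ, by rw [h2]; ring⟩
    exact Int.eq_one_of_dvd_one h1 this
  rw [key a ha, h3, mul_one]

theorem IsWeakModel.mem_regularAt_iff {Y X : Variety} {g : Y.sch ⟶ X.sch} (hg : IsWeakModel g)
    (E : PrimeDivisor Y) {φ : X.K} (hφ : φ ≠ 0) :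
    φ ∈ regularAt g E.1 ↔ 0 ≤ ordAt E (pullFun g φ) := by
  rw [regularAt_eq hg.dom, pullFun_eq hg.dom,
    ordAt_nonneg_iff hg.normal E ((map_ne_zero (pullHom g hg.dom)).2 hφ)]
  rfl

/-- The order along a prime divisor over `X` is determined by its valuation ring in `K(X)`. -/
theorem ordAt_pullFun_eq_of_regularAt_eq {Y Y' X : Variety} {g : Y.sch ⟶ X.sch}
    {g' : Y'.sch ⟶ X.sch} (hg : IsWeakModel g) (hg' : IsWeakModel g') {E : PrimeDivisor Y}
    {E' : PrimeDivisor Y'} (h : regularAt g E.1 = regularAt g' E'.1) (φ : X.K) :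
    ordAt E (pullFun g φ) = ordAt E' (pullFun g' φ) := by
  by_cases hφ : φ = 0
  · subst hφ
    rw [pullFun_eq hg.dom, pullFun_eq hg'.dom, map_zero, map_zero]
    simp [ordAt]
  have hs {Y : Variety} {g : Y.sch ⟶ X.sch} (hg : IsWeakModel g) (E : PrimeDivisor Y) :
      (∀ a b, a ≠ 0 → b ≠ 0 → ordAt E (pullFun g (a * b)) =
        ordAt E (pullFun g a) + ordAt E (pullFun g b)) ∧
      ∃ a : X.K, a ≠ 0 ∧ ordAt E (pullFun g a) = 1 := by
    constructor
    · intro a b ha hb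
      simp only [pullFun_eq hg.dom, map_mul]
      exact ordAt_mul E ((map_ne_zero _).2 ha) ((map_ne_zero _).2 hb)
    · obtain ⟨ψ, h0, h1⟩ := exists_ordAt_eq_one hg.normal E
      obtain ⟨a, rfl⟩ := hg.bij.2 ψ
      exact ⟨a, fun ha => h0 (by rw [ha, map_zero]), by rw [pullFun_eq hg.dom, h1]⟩
  refine eq_of_nonneg_iff (hs hg E).1 (hs hg' E').1 (fun a ha => ?_) (hs hg E).2 (hs hg' E').2 hφ
  rw [← hg.mem_regularAt_iff E ha, ← hg'.mem_regularAt_iff E' ha, h]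

/-! ### Real combinations of principal divisors -/

/-- A real linear relation between values of homomorphisms to `ℤ` which is implied by integral
relations. -/
theorem linearCombination_eq_zero_of_forall {G ι : Type*} [CommGroup G]
    (o : ι → G →* Multiplicative ℤ) (v : G →* Multiplicative ℤ)
    (hv : ∀ φ, (∀ i, o i φ = 1) → v φ = 1) (α : G →₀ ℝ)
    (hα : ∀ i, Finsupp.linearCombination ℝ (fun φ => ((o i φ).toAdd : ℝ)) α = 0) :
    Finsupp.linearCombination ℝ (fun φ => ((v φ).toAdd : ℝ)) α = 0 := by
  -- A real number vanishes if every `ℚ`-linear functional kills it. A functional turns the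
  -- coefficients of `α` into rationals and, after clearing denominators, into exponents `m`. The
  -- real relation becomes a statement about the single element `∏ φ ^ m φ`, to which `hv` applies.
  rw [← Module.forall_dual_apply_eq_zero_iff ℚ]
  intro l
  obtain ⟨N, hN⟩ := IsLocalization.exist_integer_multiples_of_finset (nonZeroDivisors ℤ)
    (α.support.image fun φ => l (α φ))
  have hN0 : (N : ℤ) ≠ 0 := nonZeroDivisors.ne_zero N.2
  have hm : ∀ φ, ∃ m : ℤ, φ ∈ α.support → (m : ℚ) = (N : ℤ) * l (α φ) := by
    intro φ
    by_cases h : φ ∈ α.support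
    · obtain ⟨m, hm⟩ := hN _ (Finset.mem_image_of_mem _ h)
      exact ⟨m, fun _ => by simpa [Submonoid.smul_def] using hm⟩
    · exact ⟨0, fun h' => absurd h' h⟩
  choose m hm using hm
  have key (w : G →* Multiplicative ℤ) :
      (N : ℤ) * l (Finsupp.linearCombination ℝ (fun φ => ((w φ).toAdd : ℝ)) α) =
        ((w (∏ φ ∈ α.support, φ ^ m φ)).toAdd : ℤ) := by
    rw [Finsupp.linearCombination_apply, Finsupp.sum, map_sum, map_prod, toAdd_prod,
      Finset.mul_sum, Int.cast_sum]
    refine Finset.sum_congr rfl fun φ hφ => ?_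
    have : α φ • ((w φ).toAdd : ℝ) = ((w φ).toAdd : ℚ) • α φ := by
      rw [Rat.smul_def]; push_cast; rw [smul_eq_mul, mul_comm]
    rw [this, map_smul, map_zpow, toAdd_zpow, smul_eq_mul, smul_eq_mul, Int.cast_mul, hm φ hφ]
    ring
  have h1 : v (∏ φ ∈ α.support, φ ^ m φ) = 1 := by
    refine hv _ fun i => ?_
    have := key (o i)
    rw [hα i, map_zero, mul_zero] at this
    exact toAdd_eq_zero.1 (by exact_mod_cast this.symm)
  have h2 := key v
  rw [h1, toAdd_one, Int.cast_zero] at h2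
  exact (mul_eq_zero.1 h2).resolve_left (by exact_mod_cast hN0)

/-- The coefficient at `E` of the pull back of the divisor of the real combination `α` of rational
functions on `X`. -/
def pullDiv {Y X : Variety} (g : Y.sch ⟶ X.sch) (E : PrimeDivisor Y) : (X.Kˣ →₀ ℝ) →ₗ[ℝ] ℝ :=
  Finsupp.linearCombination ℝ fun φ => (ordAt E (pullFun g (φ : X.K)) : ℝ)

/-- The coefficient at `P` of the divisor of the real combination `α` of rational functions. -/
def divAt {X : Variety} (P : PrimeDivisor X) : (X.Kˣ →₀ ℝ) →ₗ[ℝ] ℝ :=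
  Finsupp.linearCombination ℝ fun φ => (ordAt P (φ : X.K) : ℝ)

/-- `D` is the divisor of `α` in a neighbourhood of `x`. -/
def IsDivNear {X : Variety} (D : PrimeDivisor X → ℝ) (x : X.sch) (α : X.Kˣ →₀ ℝ) : Prop :=
  ∃ U : X.sch.Opens, x ∈ U ∧ ∀ P : PrimeDivisor X, P.1 ∈ U → D P = divAt P α

theorem pullHom_eq_unit {Y X : Variety} {g : Y.sch ⟶ X.sch} (h : IsDom g) (φ : X.Kˣ) :
    pullFun g (φ : X.K) = ((Units.map (pullHom g h).toMonoidHom φ : Y.Kˣ) : Y.K) := by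
  rw [pullFun_eq h]; rfl

/-- The order along `E` of pull backs of rational functions. -/
def pullOrd {Y X : Variety} (g : Y.sch ⟶ X.sch) (h : IsDom g) (E : PrimeDivisor Y) :
    X.Kˣ →* Multiplicative ℤ :=
  (ordHom E).comp (Units.map (pullHom g h).toMonoidHom)

theorem pullDiv_eq {Y X : Variety} {g : Y.sch ⟶ X.sch} (h : IsDom g) (E : PrimeDivisor Y) :
    pullDiv g E = Finsupp.linearCombination ℝ fun φ => ((pullOrd g h E φ).toAdd : ℝ) := by
  unfold pullDiv
  congr 1
  funext φ
  rw [pullFun_eq h]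
  rfl

theorem unit_mem_of_ordAt_eq_zero {X : Variety} (hX : X.IsNormal) {x : X.sch} (φ : X.Kˣ)
    (h : ∀ P : PrimeDivisor X, P.1 ⤳ x → ordAt P (φ : X.K) = 0) :
    (φ : X.K) ∈ localSubring X x ∧ ((φ⁻¹ : X.Kˣ) : X.K) ∈ localSubring X x := by
  constructor
  · exact mem_localSubring_of_forall_primeDivisor hX fun P hP =>
      (ordAt_nonneg_iff hX P φ.ne_zero).1 (h P hP).ge
  · refine mem_localSubring_of_forall_primeDivisor hX fun P hP =>
      (ordAt_nonneg_iff hX P (φ⁻¹).ne_zero).1 ?_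
    rw [Units.val_inv_eq_inv_val, ordAt_inv, h P hP, neg_zero]

theorem ordAt_eq_zero_of_unit_mem {X : Variety} (hX : X.IsNormal) {P : PrimeDivisor X} (φ : X.Kˣ)
    (h : (φ : X.K) ∈ localSubring X P.1) (h' : ((φ⁻¹ : X.Kˣ) : X.K) ∈ localSubring X P.1) :
    ordAt P (φ : X.K) = 0 := by
  rw [← ordAt_nonneg_iff hX P φ.ne_zero] at h
  rw [← ordAt_nonneg_iff hX P (φ⁻¹).ne_zero, Units.val_inv_eq_inv_val, ordAt_inv] at h'
  omega

/-- On a normal variety, the value of a real combination of functions under a homomorphism which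
is trivial on local units is determined by its divisor. -/
theorem linearCombination_eq_zero_of_divAt {X : Variety} (hX : X.IsNormal) {x : X.sch}
    (v : X.Kˣ →* Multiplicative ℤ)
    (hv : ∀ φ : X.Kˣ, (φ : X.K) ∈ localSubring X x → ((φ⁻¹ : X.Kˣ) : X.K) ∈ localSubring X x →
      v φ = 1) {α : X.Kˣ →₀ ℝ} (hα : ∀ P : PrimeDivisor X, P.1 ⤳ x → divAt P α = 0) :
    Finsupp.linearCombination ℝ (fun φ => ((v φ).toAdd : ℝ)) α = 0 := by
  refine linearCombination_eq_zero_of_forall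
    (fun P : {P : PrimeDivisor X // P.1 ⤳ x} => ordHom P.1) v (fun φ hφ => ?_) α
    fun P => hα P.1 P.2
  have h := unit_mem_of_ordAt_eq_zero hX φ fun P hP => hφ ⟨P, hP⟩
  exact hv φ h.1 h.2

/-- A rational function without zeros or poles through the image of `E` is a unit there by Hartogs,
so its pull back has order zero along `E`. The real case reduces to this one. Consequently the value
chosen in `pullCoeff` does not depend on the local representation of the divisor. -/
theorem pullDiv_eq_zero {Y X : Variety} {g : Y.sch ⟶ X.sch} (hX : X.IsNormal) (hY : Y.IsNormal)
    (hg : IsDom g) {E : PrimeDivisor Y} {α : X.Kˣ →₀ ℝ}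
    (hα : ∀ P : PrimeDivisor X, P.1 ⤳ g E.1 → divAt P α = 0) : pullDiv g E α = 0 := by
  rw [pullDiv_eq hg]
  refine linearCombination_eq_zero_of_divAt hX _ (fun φ h h' => ?_) hα
  have := ordAt_eq_zero_of_unit_mem hY (P := E) (Units.map (pullHom g hg).toMonoidHom φ)
    (pullHom_mem_localSubring hg h) (by
      rw [← map_inv]; exact pullHom_mem_localSubring hg h')
  exact congrArg Multiplicative.ofAdd this

theorem IsDivNear.pullDiv_eq {Y X : Variety} {g : Y.sch ⟶ X.sch} (hX : X.IsNormal)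
    (hY : Y.IsNormal) (hg : IsDom g) {E : PrimeDivisor Y} {D : PrimeDivisor X → ℝ}
    {α β : X.Kˣ →₀ ℝ} (hα : IsDivNear D (g E.1) α) (hβ : IsDivNear D (g E.1) β) :
    pullDiv g E α = pullDiv g E β := by
  obtain ⟨U, hU, h⟩ := hα
  obtain ⟨V, hV, h'⟩ := hβ
  rw [← sub_eq_zero, ← map_sub]
  refine pullDiv_eq_zero hX hY hg fun P hP => ?_
  rw [map_sub, ← h P (hP.mem_open U.isOpen hU), ← h' P (hP.mem_open V.isOpen hV), sub_self]

/-- Finitely supported functions on the units replace indexed families of functions, so that two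
local representations can be subtracted and linear maps applied to the difference. -/
theorem hasPullCoeff_iff {Y X : Variety} {g : Y.sch ⟶ X.sch} {D : PrimeDivisor X → ℝ}
    {E : PrimeDivisor Y} {t : ℝ} :
    HasPullCoeff g D E t ↔ ∃ α, IsDivNear D (g E.1) α ∧ t = pullDiv g E α := by
  constructor
  · rintro ⟨m, r, φ, U, h0, hU, hD, ht⟩
    refine ⟨∑ k, Finsupp.single (Units.mk0 (φ k) (h0 k)) (r k), ⟨U, hU, fun P hP => ?_⟩, ?_⟩
    · rw [hD P hP, map_sum]
      exact Finset.sum_congr rfl fun k _ => by simp [divAt]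
    · rw [ht, map_sum]
      exact Finset.sum_congr rfl fun k _ => by simp [pullDiv]
  · rintro ⟨α, ⟨U, hU, hD⟩, ht⟩
    refine ⟨α.support.card, fun k => α (α.support.equivFin.symm k).1,
      fun k => ((α.support.equivFin.symm k).1 : X.K), U, fun k => Units.ne_zero _, hU,
      fun P hP => ?_, ?_⟩
    · rw [hD P hP, divAt, Finsupp.linearCombination_apply, Finsupp.sum, ← Finset.sum_coe_sort,
        ← α.support.equivFin.symm.sum_comp]
      rfl
    · rw [ht, pullDiv, Finsupp.linearCombination_apply, Finsupp.sum, ← Finset.sum_coe_sort,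
        ← α.support.equivFin.symm.sum_comp]
      rfl

theorem pullCoeff_eq {Y X : Variety} {g : Y.sch ⟶ X.sch} (hX : X.IsNormal) (hY : Y.IsNormal)
    (hg : IsDom g) {D : PrimeDivisor X → ℝ} {E : PrimeDivisor Y} {α : X.Kˣ →₀ ℝ}
    (h : IsDivNear D (g E.1) α) : pullCoeff g D E = pullDiv g E α := by
  have hex : ∃ t, HasPullCoeff g D E t := ⟨_, hasPullCoeff_iff.2 ⟨α, h, rfl⟩⟩
  rw [pullCoeff, dif_pos hex]
  obtain ⟨β, hβ, e⟩ := hasPullCoeff_iff.1 hex.choose_spec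
  rw [e]
  exact hβ.pullDiv_eq hX hY hg h

theorem IsDivNear.congr {X : Variety} {D D' : PrimeDivisor X → ℝ} {x : X.sch} {α : X.Kˣ →₀ ℝ}
    (h : IsDivNear D x α) {V : X.sch.Opens} (hx : x ∈ V)
    (hD : ∀ P : PrimeDivisor X, P.1 ∈ V → D P = D' P) : IsDivNear D' x α := by
  obtain ⟨U, hU, h⟩ := h
  exact ⟨U ⊓ V, ⟨hU, hx⟩, fun P hP => (hD P hP.2).symm.trans (h P hP.1)⟩

/-- The coefficient of the pull back depends only on the divisor near the center. -/
theorem pullCoeff_congr {Y X : Variety} {g : Y.sch ⟶ X.sch} {D D' : PrimeDivisor X → ℝ}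
    {E : PrimeDivisor Y} {V : X.sch.Opens} (hV : g E.1 ∈ V)
    (hD : ∀ P : PrimeDivisor X, P.1 ∈ V → D P = D' P) : pullCoeff g D E = pullCoeff g D' E := by
  have : HasPullCoeff g D E = HasPullCoeff g D' E := by
    funext t
    rw [hasPullCoeff_iff, hasPullCoeff_iff]
    exact propext ⟨fun ⟨α, h, e⟩ => ⟨α, h.congr hV hD, e⟩,
      fun ⟨α, h, e⟩ => ⟨α, h.congr hV fun P hP => (hD P hP).symm, e⟩⟩
  have key : ∀ F G : ℝ → Prop, F = G → (open Classical in
      (if h : ∃ t, F t then h.choose else 0) = if h : ∃ t, G t then h.choose else 0) := by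
    rintro F _ rfl; rfl
  exact key _ _ this

theorem IsDivNear.add {X : Variety} {D D' : PrimeDivisor X → ℝ} {x : X.sch} {α α' : X.Kˣ →₀ ℝ}
    (h : IsDivNear D x α) (h' : IsDivNear D' x α') :
    IsDivNear (fun P => D P + D' P) x (α + α') := by
  obtain ⟨U, hU, h⟩ := h
  obtain ⟨U', hU', h'⟩ := h'
  exact ⟨U ⊓ U', ⟨hU, hU'⟩, fun P hP => by simp only [map_add, h P hP.1, h' P hP.2]⟩

theorem IsDivNear.smul {X : Variety} {D : PrimeDivisor X → ℝ} {x : X.sch} {α : X.Kˣ →₀ ℝ}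
    (h : IsDivNear D x α) (c : ℝ) : IsDivNear (fun P => c * D P) x (c • α) := by
  obtain ⟨U, hU, h⟩ := h
  exact ⟨U, hU, fun P hP => by simp only [map_smul, h P hP, smul_eq_mul]⟩

theorem IsDivNear.zero {X : Variety} (x : X.sch) : IsDivNear (fun _ => 0) x (0 : X.Kˣ →₀ ℝ) :=
  ⟨⊤, trivial, fun P _ => by rw [map_zero]⟩

theorem IsDivNear.sum {X : Variety} {ι : Type*} (s : Finset ι) {D : ι → PrimeDivisor X → ℝ}
    {x : X.sch} {α : ι → X.Kˣ →₀ ℝ} (h : ∀ i ∈ s, IsDivNear (D i) x (α i)) :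
    IsDivNear (fun P => ∑ i ∈ s, D i P) x (∑ i ∈ s, α i) := by
  classical
  induction s using Finset.induction_on with
  | empty => simpa using IsDivNear.zero x
  | insert i s hi ih =>
    simp only [Finset.sum_insert hi]
    exact (h i (Finset.mem_insert_self i s)).add
      (ih fun j hj => h j (Finset.mem_insert_of_mem hj))

theorem isDivNear_single {X : Variety} {A : PrimeDivisor X → ℤ} {x : X.sch} {φ : X.K}
    (h : IsLocalEq A x φ) :
    IsDivNear (fun P => (A P : ℝ)) x (Finsupp.single (Units.mk0 φ h.1) 1) := by
  obtain ⟨h0, U, hU, h⟩ := h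
  exact ⟨U, hU, fun P hP => by simp [divAt, h P hP]⟩

theorem IsRCartierOn.exists_isDivNear {X : Variety} {V : X.sch.Opens} {D : PrimeDivisor X → ℝ}
    (h : IsRCartierOn V D) {x : X.sch} (hx : x ∈ V) : ∃ α, IsDivNear D x α := by
  obtain ⟨m, r, A, hA, hD⟩ := h
  choose φ hφ using fun i => hA i x hx
  exact ⟨_, (IsDivNear.sum Finset.univ fun i _ => (isDivNear_single (hφ i)).smul (r i)).congr hx
    fun P hP => (hD P hP).symm⟩

/-! ### Finiteness of integral closures -/

/-- `K` is a finite extension of the fraction field of `P`, and it is separable because the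
characteristic is zero; then the trace form gives finiteness. -/
theorem finite_integralClosure_of_isFractionRing {P R K : Type*} [CommRing P] [IsDomain P]
    [IsIntegrallyClosed P] [IsNoetherianRing P] [CharZero P] [CommRing R] [IsDomain R] [Field K]
    [Algebra P R] [Module.Finite P R] [FaithfulSMul P R] [Algebra R K] [IsFractionRing R K]
    [Algebra P K] [IsScalarTower P R K] : Module.Finite P (integralClosure P K) := by
  have : FaithfulSMul P K := by
    rw [faithfulSMul_iff_algebraMap_injective, IsScalarTower.algebraMap_eq P R K]
    exact (IsFractionRing.injective R K).comp (FaithfulSMul.algebraMap_injective P R)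
  have : IsDomain (FractionRing P) := inferInstance
  let _ : Algebra (FractionRing P) K := FractionRing.liftAlgebra P K
  have : IsScalarTower P (FractionRing P) K := FractionRing.isScalarTower_liftAlgebra P K
  have : IsLocalization (Algebra.algebraMapSubmonoid R (nonZeroDivisors P)) K := by
    have : Algebra.IsAlgebraic P R := Algebra.IsAlgebraic.of_finite P R 
    infer_instance
  have : FiniteDimensional (FractionRing P) K :=
    Module.Finite.of_isLocalization P R (nonZeroDivisors P)
  have : CharZero (FractionRing P) := charZero_of_injective_algebraMap (R := P) (IsFractionRing.injective P _)
  exact IsIntegralClosure.finite P (FractionRing P) K (integralClosure P K)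

/-- `A` need not inject into `K`, so it is replaced by its image `R`, which has fraction field `K`.
Noether normalization presents `R` as finite over a polynomial ring `P`. Integrality over `A` and
over `P` agree in `K`, because the image of `P` is contained in that of `A`; so generators over `P`
also generate over `A`. -/
theorem finite_integralClosure_of_finiteType (k : Type*) {A K : Type*} [Field k] [CharZero k]
    [CommRing A] [Algebra k A] [Algebra.FiniteType k A] [Field K] [Algebra A K]
    (h : ∀ x : K, ∃ a b : A, algebraMap A K b ≠ 0 ∧ x * algebraMap A K b = algebraMap A K a) :
    Module.Finite A (integralClosure A K) := by
  classical
  let _ : Algebra k K := ((algebraMap A K).comp (algebraMap k A)).toAlgebra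
  have : IsScalarTower k A K := .of_algebraMap_eq' rfl
  let R : Subalgebra k K := (IsScalarTower.toAlgHom k A K).range
  have hRA (a : A) : algebraMap A K a ∈ R := ⟨a, rfl⟩
  have : Algebra.FiniteType k R := Algebra.FiniteType.of_surjective
    (IsScalarTower.toAlgHom k A K).rangeRestrict (AlgHom.rangeRestrict_surjective _)
  have : IsFractionRing R K := by
    refine ⟨fun y => ?_, fun x => ?_, fun {x y} hxy => ⟨1, ?_⟩⟩
    · exact isUnit_iff_ne_zero.2 fun h0 => nonZeroDivisors.ne_zero y.2 (Subtype.ext h0)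
    · obtain ⟨a, b, hb, e⟩ := h x
      exact ⟨(⟨_, hRA a⟩, ⟨⟨_, hRA b⟩, mem_nonZeroDivisors_of_ne_zero fun h0 =>
        hb congr(($h0 : K))⟩), e⟩
    · rw [Subtype.ext hxy]
  obtain ⟨s, g, hg, hfin⟩ := exists_finite_inj_algHom_of_fg k R
  let P := MvPolynomial (Fin s) k
  let _ : Algebra P R := g.toRingHom.toAlgebra
  have : Module.Finite P R := hfin
  have : FaithfulSMul P R := (faithfulSMul_iff_algebraMap_injective P R).2 hg
  let _ : Algebra P K := ((algebraMap R K).comp (algebraMap P R)).toAlgebra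
  have : IsScalarTower P R K := .of_algebraMap_eq' rfl
  have hP := finite_integralClosure_of_isFractionRing (P := P) (R := R) (K := K)
  have hint (x : K) (hx : IsIntegral A x) : IsIntegral P x := by
    have h1 : IsIntegral R x := by
      obtain ⟨p, hp, hp0⟩ := hx
      let ρ : A →+* R := (IsScalarTower.toAlgHom k A K).rangeRestrict.toRingHom
      refine ⟨p.map ρ, hp.map _, ?_⟩
      rw [Polynomial.eval₂_map]
      exact hp0
    exact isIntegral_trans (R := P) (A := R) x h1
  have hlift (y : P) : ∃ a : A, algebraMap A K a = algebraMap P K y := (g y).2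
  obtain ⟨S, hS⟩ := hP.fg_top
  have hSA (s : integralClosure P K) : (s : K) ∈ integralClosure A K := by
    obtain ⟨p, hp, hp0⟩ := s.2
    choose l hl using hlift
    obtain ⟨q, hq, hdeg, hqm⟩ := Polynomial.lifts_and_natDegree_eq_and_monic
      (f := algebraMap A K) (p := p.map (algebraMap P K)) (by
        rw [Polynomial.lifts_iff_coeff_lifts]
        intro n
        rw [Polynomial.coeff_map]
        exact ⟨_, hl _⟩) (hp.map _)
    refine ⟨q, hqm, ?_⟩
    rw [← Polynomial.eval_map, hq, Polynomial.eval_map]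
    exact hp0
  refine ⟨⟨S.image fun s : integralClosure P K => ⟨s, hSA s⟩, top_unique fun x _ => ?_⟩⟩
  have hx : (⟨x, hint _ x.2⟩ : integralClosure P K) ∈ Submodule.span P (S : Set (integralClosure P K)) :=
    hS ▸ Submodule.mem_top
  have key (y : integralClosure P K) (hy : y ∈ Submodule.span P (S : Set (integralClosure P K))) :
      (⟨y, hSA y⟩ : integralClosure A K) ∈
        Submodule.span A ((S.image fun s : integralClosure P K => (⟨s, hSA s⟩ : integralClosure A K) : Finset _) : Set _) := by
    induction hy using Submodule.span_induction with
    | mem y hy => exact Submodule.subset_span (Finset.mem_coe.2 (Finset.mem_image_of_mem _ hy))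
    | zero => exact Submodule.zero_mem _
    | add y z _ _ hy hz => exact Submodule.add_mem _ hy hz
    | smul c y _ hy =>
      obtain ⟨a, ha⟩ := hlift c
      convert! Submodule.smul_mem _ a hy using 1
      refine Subtype.ext ?_
      change c • (y : K) = a • (y : K)
      rw [Algebra.smul_def, Algebra.smul_def, ha]
  exact key _ hx

section

/-! ### Birational morphisms -/

/-- The lift of the generic point spreads out to a section `s` of `g` over an open set `U`. A
section of a separated morphism is a closed immersion. This one is also surjective, since it hits
the generic point, and its target is reduced, so it is an isomorphism inverse to `g` over `U`. -/
theorem isBirational_of_lift {Y X : Variety} (g : Y.sch ⟶ X.sch) [IsSeparated g]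
    [LocallyOfFiniteType g]
    (σ : Spec (X.sch.presheaf.stalk (genericPoint X.sch)) ⟶ Y.sch)
    (hσ : σ ≫ g = X.sch.fromSpecStalk _)
    (hgen : ∀ x, σ x ⤳ genericPoint Y.sch) : IsBirational g := by
  obtain ⟨U, hU, f, hf, hfg⟩ := spread_out_of_isGermInjective' (𝟙 X.sch) g σ
    (by rw [hσ, Category.comp_id])
  rw [Category.comp_id] at hfg
  refine ⟨U, ⟨_, hU⟩, ?_⟩
  have hrange : Set.range f ⊆ Set.range (g ⁻¹ᵁ U).ι := by
    rw [Scheme.Opens.range_ι]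
    rintro _ ⟨u, rfl⟩
    change g (f u) ∈ U
    rw [← Scheme.Hom.comp_apply, hfg]
    exact u.2
  let s : U.toScheme ⟶ (g ⁻¹ᵁ U).toScheme := IsOpenImmersion.lift (g ⁻¹ᵁ U).ι f hrange
  have hs : s ≫ (g ⁻¹ᵁ U).ι = f := IsOpenImmersion.lift_fac _ _ _
  have hsg : s ≫ (g ∣_ U) = 𝟙 _ := by
    rw [← cancel_mono U.ι, Category.assoc, morphismRestrict_ι, ← Category.assoc, hs, hfg,
      Category.id_comp]
  have : IsClosedImmersion (s ≫ (g ∣_ U)) := by rw [hsg]; infer_instance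
  have : IsClosedImmersion s := .of_comp s (g ∣_ U)
  have : Surjective s := by
    refine ⟨fun y => ?_⟩
    have hcl : IsClosed (Set.range s) := s.isClosedEmbedding.isClosed_range
    let u : U.toScheme := ⟨_, hU⟩
    let x : Spec (X.sch.presheaf.stalk (genericPoint X.sch)) := IsLocalRing.closedPoint _
    have hfu : f u = σ x := by
      rw [hf, Scheme.Hom.comp_apply]
      congr 1
      refine U.ι.isOpenEmbedding.injective ?_
      rw [← Scheme.Hom.comp_apply, Scheme.Opens.fromSpecStalkOfMem_ι]
      exact Scheme.fromSpecStalk_closedPoint.symm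
    have h1 : s u ⤳ y := by
      rw [← (g ⁻¹ᵁ U).ι.isOpenEmbedding.isInducing.specializes_iff]
      have : (g ⁻¹ᵁ U).ι (s u) = f u := by rw [← Scheme.Hom.comp_apply, hs]
      rw [this, hfu]
      exact (hgen x).trans (genericPoint_specializes _)
    exact h1.mem_closed hcl ⟨u, rfl⟩
  have : IsReduced (g ⁻¹ᵁ U).toScheme := inferInstance
  have : IsIso s := isIso_of_isClosedImmersion_of_surjective s
  have : g ∣_ U = inv s := by rw [← cancel_epi s, hsg, IsIso.hom_inv_id]
  rw [this]
  infer_instance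

/-! ### Normalization in the function field -/

section Normalization

variable {X : Variety} {T : Scheme.{0}} (p : T ⟶ X.sch)
  (η : Spec (X.sch.presheaf.stalk (genericPoint X.sch)) ⟶ T)

theorem stalkClosedPointTo_surjective (hη : η ≫ p = X.sch.fromSpecStalk _) :
    Function.Surjective (Scheme.stalkClosedPointTo η).hom := by
  have h1 : Function.Surjective (Scheme.stalkClosedPointTo (η ≫ p)).hom := by
    rw [hη, Scheme.stalkClosedPointTo_fromSpecStalk]
    exact (ConcreteCategory.bijective_of_isIso
      (X.sch.presheaf.stalkCongr (by rw [Scheme.fromSpecStalk_closedPoint]; rfl)).hom).2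
  rw [Scheme.stalkClosedPointTo_comp] at h1
  exact Function.Surjective.of_comp h1

theorem isField_stalk_genericPoint (X : Variety) :
    IsField (X.sch.presheaf.stalk (genericPoint X.sch)) :=
  Field.toIsField X.K

theorem generic_eq_closedPoint (x : Spec (X.sch.presheaf.stalk (genericPoint X.sch))) :
    x = IsLocalRing.closedPoint _ :=
  have : Unique (PrimeSpectrum X.K) := inferInstance
  Subsingleton.elim (α := PrimeSpectrum X.K) _ _

/-- Every element of the function field is a fraction of functions on an affine open subset. -/
theorem exists_fraction (hη : η ≫ p = X.sch.fromSpecStalk _) {U : T.Opens} (hU : IsAffineOpen U)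
    (h : η ⁻¹ᵁ U = ⊤) (x : Γ(Spec (X.sch.presheaf.stalk (genericPoint X.sch)), η ⁻¹ᵁ U)) :
    ∃ a b : Γ(T, U), IsUnit ((η.app U).hom b) ∧ x * (η.app U).hom b = (η.app U).hom a := by
  have hm : η (IsLocalRing.closedPoint _) ∈ U := by
    change IsLocalRing.closedPoint _ ∈ η ⁻¹ᵁ U
    rw [h]; trivial
  let e := ((Spec (X.sch.presheaf.stalk (genericPoint X.sch))).presheaf.mapIso
    (eqToIso (Scheme.preimage_eq_top_of_closedPoint_mem η hm).symm).op ≪≫ Scheme.ΓSpecIso _)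
  have he (a : Γ(T, U)) : (Scheme.stalkClosedPointTo η).hom (T.presheaf.germ U _ hm a) =
      e.hom.hom ((η.app U).hom a) :=
    congr($(Scheme.germ_stalkClosedPointTo η U hm) a)
  obtain ⟨y, hy⟩ := stalkClosedPointTo_surjective p η hη (e.hom.hom x)
  let := (T.presheaf.germ U _ hm).hom.toAlgebra
  have := hU.isLocalization_stalk ⟨_, hm⟩
  obtain ⟨⟨a, b⟩, hab⟩ := IsLocalization.surj (hU.primeIdealOf ⟨_, hm⟩).asIdeal.primeCompl y
  have hb : IsUnit (T.presheaf.germ U _ hm b) :=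
    IsLocalization.map_units (M := (hU.primeIdealOf ⟨_, hm⟩).asIdeal.primeCompl) _ b
  have hinj : Function.Injective e.hom.hom := (ConcreteCategory.bijective_of_isIso e.hom).1
  refine ⟨a, b, ?_, hinj ?_⟩
  · have h2 := hb.map (Scheme.stalkClosedPointTo η).hom
    rw [he] at h2
    have h3 := h2.map e.inv.hom
    have h4 (z) : e.inv.hom (e.hom.hom z) = z := congr($(e.hom_inv_id) z)
    rwa [h4] at h3
  · rw [map_mul, ← he, ← he, ← hy, ← map_mul]
    exact congrArg _ hab

end Normalization

end

section

/-! ### Normal models -/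

theorem isIntegrallyClosed_integralClosure_of_fraction {A K : Type*} [CommRing A] [Field K]
    [Algebra A K]
    (h : ∀ x : K, ∃ a b : A, IsUnit (algebraMap A K b) ∧ x * algebraMap A K b = algebraMap A K a) :
    IsIntegrallyClosed (integralClosure A K) := by
  have : IsFractionRing (integralClosure A K) K := by
    refine ⟨fun y => ?_, fun x => ?_, fun {x y} hxy => ⟨1, ?_⟩⟩
    · exact isUnit_iff_ne_zero.2 fun h0 => nonZeroDivisors.ne_zero y.2 (Subtype.ext h0)
    · obtain ⟨a, b, hb, e⟩ := h x
      exact ⟨(algebraMap A _ a, ⟨algebraMap A _ b, mem_nonZeroDivisors_of_ne_zero fun h0 =>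
        hb.ne_zero congr(($h0 : K))⟩), e⟩
    · rw [Subtype.ext hxy]
  rw [isIntegrallyClosed_iff K]
  intro x hx
  exact ⟨⟨x, isIntegral_trans (R := A) (A := integralClosure A K) x hx⟩, rfl⟩

theorem isSeparated_of_isProper {X : Variety} {T : Scheme.{0}} (p : T ⟶ X.sch) [IsProper p] :
    T.IsSeparated := by
  have : IsSeparated (p ≫ X.str) := inferInstance
  refine ⟨?_⟩
  have : terminal.from T = (p ≫ X.str) ≫ terminal.from _ := Subsingleton.elim _ _
  rw [this]
  infer_instance

section Normalization

variable {X : Variety} {T : Scheme.{0}} (p : T ⟶ X.sch) [IsProper p]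
  (η : Spec (X.sch.presheaf.stalk (genericPoint X.sch)) ⟶ T)

theorem preimage_eq_bot_or_top (U : T.Opens) : η ⁻¹ᵁ U = ⊥ ∨ η ⁻¹ᵁ U = ⊤ := by
  by_cases h : (IsLocalRing.closedPoint _ : Spec (X.sch.presheaf.stalk (genericPoint X.sch))) ∈
      η ⁻¹ᵁ U
  · right
    exact top_unique fun x _ => by rwa [generic_eq_closedPoint x]
  · left
    exact bot_unique fun x hx => h (by rwa [generic_eq_closedPoint x] at hx)

theorem isField_app_of_eq_top {V : (Spec (X.sch.presheaf.stalk (genericPoint X.sch))).Opens}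
    (h : V = ⊤) : IsField Γ(Spec (X.sch.presheaf.stalk (genericPoint X.sch)), V) := by
  subst h
  exact (Scheme.ΓSpecIso (X.sch.presheaf.stalk (genericPoint X.sch))).commRingCatIsoToRingEquiv.toMulEquiv.isField
    (isField_stalk_genericPoint X)

/-- Over an affine open set of `T` the ring in which one normalizes is either zero or the function
field. The latter consists of fractions of functions on the affine open set, so finiteness of
integral closures applies. -/
theorem isFinite_fromNormalization [QuasiCompact η] [QuasiSeparated η]
    (hη : η ≫ p = X.sch.fromSpecStalk _) : IsFinite η.fromNormalization := by
  refine { finite_app := fun U hU => ?_ }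
  rw [η.fromNormalization_app hU]
  let := (η.app U).hom.toAlgebra
  have hfin : Module.Finite Γ(T, U) (integralClosure Γ(T, U)
      Γ(Spec (X.sch.presheaf.stalk (genericPoint X.sch)), η ⁻¹ᵁ U)) := by
    rcases preimage_eq_bot_or_top η U with h | h
    · have : Subsingleton Γ(Spec (X.sch.presheaf.stalk (genericPoint X.sch)), η ⁻¹ᵁ U) := by
        rw [h]; infer_instance
      infer_instance
    · let fK := (isField_app_of_eq_top h).toField
      let sV : T ⟶ Spec (CommRingCat.of ℂ) := p ≫ X.str
      have hft : (sV.appLE ⊤ U le_top).hom.FiniteType :=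
        sV.finiteType_appLE (isAffineOpen_top _) hU _
      have hft2 : ((Scheme.ΓSpecIso (CommRingCat.of ℂ)).inv ≫ sV.appLE ⊤ U le_top).hom.FiniteType := by
        rw [CommRingCat.hom_comp]
        exact hft.comp (RingHom.FiniteType.of_surjective _ (ConcreteCategory.bijective_of_isIso
          (Scheme.ΓSpecIso (CommRingCat.of ℂ)).inv).2)
      let := ((Scheme.ΓSpecIso (CommRingCat.of ℂ)).inv ≫ sV.appLE ⊤ U le_top).hom.toAlgebra
      have : Algebra.FiniteType ℂ Γ(T, U) := hft2
      refine finite_integralClosure_of_finiteType ℂ fun x => ?_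
      obtain ⟨a, b, hb, e⟩ := exists_fraction p η hη hU h x
      exact ⟨a, b, hb.ne_zero, e⟩
  rw [CommRingCat.hom_comp]
  refine RingHom.Finite.comp ?_ hfin
  exact RingHom.Finite.of_surjective _ (ConcreteCategory.bijective_of_isIso _).2

theorem generic_normalization [QuasiCompact η] [QuasiSeparated η] [IsIntegral η.normalization]
    (x : Spec (X.sch.presheaf.stalk (genericPoint X.sch))) :
    η.toNormalization x = genericPoint η.normalization := by
  have h1 : closure {η.toNormalization x} = Set.univ := by
    have h := η.toNormalization.denseRange.closure_range
    have h2 : Set.range η.toNormalization = {η.toNormalization x} := by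
      ext y
      constructor
      · rintro ⟨z, rfl⟩
        rw [generic_eq_closedPoint z, generic_eq_closedPoint x]; rfl
      · rintro rfl
        exact ⟨x, rfl⟩
    rwa [h2] at h
  have h3 : η.toNormalization x ⤳ genericPoint η.normalization := by
    rw [specializes_iff_mem_closure, h1]; trivial
  exact (h3.antisymm (genericPoint_specializes _)).eq

omit [IsProper p] in

theorem isIntegrallyClosed_stalk_normalization [QuasiCompact η] [QuasiSeparated η]
    [IsIntegral η.normalization]
    (hη : η ≫ p = X.sch.fromSpecStalk _) (n : η.normalization) :
    IsIntegrallyClosed (η.normalization.presheaf.stalk n) := by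
  obtain ⟨_, ⟨U, hU, rfl⟩, hx, -⟩ := T.isBasis_affineOpens.exists_subset_of_mem_open
    (Set.mem_univ (η.fromNormalization n)) isOpen_univ
  let N := η.normalization
  have hV : IsAffineOpen (η.fromNormalization ⁻¹ᵁ U) := hU.preimage _
  have hn : n ∈ η.fromNormalization ⁻¹ᵁ U := hx
  let pt : Spec (X.sch.presheaf.stalk (genericPoint X.sch)) := IsLocalRing.closedPoint _
  have h : η ⁻¹ᵁ U = ⊤ := by
    refine (preimage_eq_bot_or_top η U).resolve_left fun h0 => ?_
    have h1 : η.toNormalization pt ∈ η.fromNormalization ⁻¹ᵁ U := by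
      rw [generic_normalization]
      exact (genericPoint_specializes n).mem_open (η.fromNormalization ⁻¹ᵁ U).isOpen hn
    have h2 : pt ∈ η ⁻¹ᵁ U := by
      change η pt ∈ U
      rw [← η.toNormalization_fromNormalization, Scheme.Hom.comp_apply]
      exact h1
    rw [h0] at h2
    exact h2
  let := (η.app U).hom.toAlgebra
  let fK := (isField_app_of_eq_top h).toField
  have h1 : IsIntegrallyClosed (integralClosure Γ(T, U)
      Γ(Spec (X.sch.presheaf.stalk (genericPoint X.sch)), η ⁻¹ᵁ U)) :=
    isIntegrallyClosed_integralClosure_of_fraction fun x => exists_fraction p η hη hU h x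
  have h2 : IsIntegrallyClosed Γ(η.normalization, η.fromNormalization ⁻¹ᵁ U) :=
    IsIntegrallyClosed.of_equiv (η.normalizationObjIso hU).symm.commRingCatIsoToRingEquiv
  let := (η.normalization.presheaf.germ _ n hn).hom.toAlgebra
  have := hV.isLocalization_stalk ⟨n, hn⟩
  have : Nonempty (η.fromNormalization ⁻¹ᵁ U) := ⟨⟨n, hn⟩⟩
  exact isIntegrallyClosed_of_isLocalization _ (hV.primeIdealOf ⟨n, hn⟩).asIdeal.primeCompl
    (Ideal.primeCompl_le_nonZeroDivisors _)

/-- A proper scheme over a variety `X` with a point over the generic point, with the same residue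
field, receives a finite morphism from a normal model of `X`. -/
theorem exists_isModel_of_lift (hη : η ≫ p = X.sch.fromSpecStalk _) :
    ∃ (N : Variety) (ν : N.sch ⟶ T)
      (σ : Spec (X.sch.presheaf.stalk (genericPoint X.sch)) ⟶ N.sch),
      IsFinite ν ∧ σ ≫ ν = η ∧ IsModel (ν ≫ p) ∧ ∀ x, σ x = genericPoint N.sch := by
  have := isSeparated_of_isProper p
  have : QuasiCompact η := inferInstance
  have : QuasiSeparated η := inferInstance
  have : IsIntegral (Spec (X.sch.presheaf.stalk (genericPoint X.sch))) := inferInstance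
  have : IsFinite η.fromNormalization := isFinite_fromNormalization p η hη
  let N : Variety := ⟨η.normalization, η.fromNormalization ≫ p ≫ X.str⟩
  have hg := generic_normalization η
  have hfac : η.toNormalization ≫ η.fromNormalization ≫ p = X.sch.fromSpecStalk _ := by
    rw [← hη, η.toNormalization_fromNormalization_assoc]
  refine ⟨N, η.fromNormalization, η.toNormalization, inferInstance,
    η.toNormalization_fromNormalization, ⟨?_, ?_, ?_, ?_⟩, hg⟩
  · exact isIntegrallyClosed_stalk_normalization p η hη
  · exact Category.assoc _ _ _
  · exact (inferInstance : IsProper (η.fromNormalization ≫ p))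
  · have : IsProper (η.fromNormalization ≫ p) := inferInstance
    exact isBirational_of_lift (Y := N) (η.fromNormalization ≫ p) η.toNormalization hfac
      fun x => specializes_of_eq (hg x)

end Normalization

end

/-! ### Comparison of models -/

theorem pullHom_bijective_of_isIso_stalkMap {Y X : Variety} {g : Y.sch ⟶ X.sch} (h : IsDom g)
    [IsIso (g.stalkMap (genericPoint Y.sch))] : Function.Bijective (pullHom g h) := by
  have : IsIso (X.sch.presheaf.stalkSpecializes h) :=
    (X.sch.presheaf.stalkCongr (.of_eq h.eq)).isIso_inv
  exact ConcreteCategory.bijective_of_isIso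
    (X.sch.presheaf.stalkSpecializes h ≫ g.stalkMap (genericPoint Y.sch))

theorem IsModel.isWeakModel {Y X : Variety} {g : Y.sch ⟶ X.sch} (h : IsModel g) :
    IsWeakModel g := by
  obtain ⟨V, ⟨v, hv⟩, hiso⟩ := h.birational
  have hV : genericPoint X.sch ∈ V := (genericPoint_specializes v).mem_open V.isOpen hv
  obtain ⟨y, hy⟩ : ∃ y, (g ∣_ V) y = ⟨_, hV⟩ :=
    (ConcreteCategory.bijective_of_isIso ((Scheme.forgetToTop ⋙ forget TopCat).map (g ∣_ V))).2 _
  have hgy : g y.1 = genericPoint X.sch := by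
    have := congrArg V.ι hy
    rw [← Scheme.Hom.comp_apply, morphismRestrict_ι] at this
    exact this
  have hdom : IsDom g := by
    rw [IsDom, ← hgy]
    exact (genericPoint_specializes y.1).map g.continuous
  refine ⟨h.normal, h.isOverC, hdom, ?_⟩
  have hmem : genericPoint Y.sch ∈ g ⁻¹ᵁ V := by
    change g _ ∈ V
    rwa [hdom.eq]
  let y' : (g ⁻¹ᵁ V).toScheme := ⟨_, hmem⟩
  have h1 : IsIso ((g ∣_ V).stalkMap y') := inferInstance
  have h2 : IsIso (g.stalkMap (genericPoint Y.sch)) :=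
    ((MorphismProperty.isomorphisms _).arrow_mk_iso_iff
      (morphismRestrictStalkMap g V y')).1 h1
  exact pullHom_bijective_of_isIso_stalkMap hdom

/-- The generic point of a birational `g : Y ⟶ X`, as a point with values in `K(X)`. -/
theorem IsWeakModel.exists_lift {Y X : Variety} {g : Y.sch ⟶ X.sch} (h : IsWeakModel g) :
    ∃ σ : Spec (X.sch.presheaf.stalk (genericPoint X.sch)) ⟶ Y.sch,
      σ ≫ g = X.sch.fromSpecStalk _ ∧
      Spec.map (CommRingCat.ofHom (pullHom g h.dom)) ≫ σ = Y.sch.fromSpecStalk _ := by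
  let θ : X.sch.presheaf.stalk (genericPoint X.sch) ⟶ Y.sch.presheaf.stalk (genericPoint Y.sch) :=
    CommRingCat.ofHom (pullHom g h.dom)
  have : IsIso θ := by
    rw [ConcreteCategory.isIso_iff_bijective]
    exact h.bij
  refine ⟨Spec.map (inv θ) ≫ Y.sch.fromSpecStalk _, ?_, ?_⟩
  · rw [Category.assoc, ← Scheme.SpecMap_stalkMap_fromSpecStalk]
    have h1 : Spec.map θ ≫ X.sch.fromSpecStalk _ =
        Spec.map (g.stalkMap (genericPoint Y.sch)) ≫ X.sch.fromSpecStalk _ := by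
      have : θ = X.sch.presheaf.stalkSpecializes h.dom ≫ g.stalkMap (genericPoint Y.sch) := rfl
      rw [this, Spec.map_comp, Category.assoc]
      exact congrArg _ (Scheme.SpecMap_stalkSpecializes_fromSpecStalk _)
    rw [← h1, ← Category.assoc, ← Spec.map_comp, IsIso.hom_inv_id, Spec.map_id, Category.id_comp]
  · rw [← Category.assoc]
    change (Spec.map θ ≫ Spec.map (inv θ)) ≫ _ = _
    rw [← Spec.map_comp, IsIso.inv_hom_id, Spec.map_id, Category.id_comp]

/-- Two models are dominated by a third one. -/
theorem exists_isModel_over {Y₁ Y₂ X : Variety} {g₁ : Y₁.sch ⟶ X.sch} {g₂ : Y₂.sch ⟶ X.sch}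
    (h₁ : IsModel g₁) (h₂ : IsModel g₂) :
    ∃ (N : Variety) (q₁ : N.sch ⟶ Y₁.sch) (q₂ : N.sch ⟶ Y₂.sch),
      q₁ ≫ g₁ = q₂ ≫ g₂ ∧ IsModel (q₁ ≫ g₁) := by
  obtain ⟨σ₁, hσ₁, -⟩ := h₁.isWeakModel.exists_lift
  obtain ⟨σ₂, hσ₂, -⟩ := h₂.isWeakModel.exists_lift
  have := h₁.proper
  have := h₂.proper
  let p : pullback g₁ g₂ ⟶ X.sch := pullback.fst g₁ g₂ ≫ g₁
  -- The generic points of both models define one `K(X)`-valued point of the fibre product, and the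
  -- normalization at this point dominates both.
  obtain ⟨N, ν, -, -, -, hN, -⟩ := exists_isModel_of_lift p (pullback.lift σ₁ σ₂ (hσ₁.trans hσ₂.symm))
    ((pullback.lift_fst_assoc _ _ _ _).trans hσ₁)
  refine ⟨N, ν ≫ pullback.fst _ _, ν ≫ pullback.snd _ _, ?_, ?_⟩
  · rw [Category.assoc, Category.assoc, pullback.condition]
  · rw [Category.assoc]; exact hN

/-- A morphism between weak models over `X` is dominant and birational. -/
theorem IsWeakModel.of_comp {N Y X : Variety} {q : N.sch ⟶ Y.sch} {g : Y.sch ⟶ X.sch}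
    (h : IsWeakModel (q ≫ g)) (hg : IsWeakModel g) : IsWeakModel q := by
  have hq : IsDom q := by
    rw [IsDom]
    have h1 : g (q (genericPoint N.sch)) = genericPoint X.sch := by
      have := h.dom.eq
      rwa [Scheme.Hom.comp_apply] at this
    -- If `q` missed the generic point, the local ring of `Y` at the image would contain some `φ`
    -- whose inverse it does not contain. But `φ⁻¹` is pulled back from `X`, and the image in `X` is
    -- the generic point, whose local ring contains every rational function.
    by_contra hc
    obtain ⟨φ, hφ, hφ'⟩ : ∃ φ : Y.K, φ ∈ localSubring Y (q (genericPoint N.sch)) ∧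
        φ ≠ 0 ∧ φ⁻¹ ∉ localSubring Y (q (genericPoint N.sch)) := by
      by_contra hall
      push Not at hall
      have hdim : IsField (Y.sch.presheaf.stalk (q (genericPoint N.sch))) := by
        refine ⟨⟨0, 1, zero_ne_one⟩, mul_comm, fun {a} ha => ?_⟩
        have ha' : algebraMap _ Y.K a ≠ 0 := by
          rwa [Ne, FaithfulSMul.algebraMap_eq_zero_iff]
        obtain ⟨b, hb⟩ := hall _ ⟨a, rfl⟩ ha'
        refine ⟨b, IsFractionRing.injective _ Y.K ?_⟩
        rw [map_mul, hb, map_one, mul_inv_cancel₀ ha']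
      have h2 := ringKrullDim_stalk_eq_coheight (q (genericPoint N.sch))
      rw [ringKrullDim_eq_zero_of_isField hdim] at h2
      have h3 : Order.coheight (q (genericPoint N.sch)) = 0 := by exact_mod_cast h2.symm
      rw [Order.coheight_eq_zero] at h3
      exact hc (h3 (b := genericPoint Y.sch) (genericPoint_specializes _))
    obtain ⟨ψ, rfl⟩ := hg.bij.2 φ
    refine hφ'.2 ?_
    rw [← map_inv₀]
    refine pullHom_mem_localSubring hg.dom ?_
    rw [h1]
    exact ⟨ψ⁻¹, by rw [RingHom.algebraMap_toAlgebra]; simp⟩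
  refine ⟨h.normal, ?_, hq, RingHom.injective _, fun φ => ?_⟩
  · rw [IsOverC, ← hg.isOverC, ← Category.assoc, h.isOverC]
  · obtain ⟨ψ, rfl⟩ := h.bij.2 φ
    exact ⟨pullHom g hg.dom ψ, (pullHom_comp hq hg.dom ψ).symm⟩

/-! ### Points with values in local rings -/

theorem SpecMap_pullHom_fromSpecStalk {Y X : Variety} {g : Y.sch ⟶ X.sch} (h : IsDom g) :
    Spec.map (CommRingCat.ofHom (R := X.sch.presheaf.stalk (genericPoint X.sch))
      (S := Y.sch.presheaf.stalk (genericPoint Y.sch)) (pullHom g h)) ≫ X.sch.fromSpecStalk _ =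
      Y.sch.fromSpecStalk _ ≫ g := by
  have : CommRingCat.ofHom (R := X.sch.presheaf.stalk (genericPoint X.sch))
      (S := Y.sch.presheaf.stalk (genericPoint Y.sch)) (pullHom g h) =
      X.sch.presheaf.stalkSpecializes h ≫ g.stalkMap (genericPoint Y.sch) := rfl
  rw [this, Spec.map_comp, Category.assoc, ← Scheme.SpecMap_stalkMap_fromSpecStalk]
  exact congrArg _ (Scheme.SpecMap_stalkSpecializes_fromSpecStalk _)

theorem stalkSpecializes_stalkClosedPointTo_comp {N : Scheme.{0}} {O K : CommRingCat.{0}}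
    [IsLocalRing O] [IsLocalRing K] (κ : O ⟶ K) (l : Spec O ⟶ N) (f : Spec K ⟶ N)
    (hf : f = Spec.map κ ≫ l)
    (h : f (IsLocalRing.closedPoint _ : Spec K) ⤳ l (IsLocalRing.closedPoint _ : Spec O)) :
    N.presheaf.stalkSpecializes h ≫ Scheme.stalkClosedPointTo f =
      Scheme.stalkClosedPointTo l ≫ κ := by
  apply Spec.map_injective
  rw [← cancel_mono (N.fromSpecStalk _), Spec.map_comp, Spec.map_comp, Category.assoc,
    Category.assoc, Scheme.Spec_stalkClosedPointTo_fromSpecStalk, ← hf]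
  exact (congrArg _ (Scheme.SpecMap_stalkSpecializes_fromSpecStalk _)).trans
    (Scheme.Spec_stalkClosedPointTo_fromSpecStalk f)

/-- If `σ` lifts the generic point of `X` to a model, then it is inverse to the pull back of
functions. -/
theorem pullHom_stalkClosedPointTo {N X : Variety} {h : N.sch ⟶ X.sch} (hh : IsWeakModel h)
    (σ : Spec (X.sch.presheaf.stalk (genericPoint X.sch)) ⟶ N.sch)
    (hσ : σ ≫ h = X.sch.fromSpecStalk _)
    (hs : σ (IsLocalRing.closedPoint _ : Spec (X.sch.presheaf.stalk (genericPoint X.sch))) ⤳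
      genericPoint N.sch) (φ : N.K) :
    pullHom h hh.dom ((N.sch.presheaf.stalkSpecializes hs ≫ Scheme.stalkClosedPointTo σ).hom φ) =
      φ := by
  obtain ⟨ψ, rfl⟩ := hh.bij.2 φ
  congr 1
  have h1 : CommRingCat.ofHom (R := X.sch.presheaf.stalk (genericPoint X.sch))
      (S := N.sch.presheaf.stalk (genericPoint N.sch)) (pullHom h hh.dom) ≫
      N.sch.presheaf.stalkSpecializes hs ≫
      Scheme.stalkClosedPointTo σ = 𝟙 (X.sch.presheaf.stalk (genericPoint X.sch)) := by
    apply Spec.map_injective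
    rw [← cancel_mono (X.sch.fromSpecStalk _), Spec.map_comp, Spec.map_comp, Category.assoc,
      Category.assoc, SpecMap_pullHom_fromSpecStalk]
    have h5 : Spec.map (𝟙 (X.sch.presheaf.stalk (genericPoint X.sch))) ≫
        X.sch.fromSpecStalk (genericPoint X.sch) = σ ≫ h := by
      rw [Spec.map_id, Category.id_comp, hσ]
    refine Eq.trans ?_ (Eq.trans (congrArg (· ≫ h) (Scheme.Spec_stalkClosedPointTo_fromSpecStalk σ)) h5.symm)
    rw [Category.assoc]
    congr 1
    rw [← Category.assoc]
    exact congrArg (· ≫ h) (Scheme.SpecMap_stalkSpecializes_fromSpecStalk hs)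
  exact congr($h1 ψ)

/-! ### Projective space -/

/-- `Proj` is proper over the spectrum of the degree-zero part. That part consists of the integer
constants, so its spectrum is closed in `Spec ℤ`, the terminal scheme. -/
theorem isProper_terminal_projectiveSpaceInt (n : ℕ) :
    IsProper (terminal.from (projectiveSpaceInt n)) := by
  let _ : GradedAlgebra (MvPolynomial.homogeneousSubmodule (Fin (n + 1)) ℤ) :=
    MvPolynomial.gradedAlgebra
  let 𝒜 := MvPolynomial.homogeneousSubmodule (Fin (n + 1)) ℤ
  have hC (c : 𝒜 0) : ∃ m : ℤ, (c : MvPolynomial (Fin (n + 1)) ℤ) = m := by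
    have h := (MvPolynomial.mem_homogeneousSubmodule 0 c.1).1 c.2
    have h' := MvPolynomial.totalDegree_eq_zero_iff_eq_C.1 (Nat.le_zero.1 h.totalDegree_le)
    exact ⟨_, h'⟩
  have hsurj : Function.Surjective (Int.castRingHom (𝒜 0)) := fun c => by
    obtain ⟨m, hm⟩ := hC c
    refine ⟨m, Subtype.ext ?_⟩
    rw [hm]
    exact map_intCast (algebraMap (𝒜 0) (MvPolynomial (Fin (n + 1)) ℤ)) m
  have hft : Algebra.FiniteType (𝒜 0) (MvPolynomial (Fin (n + 1)) ℤ) := by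
    have e : (algebraMap (𝒜 0) (MvPolynomial (Fin (n + 1)) ℤ)).comp (Int.castRingHom (𝒜 0)) =
      algebraMap ℤ _ := Subsingleton.elim _ _
    have h0 : ((algebraMap (𝒜 0) (MvPolynomial (Fin (n + 1)) ℤ)).comp
        (Int.castRingHom (𝒜 0))).FiniteType := by
      rw [e]
      exact RingHom.finiteType_algebraMap.2 inferInstance
    exact RingHom.FiniteType.of_comp_finiteType h0
  have h1 : IsProper (Proj.toSpecZero 𝒜) := inferInstance
  have h2 : IsClosedImmersion (Spec.map (CommRingCat.ofHom (Int.castRingHom (𝒜 0)))) :=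
    IsClosedImmersion.spec_of_surjective _ hsurj
  have h4 : IsProper (Spec.map (CommRingCat.ofHom (Int.castRingHom (𝒜 0))) ≫
      (specZIsTerminal.uniqueUpToIso terminalIsTerminal).hom) := inferInstance
  have h3 : terminal.from (projectiveSpaceInt n) = Proj.toSpecZero 𝒜 ≫
    Spec.map (CommRingCat.ofHom (Int.castRingHom (𝒜 0))) ≫
      (specZIsTerminal.uniqueUpToIso terminalIsTerminal).hom := Subsingleton.elim _ _
  rw [h3]
  exact MorphismProperty.comp_mem _ _ _ h1 h4

/-- The point lies in the chart where `f` is invertible. There `x / f` is a function, and it pulls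
back to `ev x` because `ev f = 1`. -/
theorem exists_proj_point {A : Type} [CommRing A] (𝒜 : ℕ → Submodule ℤ A) [GradedAlgebra 𝒜]
    {f : A} (hf : f ∈ 𝒜 1) {O : CommRingCat.{0}} [IsLocalRing O] (ev : A →+* O) (hev : ev f = 1) :
    ∃ e : Spec O ⟶ Proj 𝒜, ∀ x ∈ 𝒜 1, ev x ∈ (Scheme.stalkClosedPointTo e).hom.range := by
  have hev0 : IsUnit (ev f) := by rw [hev]; exact isUnit_one
  let ψ : HomogeneousLocalization.Away 𝒜 f →+* O :=
    (IsLocalization.Away.lift (S := Localization.Away f) f hev0).comp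
      (algebraMap (HomogeneousLocalization.Away 𝒜 f) (Localization.Away f))
  refine ⟨Spec.map (CommRingCat.ofHom ψ) ≫ Proj.awayι 𝒜 f hf one_pos, fun x hx => ?_⟩
  have hx' : x ∈ 𝒜 (1 • 1) := hx
  let y := HomogeneousLocalization.Away.mk 𝒜 hf 1 x hx'
  have hy : ψ y = ev x := by
    change IsLocalization.Away.lift f hev0 (HomogeneousLocalization.val y) = _
    rw [HomogeneousLocalization.Away.val_mk, Localization.mk_eq_mk', IsLocalization.Away.lift,
      IsLocalization.lift_mk'_spec]
    simp [hev]
  rw [Scheme.stalkClosedPointTo_comp]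
  have h1 := Scheme.germ_stalkClosedPointTo_Spec (CommRingCat.ofHom ψ)
  obtain ⟨w, hw⟩ := (ConcreteCategory.bijective_of_isIso ((Proj.awayι 𝒜 f hf one_pos).stalkMap
    (Spec.map (CommRingCat.ofHom ψ) (IsLocalRing.closedPoint O : Spec O)))).2
    ((Spec (.of (HomogeneousLocalization.Away 𝒜 f))).presheaf.germ ⊤ _ trivial
      ((Scheme.ΓSpecIso _).inv y))
  refine ⟨w, ?_⟩
  refine (congrArg (Scheme.stalkClosedPointTo (Spec.map (CommRingCat.ofHom ψ))).hom hw).trans ?_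
  refine (congr($h1 ((Scheme.ΓSpecIso _).inv y))).trans ?_
  rw [← hy]
  exact congrArg ψ congr($((Scheme.ΓSpecIso (.of (HomogeneousLocalization.Away 𝒜 f))).inv_hom_id) y)

/-- A local ring is the target of a morphism from projective space with given affine
coordinates. -/
theorem exists_projectiveSpaceInt_point {O : CommRingCat.{0}} [IsLocalRing O] {n : ℕ}
    (a : Fin n → O) : ∃ e : Spec O ⟶ projectiveSpaceInt n,
      ∀ i, a i ∈ (Scheme.stalkClosedPointTo e).hom.range := by
  let _ : GradedAlgebra (MvPolynomial.homogeneousSubmodule (Fin (n + 1)) ℤ) :=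
    MvPolynomial.gradedAlgebra
  have hX (i : Fin (n + 1)) : (MvPolynomial.X i : MvPolynomial (Fin (n + 1)) ℤ) ∈
      MvPolynomial.homogeneousSubmodule (Fin (n + 1)) ℤ 1 :=
    (MvPolynomial.mem_homogeneousSubmodule _ _).2 (MvPolynomial.isHomogeneous_X _ _)
  obtain ⟨e, he⟩ := exists_proj_point (MvPolynomial.homogeneousSubmodule (Fin (n + 1)) ℤ) (hX 0)
    (MvPolynomial.eval₂Hom (Int.castRingHom O) (Fin.cons 1 a)) (by simp)
  refine ⟨e, fun i => ?_⟩
  have := he _ (hX i.succ)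
  rwa [MvPolynomial.coe_eval₂Hom, MvPolynomial.eval₂_X, Fin.cons_succ] at this

/-! ### Prime divisors over a variety appear on proper models -/

theorem range_stalkClosedPointTo_le {S T : Scheme.{0}} {O : CommRingCat.{0}} [IsLocalRing O]
    (f : Spec O ⟶ S) (g : S ⟶ T) (k : Spec O ⟶ T) (h : f ≫ g = k) :
    (Scheme.stalkClosedPointTo k).hom.range ≤ (Scheme.stalkClosedPointTo f).hom.range := by
  subst h
  rw [Scheme.stalkClosedPointTo_comp]
  rintro _ ⟨a, rfl⟩
  exact ⟨(g.stalkMap _).hom a, rfl⟩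

theorem stalkClosedPointTo_fromSpecStalk_germ {S : Scheme.{0}} (x : S) (V : S.Opens) (hx : x ∈ V)
    (hV : S.fromSpecStalk x (IsLocalRing.closedPoint _ : Spec (S.presheaf.stalk x)) ∈ V)
    (t : Γ(S, V)) : (Scheme.stalkClosedPointTo (S.fromSpecStalk x)).hom
      (S.presheaf.germ V _ hV t) = S.presheaf.germ V x hx t := by
  rw [Scheme.stalkClosedPointTo_fromSpecStalk, TopCat.Presheaf.stalkCongr_hom]
  exact congr($(S.presheaf.germ_stalkSpecializes hV _) t)

/-- The `a i` are generators of the coordinate ring of an affine neighbourhood as a `ℂ`-algebra. The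
conclusion is a closure property of subrings, which is how surjectivity of a stalk map is tested
later. -/
theorem exists_affine_generators (Y : Variety) (y : Y.sch) :
    ∃ (U : Y.sch.Opens) (hy : y ∈ U) (n : ℕ) (a : Fin n → Y.sch.presheaf.stalk y),
      IsAffineOpen U ∧ ∀ R : Subring (Y.sch.presheaf.stalk y),
        (Scheme.stalkClosedPointTo (Y.sch.fromSpecStalk y ≫ Y.str)).hom.range ≤ R →
        (∀ i, a i ∈ R) → ∀ t : Γ(Y.sch, U), Y.sch.presheaf.germ U y hy t ∈ R := by
  obtain ⟨U, hU, hy⟩ := exists_isAffineOpen_mem Y y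
  have hft : (Y.str.appLE ⊤ U le_top).hom.FiniteType :=
    Y.str.finiteType_appLE (isAffineOpen_top _) hU _
  let _ := (Y.str.appLE ⊤ U le_top).hom.toAlgebra
  have hft' : Algebra.FiniteType Γ(Spec (CommRingCat.of ℂ), ⊤) Γ(Y.sch, U) := hft
  obtain ⟨S, hS⟩ := hft'.out
  refine ⟨U, hy, S.card, fun i => Y.sch.presheaf.germ U y hy (S.equivFin.symm i).1, hU,
    fun R hR ha t => ?_⟩
  have ht : t ∈ Algebra.adjoin Γ(Spec (CommRingCat.of ℂ), ⊤) (S : Set Γ(Y.sch, U)) :=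
    hS ▸ Algebra.mem_top
  induction ht using Algebra.adjoin_induction with
  | mem x hx => simpa using ha (S.equivFin ⟨x, hx⟩)
  | algebraMap r =>
    refine hR ⟨(Spec (CommRingCat.of ℂ)).presheaf.germ ⊤ _ trivial r, ?_⟩
    rw [Scheme.stalkClosedPointTo_comp]
    have hy' : Y.sch.fromSpecStalk y (IsLocalRing.closedPoint _ : Spec (Y.sch.presheaf.stalk y)) ∈
      Y.str ⁻¹ᵁ ⊤ := trivial
    have h1 := congr($(Scheme.Hom.germ_stalkMap Y.str ⊤ (Y.sch.fromSpecStalk y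
      (IsLocalRing.closedPoint _ : Spec (Y.sch.presheaf.stalk y))) trivial) r)
    refine (congrArg (Scheme.stalkClosedPointTo (Y.sch.fromSpecStalk y)).hom h1).trans ?_
    refine (stalkClosedPointTo_fromSpecStalk_germ y (Y.str ⁻¹ᵁ ⊤) trivial hy' _).trans ?_
    change _ = Y.sch.presheaf.germ U y hy ((Y.str.appLE ⊤ U le_top).hom r)
    exact (Y.sch.presheaf.germ_res_apply (homOfLE (le_top : U ≤ Y.str ⁻¹ᵁ ⊤)) y hy _).symm
  | add x z _ _ hx hz => rw [map_add]; exact R.add_mem hx hz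
  | mul x z _ _ hx hz => rw [map_mul]; exact R.mul_mem hx hz

/-- A local homomorphism to the local ring of `Y` at `y` is onto if its image contains the affine
coordinate functions. -/
theorem surjective_of_germ_mem {Y : Variety} {y : Y.sch} {U : Y.sch.Opens} (hU : IsAffineOpen U)
    (hy : y ∈ U) {B : Type*} [CommRing B] [IsLocalRing B] (f : B →+* Y.sch.presheaf.stalk y)
    [IsLocalHom f] (h : ∀ t : Γ(Y.sch, U), Y.sch.presheaf.germ U y hy t ∈ f.range) :
    Function.Surjective f := by
  intro x
  let := (Y.sch.presheaf.germ U y hy).hom.toAlgebra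
  have := hU.isLocalization_stalk ⟨y, hy⟩
  obtain ⟨⟨a, b⟩, hab⟩ := IsLocalization.surj (hU.primeIdealOf ⟨y, hy⟩).asIdeal.primeCompl x
  have hb : IsUnit (Y.sch.presheaf.germ U y hy b) :=
    IsLocalization.map_units (M := (hU.primeIdealOf ⟨y, hy⟩).asIdeal.primeCompl) _ b
  obtain ⟨a', ha'⟩ := h a
  obtain ⟨b', hb'⟩ := h b
  rw [← hb'] at hb
  obtain ⟨u, rfl⟩ := (isUnit_map_iff f b').1 hb
  refine ⟨a' * ↑u⁻¹, ?_⟩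
  rw [map_mul, ha']
  have h1 : x * f u = Y.sch.presheaf.germ U y hy a := by rw [hb']; exact hab
  rw [← h1, mul_assoc, ← map_mul, Units.mul_inv, map_one, mul_one]

/-- Take `T = ℙⁿ × X`, and send the spectrum of the local ring to it by affine generators as
coordinates in the first factor and by `g` in the second. The image of the stalk map contains the
generators and, through `X`, the constants, hence it is everything. -/
theorem exists_proper_point {Y X : Variety} {g : Y.sch ⟶ X.sch} (hg : IsOverC g) (y : Y.sch) :
    ∃ (T : Scheme.{0}) (p : T ⟶ X.sch) (s : Spec (Y.sch.presheaf.stalk y) ⟶ T), IsProper p ∧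
      s ≫ p = Y.sch.fromSpecStalk y ≫ g ∧
      Function.Surjective (Scheme.stalkClosedPointTo s).hom := by
  let O := Y.sch.presheaf.stalk y
  obtain ⟨U, hU, n, a, hUa, hgen⟩ := exists_affine_generators Y y
  obtain ⟨e, he⟩ := exists_projectiveSpaceInt_point a
  have hP := isProper_terminal_projectiveSpaceInt n
  let p : pullback (terminal.from (projectiveSpaceInt n)) (terminal.from X.sch) ⟶ X.sch :=
    pullback.snd _ _
  have hp : IsProper p := inferInstance
  let s : Spec O ⟶ pullback (terminal.from (projectiveSpaceInt n)) (terminal.from X.sch) :=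
    pullback.lift e (Y.sch.fromSpecStalk y ≫ g) (Subsingleton.elim _ _)
  have hse : s ≫ pullback.fst _ _ = e := pullback.lift_fst _ _ _
  have hsp : s ≫ p = Y.sch.fromSpecStalk y ≫ g := pullback.lift_snd _ _ _
  have hsurj : Function.Surjective (Scheme.stalkClosedPointTo s).hom := by
    refine surjective_of_germ_mem hUa hU _ (hgen _ ?_ fun i =>
      range_stalkClosedPointTo_le s _ e hse (he i))
    refine range_stalkClosedPointTo_le s (p ≫ X.str) _ ?_
    rw [← Category.assoc, hsp, Category.assoc, hg]
  exact ⟨_, p, s, hp, hsp, hsurj⟩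

/-- The valuative criterion for discrete valuation rings. -/
theorem exists_lift_of_isProper {N T : Scheme.{0}} (ν : N ⟶ T) [IsProper ν] {O K : Type}
    [CommRing O] [IsDomain O] [IsDiscreteValuationRing O] [Field K] (κ : O →+* K)
    (hκ : Function.Injective κ) (hf : ∀ x : K, ∃ a b : O, b ≠ 0 ∧ x * κ b = κ a)
    (σ : Spec (.of K) ⟶ N) (s : Spec (.of O) ⟶ T) (h : σ ≫ ν = Spec.map (CommRingCat.ofHom κ) ≫ s) :
    ∃ l : Spec (.of O) ⟶ N, Spec.map (CommRingCat.ofHom κ) ≫ l = σ ∧ l ≫ ν = s := by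
  have hex : ValuativeCriterion.Existence ν := by
    have : UniversallyClosed ν := inferInstance
    rw [UniversallyClosed.eq_valuativeCriterion] at this
    exact this.1
  let _ : Algebra O K := κ.toAlgebra
  have : IsFractionRing O K := by
    refine ⟨fun y => ?_, fun x => ?_, fun {x y} hxy => ⟨1, ?_⟩⟩
    · exact isUnit_iff_ne_zero.2 ((map_ne_zero_iff _ hκ).2 (nonZeroDivisors.ne_zero y.2))
    · obtain ⟨a, b, hb, e⟩ := hf x
      exact ⟨(a, ⟨b, mem_nonZeroDivisors_of_ne_zero hb⟩), e⟩
    · rw [hκ hxy]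
  have h1 := (hex ⟨O, K, σ, s, ⟨h⟩⟩).exists_lift.some
  exact ⟨h1.l, h1.fac_left, h1.fac_right⟩

/-- The passage from models that are not proper to proper ones. With `O` the discrete valuation ring
of `E`, map `Spec O` to a `T` proper over `X` so that the stalk surjects onto `O`, and normalize `T`
at the generic point to get a proper model `N`. The valuative criterion lifts `Spec O` to `N`. The
stalk of `N` at the image of the closed point maps onto `O`, since that of `T` does, and
injectively, since both sit in the function field. So this point is a prime divisor with the same
valuation ring and the same image in `X`. -/
theorem exists_isModel_regularAt_eq {Y X : Variety} {g : Y.sch ⟶ X.sch} (hg : IsWeakModel g)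
    (E : PrimeDivisor Y) :
    ∃ (N : Variety) (h : N.sch ⟶ X.sch) (E' : PrimeDivisor N),
      IsModel h ∧ regularAt h E'.1 = regularAt g E.1 ∧ h E'.1 = g E.1 := by
  let O := Y.sch.presheaf.stalk E.1
  let KX := X.sch.presheaf.stalk (genericPoint X.sch)
  have hdvr : IsDiscreteValuationRing O := isDiscreteValuationRing_stalk hg.normal E
  obtain ⟨T, p, s, hp, hsp, hsurj⟩ := exists_proper_point hg.isOverC E.1
  -- the embedding of the local ring in the function field of `X`
  let θ := RingEquiv.ofBijective (pullHom g hg.dom) hg.bij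
  let κ : O ⟶ KX := CommRingCat.ofHom (R := O) (S := KX)
    ((θ.symm : Y.K →+* X.K).comp (algebraMap (Y.sch.presheaf.stalk E.1) Y.K))
  have hκ (x : O) : pullHom g hg.dom (κ.hom x) = algebraMap (Y.sch.presheaf.stalk E.1) Y.K x :=
    θ.apply_symm_apply _
  have hκp : (Spec.map κ ≫ s) ≫ p = X.sch.fromSpecStalk _ := by
    have hθ : CommRingCat.ofHom (R := KX) (S := Y.sch.presheaf.stalk (genericPoint Y.sch))
        (pullHom g hg.dom) ≫ CommRingCat.ofHom (S := KX)
          (R := Y.sch.presheaf.stalk (genericPoint Y.sch)) (θ.symm : Y.K →+* X.K) = 𝟙 _ := by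
      ext x; exact θ.symm_apply_apply x
    have hκ' : κ = Y.sch.presheaf.stalkSpecializes (genericPoint_specializes E.1) ≫
      CommRingCat.ofHom (S := KX)
          (R := Y.sch.presheaf.stalk (genericPoint Y.sch)) (θ.symm : Y.K →+* X.K) := rfl
    rw [Category.assoc, hsp, hκ', Spec.map_comp, Category.assoc,
      Scheme.SpecMap_stalkSpecializes_fromSpecStalk_assoc, ← SpecMap_pullHom_fromSpecStalk hg.dom,
      ← Category.assoc, ← Spec.map_comp, hθ, Spec.map_id]
    exact Category.id_comp _
  obtain ⟨N, ν, σ, hν, hσν, hN, hσ⟩ := exists_isModel_of_lift p (Spec.map κ ≫ s) hκp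
  have hw := hN.isWeakModel
  -- the center
  obtain ⟨l, hl1, hl2⟩ : ∃ l : Spec O ⟶ N.sch, Spec.map κ ≫ l = σ ∧ l ≫ ν = s := by
    have : IsProper ν := inferInstance
    refine exists_lift_of_isProper (K := X.K) ν (CommRingCat.Hom.hom κ) ?_ ?_ σ s hσν
    · intro x x' hx
      refine IsFractionRing.injective _ Y.K ?_
      rw [← hκ, ← hκ]
      exact congrArg _ hx
    · intro x
      obtain ⟨a, b, hb, e⟩ := IsFractionRing.div_surjective
        (Y.sch.presheaf.stalk E.1) (pullHom g hg.dom x)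
      refine ⟨a, b, nonZeroDivisors.ne_zero hb, (pullHom g hg.dom).injective ?_⟩
      have hb0 : algebraMap (Y.sch.presheaf.stalk E.1) Y.K b ≠ 0 := by
        rw [Ne, FaithfulSMul.algebraMap_eq_zero_iff]
        exact nonZeroDivisors.ne_zero hb
      have := (eq_div_iff hb0).1 e.symm
      rwa [← hκ, ← hκ, ← map_mul] at this
  let y : N.sch := l (IsLocalRing.closedPoint _ : Spec O)
  have hs1 : σ (IsLocalRing.closedPoint _ : Spec KX) ⤳ genericPoint N.sch :=
    specializes_of_eq (hσ _)
  have hkey (b : N.sch.presheaf.stalk y) : pullHom (ν ≫ p) hw.dom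
      (κ.hom ((Scheme.stalkClosedPointTo l).hom b)) = algebraMap _ N.K b := by
    have h1 := pullHom_stalkClosedPointTo hw σ (by rw [← hκp, ← hσν, Category.assoc]) hs1
      (algebraMap _ N.K b)
    rw [← h1]
    congr 1
    have h2 := stalkSpecializes_stalkClosedPointTo_comp κ l σ hl1.symm
      (hs1.trans (genericPoint_specializes _))
    refine (congr($h2 b)).symm.trans ?_
    exact congrArg (Scheme.stalkClosedPointTo σ).hom
      (N.sch.presheaf.stalkSpecializes_comp_apply hs1 (genericPoint_specializes y) b).symm
  have hlsurj : Function.Surjective (Scheme.stalkClosedPointTo l).hom := by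
    intro x
    obtain ⟨b, hb⟩ := range_stalkClosedPointTo_le l ν s hl2 (hsurj x)
    exact ⟨b, hb⟩
  have hlinj : Function.Injective (Scheme.stalkClosedPointTo l).hom := by
    intro b b' hb
    refine IsFractionRing.injective _ N.K ?_
    rw [← hkey, ← hkey, hb]
  have hdim : Order.coheight y = 1 := by
    have h1 := ringKrullDim_stalk_eq_coheight y
    rw [ringKrullDim_eq_of_ringEquiv (RingEquiv.ofBijective _ ⟨hlinj, hlsurj⟩)] at h1
    have h2 := ringKrullDim_stalk_eq_coheight E.1
    rw [E.2] at h2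
    exact_mod_cast (h1.symm.trans h2)
  refine ⟨N, ν ≫ p, ⟨y, hdim⟩, hN, ?_, ?_⟩
  · ext φ
    rw [regularAt_eq hw.dom, regularAt_eq hg.dom, Subring.mem_comap, Subring.mem_comap]
    constructor
    · rintro ⟨b, hb⟩
      have : φ = κ.hom ((Scheme.stalkClosedPointTo l).hom b) :=
        (pullHom (ν ≫ p) hw.dom).injective (by rw [hkey, hb])
      rw [this, hκ]
      exact ⟨_, rfl⟩
    · rintro ⟨x, hx⟩
      obtain ⟨b, rfl⟩ := hlsurj x
      rw [← hκ] at hx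
      rw [← (pullHom g hg.dom).injective hx, hkey]
      exact ⟨b, rfl⟩
  · let c : Spec O := IsLocalRing.closedPoint _
    change (ν ≫ p) (l c) = g E.1
    rw [← Scheme.Hom.comp_apply, ← Category.assoc, hl2, hsp, Scheme.Hom.comp_apply]
    exact congrArg g Scheme.fromSpecStalk_closedPoint

/-! ### Centers, and b-Cartier divisors -/

/-- A prime divisor over `X` has a center on each model. -/
theorem exists_center {Y N X : Variety} {g : Y.sch ⟶ X.sch} (hg : IsModel g) {h : N.sch ⟶ X.sch}
    (hh : IsWeakModel h) (F : PrimeDivisor N) :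
    ∃ y : Y.sch, g y = h F.1 ∧ regularAt g y ≤ regularAt h F.1 := by
  let O := N.sch.presheaf.stalk F.1
  let KN := N.sch.presheaf.stalk (genericPoint N.sch)
  have hdvr : IsDiscreteValuationRing O := isDiscreteValuationRing_stalk hh.normal F
  have hw := hg.isWeakModel
  have := hg.proper
  obtain ⟨σ, hσ, hσ'⟩ := hw.exists_lift
  let ι : O ⟶ KN := N.sch.presheaf.stalkSpecializes (genericPoint_specializes F.1)
  let P : X.sch.presheaf.stalk (genericPoint X.sch) ⟶ KN := CommRingCat.ofHom (pullHom h hh.dom)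
  obtain ⟨l, hl1, hl2⟩ := exists_lift_of_isProper (K := N.K) g (O := O) ι.hom
    (IsFractionRing.injective (N.sch.presheaf.stalk F.1) N.K) (fun x => by
      obtain ⟨a, b, hb, e⟩ := IsFractionRing.div_surjective (N.sch.presheaf.stalk F.1) x
      have hb0 : algebraMap (N.sch.presheaf.stalk F.1) N.K b ≠ 0 := by
        rw [Ne, FaithfulSMul.algebraMap_eq_zero_iff]
        exact nonZeroDivisors.ne_zero hb
      exact ⟨a, b, nonZeroDivisors.ne_zero hb, (eq_div_iff hb0).1 e.symm⟩)
    (Spec.map P ≫ σ) (N.sch.fromSpecStalk F.1 ≫ h) (by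
      rw [Category.assoc, hσ]
      refine (SpecMap_pullHom_fromSpecStalk hh.dom).trans ?_
      exact (congrArg (· ≫ h) (Scheme.SpecMap_stalkSpecializes_fromSpecStalk
        (genericPoint_specializes F.1)).symm).trans (Category.assoc _ _ _))
  let c : Spec O := IsLocalRing.closedPoint _
  refine ⟨l c, ?_, ?_⟩
  · rw [← Scheme.Hom.comp_apply, hl2, Scheme.Hom.comp_apply]
    exact congrArg h Scheme.fromSpecStalk_closedPoint
  · intro φ hφ
    rw [regularAt_eq hw.dom, Subring.mem_comap] at hφ
    rw [regularAt_eq hh.dom, Subring.mem_comap]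
    obtain ⟨b, hb⟩ := hφ
    refine ⟨(Scheme.stalkClosedPointTo l).hom b, ?_⟩
    have hs : σ (IsLocalRing.closedPoint _ : Spec (X.sch.presheaf.stalk (genericPoint X.sch))) ⤳
        genericPoint Y.sch := by
      refine specializes_of_eq ?_
      let c' : Spec (Y.sch.presheaf.stalk (genericPoint Y.sch)) := IsLocalRing.closedPoint _
      have h1 : (Spec.map (CommRingCat.ofHom (pullHom g hw.dom)) ≫ σ) c' = genericPoint Y.sch := by
        rw [hσ']
        exact Scheme.fromSpecStalk_closedPoint
      rw [← h1, Scheme.Hom.comp_apply]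
      exact congrArg σ (generic_eq_closedPoint _).symm
    let cX : Spec (X.sch.presheaf.stalk (genericPoint X.sch)) := IsLocalRing.closedPoint _
    let cN : Spec KN := IsLocalRing.closedPoint _
    have hc : (Spec.map P ≫ σ) cN ⤳ σ cX := by
      refine specializes_of_eq ?_
      rw [Scheme.Hom.comp_apply]
      exact congrArg σ (generic_eq_closedPoint _)
    have k1 := stalkSpecializes_stalkClosedPointTo_comp ι l (Spec.map P ≫ σ) hl1.symm
      (hc.trans (hs.trans (genericPoint_specializes _)))
    have k2 := stalkSpecializes_stalkClosedPointTo_comp P σ (Spec.map P ≫ σ) rfl hc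
    have k3 := pullHom_stalkClosedPointTo hw σ hσ hs (pullHom g hw.dom φ)
    have k4 := (pullHom g hw.dom).injective k3
    rw [← k4, ← hb]
    refine (congr($k1 b)).symm.trans (Eq.trans ?_ (congr($k2 (Y.sch.presheaf.stalkSpecializes hs
      (algebraMap (Y.sch.presheaf.stalk (l c)) Y.K b)))))
    refine congrArg (Scheme.stalkClosedPointTo (Spec.map P ≫ σ)).hom ?_
    refine Eq.trans ?_ (Y.sch.presheaf.stalkSpecializes_comp_apply hc hs _).symm
    exact (Y.sch.presheaf.stalkSpecializes_comp_apply (hc.trans hs)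
      (genericPoint_specializes _) b).symm

/-- If the pull back of `D` to a model is integral and Cartier with local equation `φ` at the center
of `F`, then the coefficient at `F` is the order of `φ`. -/
theorem pullCoeff_eq_of_isLocalEq {Y N X : Variety} (hX : X.IsNormal) {g : Y.sch ⟶ X.sch}
    (hg : IsWeakModel g) {h : N.sch ⟶ X.sch} (hh : IsWeakModel h) {F : PrimeDivisor N} {y : Y.sch}
    (hy : g y = h F.1) (hr : regularAt g y ≤ regularAt h F.1) {D : PrimeDivisor X → ℝ}
    {α : X.Kˣ →₀ ℝ} (hD : IsDivNear D (h F.1) α) {A : PrimeDivisor Y → ℤ} {V : Y.sch.Opens}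
    (hyV : y ∈ V) (hA : ∀ E : PrimeDivisor Y, E.1 ∈ V → pullCoeff g D E = A E) {φ : X.K}
    (hφ : IsLocalEq A y (pullFun g φ)) : pullCoeff h D F = ordAt F (pullFun h φ) := by
  obtain ⟨h0, U, hyU, hU⟩ := hφ
  obtain ⟨W, hW, hDW⟩ := hD
  have hφ0 : φ ≠ 0 := by
    rintro rfl
    exact h0 (by rw [pullFun_eq hg.dom, map_zero])
  rw [pullCoeff_eq hX hh.normal hh.dom ⟨W, hW, hDW⟩]
  -- The divisor of `β` vanishes on `Y` through the center `y`, though in general not on `X`. So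
  -- Hartogs is used on `Y`: a function of order zero along all prime divisors of `Y` through `y` is
  -- a unit at `y`, hence a unit in the local ring of `F`, which contains that of `y`.
  let β : X.Kˣ →₀ ℝ := α - Finsupp.single (Units.mk0 φ hφ0) 1
  have hβ : ∀ E : PrimeDivisor Y, E.1 ⤳ y → pullDiv g E β = 0 := by
    intro E hE
    have hEV := hE.mem_open V.isOpen hyV
    have hEU := hE.mem_open U.isOpen hyU
    have hEW : g E.1 ∈ W := (hE.map g.continuous).mem_open W.isOpen (by rw [hy]; exact hW)
    have h1 := hA E hEV
    rw [pullCoeff_eq hX hg.normal hg.dom ⟨W, hEW, hDW⟩, hU E hEU] at h1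
    rw [map_sub, h1, pullDiv, Finsupp.linearCombination_single, one_smul]
    exact sub_self _
  let θ : X.Kˣ ≃* Y.Kˣ := Units.mapEquiv (RingEquiv.ofBijective (pullHom g hg.dom) hg.bij).toMulEquiv
  have key := linearCombination_eq_zero_of_forall
    (fun E : {E : PrimeDivisor Y // E.1 ⤳ y} => pullOrd g hg.dom E.1) (pullOrd h hh.dom F)
    (fun ψ hψ => ?_) β fun E => by
      rw [← pullDiv_eq]
      exact hβ E.1 E.2
  · rw [← pullDiv_eq, map_sub, pullDiv, Finsupp.linearCombination_single, one_smul] at key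
    exact sub_eq_zero.1 key
  · have h1 := unit_mem_of_ordAt_eq_zero hg.normal (x := y) (Units.map (pullHom g hg.dom).toMonoidHom ψ)
      fun E hE => congrArg Multiplicative.toAdd (hψ ⟨E, hE⟩)
    have h2 : (ψ : X.K) ∈ regularAt g y := by
      rw [regularAt_eq hg.dom]; exact h1.1
    have h3 : ((ψ⁻¹ : X.Kˣ) : X.K) ∈ regularAt g y := by
      rw [regularAt_eq hg.dom]; exact h1.2
    have h4 := hr h2
    have h5 := hr h3
    rw [regularAt_eq hh.dom, Subring.mem_comap] at h4 h5
    have := ordAt_eq_zero_of_unit_mem hh.normal (P := F) (Units.map (pullHom h hh.dom).toMonoidHom ψ)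
      h4 h5
    exact congrArg Multiplicative.ofAdd this

theorem IsQCartierOn.isRCartierOn {X : Variety} {V : X.sch.Opens} {D : PrimeDivisor X → ℝ}
    (h : IsQCartierOn V D) : IsRCartierOn V D := by
  obtain ⟨m, A, hm, hA, hD⟩ := h
  refine ⟨1, fun _ => (m : ℝ)⁻¹, fun _ => A, fun _ => hA, fun P hP => ?_⟩
  have : (m : ℝ) ≠ 0 := by positivity
  rw [Fin.sum_univ_one, ← hD P hP, inv_mul_cancel_left₀ this]

/-- The pull back of a b-Cartier divisor is integral. -/
theorem IsBCartierOn.exists_pullCoeff_eq {X : Variety} (hX : X.IsNormal) {V : X.sch.Opens}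
    {D : RDivisor X} (hD : IsBCartierOn V D) {N : Variety} {h : N.sch ⟶ X.sch}
    (hh : IsWeakModel h) (F : PrimeDivisor N) (hF : h F.1 ∈ V) :
    ∃ m : ℤ, pullCoeff h D F = m := by
  obtain ⟨hQ, Y, g, A, hg, hA, hAD⟩ := hD
  obtain ⟨y, hy, hr⟩ := exists_center hg hh F
  obtain ⟨α, hα⟩ := hQ.isRCartierOn.exists_isDivNear hF
  have hyV : y ∈ g ⁻¹ᵁ V := by
    change g y ∈ V
    rwa [hy]
  obtain ⟨φ', hφ'⟩ := hA y hyV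
  obtain ⟨φ, rfl⟩ := hg.isWeakModel.bij.2 φ'
  rw [← pullFun_eq hg.isWeakModel.dom] at hφ'
  exact ⟨_, pullCoeff_eq_of_isLocalEq hX hg.isWeakModel hh hy hr hα hyV hAD hφ'⟩

theorem pullCoeff_id {X : Variety} (hX : X.IsNormal) {V : X.sch.Opens} {D : PrimeDivisor X → ℝ}
    (hD : IsRCartierOn V D) (P : PrimeDivisor X) (hP : P.1 ∈ V) :
    pullCoeff (𝟙 X.sch) D P = D P := by
  obtain ⟨α, U, hU, h⟩ := hD.exists_isDivNear hP
  rw [pullCoeff_eq hX hX (IsDom.id X) ⟨U, hU, h⟩, h P hU, pullDiv, divAt]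
  simp only [pullFun_eq (IsDom.id X), pullHom_id]

/-! ### Sums of Cartier and b-Cartier divisors -/

theorem IsLocalEq.add {X : Variety} {A B : PrimeDivisor X → ℤ} {x : X.sch} {φ ψ : X.K}
    (h : IsLocalEq A x φ) (h' : IsLocalEq B x ψ) : IsLocalEq (A + B) x (φ * ψ) := by
  obtain ⟨h0, U, hU, hA⟩ := h
  obtain ⟨h0', U', hU', hB⟩ := h'
  refine ⟨mul_ne_zero h0 h0', U ⊓ U', ⟨hU, hU'⟩, fun P hP => ?_⟩
  rw [Pi.add_apply, ordAt_mul P h0 h0', hA P hP.1, hB P hP.2]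

theorem isLocalEq_zero {X : Variety} (x : X.sch) : IsLocalEq (0 : PrimeDivisor X → ℤ) x 1 :=
  ⟨one_ne_zero, ⊤, trivial, fun P _ => by rw [ordAt_one, Pi.zero_apply]⟩

theorem IsLocalEq.nsmul {X : Variety} {A : PrimeDivisor X → ℤ} {x : X.sch} {φ : X.K}
    (h : IsLocalEq A x φ) (n : ℕ) : IsLocalEq (n • A) x (φ ^ n) := by
  induction n with
  | zero => simpa using isLocalEq_zero x
  | succ n ih => rw [succ_nsmul, pow_succ]; exact ih.add h

theorem IsLocalEq.neg {X : Variety} {A : PrimeDivisor X → ℤ} {x : X.sch} {φ : X.K}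
    (h : IsLocalEq A x φ) : IsLocalEq (-A) x φ⁻¹ := by
  obtain ⟨h0, U, hU, hA⟩ := h
  exact ⟨inv_ne_zero h0, U, hU, fun P hP => by rw [Pi.neg_apply, ordAt_inv, hA P hP]⟩

theorem IsLocalEq.zsmul {X : Variety} {A : PrimeDivisor X → ℤ} {x : X.sch} {φ : X.K}
    (h : IsLocalEq A x φ) (n : ℤ) : IsLocalEq (n • A) x (φ ^ n) := by
  obtain ⟨n, rfl | rfl⟩ := n.eq_nat_or_neg
  · simpa using h.nsmul n
  · simpa using (h.nsmul n).neg

theorem IsCartierOn.add {X : Variety} {V : X.sch.Opens} {A B : PrimeDivisor X → ℤ}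
    (h : IsCartierOn V A) (h' : IsCartierOn V B) : IsCartierOn V (A + B) := fun x hx => by
  obtain ⟨φ, hφ⟩ := h x hx
  obtain ⟨ψ, hψ⟩ := h' x hx
  exact ⟨_, hφ.add hψ⟩

theorem IsCartierOn.nsmul {X : Variety} {V : X.sch.Opens} {A : PrimeDivisor X → ℤ}
    (h : IsCartierOn V A) (n : ℕ) : IsCartierOn V (n • A) := fun x hx => by
  obtain ⟨φ, hφ⟩ := h x hx
  exact ⟨_, hφ.nsmul n⟩

theorem isCartierOn_zero {X : Variety} (V : X.sch.Opens) :
    IsCartierOn V (0 : PrimeDivisor X → ℤ) := fun x _ => ⟨1, isLocalEq_zero x⟩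

theorem IsQCartierOn.add {X : Variety} {V : X.sch.Opens} {D D' : PrimeDivisor X → ℝ}
    (h : IsQCartierOn V D) (h' : IsQCartierOn V D') : IsQCartierOn V (fun P => D P + D' P) := by
  obtain ⟨m, A, hm, hA, hD⟩ := h
  obtain ⟨m', A', hm', hA', hD'⟩ := h'
  refine ⟨m * m', m' • A + m • A', by positivity, (hA.nsmul m').add (hA'.nsmul m), fun P hP => ?_⟩
  have h1 := hD P hP
  have h2 := hD' P hP
  have e : (m' • A + m • A') P = (m' : ℤ) * A P + (m : ℤ) * A' P := by
    simp [nsmul_eq_mul]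
  rw [e]
  push_cast
  rw [← h1, ← h2]
  ring

theorem pullCoeff_add {Y X : Variety} {g : Y.sch ⟶ X.sch} (hX : X.IsNormal) (hY : Y.IsNormal)
    (hg : IsDom g) {D D' : PrimeDivisor X → ℝ} {E : PrimeDivisor Y} {α α' : X.Kˣ →₀ ℝ}
    (h : IsDivNear D (g E.1) α) (h' : IsDivNear D' (g E.1) α') :
    pullCoeff g (fun P => D P + D' P) E = pullCoeff g D E + pullCoeff g D' E := by
  rw [pullCoeff_eq hX hY hg h, pullCoeff_eq hX hY hg h', pullCoeff_eq hX hY hg (h.add h'), map_add]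

theorem pullCoeff_smul {Y X : Variety} {g : Y.sch ⟶ X.sch} (hX : X.IsNormal) (hY : Y.IsNormal)
    (hg : IsDom g) {D : PrimeDivisor X → ℝ} {E : PrimeDivisor Y} {α : X.Kˣ →₀ ℝ}
    (h : IsDivNear D (g E.1) α) (c : ℝ) :
    pullCoeff g (fun P => c * D P) E = c * pullCoeff g D E := by
  rw [pullCoeff_eq hX hY hg h, pullCoeff_eq hX hY hg (h.smul c), map_smul, smul_eq_mul]

theorem pullCoeff_zero {Y X : Variety} {g : Y.sch ⟶ X.sch} (hX : X.IsNormal) (hY : Y.IsNormal)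
    (hg : IsDom g) (E : PrimeDivisor Y) : pullCoeff g (fun _ => 0) E = 0 := by
  rw [pullCoeff_eq hX hY hg (IsDivNear.zero _), map_zero]

theorem pullCoeff_sum {Y X : Variety} {g : Y.sch ⟶ X.sch} (hX : X.IsNormal) (hY : Y.IsNormal)
    (hg : IsDom g) {E : PrimeDivisor Y} {ι : Type*} (s : Finset ι) {D : ι → PrimeDivisor X → ℝ}
    {α : ι → X.Kˣ →₀ ℝ} (h : ∀ i ∈ s, IsDivNear (D i) (g E.1) (α i)) (c : ι → ℝ) :
    pullCoeff g (fun P => ∑ i ∈ s, c i * D i P) E = ∑ i ∈ s, c i * pullCoeff g (D i) E := by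
  rw [pullCoeff_eq hX hY hg (IsDivNear.sum s fun i hi => (h i hi).smul (c i)), map_sum]
  refine Finset.sum_congr rfl fun i hi => ?_
  rw [pullCoeff_eq hX hY hg (h i hi), map_smul, smul_eq_mul]

theorem regularAt_le_comp {N Y X : Variety} {q : N.sch ⟶ Y.sch} {g : Y.sch ⟶ X.sch}
    (hq : IsDom q) (hg : IsDom g) (n : N.sch) : regularAt g (q n) ≤ regularAt (q ≫ g) n := by
  intro φ hφ
  rw [regularAt_eq hg, Subring.mem_comap] at hφ
  rw [regularAt_eq (hq.comp hg), Subring.mem_comap, pullHom_comp hq hg]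
  exact pullHom_mem_localSubring hq hφ

theorem isModel_id {X : Variety} (hX : X.IsNormal) : IsModel (𝟙 X.sch) :=
  ⟨hX, Category.id_comp _, inferInstance, ⊤, ⟨genericPoint X.sch, trivial⟩, inferInstance⟩

theorem IsBCartierOn.zero {X : Variety} (hX : X.IsNormal) (V : X.sch.Opens) :
    IsBCartierOn V (0 : RDivisor X) := by
  refine ⟨⟨1, 0, one_pos, isCartierOn_zero V, fun P _ => by simp⟩, X, 𝟙 _, 0, isModel_id hX,
    isCartierOn_zero _, fun E _ => ?_⟩
  rw [Pi.zero_apply, Int.cast_zero]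
  exact pullCoeff_zero hX hX (IsDom.id X) E

/-- Around a point of a model dominating the given one, the pull back of a b-Cartier divisor is the
divisor of a rational function. -/
theorem exists_pullCoeff_eq_ordAt_near {X Y N : Variety} (hX : X.IsNormal) {V : X.sch.Opens}
    {D : PrimeDivisor X → ℝ} (hQ : IsRCartierOn V D) {g : Y.sch ⟶ X.sch} (hg : IsModel g)
    {A : PrimeDivisor Y → ℤ} (hA : IsCartierOn (g ⁻¹ᵁ V) A)
    (hAD : ∀ E : PrimeDivisor Y, E.1 ∈ g ⁻¹ᵁ V → pullCoeff g D E = A E) {q : N.sch ⟶ Y.sch}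
    {h : N.sch ⟶ X.sch} (hqg : q ≫ g = h) (hh : IsModel h) {n : N.sch} (hn : h n ∈ V) :
    ∃ φ : X.K, φ ≠ 0 ∧ ∃ U : N.sch.Opens, n ∈ U ∧ ∀ E : PrimeDivisor N, E.1 ∈ U →
      pullCoeff h D E = ordAt E (pullFun h φ) := by
  subst hqg
  have hw := hg.isWeakModel
  have hq := hh.isWeakModel.of_comp hw
  have hn' : q n ∈ g ⁻¹ᵁ V := by
    change g (q n) ∈ V
    rwa [← Scheme.Hom.comp_apply]
  obtain ⟨φ', hφ'⟩ := hA _ hn'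
  obtain ⟨φ, rfl⟩ := hw.bij.2 φ'
  rw [← pullFun_eq hw.dom] at hφ'
  obtain ⟨h0, U, hU, hAU⟩ := hφ'
  refine ⟨φ, ?_, q ⁻¹ᵁ U ⊓ (q ≫ g) ⁻¹ᵁ V, ⟨hU, hn⟩, fun E hE => ?_⟩
  · rintro rfl
    exact h0 (by rw [pullFun_eq hw.dom, map_zero])
  · obtain ⟨α, hα⟩ := hQ.exists_isDivNear (x := (q ≫ g) E.1) hE.2
    refine pullCoeff_eq_of_isLocalEq hX hw hh.isWeakModel (y := q E.1)
      (Scheme.Hom.comp_apply _ _ _).symm (regularAt_le_comp hq.dom hw.dom _) hα (V := g ⁻¹ᵁ V) ?_ hAD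
      ⟨h0, U, hE.1, hAU⟩
    have := hE.2
    change g (q E.1) ∈ V
    rw [← Scheme.Hom.comp_apply]
    exact this

/-- The two divisors become Cartier on different models. On a model dominating both, each pull back
is locally the divisor of a function, and the product of the two functions is an equation of the
sum. -/
theorem IsBCartierOn.add {X : Variety} (hX : X.IsNormal) {V : X.sch.Opens} {D D' : RDivisor X}
    (h : IsBCartierOn V D) (h' : IsBCartierOn V D') : IsBCartierOn V (D + D') := by
  obtain ⟨hQ, Y, g, A, hg, hA, hAD⟩ := h
  obtain ⟨hQ', Y', g', A', hg', hA', hAD'⟩ := h'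
  obtain ⟨N, q, q', hqq, hN⟩ := exists_isModel_over hg hg'
  have hw := hN.isWeakModel
  have key {n : N.sch} (hn : (q ≫ g) n ∈ V) : ∃ φ : X.K, φ ≠ 0 ∧ ∃ U : N.sch.Opens, n ∈ U ∧
      ∀ E : PrimeDivisor N, E.1 ∈ U →
        pullCoeff (q ≫ g) (⇑(D + D')) E = ordAt E (pullFun (q ≫ g) φ) := by
    obtain ⟨φ, h0, U, hU, hφ⟩ := exists_pullCoeff_eq_ordAt_near hX hQ.isRCartierOn hg hA hAD rfl hN hn
    obtain ⟨φ', h0', U', hU', hφ'⟩ := exists_pullCoeff_eq_ordAt_near hX hQ'.isRCartierOn hg' hA' hAD'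
      hqq.symm hN hn
    refine ⟨φ * φ', mul_ne_zero h0 h0', U ⊓ U' ⊓ (q ≫ g) ⁻¹ᵁ V, ⟨⟨hU, hU'⟩, hn⟩, fun E hE => ?_⟩
    obtain ⟨α, hα⟩ := hQ.isRCartierOn.exists_isDivNear (x := (q ≫ g) E.1) hE.2
    obtain ⟨α', hα'⟩ := hQ'.isRCartierOn.exists_isDivNear (x := (q ≫ g) E.1) hE.2
    have e : ⇑(D + D') = fun P => D P + D' P := rfl
    rw [e, pullCoeff_add hX hw.normal hw.dom hα hα', hφ E hE.1.1, hφ' E hE.1.2]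
    rw [pullFun_eq hw.dom, pullFun_eq hw.dom, pullFun_eq hw.dom, map_mul,
      ordAt_mul E ((map_ne_zero _).2 h0) ((map_ne_zero _).2 h0')]
    push_cast
    ring
  -- The floor only turns the real coefficients into integers. Over `V` they are orders of
  -- functions, so nothing is lost, and elsewhere the value is irrelevant.
  refine ⟨hQ.add hQ', N, q ≫ g, fun E => ⌊pullCoeff (q ≫ g) (⇑(D + D')) E⌋, hN, fun n hn => ?_,
    fun E hE => ?_⟩
  · obtain ⟨φ, h0, U, hU, hφ⟩ := key hn
    refine ⟨pullFun (q ≫ g) φ, ?_, U, hU, fun E hE => ?_⟩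
    · rw [pullFun_eq hw.dom]
      exact (map_ne_zero _).2 h0
    · change ⌊pullCoeff (q ≫ g) (⇑(D + D')) E⌋ = _
      rw [hφ E hE, Int.floor_intCast]
  · obtain ⟨φ, h0, U, hU, hφ⟩ := key hE
    change _ = ((⌊pullCoeff (q ≫ g) (⇑(D + D')) E⌋ : ℤ) : ℝ)
    rw [hφ E hU, Int.floor_intCast]

theorem IsBCartierOn.nsmul {X : Variety} (hX : X.IsNormal) {V : X.sch.Opens} {D : RDivisor X}
    (h : IsBCartierOn V D) (n : ℕ) : IsBCartierOn V (n • D) := by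
  induction n with
  | zero => rw [zero_nsmul]; exact IsBCartierOn.zero hX V
  | succ n ih => rw [succ_nsmul]; exact ih.add hX h

theorem IsBCartierOn.sum {X : Variety} (hX : X.IsNormal) {V : X.sch.Opens} {ι : Type*}
    (s : Finset ι) {D : ι → RDivisor X} (h : ∀ i ∈ s, IsBCartierOn V (D i)) :
    IsBCartierOn V (∑ i ∈ s, D i) := by
  classical
  induction s using Finset.induction_on with
  | empty => rw [Finset.sum_empty]; exact IsBCartierOn.zero hX V
  | insert i s hi ih =>
    rw [Finset.sum_insert hi]
    exact (h i (Finset.mem_insert_self _ _)).add hX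
      (ih fun j hj => h j (Finset.mem_insert_of_mem hj))

theorem IsQCartierOn.mono {X : Variety} {V V' : X.sch.Opens} (hV : V' ≤ V)
    {D : PrimeDivisor X → ℝ} (h : IsQCartierOn V D) : IsQCartierOn V' D := by
  obtain ⟨m, A, hm, hA, hD⟩ := h
  exact ⟨m, A, hm, fun x hx => hA x (hV hx), fun P hP => hD P (hV hP)⟩

theorem IsBCartierOn.mono {X : Variety} {V V' : X.sch.Opens} (hV : V' ≤ V) {D : RDivisor X}
    (h : IsBCartierOn V D) : IsBCartierOn V' D := by
  obtain ⟨hQ, Y, g, A, hg, hA, hAD⟩ := h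
  exact ⟨hQ.mono hV, Y, g, A, hg, fun y hy => hA y (hV hy), fun E hE => hAD E (hV hE)⟩

section

/-! ### Real Cartier divisors -/

theorem IsCartierDecomp.add {X : Variety} {V V' : X.sch.Opens} {D D' : PrimeDivisor X → ℝ} {m m' : ℕ}
    {r : Fin m → ℝ} {r' : Fin m' → ℝ} {A : Fin m → PrimeDivisor X → ℤ}
    {A' : Fin m' → PrimeDivisor X → ℤ} (h : IsCartierDecomp V D r A)
    (h' : IsCartierDecomp V' D' r' A') :
    IsCartierDecomp (V ⊓ V') (fun P => D P + D' P) (Fin.append r r') (Fin.append A A') := by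
  refine ⟨fun i => ?_, fun P hP => ?_⟩
  · induction i using Fin.addCases with
    | left i => rw [Fin.append_left]; exact fun x hx => h.1 i x hx.1
    | right i => rw [Fin.append_right]; exact fun x hx => h'.1 i x hx.2
  · rw [Fin.sum_univ_add]
    simp only [Fin.append_left, Fin.append_right]
    rw [h.2 P hP.1, h'.2 P hP.2]

theorem IsCartierDecomp.smul {X : Variety} {V : X.sch.Opens} {D : PrimeDivisor X → ℝ} {m : ℕ}
    {r : Fin m → ℝ} {A : Fin m → PrimeDivisor X → ℤ} (h : IsCartierDecomp V D r A) (c : ℝ) :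
    IsCartierDecomp V (fun P => c * D P) (fun i => c * r i) A :=
  ⟨h.1, fun P hP => by
    change c * D P = ∑ i, c * r i * _
    rw [h.2 P hP, Finset.mul_sum]; simp only [mul_assoc]⟩

theorem IsRCartierOn.mono {X : Variety} {V V' : X.sch.Opens} {D : PrimeDivisor X → ℝ}
    (h : IsRCartierOn V D) (hV : V' ≤ V) : IsRCartierOn V' D := by
  obtain ⟨m, r, A, hA, hD⟩ := h
  exact ⟨m, r, A, fun i x hx => hA i x (hV hx), fun P hP => hD P (hV hP)⟩

theorem IsRCartierOn.congr {X : Variety} {V : X.sch.Opens} {D D' : PrimeDivisor X → ℝ}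
    (h : IsRCartierOn V D) (hD : ∀ P : PrimeDivisor X, P.1 ∈ V → D P = D' P) :
    IsRCartierOn V D' := by
  obtain ⟨m, r, A, hA, hD'⟩ := h
  exact ⟨m, r, A, hA, fun P hP => by rw [← hD P hP, hD' P hP]⟩

theorem IsRCartierOn.add {X : Variety} {V : X.sch.Opens} {D D' : PrimeDivisor X → ℝ}
    (h : IsRCartierOn V D) (h' : IsRCartierOn V D') : IsRCartierOn V (fun P => D P + D' P) := by
  obtain ⟨m, r, A, h⟩ := h
  obtain ⟨m', r', A', h'⟩ := h'
  have := h.add h'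
  rw [inf_idem] at this
  exact ⟨_, _, _, this⟩

theorem IsRCartierOn.smul {X : Variety} {V : X.sch.Opens} {D : PrimeDivisor X → ℝ}
    (h : IsRCartierOn V D) (c : ℝ) : IsRCartierOn V (fun P => c * D P) := by
  obtain ⟨m, r, A, h⟩ := h
  exact ⟨_, _, _, h.smul c⟩

theorem isRCartierOn_zero {X : Variety} (V : X.sch.Opens) :
    IsRCartierOn V (fun _ : PrimeDivisor X => (0 : ℝ)) :=
  ⟨0, Fin.elim0, Fin.elim0, fun i => i.elim0, fun P _ => by simp⟩

theorem IsRCartierOn.sum {X : Variety} {V : X.sch.Opens} {ι : Type*} (s : Finset ι)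
    {D : ι → PrimeDivisor X → ℝ} (h : ∀ i ∈ s, IsRCartierOn V (D i)) :
    IsRCartierOn V (fun P => ∑ i ∈ s, D i P) := by
  classical
  induction s using Finset.induction_on with
  | empty => simpa using isRCartierOn_zero V
  | insert i s hi ih =>
    simp only [Finset.sum_insert hi]
    exact (h i (Finset.mem_insert_self _ _)).add (ih fun j hj => h j (Finset.mem_insert_of_mem hj))

theorem isCartierOn_ordAt {X : Variety} (V : X.sch.Opens) {φ : X.K} (hφ : φ ≠ 0) :
    IsCartierOn V (fun P => ordAt P φ) := fun _ _ => ⟨φ, hφ, ⊤, trivial, fun _ _ => rfl⟩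

theorem IsPrincipalOn.isRCartierOn {X : Variety} {V : X.sch.Opens} {D : PrimeDivisor X → ℝ}
    (h : IsPrincipalOn V D) : IsRCartierOn V D := by
  obtain ⟨φ, h0, h⟩ := h
  exact ⟨1, fun _ => 1, fun _ P => ordAt P φ, fun _ => isCartierOn_ordAt V h0, fun P hP => by
    simp [h P hP]⟩

/-! ### Intersection numbers with a curve -/

namespace CurveTo

variable {X : Variety} (c : CurveTo X)

/-- The image of the generic point of the curve. -/
abbrev ξ : X.sch := c.ν (genericPoint c.C.sch)

/-- The order at `Q` of the restriction to the curve of a unit. -/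
def ordRes (Q : PrimeDivisor c.C) : (X.sch.presheaf.stalk c.ξ)ˣ →* Multiplicative ℤ :=
  (ordHom Q).comp (Units.map (c.ν.stalkMap (genericPoint c.C.sch)).hom.toMonoidHom)

/-- The degree on the curve of a unit at the image of the generic point. -/
def deg (u : (X.sch.presheaf.stalk c.ξ)ˣ) : ℤ := ∑ᶠ Q, (c.ordRes Q u).toAdd

theorem deg_inv (u : (X.sch.presheaf.stalk c.ξ)ˣ) : c.deg u⁻¹ = - c.deg u := by
  rw [deg, deg, ← finsum_neg_distrib]
  refine finsum_congr fun Q => ?_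
  rw [map_inv, toAdd_inv]

theorem specializes (Q : PrimeDivisor c.C) : c.ξ ⤳ c.ν Q.1 :=
  (genericPoint_specializes _).map c.ν.continuous

theorem ordRes_eq_one (Q : PrimeDivisor c.C) (u : (X.sch.presheaf.stalk c.ξ)ˣ)
    (h : algebraMap _ X.K (u : X.sch.presheaf.stalk c.ξ) ∈ localSubring X (c.ν Q.1))
    (h' : algebraMap _ X.K ((u⁻¹ : (X.sch.presheaf.stalk c.ξ)ˣ) : X.sch.presheaf.stalk c.ξ) ∈
      localSubring X (c.ν Q.1)) : c.ordRes Q u = 1 := by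
  have key (u : (X.sch.presheaf.stalk c.ξ)ˣ)
      (h : algebraMap _ X.K (u : X.sch.presheaf.stalk c.ξ) ∈ localSubring X (c.ν Q.1)) :
      ((c.ν.stalkMap (genericPoint c.C.sch)).hom (u : X.sch.presheaf.stalk c.ξ) : c.C.K) ∈
        localSubring c.C Q.1 := by
    obtain ⟨b, hb⟩ := h
    have h1 : (u : X.sch.presheaf.stalk c.ξ) = X.sch.presheaf.stalkSpecializes (c.specializes Q) b := by
      refine IsFractionRing.injective _ X.K ?_
      rw [← hb]
      simp only [RingHom.algebraMap_toAlgebra]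
      exact (X.sch.presheaf.stalkSpecializes_comp_apply _ _ _).symm
    rw [h1]
    refine ⟨(c.ν.stalkMap Q.1).hom b, ?_⟩
    exact (congr($(Scheme.Hom.stalkSpecializes_stalkMap c.ν _ _
      (genericPoint_specializes Q.1)) b)).symm
  have := ordAt_eq_zero_of_unit_mem c.normal (P := Q)
    (Units.map (c.ν.stalkMap (genericPoint c.C.sch)).hom.toMonoidHom u) (key u h)
    (by rw [← map_inv]; exact key u⁻¹ h')
  exact congrArg Multiplicative.ofAdd this

variable {c}

theorem exists_unit_stalk (hX : X.IsNormal) {x : X.sch} (φ : X.Kˣ)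
    (h : ∀ P : PrimeDivisor X, P.1 ⤳ x → ordAt P (φ : X.K) = 0) :
    ∃ u : (X.sch.presheaf.stalk x)ˣ, algebraMap _ X.K (u : X.sch.presheaf.stalk x) = φ := by
  obtain ⟨⟨a, ha⟩, ⟨b, hb⟩⟩ := unit_mem_of_ordAt_eq_zero hX φ h
  refine ⟨⟨a, b, ?_, ?_⟩, ha⟩ <;> refine IsFractionRing.injective _ X.K ?_
  · rw [map_mul, ha, hb, map_one, Units.mul_inv]
  · rw [map_mul, ha, hb, map_one, Units.inv_mul]

theorem ordAt_eq_zero_of_isLocalEq {A : PrimeDivisor X → ℤ} {V : X.sch.Opens} {x : X.sch}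
    (hx : x ∈ V) (hA : ∀ P : PrimeDivisor X, P.1 ∈ V → A P = 0) {φ : X.K} (h : IsLocalEq A x φ)
    (P : PrimeDivisor X) (hP : P.1 ⤳ x) : ordAt P φ = 0 := by
  obtain ⟨-, U, hU, h⟩ := h
  rw [← h P (hP.mem_open U.isOpen hU), hA P (hP.mem_open V.isOpen hx)]

theorem isLocalEq_zero_unit (hX : X.IsNormal) {x : X.sch} (u : (X.sch.presheaf.stalk x)ˣ) :
    IsLocalEq (0 : PrimeDivisor X → ℤ) x (algebraMap _ X.K (u : X.sch.presheaf.stalk x)) := by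
  obtain ⟨U, hU, h⟩ := exists_opens_of_mem_localSubring
    (⟨_, rfl⟩ : algebraMap _ X.K (u : X.sch.presheaf.stalk x) ∈ localSubring X x)
  obtain ⟨U', hU', h'⟩ := exists_opens_of_mem_localSubring
    (⟨_, rfl⟩ : algebraMap _ X.K ((u⁻¹ : (X.sch.presheaf.stalk x)ˣ) : X.sch.presheaf.stalk x) ∈
      localSubring X x)
  let φ : X.Kˣ := Units.map (algebraMap (X.sch.presheaf.stalk x) X.K).toMonoidHom u
  refine ⟨φ.ne_zero, U ⊓ U', ⟨hU, hU'⟩, fun P hP => ?_⟩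
  refine (ordAt_eq_zero_of_unit_mem hX φ (h _ hP.1) ?_).symm
  rw [← map_inv]
  exact h' _ hP.2

theorem IsLocalEq.specializes {A : PrimeDivisor X → ℤ} {x y : X.sch} (hxy : y ⤳ x) {φ : X.K}
    (h : IsLocalEq A x φ) : IsLocalEq A y φ := by
  obtain ⟨h0, U, hU, h⟩ := h
  exact ⟨h0, U, hxy.mem_open U.isOpen hU, h⟩

/-- Two local equations differ by a unit. -/
theorem exists_unit_mul_eq (hX : X.IsNormal) {A : PrimeDivisor X → ℤ} {x : X.sch} {φ ψ : X.K}
    (h : IsLocalEq A x φ) (h' : IsLocalEq A x ψ) :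
    ∃ u : (X.sch.presheaf.stalk x)ˣ, algebraMap _ X.K (u : X.sch.presheaf.stalk x) * ψ = φ := by
  obtain ⟨u, hu⟩ := exists_unit_stalk hX (Units.mk0 φ h.1 * (Units.mk0 ψ h'.1)⁻¹) (x := x) fun P hP => by
    have h1 := ordAt_eq_zero_of_isLocalEq (V := ⊤) (A := A + -A) (x := x) trivial
      (fun P _ => by simp) (h.add h'.neg) P hP
    exact h1
  refine ⟨u, ?_⟩
  rw [hu, Units.val_mul, mul_assoc]
  change φ * (ψ⁻¹ * ψ) = φ
  rw [inv_mul_cancel₀ h'.1, mul_one]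

theorem exists_hasDegree (hX : X.IsNormal) {V : X.sch.Opens} {A : PrimeDivisor X → ℤ}
    (hA : IsCartierOn V A) (hc : ∀ y, c.ν y ∈ V) : ∃ n, c.HasDegree A n := by
  obtain ⟨ψ, hψ⟩ := hA _ (hc (genericPoint c.C.sch))
  choose φ hφ using fun Q : PrimeDivisor c.C => hA _ (hc Q.1)
  choose s hs using fun Q => exists_unit_mul_eq hX
    (IsLocalEq.specializes (c.specializes Q) (hφ Q)) hψ
  refine ⟨_, ψ, fun Q => s Q, hψ, fun Q => ⟨(s Q).isUnit, ?_⟩, rfl⟩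
  rw [hs]
  exact hφ Q

theorem exists_hasIntersection (hX : X.IsNormal) {V : X.sch.Opens} {D : PrimeDivisor X → ℝ}
    (hD : IsRCartierOn V D) (hc : ∀ y, c.ν y ∈ V) : ∃ t, c.HasIntersection D t := by
  obtain ⟨m, r, A, h⟩ := hD
  choose n hn using fun i => exists_hasDegree hX (h.1 i) hc
  exact ⟨_, V, m, r, A, n, hc, h, hn, rfl⟩

/-- With `u⁻¹` as equation at the generic point of the curve, and `1 = u * u⁻¹` at every closed
point, the zero divisor acquires the degree of `u`. So degrees are determined only up to degrees of
units, until the latter are known to vanish. -/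
theorem hasDegree_zero (hX : X.IsNormal) (u : (X.sch.presheaf.stalk c.ξ)ˣ) :
    c.HasDegree 0 (c.deg u) := by
  refine ⟨algebraMap _ X.K ((u⁻¹ : (X.sch.presheaf.stalk c.ξ)ˣ) : X.sch.presheaf.stalk c.ξ),
    fun _ => u, isLocalEq_zero_unit hX u⁻¹, fun Q => ⟨u.isUnit, ?_⟩, rfl⟩
  rw [← map_mul, Units.mul_inv, map_one]
  exact isLocalEq_zero _

/-- The restriction of a unit contributes to the ambiguity of intersection numbers. -/
theorem HasIntersection.add_deg (hX : X.IsNormal) {D : PrimeDivisor X → ℝ} {t : ℝ}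
    (h : c.HasIntersection D t) (u : (X.sch.presheaf.stalk c.ξ)ˣ) :
    c.HasIntersection D (t + c.deg u) := by
  obtain ⟨V, m, r, A, n, hV, hA, hn, rfl⟩ := h
  refine ⟨V, m + 1, Fin.cons 1 r, Fin.cons 0 A, Fin.cons (c.deg u) n, hV, ⟨?_, fun P hP => ?_⟩, ?_, ?_⟩
  · intro i
    induction i using Fin.cases with
    | zero => exact isCartierOn_zero V
    | succ i => exact hA.1 i
  · rw [Fin.sum_univ_succ]
    simpa using hA.2 P hP
  · intro i
    induction i using Fin.cases with
    | zero => exact hasDegree_zero hX u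
    | succ i => exact hn i
  · rw [Fin.sum_univ_succ]
    simp [add_comm]

theorem mem_preimage_of_isContractedIn {Z : Variety} {q : X.sch ⟶ Z.sch} {W : Z.sch.Opens}
    (h : c.IsContractedIn q W) (y : c.C.sch) : c.ν y ∈ q ⁻¹ᵁ W := by
  obtain ⟨z, hz, h⟩ := h
  change q (c.ν y) ∈ W
  rwa [h y]

/-- If some divisor is nef over `W`, then units have degree `0` on contracted curves. -/
theorem deg_eq_zero_of_isNefOver (hX : X.IsNormal) {Z : Variety} {q : X.sch ⟶ Z.sch}
    {W : Z.sch.Opens} {D : PrimeDivisor X → ℝ} (hD : IsNefOver q W D) (hc : c.IsContractedIn q W)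
    (u : (X.sch.presheaf.stalk c.ξ)ˣ) : c.deg u = 0 := by
  obtain ⟨t, ht⟩ := exists_hasIntersection hX hD.1 (mem_preimage_of_isContractedIn hc)
  -- Nefness bounds every admissible value of the intersection number from below. A unit of negative
  -- degree could be added to a value any number of times, producing a negative one. Applied to `u`
  -- and `u⁻¹`, this replaces the theorem that principal divisors on a proper curve have degree
  -- zero.
  have key (u : (X.sch.presheaf.stalk c.ξ)ˣ) : 0 ≤ c.deg u := by
    have h1 (k : ℕ) : c.HasIntersection D (t + k * c.deg u) := by
      induction k with
      | zero => simpa using ht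
      | succ k ih =>
        have := ih.add_deg hX u
        push_cast
        convert! this using 1
        ring
    by_contra hneg
    push Not at hneg
    have h2 : (c.deg u : ℝ) ≤ -1 := by exact_mod_cast Int.le_sub_one_of_lt hneg
    obtain ⟨k, hk⟩ := exists_nat_gt t
    have h3 := hD.2 c hc _ (h1 k)
    nlinarith [(Nat.cast_nonneg k : (0 : ℝ) ≤ k)]
  have h1 := key u
  have h2 := key u⁻¹
  rw [deg_inv] at h2
  omega

end CurveTo

end

/-! ### Linear relations between degrees, and uniqueness of intersection numbers -/

section

namespace CurveTo

variable {X : Variety} {c : CurveTo X}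

/-- A choice of local data computing a degree, through units. -/
theorem HasDegree.exists_units (hX : X.IsNormal) {A : PrimeDivisor X → ℤ} {n : ℤ}
    (h : c.HasDegree A n) : ∃ (ψ : X.Kˣ) (s : PrimeDivisor c.C → (X.sch.presheaf.stalk c.ξ)ˣ),
      IsLocalEq A c.ξ (ψ : X.K) ∧
      (∀ Q, IsLocalEq A (c.ν Q.1) (algebraMap _ X.K (s Q : X.sch.presheaf.stalk c.ξ) * (ψ : X.K))) ∧
      (Function.support fun Q => (c.ordRes Q (s Q)).toAdd).Finite ∧
      n = ∑ᶠ Q, (c.ordRes Q (s Q)).toAdd := by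
  obtain ⟨ψ, s, hψ, hs, hn⟩ := h
  refine ⟨Units.mk0 ψ hψ.1, fun Q => (hs Q).1.unit, hψ, fun Q => (hs Q).2, ?_, hn⟩
  obtain ⟨hψ0, U, hU, hA⟩ := hψ
  -- At all but finitely many points of the curve the generic equation `ψ` is itself a local
  -- equation, so `s Q` is a unit there and contributes nothing.
  refine (finite_primeDivisor_notMem (X := c.C) (U := c.ν ⁻¹ᵁ U) ⟨genericPoint c.C.sch, hU⟩).subset
    fun Q hQ hQU => hQ ?_
  have hloc : IsLocalEq A (c.ν Q.1) ψ := ⟨hψ0, U, hQU, hA⟩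
  obtain ⟨v, hv⟩ := exists_unit_mul_eq hX (hs Q).2 hloc
  have hsv : algebraMap _ X.K (v : X.sch.presheaf.stalk (c.ν Q.1)) =
      algebraMap _ X.K (s Q) := mul_right_cancel₀ hψ0 hv
  have := c.ordRes_eq_one Q (hs Q).1.unit ⟨v, hsv⟩
    ⟨((v⁻¹ : (X.sch.presheaf.stalk (c.ν Q.1))ˣ) : X.sch.presheaf.stalk (c.ν Q.1)), by
      have h1 : algebraMap _ X.K (v : X.sch.presheaf.stalk (c.ν Q.1)) ≠ 0 := by
        rw [hsv]; exact ((hs Q).1.map (algebraMap _ X.K)).ne_zero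
      refine mul_left_cancel₀ h1 ?_
      rw [← map_mul, Units.mul_inv, map_one, hsv]
      exact ((map_mul (algebraMap (X.sch.presheaf.stalk c.ξ) X.K) _ _).symm.trans
        ((congrArg _ (hs Q).1.mul_val_inv).trans (map_one _))).symm⟩
  exact congrArg Multiplicative.toAdd this

theorem IsLocalEq.prod_zpow {ι : Type*} (t : Finset ι) {A : ι → PrimeDivisor X → ℤ} {x : X.sch}
    {φ : ι → X.Kˣ} (h : ∀ i, IsLocalEq (A i) x (φ i : X.K)) (m : ι → ℤ) :
    IsLocalEq (∑ i ∈ t, m i • A i) x ((∏ i ∈ t, φ i ^ m i : X.Kˣ) : X.K) := by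
  classical
  induction t using Finset.induction_on with
  | empty => simpa using isLocalEq_zero x
  | insert i t hi ih =>
    rw [Finset.sum_insert hi, Finset.prod_insert hi, Units.val_mul, Units.val_zpow_eq_zpow_val]
    exact ((h i).zsmul _).add ih

/-- Degrees respect integral linear relations. -/
theorem sum_zsmul_degree_eq_zero (hX : X.IsNormal) (hdeg : ∀ u, c.deg u = 0) {V : X.sch.Opens}
    (hV : ∀ y, c.ν y ∈ V) {m : ℕ} {A : Fin m → PrimeDivisor X → ℤ} {n : Fin m → ℤ}
    (h : ∀ i, c.HasDegree (A i) (n i)) (ρ : Fin m → ℤ)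
    (hρ : ∀ P : PrimeDivisor X, P.1 ∈ V → ∑ i, ρ i * A i P = 0) : ∑ i, ρ i * n i = 0 := by
  choose ψ s hψ hs hfin hn using fun i => (h i).exists_units hX
  have hA : ∀ P : PrimeDivisor X, P.1 ∈ V → (∑ i, ρ i • A i) P = 0 := fun P hP => by
    rw [Finset.sum_apply]
    simpa using hρ P hP
  -- `∏ ψ i ^ ρ i` is an equation of the zero divisor, hence a unit `u` at the generic point of the
  -- curve. At each `Q` the product of `u` and `∏ s i Q ^ ρ i` is again an equation of the zero
  -- divisor, so the orders of the two factors cancel. The sum of the degrees is therefore minus the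
  -- degree of `u`, which is zero.
  obtain ⟨u, hu⟩ := exists_unit_stalk hX (x := c.ξ) (∏ i, ψ i ^ ρ i)
    fun P hP => ordAt_eq_zero_of_isLocalEq (hV _) hA (IsLocalEq.prod_zpow _ hψ ρ) P hP
  have key (Q : PrimeDivisor c.C) :
      ∑ i, ρ i * (c.ordRes Q (s i Q)).toAdd = - (c.ordRes Q u).toAdd := by
    let σ : (X.sch.presheaf.stalk c.ξ)ˣ →* X.Kˣ :=
      Units.map (algebraMap (X.sch.presheaf.stalk c.ξ) X.K).toMonoidHom
    have h1 := IsLocalEq.prod_zpow Finset.univ (x := c.ν Q.1) (A := A)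
      (φ := fun i => σ (s i Q) * ψ i) (fun i => hs i Q) ρ
    let w : (X.sch.presheaf.stalk c.ξ)ˣ := (∏ i, s i Q ^ ρ i) * u
    have hw : ∏ i, (σ (s i Q) * ψ i) ^ ρ i = σ w := by
      have hu' : σ u = ∏ i, ψ i ^ ρ i := Units.ext hu
      simp only [w, mul_zpow, Finset.prod_mul_distrib, map_mul, map_prod, map_zpow, hu']
    rw [hw] at h1
    obtain ⟨⟨a, ha⟩, ⟨b, hb⟩⟩ := unit_mem_of_ordAt_eq_zero hX (x := c.ν Q.1) (σ w)
      fun P hP => ordAt_eq_zero_of_isLocalEq (hV _) hA h1 P hP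
    have h2 := c.ordRes_eq_one Q w ⟨a, ha⟩ ⟨b, by rw [hb, ← map_inv]; rfl⟩
    have h3 := congrArg Multiplicative.toAdd h2
    simp only [w, map_mul, map_prod, map_zpow, toAdd_mul, toAdd_one, toAdd_prod, toAdd_zpow,
      smul_eq_mul] at h3
    omega
  have h1 : ∑ i, ρ i * n i = ∑ᶠ Q, ∑ i, ρ i * (c.ordRes Q (s i Q)).toAdd := by
    rw [finsum_sum_comm _ _ fun i _ => ?_]
    · refine Finset.sum_congr rfl fun i _ => ?_
      rw [hn i]
      exact mul_finsum _ (ρ i)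
    · exact (hfin i).subset fun Q hQ h0 => hQ (by
        change ρ i * _ = 0
        rw [show (c.ordRes Q (s i Q)).toAdd = 0 from h0, mul_zero])
  rw [h1, finsum_congr key, finsum_neg_distrib]
  exact neg_eq_zero.2 (hdeg u)

/-- Degrees respect real linear relations. -/
theorem sum_mul_degree_eq_zero (hX : X.IsNormal) (hdeg : ∀ u, c.deg u = 0) {V : X.sch.Opens}
    (hV : ∀ y, c.ν y ∈ V) {m : ℕ} {A : Fin m → PrimeDivisor X → ℤ} {n : Fin m → ℤ}
    (h : ∀ i, c.HasDegree (A i) (n i)) (ρ : Fin m → ℝ)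
    (hρ : ∀ P : PrimeDivisor X, P.1 ∈ V → ∑ i, ρ i * (A i P : ℝ) = 0) :
    ∑ i, ρ i * (n i : ℝ) = 0 := by
  -- Integer vectors become homomorphisms on `ℤ ^ m`, the coefficients of the divisors at each `P`
  -- as well as the degrees, so that the reduction of real relations to integral ones applies.
  let pair (a : Fin m → ℤ) : Multiplicative (Fin m → ℤ) →* Multiplicative ℤ :=
    AddMonoidHom.toMultiplicative
      { toFun := fun x => ∑ i, x i * a i
        map_zero' := by simp
        map_add' := fun x y => by simp [add_mul, Finset.sum_add_distrib] }
  have hpair (a x : Fin m → ℤ) : (pair a (Multiplicative.ofAdd x)).toAdd = ∑ i, x i * a i := rfl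
  let α : Multiplicative (Fin m → ℤ) →₀ ℝ :=
    ∑ i, Finsupp.single (Multiplicative.ofAdd (Pi.single i (1 : ℤ))) (ρ i)
  have hα (a : Fin m → ℤ) :
      Finsupp.linearCombination ℝ (fun φ => ((pair a φ).toAdd : ℝ)) α = ∑ i, ρ i * (a i : ℝ) := by
    rw [map_sum]
    refine Finset.sum_congr rfl fun i _ => ?_
    rw [Finsupp.linearCombination_single, hpair, smul_eq_mul]
    simp [Pi.single_apply]
  rw [← hα]
  refine linearCombination_eq_zero_of_forall
    (fun P : {P : PrimeDivisor X // P.1 ∈ V} => pair fun i => A i P.1) _ (fun φ hφ => ?_) α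
    fun P => (hα _).trans (hρ P.1 P.2)
  exact congrArg Multiplicative.ofAdd (sum_zsmul_degree_eq_zero hX hdeg hV h φ.toAdd fun P hP =>
    congrArg Multiplicative.toAdd (hφ ⟨P, hP⟩))

theorem HasIntersection.add {D D' : PrimeDivisor X → ℝ} {t t' : ℝ} (h : c.HasIntersection D t)
    (h' : c.HasIntersection D' t') : c.HasIntersection (fun P => D P + D' P) (t + t') := by
  obtain ⟨V, m, r, A, n, hV, hA, hn, rfl⟩ := h
  obtain ⟨V', m', r', A', n', hV', hA', hn', rfl⟩ := h'
  refine ⟨V ⊓ V', m + m', _, _, Fin.append n n', fun y => ⟨hV y, hV' y⟩, hA.add hA', fun i => ?_, ?_⟩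
  · induction i using Fin.addCases with
    | left i => rw [Fin.append_left, Fin.append_left]; exact hn i
    | right i => rw [Fin.append_right, Fin.append_right]; exact hn' i
  · rw [Fin.sum_univ_add]
    simp only [Fin.append_left, Fin.append_right]

theorem HasIntersection.smul {D : PrimeDivisor X → ℝ} {t : ℝ} (h : c.HasIntersection D t) (a : ℝ) :
    c.HasIntersection (fun P => a * D P) (a * t) := by
  obtain ⟨V, m, r, A, n, hV, hA, hn, rfl⟩ := h
  refine ⟨V, m, _, A, n, hV, hA.smul a, hn, ?_⟩
  rw [Finset.mul_sum]; simp only [mul_assoc]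

theorem hasIntersection_zero (c : CurveTo X) : c.HasIntersection (fun _ => 0) 0 :=
  ⟨⊤, 0, Fin.elim0, Fin.elim0, Fin.elim0, fun _ => trivial, ⟨fun i => i.elim0, fun P _ => by simp⟩,
    fun i => i.elim0, by simp⟩

theorem HasIntersection.sum {ι : Type*} (s : Finset ι) {D : ι → PrimeDivisor X → ℝ} {t : ι → ℝ}
    (h : ∀ i ∈ s, c.HasIntersection (D i) (t i)) :
    c.HasIntersection (fun P => ∑ i ∈ s, D i P) (∑ i ∈ s, t i) := by
  classical
  induction s using Finset.induction_on with
  | empty => simpa using hasIntersection_zero c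
  | insert i s hi ih =>
    simp only [Finset.sum_insert hi]
    exact (h i (Finset.mem_insert_self _ _)).add (ih fun j hj => h j (Finset.mem_insert_of_mem hj))

theorem HasIntersection.eq_zero (hX : X.IsNormal) (hdeg : ∀ u, c.deg u = 0) {t : ℝ}
    (h : c.HasIntersection (fun _ => 0) t) : t = 0 := by
  obtain ⟨V, m, r, A, n, hV, hA, hn, rfl⟩ := h
  exact sum_mul_degree_eq_zero hX hdeg hV hn r fun P hP => (hA.2 P hP).symm

theorem HasIntersection.unique (hX : X.IsNormal) (hdeg : ∀ u, c.deg u = 0)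
    {D : PrimeDivisor X → ℝ} {t t' : ℝ} (h : c.HasIntersection D t) (h' : c.HasIntersection D t') :
    t = t' := by
  have h1 := h.add (h'.smul (-1))
  simp only [neg_one_mul, add_neg_cancel] at h1
  have := h1.eq_zero hX hdeg
  linarith

end CurveTo

/-- Nonnegative combinations of nef divisors are nef. -/
theorem IsNefOver.sum {X Z : Variety} (hX : X.IsNormal) {q : X.sch ⟶ Z.sch} {W : Z.sch.Opens}
    {D₀ : PrimeDivisor X → ℝ} (h₀ : IsNefOver q W D₀) {ι : Type*} (s : Finset ι)
    {D : ι → PrimeDivisor X → ℝ} (h : ∀ i ∈ s, IsNefOver q W (D i)) {μ : ι → ℝ}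
    (hμ : ∀ i ∈ s, 0 ≤ μ i) : IsNefOver q W (fun P => ∑ i ∈ s, μ i * D i P) := by
  refine ⟨IsRCartierOn.sum s fun i hi => (h i hi).1.smul _, fun c hc t ht => ?_⟩
  -- Intersection numbers become unique as soon as some divisor is nef. `D₀` is a separate datum
  -- because `s` may be empty.
  have hdeg := CurveTo.deg_eq_zero_of_isNefOver hX h₀ hc
  have hex (i : ι) : ∃ t, i ∈ s → c.HasIntersection (D i) t := by
    by_cases hi : i ∈ s
    · obtain ⟨t, ht⟩ := CurveTo.exists_hasIntersection hX (h i hi).1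
        (CurveTo.mem_preimage_of_isContractedIn hc)
      exact ⟨t, fun _ => ht⟩
    · exact ⟨0, fun h => absurd h hi⟩
  choose T hT using hex
  have h1 := CurveTo.HasIntersection.sum s (fun i hi => (hT i hi).smul (μ i))
  rw [ht.unique hX hdeg h1]
  exact Finset.sum_nonneg fun i hi => mul_nonneg (hμ i hi) ((h i hi).2 c hc _ (hT i hi))

theorem IsNefOver.mono {X Z : Variety} {q : X.sch ⟶ Z.sch} {W W' : Z.sch.Opens} (hW : W' ≤ W)
    {D : PrimeDivisor X → ℝ} (h : IsNefOver q W D) : IsNefOver q W' D :=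
  ⟨h.1.mono fun _ hx => hW hx, fun c ⟨z, hz, hc⟩ t ht => h.2 c ⟨z, hW hz, hc⟩ t ht⟩

end

/-! ### Kronecker's theorem on the torus, by equidistribution -/

section

open MeasureTheory Filter Topology

theorem mFourier_apply_add {d : Type*} [Fintype d] (m : d → ℤ) (x y : UnitAddTorus d) :
    UnitAddTorus.mFourier m (x + y) = UnitAddTorus.mFourier m x * UnitAddTorus.mFourier m y := by
  simp only [UnitAddTorus.mFourier, ContinuousMap.coe_mk, ← Finset.prod_mul_distrib]
  refine Finset.prod_congr rfl fun i _ => ?_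
  simp [fourier_apply, AddCircle.toCircle_add]

theorem mFourier_nsmul {d : Type*} [Fintype d] (m : d → ℤ) (x : UnitAddTorus d) (n : ℕ) :
    UnitAddTorus.mFourier m (n • x) = UnitAddTorus.mFourier m x ^ n := by
  induction n with
  | zero => simp [UnitAddTorus.mFourier]
  | succ n ih => rw [succ_nsmul, mFourier_apply_add, ih, pow_succ]

/-- **Kronecker's theorem**. -/
theorem exists_nsmul_mem_of_mFourier_ne_one {d : Type*} [Fintype d] (θ : UnitAddTorus d)
    (hθ : ∀ m : d → ℤ, m ≠ 0 → UnitAddTorus.mFourier m θ ≠ 1) {U : Set (UnitAddTorus d)}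
    (hU : IsOpen U) (hne : U.Nonempty) : ∃ n : ℕ, 0 < n ∧ n • θ ∈ U := by
  by_contra! hcon
  let μ : Measure (UnitAddTorus d) := Measure.addHaar
  have hint (f : C(UnitAddTorus d, ℂ)) : Integrable f μ :=
    f.continuous.integrable_of_hasCompactSupport (HasCompactSupport.of_compactSpace _)
  let avg (f : C(UnitAddTorus d, ℂ)) (N : ℕ) : ℂ := (N : ℂ)⁻¹ * ∑ n ∈ Finset.range N, f ((n + 1) • θ)
  let c : ℝ := μ.real Set.univ
  have hc : 0 < c := by
    refine ENNReal.toReal_pos ?_ (measure_ne_top _ _)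
    exact (isOpen_univ.measure_pos μ Set.univ_nonempty).ne'
  -- Averages over the orbit of `θ` converge to the Haar integral for trigonometric polynomials. The
  -- factor `c` is the total mass, as the measure is not normalized.
  have hlim : ∀ P ∈ Submodule.span ℂ (Set.range (UnitAddTorus.mFourier (d := d))),
      Tendsto (fun N => c * avg P N) atTop (𝓝 (∫ x, P x ∂μ)) := by
    intro P hP
    induction hP using Submodule.span_induction with
    | mem P hP =>
      obtain ⟨m, rfl⟩ := hP
      by_cases hm : m = 0
      · subst hm
        have h1 : ∫ x, UnitAddTorus.mFourier (0 : d → ℤ) x ∂μ = c := by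
          simp [UnitAddTorus.mFourier_zero, c]
        rw [h1]
        refine tendsto_const_nhds.congr' ?_
        filter_upwards [eventually_gt_atTop 0] with N hN
        have : (N : ℂ) ≠ 0 := by exact_mod_cast hN.ne'
        simp [avg, UnitAddTorus.mFourier_zero, this]
      -- For a nontrivial character the integral vanishes by invariance, and the average is a
      -- geometric sum of ratio `w ≠ 1`, hence of size `O(1 / N)`.
      · let w := UnitAddTorus.mFourier m θ
        have hw : w ≠ 1 := hθ m hm
        have h1 : ∫ x, UnitAddTorus.mFourier m x ∂μ = 0 := by
          have h2 := integral_add_right_eq_self (μ := μ) (fun x => UnitAddTorus.mFourier m x) θ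
          simp only [mFourier_apply_add, integral_mul_const] at h2
          have h3 : (∫ x, UnitAddTorus.mFourier m x ∂μ) * (w - 1) = 0 := by
            rw [mul_sub, mul_one, sub_eq_zero]; exact h2
          exact (mul_eq_zero.1 h3).resolve_right (sub_ne_zero.2 hw)
        rw [h1]
        have hwn : ‖w‖ ≤ 1 :=
          (ContinuousMap.norm_coe_le_norm _ _).trans UnitAddTorus.mFourier_norm.le
        have hb (N : ℕ) : ‖c * avg (UnitAddTorus.mFourier m) N‖ ≤ c * (2 / ‖w - 1‖) / N := by
          have h4 : ∑ n ∈ Finset.range N, UnitAddTorus.mFourier m ((n + 1) • θ) =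
              w * ((w ^ N - 1) / (w - 1)) := by
            rw [← geom_sum_eq hw, Finset.mul_sum]
            refine Finset.sum_congr rfl fun n _ => ?_
            rw [mFourier_nsmul, pow_succ']
          simp only [avg, h4, norm_mul, norm_div, norm_inv, Complex.norm_real, Complex.norm_natCast,
            Real.norm_of_nonneg hc.le]
          have h5 : ‖w ^ N - 1‖ ≤ 2 := (norm_sub_le _ _).trans (by
            rw [norm_pow, norm_one]
            linarith [pow_le_one₀ (n := N) (norm_nonneg w) hwn])
          rw [mul_div_assoc, div_eq_inv_mul _ (N : ℝ)]
          gcongr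
          calc ‖w‖ * (‖w ^ N - 1‖ / ‖w - 1‖) ≤ 1 * (2 / ‖w - 1‖) := by gcongr
            _ = _ := one_mul _
        exact squeeze_zero_norm hb (tendsto_const_div_atTop_nhds_zero_nat _)
    | zero => simp [avg]
    | add P Q _ _ hP hQ =>
      have : ∫ x, (P + Q) x ∂μ = (∫ x, P x ∂μ) + ∫ x, Q x ∂μ := integral_add (hint P) (hint Q)
      rw [this]
      refine (hP.add hQ).congr fun N => ?_
      simp only [avg, ContinuousMap.add_apply, Finset.sum_add_distrib]; ring
    | smul a P _ hP =>
      have : ∫ x, (a • P) x ∂μ = a * ∫ x, P x ∂μ := integral_const_mul a _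
      rw [this]
      refine (hP.const_mul a).congr fun N => ?_
      simp only [avg, ContinuousMap.smul_apply, smul_eq_mul, ← Finset.mul_sum]; ring
  obtain ⟨x₀, hx₀⟩ := hne
  obtain ⟨g, hg0, hg1, hg⟩ := exists_continuous_zero_one_of_isClosed hU.isClosed_compl
    (isClosed_singleton (x := x₀)) (by simpa using hx₀)
  let f : C(UnitAddTorus d, ℂ) := ⟨fun x => (g x : ℂ), by fun_prop⟩
  have hf : ∫ x, f x ∂μ = ((∫ x, g x ∂μ : ℝ) : ℂ) := integral_ofReal
  have hpos : 0 < ∫ x, g x ∂μ := by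
    refine g.continuous.integral_pos_of_hasCompactSupport_nonneg_nonzero
      (HasCompactSupport.of_compactSpace _) (fun x => (hg x).1) (x := x₀) ?_
    rw [hg1 rfl]; exact one_ne_zero
  set I := ∫ x, g x ∂μ
  have hcl : f ∈ (Submodule.span ℂ (Set.range (UnitAddTorus.mFourier (d := d)))).topologicalClosure := by
    rw [UnitAddTorus.span_mFourier_closure_eq_top]; trivial
  -- The bump function `f` has integral `I` and vanishes along the orbit. With tolerance `I / (3 *
  -- c)`, the integral of `P` is at most `I / 3` by averaging along the orbit, and within `I / 3` of
  -- `I` by comparison with `f`: a contradiction.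
  obtain ⟨P, hP, hPf⟩ := Metric.mem_closure_iff.1 hcl (I / (3 * c)) (by positivity)
  rw [dist_comm, dist_eq_norm] at hPf
  have hclose (x) : ‖P x - f x‖ ≤ I / (3 * c) := (ContinuousMap.norm_coe_le_norm (P - f) x).trans hPf.le
  have h1 : ‖∫ x, P x ∂μ‖ ≤ I / 3 := by
    refine le_of_tendsto (hlim P hP).norm (Eventually.of_forall fun N => ?_)
    have h2 : ‖∑ n ∈ Finset.range N, P ((n + 1) • θ)‖ ≤ N * (I / (3 * c)) := by
      have h0 : ∑ n ∈ Finset.range N, I / (3 * c) = N * (I / (3 * c)) := by simp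
      rw [← h0]
      refine norm_sum_le_of_le _ fun n _ => ?_
      have h3 := hclose ((n + 1) • θ)
      have h4 : f ((n + 1) • θ) = 0 := by
        change ((g _ : ℝ) : ℂ) = 0
        rw [hg0 (hcon (n + 1) n.succ_pos)]; simp
      rwa [h4, sub_zero] at h3
    simp only [avg, norm_mul, norm_inv, Complex.norm_real, Complex.norm_natCast, Real.norm_of_nonneg hc.le]
    rcases N.eq_zero_or_pos with rfl | hN
    · simp; positivity
    · calc c * ((N : ℝ)⁻¹ * ‖∑ n ∈ Finset.range N, P ((n + 1) • θ)‖)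
        ≤ c * ((N : ℝ)⁻¹ * (N * (I / (3 * c)))) := by gcongr
        _ = I / 3 := by field_simp
  have h2 : ‖(∫ x, P x ∂μ) - ∫ x, f x ∂μ‖ ≤ I / 3 := by
    rw [← integral_sub (hint P) (hint f)]
    refine (norm_integral_le_of_norm_le_const (Eventually.of_forall hclose)).trans (le_of_eq ?_)
    change I / (3 * c) * c = _
    field_simp
  have h3 : ‖∫ x, f x ∂μ‖ = I := by rw [hf, Complex.norm_real, Real.norm_of_nonneg hpos.le]
  have := norm_sub_norm_le (∫ x, f x ∂μ) (∫ x, P x ∂μ)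
  rw [norm_sub_rev] at this
  linarith

end

/-! ### Simultaneous approximation from above -/

section

open MeasureTheory Filter Topology


/-- Kronecker's theorem for the rotation by `D * ω`, which makes the number of steps divisible by
`D`, aimed at `-y` for a point `y` of `O`. Then `n * D * ω + y` is close to integers, which are the
`p i`. -/
theorem exists_int_sub_mem_of_isOpen {d : Type*} [Fintype d] (ω : d → ℝ)
    (hω : ∀ (m : d → ℤ) (k : ℤ), ∑ i, (m i : ℝ) * ω i = k → m = 0) {O : Set (d → ℝ)}
    (hO : IsOpen O) (hne : O.Nonempty) {D : ℕ} (hD : 0 < D) :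
    ∃ (n : ℕ) (p : d → ℤ), 0 < n ∧ D ∣ n ∧ (fun i => (p i : ℝ) - n * ω i) ∈ O := by
  obtain ⟨y, hy⟩ := hne
  obtain ⟨δ, hδ, hball⟩ := Metric.isOpen_iff.1 hO y hy
  let θ : UnitAddTorus d := fun i => ((D * ω i : ℝ) : UnitAddCircle)
  let y' : UnitAddTorus d := fun i => ((-y i : ℝ) : UnitAddCircle)
  have hθ (m : d → ℤ) (hm : m ≠ 0) : UnitAddTorus.mFourier m θ ≠ 1 := by
    intro h
    have h1 : UnitAddTorus.mFourier m θ =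
        Complex.exp (2 * Real.pi * Complex.I * (∑ i, m i * (D * ω i) : ℝ)) := by
      simp only [UnitAddTorus.mFourier, ContinuousMap.coe_mk, θ, fourier_coe_apply]
      rw [← Complex.exp_sum]
      congr 1
      push_cast
      rw [Finset.mul_sum]
      refine Finset.sum_congr rfl fun i _ => ?_
      ring
    rw [h1, Complex.exp_eq_one_iff] at h
    obtain ⟨k, hk⟩ := h
    have h2 : (2 * Real.pi * Complex.I : ℂ) ≠ 0 := Complex.two_pi_I_ne_zero
    rw [mul_comm] at hk
    have h3 := mul_right_cancel₀ h2 hk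
    have h4 : ∑ i, (m i : ℝ) * (D * ω i) = k := by exact_mod_cast h3
    have h5 := hω (fun i => m i * D) k (by
      rw [← h4]
      refine Finset.sum_congr rfl fun i _ => ?_
      push_cast; ring)
    refine hm (funext fun i => ?_)
    have h6 := congrFun h5 i
    have : (D : ℤ) ≠ 0 := by exact_mod_cast hD.ne'
    exact (mul_eq_zero.1 h6).resolve_right this
  obtain ⟨n, hn, hmem⟩ := exists_nsmul_mem_of_mFourier_ne_one θ hθ (U := Metric.ball y' δ)
    Metric.isOpen_ball ⟨y', Metric.mem_ball_self hδ⟩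
  refine ⟨n * D, fun i => round (n * (D * ω i) + y i), Nat.mul_pos hn hD, dvd_mul_left _ _,
    hball ?_⟩
  rw [Metric.mem_ball, dist_pi_lt_iff hδ] at hmem ⊢
  intro i
  have h1 := hmem i
  have h2 : (n • θ) i - y' i = ((n * (D * ω i) + y i : ℝ) : UnitAddCircle) := by
    simp only [θ, y', Pi.smul_apply, AddCircle.coe_add, AddCircle.coe_neg, sub_neg_eq_add]
    rw [← nsmul_eq_mul n (D * ω i), AddCircle.coe_nsmul]
  rw [dist_eq_norm, h2, UnitAddCircle.norm_eq] at h1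
  rw [Real.dist_eq, abs_sub_comm]
  push_cast
  convert h1 using 2
  ring

/-- The `w i` span a finite-dimensional rational space. Send the vectors of a basis to rationals
close to them, and extend the functional to all reals. -/
theorem exists_rat_linearMap_near {ι : Type*} [Finite ι] (w : ι → ℝ) {δ : ℝ} (hδ : 0 < δ) :
    ∃ l : ℝ →ₗ[ℚ] ℚ, ∀ i, |(l (w i) : ℝ) - w i| < δ := by
  let E := Submodule.span ℚ (Set.range w)
  have : FiniteDimensional ℚ E := FiniteDimensional.span_of_finite ℚ (Set.finite_range w)
  let b := Module.finBasis ℚ E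
  let w' (i : ι) : E := ⟨w i, Submodule.subset_span ⟨i, rfl⟩⟩
  have hw (i : ι) : w i = ∑ j, (b.repr (w' i) j : ℝ) * (b j : ℝ) := by
    have h := congrArg (Submodule.subtype E) (b.sum_repr (w' i))
    rw [map_sum] at h
    rw [show w i = Submodule.subtype E (w' i) from rfl, ← h]
    refine Finset.sum_congr rfl fun j _ => ?_
    rw [map_smul, Rat.smul_def]; rfl
  let O : Set (Fin (Module.finrank ℚ E) → ℝ) :=
    {x | ∀ i, |∑ j, (b.repr (w' i) j : ℝ) * x j - w i| < δ}
  have hO : IsOpen O := by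
    have : O = ⋂ i, {x | |∑ j, (b.repr (w' i) j : ℝ) * x j - w i| < δ} := by ext; simp [O]
    rw [this]
    exact isOpen_iInter_of_finite fun i => isOpen_lt (by fun_prop) continuous_const
  have hd : DenseRange fun (ρ : Fin (Module.finrank ℚ E) → ℚ) j => ((ρ j : ℚ) : ℝ) :=
    DenseRange.piMap fun _ => Rat.denseRange_cast
  obtain ⟨ρ, hρ⟩ := hd.exists_mem_open hO ⟨fun j => (b j : ℝ), fun i => by rw [← hw, sub_self, abs_zero]; exact hδ⟩
  obtain ⟨l, hl⟩ := LinearMap.exists_extend (b.constr ℚ ρ)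
  refine ⟨l, fun i => ?_⟩
  have h1 : l (w i) = ∑ j, b.repr (w' i) j * ρ j := by
    have := LinearMap.congr_fun hl (w' i)
    rw [Module.Basis.constr_apply_fintype] at this
    simpa using this
  rw [h1]
  push_cast
  exact hρ i

/-- **Gordan's theorem** for rational vectors. -/
theorem exists_sum_mul_pos {κ d : Type*} [Fintype κ] [Fintype d] (c : κ → d → ℚ)
    (hc : ∀ a : κ → ℚ, (∀ t, 0 ≤ a t) → (∀ k, ∑ t, a t * c t k = 0) → a = 0) :
    ∃ x : d → ℝ, ∀ t, 0 < ∑ k, (c t k : ℝ) * x k := by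
  classical
  let C (t : κ) : d → ℝ := fun k => c t k
  -- If zero were a convex combination of the vectors with real weights `w`, a functional to `ℚ`
  -- close to the identity on the weights would keep them nonnegative and the positive ones
  -- positive. This gives a nontrivial rational relation, excluded by `hc`.
  have h0 : (0 : d → ℝ) ∉ convexHull ℝ (Set.range C) := by
    intro h
    obtain ⟨ι, _, w, z, hw0, hw1, hz, hsum⟩ := mem_convexHull_iff_exists_fintype.1 h
    choose τ hτ using hz
    obtain ⟨δ, hδ, hδw⟩ : ∃ δ > 0, ∀ i, 0 < w i → δ ≤ w i := by
      have h1 : ∀ᶠ δ : ℝ in 𝓝[>] 0, ∀ i, 0 < w i → δ ≤ w i := by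
        refine eventually_all.2 fun i => ?_
        by_cases hi : 0 < w i
        · filter_upwards [mem_nhdsWithin_of_mem_nhds (Iic_mem_nhds hi)] with δ h _ using h
        · exact Eventually.of_forall fun _ h => absurd h hi
      obtain ⟨δ, h2, h3⟩ := (h1.and self_mem_nhdsWithin).exists
      exact ⟨δ, h3, h2⟩
    obtain ⟨l, hl⟩ := exists_rat_linearMap_near w hδ
    have hpos (i : ι) (hi : 0 < w i) : 0 < l (w i) := by
      have h2 := (abs_lt.1 (hl i)).1
      have h3 := hδw i hi
      have : (0 : ℝ) < l (w i) := by linarith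
      exact_mod_cast this
    have hnn (i : ι) : 0 ≤ l (w i) := by
      rcases (hw0 i).eq_or_lt with h2 | h2
      · rw [← h2, map_zero]
      · exact (hpos i h2).le
    have ha := hc (fun t => ∑ i with τ i = t, l (w i)) (fun t => Finset.sum_nonneg fun i _ => hnn i)
      fun k => by
        have h2 : ∑ i, w i * (c (τ i) k : ℝ) = 0 := by
          have := congrFun hsum k
          simp only [Finset.sum_apply, Pi.smul_apply, smul_eq_mul, ← hτ] at this
          exact this
        have h3 := congrArg l h2
        rw [map_sum, map_zero] at h3
        rw [← h3]
        simp only [Finset.sum_mul]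
        rw [← Finset.sum_fiberwise Finset.univ τ]
        refine Finset.sum_congr rfl fun t _ => Finset.sum_congr rfl fun i hi => ?_
        rw [← (Finset.mem_filter.1 hi).2, mul_comm (w i), ← Rat.smul_def, map_smul, smul_eq_mul,
          mul_comm]
    obtain ⟨i, hi⟩ : ∃ i, 0 < w i := by
      by_contra! h2
      have : ∑ i, w i ≤ 0 := Finset.sum_nonpos fun i _ => h2 i
      linarith
    have h4 := congrFun ha (τ i)
    have h5 := (Finset.sum_eq_zero_iff_of_nonneg fun i _ => hnn i).1 h4 i (by simp)
    exact (hpos i hi).ne' h5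
  obtain ⟨f, u, hu0, hu⟩ := geometric_hahn_banach_point_closed (convex_convexHull ℝ _)
    ((Set.finite_range C).isClosed_convexHull ℝ) h0
  refine ⟨fun k => f (Pi.single k 1), fun t => ?_⟩
  rw [map_zero] at hu0
  have h1 := hu0.trans (hu _ (subset_convexHull ℝ _ ⟨t, rfl⟩))
  refine h1.trans_eq ?_
  conv_lhs => rw [pi_eq_sum_univ' (C t)]
  rw [map_sum]
  refine Finset.sum_congr rfl fun k _ => ?_
  rw [map_smul, smul_eq_mul]

/-- Simultaneous approximation of finitely many reals by a `ℚ`-linear functional with small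
denominators, from above on a set without rational positive combinations. -/
theorem exists_linearMap_near {ι : Type*} [Finite ι] (v : ι → ℝ) (F : Set ι)
    (hF : ∀ a : F → ℚ, (∀ t, 0 ≤ a t) → (∃ q : ℚ, (q : ℝ) = ∑ᶠ t : F, a t * v t) → a = 0)
    {D : ℕ} (hD : 0 < D) {δ : ℝ} (hδ : 0 < δ) :
    ∃ (n : ℕ) (l : ℝ →ₗ[ℚ] ℝ), 0 < n ∧ D ∣ n ∧ l 1 = 1 ∧ (∀ i, ∃ z : ℤ, n * l (v i) = z) ∧
      (∀ i, |n * l (v i) - n * v i| < δ) ∧ ∀ i ∈ F, v i ≤ l (v i) := by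
  classical
  have := Fintype.ofFinite ι
  -- `ρ` splits the reals into the rationals and its kernel. The rational part of each `v i` is kept
  -- exactly, and only the component `u i` in the kernel is approximated.
  obtain ⟨ρ, hρ⟩ : ∃ ρ : ℝ →ₗ[ℚ] ℚ, ρ 1 = 1 := by
    obtain ⟨l, hl⟩ := exists_rat_linearMap_near (fun _ : Unit => (1 : ℝ)) one_pos
    have h1 := (abs_lt.1 (hl ())).1
    have h2 : (0 : ℝ) < l 1 := by linarith
    have h3 : l 1 ≠ 0 := by exact_mod_cast h2.ne'
    exact ⟨(l 1)⁻¹ • l, by simp [h3]⟩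
  let u (i : ι) : ℝ := v i - ρ (v i)
  let E := Submodule.span ℚ (Set.range u)
  have : FiniteDimensional ℚ E := FiniteDimensional.span_of_finite ℚ (Set.finite_range u)
  have hE : E ≤ LinearMap.ker ρ := by
    refine Submodule.span_le.2 ?_
    rintro _ ⟨i, rfl⟩
    simp only [SetLike.mem_coe, LinearMap.mem_ker, u, map_sub]
    have h1 : ρ ((ρ (v i) : ℚ) : ℝ) = ρ (v i) := by
      rw [← mul_one ((ρ (v i) : ℚ) : ℝ), ← Rat.smul_def, map_smul, hρ, smul_eq_mul, mul_one]
    rw [h1, sub_self]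
  let b := Module.finBasis ℚ E
  let ω (k) : ℝ := b k
  let u' (i : ι) : E := ⟨u i, Submodule.subset_span ⟨i, rfl⟩⟩
  let c (i : ι) (k) : ℚ := b.repr (u' i) k
  have hu (i : ι) : u i = ∑ k, (c i k : ℝ) * ω k := by
    have h := congrArg (Submodule.subtype E) (b.sum_repr (u' i))
    rw [map_sum] at h
    rw [show u i = Submodule.subtype E (u' i) from rfl, ← h]
    refine Finset.sum_congr rfl fun j _ => ?_
    rw [map_smul, Rat.smul_def]; rfl
  -- The nonresonance needed for Kronecker's theorem: an integer `k` lying in `E` is killed by `ρ`,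
  -- while `ρ k = k`.
  have hω (m : Fin (Module.finrank ℚ E) → ℤ) (k : ℤ) (h : ∑ i, (m i : ℝ) * ω i = k) : m = 0 := by
    have h0 : ∑ i, (m i : ℚ) • b i = (0 : E) := by
      have h1 : (∑ i, (m i : ℚ) • b i : E) = (k : ℝ) := by
        rw [← h]
        have := map_sum (Submodule.subtype E) (fun i => (m i : ℚ) • b i) Finset.univ
        refine this.trans (Finset.sum_congr rfl fun i _ => ?_)
        rw [map_smul, Rat.smul_def]
        simp [ω]
      have h2 : ρ (k : ℝ) = 0 := by
        rw [← h1]; exact hE (Subtype.coe_prop _)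
      have h3 : ρ (k : ℝ) = k := by
        have : (k : ℝ) = (k : ℚ) • (1 : ℝ) := by rw [Rat.smul_def]; simp
        rw [this, map_smul, hρ]; simp
      rw [h3] at h2
      apply Subtype.ext
      rw [h1]
      have h4 : k = 0 := by exact_mod_cast h2
      rw [h4]; simp
    funext i
    have := Fintype.linearIndependent_iff.1 b.linearIndependent _ h0 i
    exact_mod_cast this
  obtain ⟨N, hN, hNc, hNρ⟩ : ∃ N : ℕ, 0 < N ∧ (∀ i k, ∃ z : ℤ, (N : ℚ) * c i k = z) ∧
      ∀ i, ∃ z : ℤ, (N : ℚ) * ρ (v i) = z := by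
    have key (q : ℚ) (N : ℕ) (h : q.den ∣ N) : ∃ z : ℤ, (N : ℚ) * q = z := by
      obtain ⟨w, rfl⟩ := h
      refine ⟨w * q.num, ?_⟩
      push_cast
      rw [mul_comm (q.den : ℚ), mul_assoc, Rat.den_mul_eq_num]
    refine ⟨(∏ i, ∏ k, (c i k).den) * ∏ i, (ρ (v i)).den, ?_, fun i k => key _ _ ?_,
      fun i => key _ _ ?_⟩
    · exact Nat.mul_pos (Finset.prod_pos fun i _ => Finset.prod_pos fun k _ => (c i k).den_pos)
        (Finset.prod_pos fun i _ => Rat.den_pos _)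
    · exact Dvd.dvd.mul_right ((Finset.dvd_prod_of_mem _ (Finset.mem_univ k)).trans
        (Finset.dvd_prod_of_mem (fun i => ∏ k, (c i k).den) (Finset.mem_univ i))) _
    · exact Dvd.dvd.mul_left (Finset.dvd_prod_of_mem (fun i => (ρ (v i)).den) (Finset.mem_univ i)) _
  have hN' : (0 : ℝ) < N := by exact_mod_cast hN
  -- A nonnegative rational relation between the irrational parts of the `v t`, `t ∈ F`, would make
  -- the same combination of the `v t` rational, against `hF`. So Gordan's theorem gives a direction
  -- `x` in which all of them increase.
  obtain ⟨x, hx⟩ := exists_sum_mul_pos (fun t : F => c t) fun a ha h => by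
    refine hF a ha ⟨∑ t, a t * ρ (v t), ?_⟩
    rw [finsum_eq_sum_of_fintype]
    have h1 : ∑ t : F, (a t : ℝ) * u t = 0 := by
      simp only [hu, Finset.mul_sum, ← mul_assoc]
      rw [Finset.sum_comm]
      refine Finset.sum_eq_zero fun k _ => ?_
      rw [← Finset.sum_mul]
      have : (∑ t : F, (a t : ℝ) * c t k) = 0 := by exact_mod_cast congrArg ((↑) : ℚ → ℝ) (h k)
      rw [this, zero_mul]
    simp only [u, mul_sub, Finset.sum_sub_distrib] at h1
    push_cast
    linarith
  -- The conditions on the error vector `p - n * ω`: errors below `δ`, and positive along `F`. The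
  -- factor `N` appears since the final index is `N * n`. Small positive multiples of `x` show that
  -- `O` is nonempty.
  let O : Set (Fin (Module.finrank ℚ E) → ℝ) :=
    {y | (∀ i, |N * ∑ k, (c i k : ℝ) * y k| < δ) ∧ ∀ t : F, 0 < ∑ k, (c t k : ℝ) * y k}
  have hO : IsOpen O := by
    have : O = (⋂ i, {y | |N * ∑ k, (c i k : ℝ) * y k| < δ}) ∩
      ⋂ t : F, {y | 0 < ∑ k, (c t k : ℝ) * y k} := by ext; simp [O]
    rw [this]
    exact (isOpen_iInter_of_finite fun i => isOpen_lt (by fun_prop) continuous_const).inter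
      (isOpen_iInter_of_finite fun i => isOpen_lt continuous_const (by fun_prop))
  have hne : O.Nonempty := by
    have h1 : ∀ᶠ s : ℝ in 𝓝[>] 0, ∀ i, |N * ∑ k, (c i k : ℝ) * (s * x k)| < δ := by
      refine eventually_all.2 fun i => mem_nhdsWithin_of_mem_nhds ?_
      refine (isOpen_lt (f := fun s : ℝ => |N * ∑ k, (c i k : ℝ) * (s * x k)|) (by fun_prop)
        continuous_const).mem_nhds ?_
      simpa using hδ
    obtain ⟨s, h2, h3⟩ := (h1.and self_mem_nhdsWithin).exists
    refine ⟨fun k => s * x k, h2, fun t => ?_⟩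
    have h4 : ∑ k, (c t k : ℝ) * (s * x k) = s * ∑ k, (c t k : ℝ) * x k := by
      rw [Finset.mul_sum]; exact Finset.sum_congr rfl fun _ _ => by ring
    rw [h4]
    exact mul_pos h3 (hx t)
  obtain ⟨n, p, hn, hDn, hmem⟩ := exists_int_sub_mem_of_isOpen ω hω hO hne hD
  have hn' : (0 : ℝ) < n := by exact_mod_cast hn
  obtain ⟨μ, hμ⟩ := LinearMap.exists_extend (b.constr ℚ fun k => (p k : ℝ) / n)
  have hμu (i : ι) : μ (u i) = ∑ k, (c i k : ℝ) * ((p k : ℝ) / n) := by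
    have := LinearMap.congr_fun hμ (u' i)
    rw [Module.Basis.constr_apply_fintype] at this
    refine this.trans (Finset.sum_congr rfl fun k _ => ?_)
    rw [Rat.smul_def]; rfl
  let ρ' : ℝ →ₗ[ℚ] ℝ := (Algebra.linearMap ℚ ℝ) ∘ₗ ρ
  have hρ' (y : ℝ) : ρ' y = (ρ y : ℝ) := rfl
  -- `l` is the identity on the rationals, and on the kernel component it replaces each basis
  -- element `ω k` by `p k / n`.
  let l : ℝ →ₗ[ℚ] ℝ := ρ' + μ ∘ₗ (LinearMap.id - ρ')
  have hl (i : ι) : l (v i) = ρ (v i) + ∑ k, (c i k : ℝ) * ((p k : ℝ) / n) := by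
    rw [← hμu]; rfl
  have hdiff (i : ι) : n * l (v i) - n * v i = ∑ k, (c i k : ℝ) * (p k - n * ω k) := by
    have h1 : v i = ρ (v i) + ∑ k, (c i k : ℝ) * ω k := by rw [← hu]; simp [u]
    have h2 : l (v i) - v i = ∑ k, (c i k : ℝ) * ((p k : ℝ) / n - ω k) := by
      rw [hl]
      simp only [mul_sub, Finset.sum_sub_distrib]
      linarith
    rw [← mul_sub, h2, Finset.mul_sum]
    refine Finset.sum_congr rfl fun k _ => ?_
    field_simp
  refine ⟨N * n, l, Nat.mul_pos hN hn, hDn.mul_left _, ?_, fun i => ?_, fun i => ?_, fun i hi => ?_⟩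
  · simp [l, hρ', hρ]
  · obtain ⟨z, hz⟩ := hNρ i
    choose w hw using hNc i
    refine ⟨n * z + ∑ k, w k * p k, ?_⟩
    have hz' : (N : ℝ) * ρ (v i) = z := by exact_mod_cast congrArg ((↑) : ℚ → ℝ) hz
    have hw' (k) : (N : ℝ) * c i k = w k := by exact_mod_cast congrArg ((↑) : ℚ → ℝ) (hw k)
    rw [hl]
    push_cast
    rw [← hz', mul_add, Finset.mul_sum]
    congr 1
    · ring
    · refine Finset.sum_congr rfl fun k _ => ?_
      rw [← hw']; field_simp
  · have := hmem.1 i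
    rw [← hdiff] at this
    push_cast
    convert this using 2
    ring
  · have := hmem.2 ⟨i, hi⟩
    simp only [← hdiff] at this
    have h1 : n * v i < n * l (v i) := by linarith
    exact (lt_of_mul_lt_mul_left h1 hn'.le).le

end

/-! ### Rational weights for convex combinations -/

section

open Filter Topology


/-- As `n * v` is an integer, `⌊(n + 1) * b⌋ ≤ n * v` means just `(n + 1) * b < n * v + 1`. The case
`b = 1` is separate, because its fractional part is zero. -/
theorem coeffIneq_of_le {n : ℕ} {b v : ℝ} (hb : b ∈ Set.Icc (0 : ℝ) 1) (hv : ∃ z : ℤ, n * v = z)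
    (h1 : b = 1 → 1 ≤ v) (h2 : b < 1 → (n + 1) * b < n * v + 1) : Data.CoeffIneq n b v := by
  unfold Data.CoeffIneq
  rcases hb.2.eq_or_lt with h | h
  · subst h
    have := h1 rfl
    simp only [Int.floor_one, Int.fract_one, mul_zero, Int.floor_zero]
    push_cast
    nlinarith [(Nat.cast_nonneg n : (0 : ℝ) ≤ n)]
  · have h0 : ⌊b⌋ = 0 := Int.floor_eq_zero_iff.2 ⟨hb.1, h⟩
    have h3 : Int.fract b = b := Int.fract_eq_self.2 ⟨hb.1, h⟩
    obtain ⟨z, hz⟩ := hv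
    rw [h0, h3, hz]
    have h4 : ⌊((n : ℝ) + 1) * b⌋ < z + 1 := by
      rw [Int.floor_lt]
      push_cast
      rw [← hz]
      exact h2 h
    have h5 : ⌊((n : ℝ) + 1) * b⌋ ≤ z := by omega
    simp only [Int.cast_zero, mul_zero, zero_add]
    exact_mod_cast h5

theorem coeffIneq_of_one_le {n : ℕ} {b v : ℝ} (hb : b ∈ Set.Icc (0 : ℝ) 1) (h1 : 1 ≤ v) :
    Data.CoeffIneq n b v := by
  have h : Data.CoeffIneq n b 1 := coeffIneq_of_le hb ⟨n, by simp⟩ (fun _ => le_rfl) fun h => by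
    have := hb.1
    nlinarith [(Nat.cast_nonneg n : (0 : ℝ) ≤ n)]
  exact h.trans (mul_le_mul_of_nonneg_left h1 n.cast_nonneg)

/-- A rational value of such a combination lies in the span, so it is zero. The `v t` are
nonnegative and irrational, hence positive, and a vanishing nonnegative combination of positive
numbers is trivial. -/
theorem eq_zero_of_spanCondition {ε : ℝ} (hε : 0 ≤ ε) {Γ : Set ℝ} (hΓ : Γ ⊆ Set.Icc 0 1)
    (hS : SpanCondition ε Γ) {κ : Type*} [Finite κ] {v : κ → ℝ}
    (hv : ∀ t, v t ∈ (closure Γ ∪ {ε}) \ Set.range ((↑) : ℚ → ℝ)) {a : κ → ℚ} (ha : ∀ t, 0 ≤ a t)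
    (h : ∃ q : ℚ, (q : ℝ) = ∑ᶠ t, a t * v t) : a = 0 := by
  have := Fintype.ofFinite κ
  obtain ⟨q, hq⟩ := h
  rw [finsum_eq_sum_of_fintype] at hq
  have hpos (t : κ) : 0 < v t := by
    refine lt_of_le_of_ne ?_ fun h0 => (hv t).2 ⟨0, by simpa using h0⟩
    rcases (hv t).1 with h | h
    · exact (closure_minimal hΓ isClosed_Icc h).1
    · rw [Set.mem_singleton_iff.1 h]; exact hε
  have hmem : (q : ℝ) ∈ Submodule.span ℚ≥0 ((closure Γ ∪ {ε}) \ Set.range ((↑) : ℚ → ℝ)) := by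
    rw [hq]
    refine Submodule.sum_mem _ fun t _ => ?_
    have : (a t : ℝ) * v t = (a t).toNNRat • v t := by
      rw [NNRat.smul_def]
      congr 1
      have := congrArg ((↑) : ℚ → ℝ) (Rat.coe_toNNRat _ (ha t))
      simpa using this.symm
    rw [this]
    exact Submodule.smul_mem _ _ (Submodule.subset_span (hv t))
  have hq0 : (q : ℝ) = 0 := by
    by_contra h0
    exact (Set.eq_empty_iff_forall_notMem.1 hS) q ⟨hmem, ⟨q, rfl⟩, h0⟩
  rw [hq0] at hq
  funext t
  have h1 := (Finset.sum_eq_zero_iff_of_nonneg fun t _ =>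
    mul_nonneg (by exact_mod_cast ha t : (0 : ℝ) ≤ a t) (hpos t).le).1 hq.symm t (Finset.mem_univ t)
  have := (mul_eq_zero.1 h1).resolve_right (hpos t).ne'
  exact_mod_cast this

/-- Rational approximation of the coefficients of convex combinations. -/
theorem exists_coefficients (ε : ℝ) (hε : 0 ≤ ε) (Γ : Set ℝ) (hΓ : Γ ⊆ Set.Icc 0 1) (Γ₀ : Finset ℝ)
    (hΓ₀ : ∀ a ∈ Γ₀, 0 < a ∧ a ≤ 1) {n₀ p : ℕ} (hn₀ : 0 < n₀) (hp : 0 < p) :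
    ∃ (n : ℕ) (β : ℝ → ℝ), 0 < n ∧ p ∣ n ∧ n₀ ∣ n ∧
      (∀ a ∈ Γ₀, 0 ≤ β a ∧ ∃ z : ℕ, n * β a = n₀ * z) ∧
      ∀ {k : ℕ} (a : Fin k → ℝ), (∀ i, a i ∈ Γ₀) → ∑ i, a i = 1 → ∑ i, β (a i) = 1 ∧
        ∀ x : Fin k → ℝ, (∀ i, ∃ y : ℕ, n₀ * x i = y) →
          (ε ≤ ∑ i, a i * x i → ε ≤ ∑ i, β (a i) * x i) ∧
          (∀ b ∈ Set.Icc (0 : ℝ) 1, b ≤ ∑ i, a i * x i → Data.CoeffIneq n b (∑ i, β (a i) * x i)) ∧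
          (SpanCondition ε Γ → ∀ b, b ∈ Γ ∨ b = 0 → b ≤ ∑ i, a i * x i →
            b ≤ ∑ i, β (a i) * x i) := by
  classical
  have hn₀' : (0 : ℝ) < n₀ := by exact_mod_cast hn₀
  -- Since the new weights are at least half the old ones, a value above `C` remains at least `1 +
  -- ε`, where all required inequalities hold. Only values up to `C` need care, and there are
  -- finitely many.
  let C : ℝ := 2 + 2 * ε
  let val (y : Γ₀ → ℕ) : ℝ := (∑ α : Γ₀, (α : ℝ) * y α) / n₀
  have hval0 (y) : 0 ≤ val y :=
    div_nonneg (Finset.sum_nonneg fun α _ => mul_nonneg (hΓ₀ α α.2).1.le (Nat.cast_nonneg _)) hn₀'.le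
  have hfin : {y : Γ₀ → ℕ | val y ≤ C}.Finite := by
    refine (Set.Finite.pi' fun α : Γ₀ => Set.finite_Iic ⌊C * n₀ / α⌋₊).subset fun y hy α => ?_
    have h1 : (α : ℝ) * y α ≤ C * n₀ := by
      rw [Set.mem_ofPred_eq, div_le_iff₀ hn₀'] at hy
      exact (Finset.single_le_sum (f := fun α : Γ₀ => (α : ℝ) * y α)
        (fun α _ => mul_nonneg (hΓ₀ α α.2).1.le (Nat.cast_nonneg _)) (Finset.mem_univ α)).trans hy
    exact Nat.le_floor ((le_div_iff₀' (hΓ₀ α α.2).1).2 h1)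
  let Y := {y : Γ₀ → ℕ // val y ≤ C}
  have : Finite Y := hfin
  -- The values that must not decrease. Rational ones are left out because `l` fixes them. Values in
  -- the closure of `Γ` matter only for monotonicity, and are included only under the span
  -- condition.
  let F : Set Y := {y | val y ∉ Set.range ((↑) : ℚ → ℝ) ∧
    (val y = ε ∨ SpanCondition ε Γ ∧ val y ∈ closure Γ)}
  have hF (a : F → ℚ) (ha : ∀ t, 0 ≤ a t) (h : ∃ q : ℚ, (q : ℝ) = ∑ᶠ t : F, a t * val t.1) :
      a = 0 := by
    by_cases hS : SpanCondition ε Γ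
    · refine eq_zero_of_spanCondition hε hΓ hS (fun t => ⟨?_, t.2.1⟩) ha h
      rcases t.2.2 with h | h
      · exact Or.inr h
      · exact Or.inl h.2
    -- Without the span condition only `ε` itself occurs in `F`, and a nonzero nonnegative rational
    -- multiple of an irrational number is irrational.
    · have hval (t : F) : val t.1 = ε := t.2.2.resolve_right fun h => hS h.1
      obtain ⟨q, hq⟩ := h
      have := Fintype.ofFinite F
      rw [finsum_eq_sum_of_fintype] at hq
      simp only [hval, ← Finset.sum_mul] at hq
      by_contra hne
      obtain ⟨t, ht⟩ : ∃ t, a t ≠ 0 := by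
        by_contra! h; exact hne (funext h)
      have hpos : 0 < ∑ t, a t :=
        Finset.sum_pos' (fun t _ => ha t) ⟨t, Finset.mem_univ t, lt_of_le_of_ne (ha t) ht.symm⟩
      refine t.2.1 ⟨q / ∑ t, a t, ?_⟩
      rw [hval]
      have : (0 : ℝ) < ∑ t, (a t : ℝ) := by exact_mod_cast hpos
      push_cast
      rw [hq]
      field_simp
  -- A common lower bound for the finitely many gaps: from the values to `1` on either side, from
  -- `ε` to the larger values, from a value outside the closure of `Γ` down to the elements of `Γ`
  -- below it, and half of each positive value.
  obtain ⟨δ, ⟨hδ1, hδ2, hδ3, hδ4, hδ5⟩, hδ⟩ : ∃ δ : ℝ, ((∀ y : Y, val y < 1 → δ ≤ 1 - val y) ∧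
      (∀ y : Y, 1 < val y → δ ≤ val y - 1) ∧ (∀ y : Y, ε < val y → δ ≤ val y - ε) ∧
      (∀ y : Y, val y ∉ closure Γ → ∀ b ∈ Γ, b ≤ val y → b ≤ val y - δ) ∧
      ∀ y : Y, 0 < val y → δ ≤ val y / 2) ∧ 0 < δ := by
    have key (P : Y → Prop) (c : Y → ℝ) (h : ∀ y, P y → 0 < c y) :
        ∀ᶠ δ : ℝ in 𝓝[>] 0, ∀ y, P y → δ ≤ c y := by
      refine eventually_all.2 fun y => ?_
      by_cases hy : P y
      · filter_upwards [mem_nhdsWithin_of_mem_nhds (Iic_mem_nhds (h y hy))] with δ h _ using h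
      · exact Eventually.of_forall fun _ h => absurd h hy
    have h4 : ∀ᶠ δ : ℝ in 𝓝[>] 0, ∀ y : Y, val y ∉ closure Γ → ∀ b ∈ Γ, b ≤ val y → b ≤ val y - δ := by
      refine eventually_all.2 fun y => ?_
      by_cases hy : val y ∈ closure Γ
      · exact Eventually.of_forall fun _ h => absurd hy h
      · obtain ⟨η, hη, hball⟩ := Metric.isOpen_iff.1 isClosed_closure.isOpen_compl _ hy
        filter_upwards [mem_nhdsWithin_of_mem_nhds (Iic_mem_nhds (half_pos hη)),
          self_mem_nhdsWithin] with δ h h0 _ b hb hbv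
        by_contra! hlt
        have h' : δ ≤ η / 2 := h
        refine hball ?_ (subset_closure hb)
        rw [Metric.mem_ball, Real.dist_eq, abs_lt]
        constructor <;> linarith
    exact (((key _ _ fun y hy => sub_pos.2 hy).and ((key _ _ fun y hy => sub_pos.2 hy).and
      ((key _ _ fun y hy => sub_pos.2 hy).and (h4.and (key _ _ fun y hy => half_pos hy))))).and
      self_mem_nhdsWithin).exists
  obtain ⟨n, l, hn, hdvd, hl1, hlint, hlnear, hlF⟩ :=
    exists_linearMap_near (fun y : Y => val y) F hF (Nat.mul_pos hp hn₀) hδ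
  have hn' : (1 : ℝ) ≤ n := by exact_mod_cast hn
  have hnear (y : Y) : |n * l (val y) - n * val y| < δ := hlnear y
  have hnear' (y : Y) : val y - δ < l (val y) := by
    by_contra! h
    have h1 := (abs_lt.1 (hnear y)).1
    nlinarith
  have hrat (q : ℚ) : l (q : ℝ) = q := by
    have : (q : ℝ) = q • (1 : ℝ) := by rw [Rat.smul_def, mul_one]
    rw [this, map_smul, hl1]
  -- The number `α / n₀` is itself one of the approximated values. This is what makes `n * l α / n₀`
  -- integral, and `l α` at least `α / 2`.
  let e (α : Γ₀) : Y := ⟨Pi.single α 1, by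
    have h1 : val (Pi.single α 1) = α / n₀ := by
      simp [val, Pi.single_apply]
    rw [h1]
    have h2 : (1 : ℝ) ≤ n₀ := by exact_mod_cast hn₀
    exact (div_le_self (hΓ₀ α α.2).1.le h2).trans ((hΓ₀ α α.2).2.trans (by simp only [C]; linarith))⟩
  have he (α : Γ₀) : val (e α) = α / n₀ := by simp [e, val, Pi.single_apply]
  have hdiv (v : ℝ) (m : ℕ) : l (v * (m / n₀)) = l v * (m / n₀) := by
    have : v * ((m : ℝ) / n₀) = ((m : ℚ) / n₀) • v := by rw [Rat.smul_def]; push_cast; ring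
    rw [this, map_smul, Rat.smul_def]; push_cast; ring
  have hle (α : Γ₀) : l (val (e α)) = l α / n₀ := by
    rw [he]
    have := hdiv α 1
    simpa [div_eq_mul_inv] using this
  have hhalf (α : Γ₀) : (α : ℝ) / 2 ≤ l α := by
    have h1 := hnear' (e α)
    have h2 := hδ5 (e α) (by rw [he]; exact div_pos (hΓ₀ α α.2).1 hn₀')
    rw [hle] at h1
    have h3 : val (e α) / 2 < l α / n₀ := by linarith
    rw [he, div_right_comm] at h3
    exact ((div_lt_div_iff_of_pos_right hn₀').1 h3).le
  refine ⟨n, l, hn, (dvd_mul_right _ _).trans hdvd, (dvd_mul_left _ _).trans hdvd, fun α hα => ?_,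
    fun {k} a ha ha1 => ?_⟩
  · have h0 : 0 ≤ l α := (half_pos (hΓ₀ α hα).1).le.trans (hhalf ⟨α, hα⟩)
    refine ⟨h0, ?_⟩
    obtain ⟨z, hz⟩ := hlint (e ⟨α, hα⟩)
    rw [hle] at hz
    have hz0 : 0 ≤ z := by
      have : (0 : ℝ) ≤ z := by rw [← hz]; positivity
      exact_mod_cast this
    obtain ⟨z, rfl⟩ := Int.eq_ofNat_of_zero_le hz0
    refine ⟨z, ?_⟩
    have : (n : ℝ) * (l α / n₀) = z := by exact_mod_cast hz
    rw [← this]; field_simp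
  · refine ⟨by rw [← map_sum, ha1, hl1], fun x hx => ?_⟩
    choose y hy using hx
    have hxy (i) : x i = y i / n₀ := by rw [← hy]; field_simp
    have hv' : ∑ i, l (a i) * x i = l (∑ i, a i * x i) := by
      rw [map_sum]
      exact Finset.sum_congr rfl fun i _ => by rw [hxy, hdiv]
    have hx0 (i) : 0 ≤ x i := by rw [hxy]; positivity
    by_cases hC : ∑ i, a i * x i ≤ C
    -- Grouping the indices with equal weight turns a combination of arbitrary length `k` into one
    -- of the finitely many values.
    · obtain ⟨w, hw⟩ : ∃ w : Y, val w = ∑ i, a i * x i := by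
        have h1 : val (fun α => ∑ i with a i = α, y i) = ∑ i, a i * x i := by
          simp only [val]
          rw [Finset.sum_div, ← Finset.sum_fiberwise Finset.univ (fun i => (⟨a i, ha i⟩ : Γ₀))]
          refine Finset.sum_congr rfl fun α _ => ?_
          push_cast
          rw [Finset.mul_sum, Finset.sum_div]
          refine Finset.sum_congr (by ext i; simp [Subtype.ext_iff]) fun i hi => ?_
          have : a i = α := congrArg Subtype.val (Finset.mem_filter.1 hi).2
          rw [hxy, this]; ring
        exact ⟨⟨_, h1.le.trans hC⟩, h1⟩
      rw [hv', ← hw]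
      have heq (h : val w ∈ Set.range ((↑) : ℚ → ℝ)) : l (val w) = val w := by
        obtain ⟨q, hq⟩ := h
        rw [← hq, hrat]
      have hge (h : val w = ε ∨ SpanCondition ε Γ ∧ val w ∈ closure Γ) : val w ≤ l (val w) := by
        by_cases hq : val w ∈ Set.range ((↑) : ℚ → ℝ)
        · exact (heq hq).ge
        · exact hlF w ⟨hq, h⟩
      refine ⟨fun h => ?_, fun b hb h => ?_, fun hS b hb h => ?_⟩
      · rcases h.eq_or_lt with h | h
        · exact h.trans_le (hge (Or.inl h.symm))
        · have := hδ3 w h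
          have := hnear' w
          linarith
      · refine coeffIneq_of_le hb (hlint w) (fun hb1 => ?_) fun hb1 => ?_
        · rw [hb1] at h
          rcases h.eq_or_lt with h | h
          · rw [heq ⟨1, by simpa using h⟩, ← h]
          · have := hδ2 w h
            have := hnear' w
            linarith
        · rcases lt_trichotomy (val w) 1 with h1 | h1 | h1
          -- Here `b ≤ val w` gives `(n + 1) * b ≤ n * val w + val w < n * l (val w) + δ + val w`,
          -- and `δ ≤ 1 - val w`.
          · have := hδ1 w h1
            have := (abs_lt.1 (hnear w)).1
            nlinarith
          · rw [heq ⟨1, by simpa using h1.symm⟩, h1]; nlinarith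
          · have := hδ2 w h1
            have := hnear' w
            nlinarith
      · rcases hb with hb | rfl
        · by_cases hcl : val w ∈ closure Γ
          · exact h.trans (hge (Or.inr ⟨hS, hcl⟩))
          · exact (hδ4 w hcl b hb h).trans (hnear' w).le
        · rw [hw, ← hv']
          exact Finset.sum_nonneg fun i _ => mul_nonneg
            ((half_pos (hΓ₀ _ (ha i)).1).le.trans (hhalf ⟨a i, ha i⟩)) (hx0 i)
    · have h1 : 1 + ε ≤ ∑ i, l (a i) * x i := by
        have h2 : (∑ i, a i * x i) / 2 ≤ ∑ i, l (a i) * x i := by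
          rw [Finset.sum_div]
          refine Finset.sum_le_sum fun i _ => ?_
          have := mul_le_mul_of_nonneg_right (hhalf ⟨a i, ha i⟩) (hx0 i)
          simp only at this
          linarith
        simp only [C] at hC
        linarith
      refine ⟨fun _ => by linarith, fun b hb _ => coeffIneq_of_one_le hb (by linarith),
        fun _ b hb _ => ?_⟩
      have : b ≤ 1 := by
        rcases hb with hb | rfl
        · exact (hΓ hb).2
        · exact zero_le_one
      linarith

end

/-! ### Divisors on open subvarieties -/

section

theorem isNormal_of_isOpenImmersion {U X : Variety} (ι : U.sch ⟶ X.sch) [IsOpenImmersion ι]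
    (hX : X.IsNormal) : U.IsNormal := fun x =>
  have := hX (ι x)
  IsIntegrallyClosed.of_equiv (asIso (ι.stalkMap x)).commRingCatIsoToRingEquiv

section OpenImmersion

variable {U X : Variety} (ι : U.sch ⟶ X.sch) [IsOpenImmersion ι]

theorem isDom_of_isOpenImmersion : IsDom ι :=
  specializes_of_eq (genericPoint_eq_of_isOpenImmersion ι)

theorem pullHom_bijective_of_isOpenImmersion :
    Function.Bijective (pullHom ι (isDom_of_isOpenImmersion ι)) :=
  pullHom_bijective_of_isIso_stalkMap _

theorem isWeakModel_of_isOpenImmersion (hX : X.IsNormal) (hι : IsOverC ι) : IsWeakModel ι where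
  normal := isNormal_of_isOpenImmersion ι hX
  isOverC := hι
  dom := isDom_of_isOpenImmersion ι
  bij := pullHom_bijective_of_isOpenImmersion ι

theorem regularAt_openImmersion (y : U.sch) : regularAt ι y = localSubring X (ι y) := by
  refine le_antisymm (fun φ hφ => ?_) (localSubring_le_regularAt (isDom_of_isOpenImmersion ι) y)
  rw [regularAt_eq (isDom_of_isOpenImmersion ι)] at hφ
  obtain ⟨a, ha⟩ := hφ
  obtain ⟨b, rfl⟩ := (ConcreteCategory.bijective_of_isIso (ι.stalkMap y)).2 a
  have := pullHom_algebraMap (isDom_of_isOpenImmersion ι) y b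
  exact ⟨b, (pullHom_bijective_of_isOpenImmersion ι).1 (this.trans ha)⟩

theorem regularAt_openImmersion_comp {W : Variety} {g : X.sch ⟶ W.sch} (hg : IsDom g) (y : U.sch) :
    regularAt (ι ≫ g) y = regularAt g (ι y) := by
  have hι := isDom_of_isOpenImmersion ι
  ext φ
  rw [regularAt_eq (hι.comp hg), regularAt_eq hg, ← regularAt_openImmersion, regularAt_eq hι]
  simp only [Subring.mem_comap]
  rw [pullHom_comp hι hg]

/-- A prime divisor of an open subvariety is a prime divisor of the whole. -/
def PrimeDivisor.map (E : PrimeDivisor U) : PrimeDivisor X :=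
  ⟨ι E.1, ((ι.isOpenEmbedding).coheight_eq).trans E.2⟩

theorem PrimeDivisor.map_injective : Function.Injective (PrimeDivisor.map ι) := fun _ _ h =>
  Subtype.ext (ι.isOpenEmbedding.injective (congrArg Subtype.val h))

theorem PrimeDivisor.exists_map_eq {P : PrimeDivisor X} (h : P.1 ∈ ι.opensRange) :
    ∃ E, PrimeDivisor.map ι E = P := by
  obtain ⟨y, hy⟩ := h
  refine ⟨⟨y, ?_⟩, Subtype.ext hy⟩
  have := (ι.isOpenEmbedding).coheight_eq (x := y)
  rw [← this]
  exact (congrArg _ hy).trans P.2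

theorem ordAt_pullFun_openImmersion_comp (hX : X.IsNormal) (hι : IsOverC ι) {W : Variety}
    {g : X.sch ⟶ W.sch} (hg : IsWeakModel g) (E : PrimeDivisor U) (φ : W.K) :
    ordAt E (pullFun (ι ≫ g) φ) = ordAt (E.map ι) (pullFun g φ) :=
  ordAt_pullFun_eq_of_regularAt_eq ((isWeakModel_of_isOpenImmersion ι hX hι).comp hg) hg
    (E' := E.map ι) (regularAt_openImmersion_comp ι hg.dom E.1) φ

theorem pullFun_id {X : Variety} (φ : X.K) : pullFun (𝟙 X.sch) φ = φ := by
  rw [pullFun_eq (IsDom.id X), pullHom_id]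

theorem ordAt_pullFun_openImmersion (hX : X.IsNormal) (hι : IsOverC ι) (E : PrimeDivisor U)
    (φ : X.K) : ordAt E (pullFun ι φ) = ordAt (E.map ι) φ := by
  have := ordAt_pullFun_openImmersion_comp ι hX hι (IsWeakModel.id hX) E φ
  rwa [Category.comp_id, pullFun_id] at this

theorem pullFun_ne_zero {Y X : Variety} {g : Y.sch ⟶ X.sch} (hg : IsDom g) {φ : X.K} (h : φ ≠ 0) :
    pullFun g φ ≠ 0 := by
  rw [pullFun_eq hg]
  exact (map_ne_zero_iff _ (pullHom g hg).injective).2 h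

theorem isLocalEq_comp_map_iff (hX : X.IsNormal) (hι : IsOverC ι) {A : PrimeDivisor X → ℤ}
    {y : U.sch} {φ : X.K} :
    IsLocalEq (A ∘ PrimeDivisor.map ι) y (pullFun ι φ) ↔ IsLocalEq A (ι y) φ := by
  constructor
  · rintro ⟨h0, V, hy, hA⟩
    refine ⟨fun h => h0 ?_, ι ''ᵁ V, ⟨y, hy, rfl⟩, fun P hP => ?_⟩
    · rw [h, pullFun_eq (isDom_of_isOpenImmersion ι), map_zero]
    · obtain ⟨x, hx, hxP⟩ := hP
      obtain ⟨E, rfl⟩ := PrimeDivisor.exists_map_eq ι (P := P) ⟨x, hxP⟩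
      have : x = E.1 := ι.isOpenEmbedding.injective hxP
      rw [← ordAt_pullFun_openImmersion ι hX hι]
      exact hA E (this ▸ hx)
  · rintro ⟨h0, V, hy, hA⟩
    refine ⟨pullFun_ne_zero (isDom_of_isOpenImmersion ι) h0, ι ⁻¹ᵁ V, hy, fun E hE => ?_⟩
    rw [ordAt_pullFun_openImmersion ι hX hι]
    exact hA (E.map ι) hE

theorem exists_pullFun_eq (ψ : U.K) : ∃ φ : X.K, pullFun ι φ = ψ := by
  obtain ⟨φ, hφ⟩ := (pullHom_bijective_of_isOpenImmersion ι).2 ψ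
  exact ⟨φ, (pullFun_eq _ φ).trans hφ⟩

theorem isCartierOn_comp_map_iff (hX : X.IsNormal) (hι : IsOverC ι) {A : PrimeDivisor X → ℤ}
    {V : U.sch.Opens} :
    IsCartierOn V (A ∘ PrimeDivisor.map ι) ↔ IsCartierOn (ι ''ᵁ V) A := by
  constructor
  · rintro h _ ⟨y, hy, rfl⟩
    obtain ⟨ψ, hψ⟩ := h y hy
    obtain ⟨φ, rfl⟩ := exists_pullFun_eq ι ψ
    exact ⟨φ, (isLocalEq_comp_map_iff ι hX hι).1 hψ⟩
  · intro h y hy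
    obtain ⟨φ, hφ⟩ := h (ι y) ⟨y, hy, rfl⟩
    exact ⟨_, (isLocalEq_comp_map_iff ι hX hι).2 hφ⟩

theorem forall_mem_image_iff {V : U.sch.Opens} {p : PrimeDivisor X → Prop} :
    (∀ P : PrimeDivisor X, P.1 ∈ ι ''ᵁ V → p P) ↔
      ∀ E : PrimeDivisor U, E.1 ∈ V → p (E.map ι) := by
  constructor
  · exact fun h E hE => h _ ⟨E.1, hE, rfl⟩
  · rintro h P ⟨x, hx, hxP⟩
    obtain ⟨E, rfl⟩ := PrimeDivisor.exists_map_eq ι (P := P) ⟨x, hxP⟩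
    have : x = E.1 := ι.isOpenEmbedding.injective hxP
    exact h E (this ▸ hx)

theorem exists_comp_map_eq {R : Type*} [Zero R] (A : PrimeDivisor U → R) :
    ∃ A' : PrimeDivisor X → R, A' ∘ PrimeDivisor.map ι = A :=
  ⟨Function.extend (PrimeDivisor.map ι) A 0, funext fun E => (PrimeDivisor.map_injective ι).extend_apply _ _ E⟩

theorem isCartierDecomp_comp_map_iff (hX : X.IsNormal) (hι : IsOverC ι) {D : PrimeDivisor X → ℝ}
    {V : U.sch.Opens} {m : ℕ} {r : Fin m → ℝ} {A : Fin m → PrimeDivisor X → ℤ} :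
    IsCartierDecomp V (D ∘ PrimeDivisor.map ι) r (fun i => A i ∘ PrimeDivisor.map ι) ↔
      IsCartierDecomp (ι ''ᵁ V) D r A := by
  refine and_congr (forall_congr' fun i => isCartierOn_comp_map_iff ι hX hι) ?_
  exact (forall_mem_image_iff ι (p := fun P => D P = ∑ i, r i * (A i P : ℝ))).symm

theorem isRCartierOn_comp_map_iff (hX : X.IsNormal) (hι : IsOverC ι) {D : PrimeDivisor X → ℝ}
    {V : U.sch.Opens} :
    IsRCartierOn V (D ∘ PrimeDivisor.map ι) ↔ IsRCartierOn (ι ''ᵁ V) D := by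
  constructor
  · rintro ⟨m, r, A, h⟩
    choose A' hA' using fun i => exists_comp_map_eq ι (A i)
    refine ⟨m, r, A', (isCartierDecomp_comp_map_iff ι hX hι).1 ?_⟩
    simpa only [hA'] using h
  · rintro ⟨m, r, A, h⟩
    exact ⟨m, r, _, (isCartierDecomp_comp_map_iff ι hX hι).2 h⟩

theorem isQCartierOn_comp_map (hX : X.IsNormal) (hι : IsOverC ι) {D : PrimeDivisor X → ℝ}
    {V : U.sch.Opens} (h : IsQCartierOn (ι ''ᵁ V) D) : IsQCartierOn V (D ∘ PrimeDivisor.map ι) := by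
  obtain ⟨m, A, hm, hA, hD⟩ := h
  exact ⟨m, _, hm, (isCartierOn_comp_map_iff ι hX hι).2 hA, fun E hE => hD _ ⟨E.1, hE, rfl⟩⟩

theorem isPrincipalOn_of_comp_map (hX : X.IsNormal) (hι : IsOverC ι) {D : PrimeDivisor X → ℝ}
    {V : U.sch.Opens} (h : IsPrincipalOn V (D ∘ PrimeDivisor.map ι)) :
    IsPrincipalOn (ι ''ᵁ V) D := by
  obtain ⟨ψ, h0, h⟩ := h
  obtain ⟨φ, rfl⟩ := exists_pullFun_eq ι ψ
  refine ⟨φ, fun h1 => h0 ?_, (forall_mem_image_iff ι).2 fun E hE => ?_⟩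
  · rw [h1, pullFun_eq (isDom_of_isOpenImmersion ι), map_zero]
  · rw [← ordAt_pullFun_openImmersion ι hX hι]
    exact h E hE

/-- Pull back coefficients are insensitive to shrinking the target. -/
theorem pullCoeff_comp_openImmersion (hX : X.IsNormal) (hι : IsOverC ι) {Y : Variety}
    {h : Y.sch ⟶ U.sch} (hY : Y.IsNormal) (hh : IsDom h) {D : PrimeDivisor X → ℝ}
    {E : PrimeDivisor Y} {α : X.Kˣ →₀ ℝ} (hα : IsDivNear D ((h ≫ ι) E.1) α) :
    pullCoeff (h ≫ ι) D E = pullCoeff h (D ∘ PrimeDivisor.map ι) E := by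
  have hd := isDom_of_isOpenImmersion ι
  let τ : X.Kˣ → U.Kˣ := Units.map (pullHom ι hd).toMonoidHom
  have hτ (φ : X.Kˣ) : (τ φ : U.K) = pullFun ι (φ : X.K) := (pullHom_eq_unit hd φ).symm
  have hα' : IsDivNear (D ∘ PrimeDivisor.map ι) (h E.1) (α.mapDomain τ) := by
    obtain ⟨V, hV, hD⟩ := hα
    refine ⟨ι ⁻¹ᵁ V, hV, fun P hP => (hD (P.map ι) hP).trans ?_⟩
    simp only [divAt, Finsupp.linearCombination_mapDomain]
    congr 2
    funext φ
    simp only [Function.comp, hτ, ordAt_pullFun_openImmersion ι hX hι]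
  rw [pullCoeff_eq hX hY (hh.comp hd) hα, pullCoeff_eq (isNormal_of_isOpenImmersion ι hX) hY hh hα']
  simp only [pullDiv, Finsupp.linearCombination_mapDomain]
  congr 2
  funext φ
  simp only [Function.comp, hτ, pullFun_eq hd, pullFun_eq hh, pullFun_eq (hh.comp hd),
    pullHom_comp hh hd]

end OpenImmersion

/-- Pull back coefficients only depend on the center and on the valuation. -/
theorem pullCoeff_eq_of_regularAt_eq {Y Y' X : Variety} (hX : X.IsNormal) {g : Y.sch ⟶ X.sch}
    {g' : Y'.sch ⟶ X.sch} (hg : IsWeakModel g) (hg' : IsWeakModel g') {E : PrimeDivisor Y}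
    {E' : PrimeDivisor Y'} (h : regularAt g E.1 = regularAt g' E'.1) (hc : g E.1 = g' E'.1)
    {D : PrimeDivisor X → ℝ} {α : X.Kˣ →₀ ℝ} (hα : IsDivNear D (g E.1) α) :
    pullCoeff g D E = pullCoeff g' D E' := by
  rw [pullCoeff_eq hX hg.normal hg.dom hα, pullCoeff_eq hX hg'.normal hg'.dom (hc ▸ hα)]
  simp only [pullDiv]
  congr 2
  funext φ
  rw [ordAt_pullFun_eq_of_regularAt_eq hg hg' h]

end

/-! ### Rational top forms under isomorphisms of function fields -/

section

section Forms

variable {k K K' : Type} [Field k] [Field K] [Field K'] [Algebra k K] [Algebra k K']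

/-- Pull back of forms along an isomorphism of fields: existence. -/
theorem exists_kaehlerMap (θ : K ≃ₐ[k] K') : ∃ m : Ω[K⁄k] →+ Ω[K'⁄k],
    (∀ a x, m (a • x) = θ a • m x) ∧
      ∀ a, m (KaehlerDifferential.D k K a) = KaehlerDifferential.D k K' (θ a) := by
  let := θ.toRingHom.toAlgebra
  have : IsScalarTower k K K' := IsScalarTower.of_algebraMap_eq fun x => (θ.commutes x).symm
  refine ⟨(KaehlerDifferential.map k k K K').toAddMonoidHom, fun a x => ?_, fun a => ?_⟩
  · exact ((KaehlerDifferential.map k k K K').map_smul a x).trans (algebraMap_smul K' a _).symm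
  · exact KaehlerDifferential.map_D k k K K' a

theorem exists_formMap (θ : K ≃ₐ[k] K') (d : ℕ) : ∃ T : ⋀[K]^d Ω[K⁄k] →+ ⋀[K']^d Ω[K'⁄k],
    (∀ a x, T (a • x) = θ a • T x) ∧
      ∀ a : Fin d → K, T (exteriorPower.ιMulti K d fun i => KaehlerDifferential.D k K (a i)) =
        exteriorPower.ιMulti K' d fun i => KaehlerDifferential.D k K' (θ (a i)) := by
  obtain ⟨m, hm, hD⟩ := exists_kaehlerMap θ
  -- The map of differentials is only `θ`-semilinear. Viewing the target as a `K`-module through `θ`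
  -- makes the alternating map `F` linear.
  let : Module K (⋀[K']^d Ω[K'⁄k]) := Module.compHom _ θ.toRingHom
  let F : Ω[K⁄k] [⋀^Fin d]→ₗ[K] (⋀[K']^d Ω[K'⁄k]) :=
    { toFun := fun v => exteriorPower.ιMulti K' d fun i => m (v i)
      map_update_add' := by
        intro dec v i x y
        have h (z) : (fun j => m (Function.update v i z j)) = Function.update (fun j => m (v j)) i (m z) :=
          funext fun j => Function.apply_update (fun _ => m) v i z j
        simp only [h, map_add, AlternatingMap.map_update_add]
      map_update_smul' := by
        intro dec v i c x
        have h (z) : (fun j => m (Function.update v i z j)) = Function.update (fun j => m (v j)) i (m z) :=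
          funext fun j => Function.apply_update (fun _ => m) v i z j
        simp only [h, hm, AlternatingMap.map_update_smul]
        rfl
      map_eq_zero_of_eq' := fun v i j hij hne =>
        (exteriorPower.ιMulti K' d).map_eq_zero_of_eq _ (congrArg m hij) hne }
  refine ⟨(exteriorPower.alternatingMapLinearEquiv F).toAddMonoidHom, fun a x => ?_, fun a => ?_⟩
  · exact (exteriorPower.alternatingMapLinearEquiv F).map_smul a x
  · refine (exteriorPower.alternatingMapLinearEquiv_apply_ιMulti F _).trans ?_
    change exteriorPower.ιMulti K' d (fun i => m _) = _
    simp only [hD]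

/-- The map induced by `θ⁻¹` is a left inverse, as one checks on wedge products of exact
differentials, which span. The two degrees are separate because they will be the dimensions of two
different varieties. -/
theorem exists_formMap_injective (θ : K ≃ₐ[k] K') {d d' : ℕ} (h : d = d') :
    ∃ T : ⋀[K]^d Ω[K⁄k] →+ ⋀[K']^d' Ω[K'⁄k], Function.Injective T ∧
      (∀ a x, T (a • x) = θ a • T x) ∧
      ∀ a : Fin d → K, T (exteriorPower.ιMulti K d fun i => KaehlerDifferential.D k K (a i)) =
        exteriorPower.ιMulti K' d' fun i => KaehlerDifferential.D k K' (θ (a (Fin.cast h.symm i))) := by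
  subst h
  obtain ⟨T, hT, hTD⟩ := exists_formMap θ d
  obtain ⟨T', hT', hTD'⟩ := exists_formMap θ.symm d
  refine ⟨T, ?_, hT, hTD⟩
  refine Function.LeftInverse.injective (g := T') fun x => ?_
  have hx : x ∈ Submodule.span K (exteriorPower.ιMulti K d ''
      {a | Set.range a ⊆ Set.range (KaehlerDifferential.D k K)}) := by
    rw [exteriorPower.ιMulti_span_of_span K d _ (KaehlerDifferential.span_range_derivation k K)]
    trivial
  induction hx using Submodule.span_induction with
  | mem x hx =>
    obtain ⟨a, ha, rfl⟩ := hx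
    choose b hb using fun i => ha ⟨i, rfl⟩
    obtain rfl : (fun i => KaehlerDifferential.D k K (b i)) = a := funext hb
    simp only [hTD, hTD', AlgEquiv.symm_apply_apply]
  | zero => simp
  | add x y _ _ hx hy => rw [map_add, map_add, hx, hy]
  | smul c x _ hx => rw [hT, hT', hx, AlgEquiv.symm_apply_apply]

/-- `ω` generates `φ` times the module of the forms `da_1 ∧ ⋯ ∧ da_d`, `a_i ∈ S`. -/
def IsFormGen {d : ℕ} (ω : ⋀[K]^d Ω[K⁄k]) (S : Subring K) (φ : K) : Prop :=
  φ ≠ 0 ∧ Submodule.span S {ω} = Submodule.span S (Set.range fun a : Fin d → S =>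
    φ • exteriorPower.ιMulti K d (fun i => KaehlerDifferential.D k K (a i : K)))

/-- Let `N` be the module of regular forms. Then `ω = φ • n` with `n` in `N`, while `φ' • n` lies in
`φ' N`, which is generated by `ω`. Comparing gives `φ' = s * φ`. By symmetry two generators have the
same order, so `formOrd` does not depend on the one chosen. -/
theorem IsFormGen.exists_mul_eq {d : ℕ} {ω : ⋀[K]^d Ω[K⁄k]} (hω : ω ≠ 0) {S : Subring K}
    {φ φ' : K} (h : IsFormGen ω S φ) (h' : IsFormGen ω S φ') : ∃ s ∈ S, φ' = s * φ := by
  have key : ∀ η ∈ Submodule.span S (Set.range fun a : Fin d → S =>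
      φ • exteriorPower.ιMulti K d (fun i => KaehlerDifferential.D k K (a i : K))),
      ∃ n, η = φ • n ∧ φ' • n ∈ Submodule.span S (Set.range fun a : Fin d → S =>
      φ' • exteriorPower.ιMulti K d (fun i => KaehlerDifferential.D k K (a i : K))) := by
    intro η hη
    induction hη using Submodule.span_induction with
    | mem η hη =>
      obtain ⟨a, rfl⟩ := hη
      exact ⟨_, rfl, Submodule.subset_span ⟨a, rfl⟩⟩
    | zero => exact ⟨0, by simp, by simp⟩
    | add x y _ _ hx hy =>
      obtain ⟨n, rfl, hn⟩ := hx
      obtain ⟨m, rfl, hm⟩ := hy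
      exact ⟨n + m, by rw [smul_add], by rw [smul_add]; exact add_mem hn hm⟩
    | smul s x _ hx =>
      obtain ⟨n, rfl, hn⟩ := hx
      refine ⟨s • n, smul_comm s φ n, ?_⟩
      rw [← smul_comm s φ' n]
      exact Submodule.smul_mem _ _ hn
  have h1 : ω ∈ Submodule.span S {ω} := Submodule.mem_span_singleton_self ω
  rw [h.2] at h1
  obtain ⟨n, hn, hn'⟩ := key ω h1
  rw [← h'.2, Submodule.mem_span_singleton] at hn'
  obtain ⟨s, hs⟩ := hn'
  refine ⟨s, s.2, ?_⟩
  have h2 : ((s : K) * φ) • n = φ' • n := by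
    rw [← hs, mul_smul, ← hn]; rfl
  have hn0 : n ≠ 0 := by
    rintro rfl
    exact hω (by rw [hn, smul_zero])
  exact (smul_left_injective K hn0 h2).symm

theorem mem_span_image_iff {M M' : Type} [AddCommGroup M] [AddCommGroup M'] [Module K M]
    [Module K' M'] (θ : K ≃ₐ[k] K') {T : M →+ M'} (hinj : Function.Injective T)
    (hT : ∀ a x, T (a • x) = θ a • T x) {S : Subring K} {S' : Subring K'}
    (hS : ∀ a, a ∈ S ↔ θ a ∈ S') {A : Set M} {x : M} :
    T x ∈ Submodule.span S' (T '' A) ↔ x ∈ Submodule.span S A := by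
  constructor
  · have key : ∀ y ∈ Submodule.span S' (T '' A), ∃ x ∈ Submodule.span S A, T x = y := by
      intro y hy
      induction hy using Submodule.span_induction with
      | mem y hy =>
        obtain ⟨x, hx, rfl⟩ := hy
        exact ⟨x, Submodule.subset_span hx, rfl⟩
      | zero => exact ⟨0, zero_mem _, map_zero _⟩
      | add y y' _ _ hy hy' =>
        obtain ⟨x, hx, rfl⟩ := hy
        obtain ⟨x', hx', rfl⟩ := hy'
        exact ⟨x + x', add_mem hx hx', map_add _ _ _⟩
      | smul s y _ hy =>
        obtain ⟨x, hx, rfl⟩ := hy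
        have hs : θ.symm (s : K') ∈ S := by rw [hS, θ.apply_symm_apply]; exact s.2
        refine ⟨(⟨_, hs⟩ : S) • x, Submodule.smul_mem _ _ hx, ?_⟩
        refine (hT _ x).trans ?_
        rw [θ.apply_symm_apply]; rfl
    intro h
    obtain ⟨x', hx', e⟩ := key _ h
    rwa [← hinj e]
  · intro h
    induction h using Submodule.span_induction with
    | mem x hx => exact Submodule.subset_span ⟨x, hx, rfl⟩
    | zero => rw [map_zero]; exact zero_mem _
    | add x y _ _ hx hy => rw [map_add]; exact add_mem hx hy
    | smul s x _ hx =>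
      refine (congrArg (· ∈ _) (hT (s : K) x)).mpr ?_
      exact Submodule.smul_mem _ (⟨θ s, (hS _).1 s.2⟩ : S') hx

theorem span_image_eq_iff {M M' : Type} [AddCommGroup M] [AddCommGroup M'] [Module K M]
    [Module K' M'] (θ : K ≃ₐ[k] K') {T : M →+ M'} (hinj : Function.Injective T)
    (hT : ∀ a x, T (a • x) = θ a • T x) {S : Subring K} {S' : Subring K'}
    (hS : ∀ a, a ∈ S ↔ θ a ∈ S') {A B : Set M} :
    Submodule.span S' (T '' A) = Submodule.span S' (T '' B) ↔
      Submodule.span S A = Submodule.span S B := by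
  have key (A B : Set M) : T '' A ⊆ Submodule.span S' (T '' B) ↔ A ⊆ Submodule.span S B := by
    rw [Set.image_subset_iff]
    exact forall₂_congr fun x _ => mem_span_image_iff θ hinj hT hS
  rw [le_antisymm_iff, le_antisymm_iff, Submodule.span_le, Submodule.span_le, Submodule.span_le,
    Submodule.span_le, key, key]

theorem isFormGen_map_iff (θ : K ≃ₐ[k] K') {d d' : ℕ} (h : d = d')
    {T : ⋀[K]^d Ω[K⁄k] →+ ⋀[K']^d' Ω[K'⁄k]} (hinj : Function.Injective T)
    (hT : ∀ a x, T (a • x) = θ a • T x)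
    (hTD : ∀ a : Fin d → K, T (exteriorPower.ιMulti K d fun i => KaehlerDifferential.D k K (a i)) =
        exteriorPower.ιMulti K' d' fun i => KaehlerDifferential.D k K' (θ (a (Fin.cast h.symm i))))
    {S : Subring K} {S' : Subring K'} (hS : ∀ a, a ∈ S ↔ θ a ∈ S') {ω : ⋀[K]^d Ω[K⁄k]} {φ : K} :
    IsFormGen (T ω) S' (θ φ) ↔ IsFormGen ω S φ := by
  subst h
  refine and_congr (map_ne_zero_iff θ θ.injective) ?_
  rw [← span_image_eq_iff θ hinj hT hS, Set.image_singleton, ← Set.range_comp]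
  refine Eq.congr_right (congrArg _ ?_)
  ext y
  constructor
  · rintro ⟨a, rfl⟩
    have ha (i) : θ.symm (a i : K') ∈ S := by rw [hS, θ.apply_symm_apply]; exact (a i).2
    refine ⟨fun i => ⟨_, ha i⟩, ?_⟩
    simp only [Function.comp, hT, hTD, Fin.cast_eq_self, θ.apply_symm_apply]
  · rintro ⟨a, rfl⟩
    refine ⟨fun i => ⟨θ (a i), (hS _).1 (a i).2⟩, ?_⟩
    simp only [Function.comp, hT, hTD, Fin.cast_eq_self]

end Forms

/-- A generator of a form, or `1` if there is none. -/
def formGen {X : Variety} (ω : TopForm X) (S : Subring X.K) : X.K :=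
  open Classical in
  if h : ∃ φ, IsFormGen ω S φ then h.choose else 1


theorem formOrd_eq {Y X : Variety} {g : Y.sch ⟶ X.sch} (hg : IsDom g) (ω : TopForm X)
    (E : PrimeDivisor Y) : formOrd g ω E = ordAt E (pullFun g (formGen ω (regularAt g E.1))) := by
  by_cases h : ∃ φ, IsFormGen ω (regularAt g E.1) φ
  · rw [formGen, dif_pos h]
    exact dif_pos h
  · rw [formGen, dif_neg h, pullFun_eq hg, map_one, ordAt_one]
    exact dif_neg h

theorem formOrd_eq_of_regularAt_eq {Y Y' X : Variety} {g : Y.sch ⟶ X.sch} {g' : Y'.sch ⟶ X.sch}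
    (hg : IsWeakModel g) (hg' : IsWeakModel g') {E : PrimeDivisor Y} {E' : PrimeDivisor Y'}
    (h : regularAt g E.1 = regularAt g' E'.1) (ω : TopForm X) : formOrd g ω E = formOrd g' ω E' := by
  rw [formOrd_eq hg.dom, formOrd_eq hg'.dom, ordAt_pullFun_eq_of_regularAt_eq hg hg' h, h]

theorem IsFormGen.ordAt_le {Y X : Variety} {g : Y.sch ⟶ X.sch} (hg : IsWeakModel g)
    {E : PrimeDivisor Y} {ω : TopForm X} (hω : ω ≠ 0) {φ φ' : X.K}
    (h : IsFormGen ω (regularAt g E.1) φ) (h' : IsFormGen ω (regularAt g E.1) φ') :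
    ordAt E (pullFun g φ) ≤ ordAt E (pullFun g φ') := by
  obtain ⟨s, hs, rfl⟩ := h.exists_mul_eq hω h'
  have hs0 : s ≠ 0 := left_ne_zero_of_mul h'.1
  have h1 := (hg.mem_regularAt_iff E hs0).1 hs
  rw [pullFun_eq hg.dom (s * φ), map_mul, ← pullFun_eq hg.dom, ← pullFun_eq hg.dom,
    ordAt_mul E (pullFun_ne_zero hg.dom hs0) (pullFun_ne_zero hg.dom h.1)]
  omega

theorem IsFormGen.formOrd_eq {Y X : Variety} {g : Y.sch ⟶ X.sch} (hg : IsWeakModel g)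
    {E : PrimeDivisor Y} {ω : TopForm X} (hω : ω ≠ 0) {φ : X.K}
    (h : IsFormGen ω (regularAt g E.1) φ) : formOrd g ω E = ordAt E (pullFun g φ) := by
  have hex : ∃ φ, IsFormGen ω (regularAt g E.1) φ := ⟨φ, h⟩
  rw [GenPair.formOrd_eq hg.dom, formGen, dif_pos hex]
  exact le_antisymm (hex.choose_spec.ordAt_le hg hω h) (h.ordAt_le hg hω hex.choose_spec)

end

/-! ### Dimension as transcendence degree, and restriction of forms -/

section

section Dimension

/-- Integral extensions preserve the dimension. -/
theorem ringKrullDim_eq_of_isIntegral (R A : Type*) [CommRing R] [CommRing A] [Algebra R A]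
    [Algebra.IsIntegral R A] (hinj : Function.Injective (algebraMap R A)) :
    ringKrullDim R = ringKrullDim A := by
  refine le_antisymm ?_ (Order.krullDim_le_of_strictMono (PrimeSpectrum.comap (algebraMap R A))
    fun I J h => ?_)
  · have key (p : LTSeries (PrimeSpectrum R)) : ∃ q : LTSeries (PrimeSpectrum A),
        q.length = p.length ∧ PrimeSpectrum.comap (algebraMap R A) q.last = p.last := by
      induction p using RelSeries.inductionOn' with
      | singleton x =>
        obtain ⟨Q, -, hQ, hQx⟩ := Ideal.exists_ideal_over_prime_of_isIntegral (S := A) x.asIdeal ⊥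
          (by rw [Ideal.comap_bot_of_injective _ hinj]; exact bot_le)
        exact ⟨RelSeries.singleton _ ⟨Q, hQ⟩, rfl, PrimeSpectrum.ext hQx⟩
      | snoc p x hx ih =>
        obtain ⟨q, hq, hqp⟩ := ih
        have hlt : p.last < x := hx
        obtain ⟨Q, hle, hQ, hQx⟩ := Ideal.exists_ideal_over_prime_of_isIntegral (S := A) x.asIdeal
          q.last.asIdeal ((congrArg PrimeSpectrum.asIdeal hqp).le.trans hlt.le)
        have hlt' : q.last < ⟨Q, hQ⟩ := by
          refine lt_of_le_of_ne hle fun h => hlt.ne ?_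
          rw [← hqp, h]
          exact PrimeSpectrum.ext hQx
        refine ⟨q.snoc _ hlt', ?_, ?_⟩
        · simp [hq]
        · simpa using PrimeSpectrum.ext hQx
    refine iSup_le fun p => ?_
    obtain ⟨q, hq, -⟩ := key p
    rw [← hq]
    exact le_iSup (fun q : LTSeries (PrimeSpectrum A) => (q.length : WithBot ℕ∞)) q
  · exact Ideal.IsIntegral.comap_lt_comap h

/-- Both numbers are the number of variables in a Noether normalization, as integral injective
extensions change neither of them. -/
theorem exists_ringKrullDim_eq_trdeg (k A K : Type) [Field k] [CommRing A] [IsDomain A] [Field K]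
    [Algebra k A] [Algebra k K] [Algebra A K] [IsScalarTower k A K] [IsFractionRing A K]
    [Algebra.FiniteType k A] : ∃ s : ℕ, ringKrullDim A = s ∧ Algebra.trdeg k K = s := by
  obtain ⟨s, g, hg, hint⟩ := exists_integral_inj_algHom_of_fg k A
  let := g.toRingHom.toAlgebra
  have : Algebra.IsIntegral (MvPolynomial (Fin s) k) A := ⟨hint⟩
  have : IsScalarTower k (MvPolynomial (Fin s) k) A := IsScalarTower.of_algHom g
  have hinj : Function.Injective (algebraMap (MvPolynomial (Fin s) k) A) := hg
  have : FaithfulSMul (MvPolynomial (Fin s) k) A := (faithfulSMul_iff_algebraMap_injective _ _).2 hinj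
  refine ⟨s, ?_, ?_⟩
  · rw [← ringKrullDim_eq_of_isIntegral _ A hinj, MvPolynomial.ringKrullDim_of_isNoetherianRing,
      ringKrullDim_eq_zero_of_field]
    simp
  · have : FaithfulSMul k A := (faithfulSMul_iff_algebraMap_injective _ _).2 (algebraMap k A).injective
    have : Algebra.IsAlgebraic A K := IsLocalization.isAlgebraic (S := K) (nonZeroDivisors A)
    rw [← trdeg_add_eq k A (A := K), ← trdeg_add_eq k (MvPolynomial (Fin s) k) (A := A),
      trdeg_eq_zero (R := A) (A := K), trdeg_eq_zero (R := MvPolynomial (Fin s) k) (A := A),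
      MvPolynomial.trdeg_of_isDomain]
    simp

theorem coheight_le_topologicalKrullDim (S : Scheme.{0}) (x : S) :
    (Order.coheight x : WithBot ℕ∞) ≤ topologicalKrullDim S := by
  rw [← Order.coheight_orderIso (irreducibleSetEquivPoints (α := S)).symm]
  exact Order.coheight_le_krullDim _

theorem coheight_openImmersion {S T : Scheme.{0}} (f : S ⟶ T) [IsOpenImmersion f] (x : S) :
    Order.coheight (f x) = Order.coheight x := f.isOpenEmbedding.coheight_eq

/-- The dimension of a variety is the transcendence degree of its function field. -/
theorem exists_topologicalKrullDim_eq_trdeg (X : Variety) :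
    ∃ s : ℕ, topologicalKrullDim X.sch = s ∧ Algebra.trdeg ℂ X.K = s := by
  have key (V : X.sch.Opens) (hV : IsAffineOpen V) (hne : Nonempty V) :
      ∃ s : ℕ, topologicalKrullDim V.toScheme = s ∧ Algebra.trdeg ℂ X.K = s := by
    let φ : CommRingCat.of ℂ ⟶ Γ(X.sch, V) :=
      (Scheme.ΓSpecIso (CommRingCat.of ℂ)).inv ≫ X.str.appLE ⊤ V le_top
    let : Algebra ℂ Γ(X.sch, V) := φ.hom.toAlgebra
    have hft : φ.hom.FiniteType := by
      rw [CommRingCat.hom_comp]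
      exact (X.str.finiteType_appLE (isAffineOpen_top _) hV _).comp
        (RingHom.FiniteType.of_surjective _ (ConcreteCategory.bijective_of_isIso
          (Scheme.ΓSpecIso (CommRingCat.of ℂ)).inv).2)
    have : Algebra.FiniteType ℂ Γ(X.sch, V) := hft
    have : IsScalarTower ℂ Γ(X.sch, V) X.K := IsScalarTower.of_algebraMap_eq fun c => by
      have h : X.str.appLE ⊤ V le_top ≫ X.sch.germToFunctionField V =
          X.str.appTop ≫ @Scheme.germToFunctionField X.sch _ ⊤ ⟨⟨genericPoint X.sch, trivial⟩⟩ := by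
        refine (Category.assoc (X.str.app ⊤) _ _).trans ?_
        exact congrArg _ (X.sch.presheaf.germ_res _ _ _)
      exact (congrArg (fun f => f.hom ((Scheme.ΓSpecIso (CommRingCat.of ℂ)).inv.hom c)) h).symm
    have : IsFractionRing Γ(X.sch, V) X.K := functionField_isFractionRing_of_isAffineOpen X.sch V hV
    obtain ⟨s, h1, h2⟩ := exists_ringKrullDim_eq_trdeg ℂ Γ(X.sch, V) X.K
    refine ⟨s, ?_, h2⟩
    rw [← h1, ← PrimeSpectrum.topologicalKrullDim_eq_ringKrullDim Γ(X.sch, V)]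
    exact IsHomeomorph.topologicalKrullDim_eq _ hV.isoSpec.hom.homeomorph.isHomeomorph
  obtain ⟨V, hV, hx⟩ := exists_isAffineOpen_mem X (genericPoint X.sch)
  obtain ⟨s, h1, h2⟩ := key V hV ⟨⟨_, hx⟩⟩
  refine ⟨s, le_antisymm ?_ ?_, h2⟩
  -- The codimension of a point can be computed in an affine chart around it, and all charts have
  -- the same dimension because they share the function field.
  · rw [topologicalKrullDim, Order.krullDim_eq_iSup_coheight]
    refine iSup_le fun Z => ?_
    obtain ⟨W, hW, hz⟩ := exists_isAffineOpen_mem X (irreducibleSetEquivPoints Z)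
    obtain ⟨t, h3, h4⟩ := key W hW ⟨⟨_, hz⟩⟩
    have hst : t = s := by
      have := h4.symm.trans h2
      exact_mod_cast this
    rw [← hst, ← h3]
    have h5 := coheight_openImmersion W.ι (⟨_, hz⟩ : W.toScheme)
    rw [← Order.coheight_orderIso irreducibleSetEquivPoints Z]
    exact (le_of_eq (congrArg _ h5)).trans (coheight_le_topologicalKrullDim W.toScheme _)
  · rw [← h1]
    exact V.ι.isOpenEmbedding.isInducing.topologicalKrullDim_le

variable {U X : Variety} (ι : U.sch ⟶ X.sch) [IsOpenImmersion ι]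

theorem pullHom_algebraMap_complex (hι : IsOverC ι) (c : ℂ) :
    pullHom ι (isDom_of_isOpenImmersion ι) (algebraMap ℂ X.K c) = algebraMap ℂ U.K c := by
  have hd := isDom_of_isOpenImmersion ι
  have h : @Scheme.germToFunctionField X.sch _ ⊤ ⟨⟨genericPoint X.sch, trivial⟩⟩ ≫
      X.sch.presheaf.stalkSpecializes hd ≫ ι.stalkMap (genericPoint U.sch) =
      ι.appTop ≫ @Scheme.germToFunctionField U.sch _ ⊤ ⟨⟨genericPoint U.sch, trivial⟩⟩ := by
    rw [← Category.assoc]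
    refine (congrArg (· ≫ _) (X.sch.presheaf.germ_stalkSpecializes (U := ⊤) trivial hd)).trans ?_
    exact ι.germ_stalkMap ⊤ _ trivial
  have h2 : U.str.appTop = X.str.appTop ≫ ι.appTop := by
    rw [← Scheme.Hom.comp_appTop]
    exact congrArg Scheme.Hom.appTop hι.symm
  refine (congrArg (fun f => f.hom (X.str.appTop.hom
    ((Scheme.ΓSpecIso (CommRingCat.of ℂ)).inv.hom c))) h).trans ?_
  exact (congrArg (fun f => (f ≫ @Scheme.germToFunctionField U.sch _ ⊤
    ⟨⟨genericPoint U.sch, trivial⟩⟩).hom ((Scheme.ΓSpecIso (CommRingCat.of ℂ)).inv.hom c)) h2).symm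

/-- The isomorphism of function fields. -/
def functionFieldEquiv (hι : IsOverC ι) : X.K ≃ₐ[ℂ] U.K :=
  AlgEquiv.ofBijective
    { pullHom ι (isDom_of_isOpenImmersion ι) with commutes' := pullHom_algebraMap_complex ι hι }
    (pullHom_bijective_of_isOpenImmersion ι)

theorem topologicalKrullDim_eq_of_isOpenImmersion (hι : IsOverC ι) :
    topologicalKrullDim U.sch = topologicalKrullDim X.sch := by
  obtain ⟨s, h1, h2⟩ := exists_topologicalKrullDim_eq_trdeg X
  obtain ⟨t, h3, h4⟩ := exists_topologicalKrullDim_eq_trdeg U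
  have h5 := (functionFieldEquiv ι hι).trdeg_eq
  rw [h2, h4] at h5
  have h6 : s = t := by exact_mod_cast h5
  rw [h1, h3, h6]

theorem dim_eq_of_isOpenImmersion (hι : IsOverC ι) : U.dim = X.dim := by
  rw [Variety.dim, topologicalKrullDim_eq_of_isOpenImmersion ι hι, Variety.dim]

/-- Restriction of a rational top form to an open subvariety. -/
theorem exists_topForm_restrict (hX : X.IsNormal) (hι : IsOverC ι) {ω : TopForm X} (hω : ω ≠ 0) :
    ∃ ω' : TopForm U, ω' ≠ 0 ∧ ∀ (Y : Variety) (h : Y.sch ⟶ U.sch), IsWeakModel h →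
      ∀ E, formOrd h ω' E = formOrd (h ≫ ι) ω E := by
  let θ := functionFieldEquiv ι hι
  have hd := (dim_eq_of_isOpenImmersion ι hι).symm
  obtain ⟨T, hinj, hT, hTD⟩ := exists_formMap_injective θ hd
  have hω' : T ω ≠ 0 := (map_ne_zero_iff T hinj).2 hω
  refine ⟨T ω, hω', fun Y h hh E => ?_⟩
  have hι' := isWeakModel_of_isOpenImmersion ι hX hι
  have hS (a : X.K) : a ∈ regularAt (h ≫ ι) E.1 ↔ θ a ∈ regularAt h E.1 := by
    rw [regularAt_eq (hh.dom.comp hι'.dom), regularAt_eq hh.dom, Subring.mem_comap, Subring.mem_comap,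
      pullHom_comp hh.dom hι'.dom]
    rfl
  -- If the form has no generator over `X` it has none over `U` either, so the two default values
  -- agree and existence of a generator need not be proved.
  by_cases hex : ∃ φ, IsFormGen ω (regularAt (h ≫ ι) E.1) φ
  · obtain ⟨φ, hφ⟩ := hex
    have hφ' := (isFormGen_map_iff θ hd hinj hT hTD hS).2 hφ
    rw [hφ.formOrd_eq (hh.comp hι') hω, hφ'.formOrd_eq hh hω', pullFun_eq hh.dom,
      pullFun_eq (hh.comp hι').dom, pullHom_comp hh.dom hι'.dom]
    rfl
  · have hex' : ¬ ∃ φ, IsFormGen (T ω) (regularAt h E.1) φ := by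
      rintro ⟨φ, hφ⟩
      refine hex ⟨θ.symm φ, (isFormGen_map_iff θ hd hinj hT hTD hS).1 ?_⟩
      rwa [θ.apply_symm_apply]
    rw [formOrd_eq hh.dom, formOrd_eq (hh.comp hι').dom, formGen, formGen, dif_neg hex, dif_neg hex',
      pullFun_eq hh.dom, pullFun_eq (hh.comp hι').dom, map_one, map_one]

end Dimension

end

/-! ### Restriction of morphisms over an open subset of the target -/

section

/-- A nonempty open subvariety. -/
def Variety.restrict (X : Variety) (V : X.sch.Opens) (hV : (V : Set X.sch).Nonempty) : Variety :=
  have : Nonempty V := hV.to_subtype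
  { sch := V.toScheme
    str := V.ι ≫ X.str
    isIntegral := inferInstance
    isSeparated := inferInstance
    locallyOfFiniteType := inferInstance
    quasiCompact := inferInstance }

/-- The inclusion of an open subvariety. -/
def Variety.incl (X : Variety) (V : X.sch.Opens) (hV : (V : Set X.sch).Nonempty) :
    (X.restrict V hV).sch ⟶ X.sch := V.ι

instance (X : Variety) (V : X.sch.Opens) (hV : (V : Set X.sch).Nonempty) :
    IsOpenImmersion (X.incl V hV) := inferInstanceAs (IsOpenImmersion V.ι)

theorem isOverC_incl (X : Variety) (V : X.sch.Opens) (hV : (V : Set X.sch).Nonempty) :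
    IsOverC (X.incl V hV) := rfl

/-- Restriction of a morphism over an open subset of the target. -/
def restrictHom {Y X : Variety} (g : Y.sch ⟶ X.sch) (V : X.sch.Opens)
    (hV : (V : Set X.sch).Nonempty) (hV' : ((g ⁻¹ᵁ V : Y.sch.Opens) : Set Y.sch).Nonempty) :
    (Y.restrict (g ⁻¹ᵁ V) hV').sch ⟶ (X.restrict V hV).sch := g ∣_ V

theorem bijective_morphismRestrict_app {Y X : Scheme.{0}} (g : Y ⟶ X) (V : X.Opens)
    (hg : ∀ U : X.Opens, Function.Bijective (g.app U).hom) (U : V.toScheme.Opens) :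
    Function.Bijective ((g ∣_ V).app U).hom := by
  have h₁ : IsIso (g.app (V.ι ''ᵁ U)) := (ConcreteCategory.isIso_iff_bijective _).mpr (hg _)
  have h₂ : IsIso ((g ∣_ V).app U) := by
    have h₃ := morphismRestrict_app g V U
    exact h₃ ▸ IsIso.comp_isIso' h₁ (inferInstanceAs (IsIso (Y.presheaf.map (eqToHom _).op)))
  exact (ConcreteCategory.isIso_iff_bijective _).mp h₂

section

variable {Y X : Variety} {g : Y.sch ⟶ X.sch} {V : X.sch.Opens} (hV : (V : Set X.sch).Nonempty)
  (hV' : ((g ⁻¹ᵁ V : Y.sch.Opens) : Set Y.sch).Nonempty)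

theorem restrictHom_incl :
    restrictHom g V hV hV' ≫ X.incl V hV = Y.incl (g ⁻¹ᵁ V) hV' ≫ g := morphismRestrict_ι g V

theorem IsOverC.restrictHom (hg : IsOverC g) : IsOverC (restrictHom g V hV hV') := by
  have h := restrictHom_incl hV hV'
  refine (Category.assoc _ _ _).symm.trans ((congrArg (· ≫ X.str) h).trans ?_)
  refine (Category.assoc _ _ _).trans ?_
  rw [show g ≫ X.str = Y.str from hg]
  rfl

theorem IsBirational.restrictHom (hg : IsBirational g) : IsBirational (restrictHom g V hV hV') := by
  obtain ⟨V₀, ⟨x, hx⟩, hiso⟩ := hg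
  have hη : genericPoint X.sch ∈ V ⊓ V₀ :=
    ⟨(genericPoint_specializes hV.choose).mem_open V.isOpen hV.choose_spec,
      (genericPoint_specializes x).mem_open V₀.isOpen hx⟩
  refine ⟨V.ι ⁻¹ᵁ V₀, ⟨⟨genericPoint X.sch, hη.1⟩, hη.2⟩, ?_⟩
  have h1 : MorphismProperty.isomorphisms Scheme (g ∣_ V₀ ∣_ (V₀.ι ⁻¹ᵁ V)) :=
    inferInstanceAs (IsIso (g ∣_ V₀ ∣_ (V₀.ι ⁻¹ᵁ V)))
  have h2 := ((MorphismProperty.isomorphisms Scheme).arrow_mk_iso_iff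
    (morphismRestrictRestrict g V₀ (V₀.ι ⁻¹ᵁ V))).1 h1
  have h3 : V₀.ι ''ᵁ (V₀.ι ⁻¹ᵁ V) = V.ι ''ᵁ (V.ι ⁻¹ᵁ V₀) := by
    rw [Scheme.Hom.image_preimage_eq_opensRange_inf, Scheme.Hom.image_preimage_eq_opensRange_inf,
      Scheme.Opens.opensRange_ι, Scheme.Opens.opensRange_ι, inf_comm]
  rw [h3] at h2
  exact ((MorphismProperty.isomorphisms Scheme).arrow_mk_iso_iff
    (morphismRestrictRestrict g V (V.ι ⁻¹ᵁ V₀))).2 h2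

theorem IsModel.restrictHom (hg : IsModel g) : IsModel (restrictHom g V hV hV') where
  normal := isNormal_of_isOpenImmersion (Y.incl _ hV') hg.normal
  isOverC := hg.isOverC.restrictHom hV hV'
  proper := by
    have := hg.proper
    exact inferInstanceAs (IsProper (g ∣_ V))
  birational := hg.birational.restrictHom hV hV'

/-- The embedding over `V` is the base change of the given closed immersion along the open immersion
of `ℙⁿ_V` into `ℙⁿ_X`. -/
theorem IsProjective.restrictHom (hg : IsProjective g) :
    IsProjective (restrictHom g V hV hV') := by
  obtain ⟨n, i, hi, hig⟩ := hg
  let P := projectiveSpaceInt n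
  let j : pullback (terminal.from P) (terminal.from V.toScheme) ⟶
      pullback (terminal.from P) (terminal.from X.sch) :=
    pullback.lift (pullback.fst _ _) (pullback.snd _ _ ≫ V.ι) (terminal.hom_ext _ _)
  have hj : IsPullback j (pullback.snd _ _) (pullback.snd _ _) V.ι := by
    refine IsPullback.of_right (t := IsPullback.of_hasPullback (terminal.from P) (terminal.from X.sch))
      (p := pullback.lift_snd _ _ _) ?_
    have h1 : j ≫ pullback.fst _ _ = pullback.fst _ _ := pullback.lift_fst _ _ _
    have h2 : V.ι ≫ terminal.from X.sch = terminal.from V.toScheme := terminal.hom_ext _ _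
    rw [h1, h2]
    exact IsPullback.of_hasPullback _ _
  let i' : (g ⁻¹ᵁ V).toScheme ⟶ pullback (terminal.from P) (terminal.from V.toScheme) :=
    pullback.lift ((g ⁻¹ᵁ V).ι ≫ i ≫ pullback.fst _ _) (g ∣_ V) (terminal.hom_ext _ _)
  have hi' : i' ≫ j = (g ⁻¹ᵁ V).ι ≫ i := by
    apply pullback.hom_ext
    · rw [Category.assoc, Category.assoc, pullback.lift_fst, pullback.lift_fst]
    · rw [Category.assoc, Category.assoc, pullback.lift_snd, pullback.lift_snd_assoc, hig,
        morphismRestrict_ι]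
  have hsq : IsPullback (g ⁻¹ᵁ V).ι i' i j := by
    refine IsPullback.of_bot ?_ hi'.symm hj
    rw [pullback.lift_snd, hig]
    exact (isPullback_morphismRestrict g V).flip
  refine ⟨n, i', MorphismProperty.of_isPullback hsq hi, pullback.lift_snd _ _ _⟩

/-- Over an empty preimage the functions form the zero ring, into which the nonzero ring of
functions on `V` cannot inject. -/
theorem IsContraction.nonempty_preimage (hV : (V : Set X.sch).Nonempty) (hg : IsContraction g) :
    ((g ⁻¹ᵁ V : Y.sch.Opens) : Set Y.sch).Nonempty := by
  by_contra h
  have h0 : g ⁻¹ᵁ V = ⊥ := by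
    ext x
    exact ⟨fun hx => (h ⟨x, hx⟩).elim, fun hx => hx.elim⟩
  have h1 : Subsingleton Γ(Y.sch, g ⁻¹ᵁ V) := by
    rw [h0]; infer_instance
  have : Nonempty V := hV.to_subtype
  have h2 : Nontrivial Γ(X.sch, V) := inferInstance
  exact not_subsingleton Γ(X.sch, V) (hg.2.2 V).1.subsingleton

theorem IsContraction.isDom (hg : IsContraction g) : IsDom g := by
  refine specializes_iff_forall_open.2 fun U hU hx => ?_
  obtain ⟨y, hy⟩ := hg.nonempty_preimage (V := ⟨U, hU⟩) ⟨_, hx⟩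
  exact (genericPoint_specializes y).mem_open (g ⁻¹ᵁ ⟨U, hU⟩).isOpen hy

theorem IsContraction.restrictHom (hg : IsContraction g) :
    IsContraction (restrictHom g V hV hV') := by
  refine ⟨hg.1.restrictHom hV hV', hg.2.1.restrictHom hV hV', fun U => ?_⟩
  exact bijective_morphismRestrict_app g V hg.2.2 U

end

theorem pushCoeff_comp_map {Y X Y' X' : Variety} {f : Y.sch ⟶ X.sch} {f' : Y'.sch ⟶ X'.sch}
    (ιY : Y'.sch ⟶ Y.sch) (ιX : X'.sch ⟶ X.sch) [IsOpenImmersion ιY] [IsOpenImmersion ιX]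
    (h : f' ≫ ιX = ιY ≫ f) (hr : ∀ y, f y ∈ ιX.opensRange → y ∈ ιY.opensRange)
    {D : RDivisor Y} {D' : RDivisor Y'} (hD : ∀ Q, D' Q = D (Q.map ιY)) (P : PrimeDivisor X') :
    pushCoeff f' D' P = pushCoeff f D (P.map ιX) := by
  have hmap (y) : f (ιY y) = ιX (f' y) := by
    rw [← Scheme.Hom.comp_apply, ← h, Scheme.Hom.comp_apply]
  refine finsum_mem_eq_of_bijOn (s := {Q : PrimeDivisor Y' | f' Q.1 = P.1})
    (t := {Q : PrimeDivisor Y | f Q.1 = (P.map ιX).1}) (PrimeDivisor.map ιY)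
    ⟨fun Q hQ => ?_, (PrimeDivisor.map_injective ιY).injOn, fun Q hQ => ?_⟩ fun Q _ => hD Q
  · exact (hmap Q.1).trans (congrArg ιX hQ)
  · obtain ⟨E, rfl⟩ := PrimeDivisor.exists_map_eq ιY (P := Q) (hr _ ⟨P.1, hQ.symm⟩)
    refine ⟨E, ιX.isOpenEmbedding.injective ?_, rfl⟩
    exact (hmap E.1).symm.trans hQ

end

/-! ### Curves, nefness and bigness on open subvarieties -/

section

section

variable {U X : Variety} (ι : U.sch ⟶ X.sch) [IsOpenImmersion ι]

/-- A curve in an open subvariety is a curve in the whole. -/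
def CurveTo.map (hι : IsOverC ι) (c : CurveTo U) : CurveTo X where
  C := c.C
  normal := c.normal
  dim_eq := c.dim_eq
  proper := c.proper
  ν := c.ν ≫ ι
  isOverC := by
    rw [IsOverC, Category.assoc, show ι ≫ X.str = U.str from hι]
    exact c.isOverC

theorem CurveTo.HasDegree.map (hX : X.IsNormal) (hι : IsOverC ι) {c : CurveTo U}
    {A : PrimeDivisor X → ℤ} {n : ℤ} (h : c.HasDegree (A ∘ PrimeDivisor.map ι) n) :
    (c.map ι hι).HasDegree A n := by
  obtain ⟨ψ, s, hψ, hs, hn⟩ := h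
  obtain ⟨ψ, rfl⟩ := exists_pullFun_eq ι ψ
  have hd := isDom_of_isOpenImmersion ι
  let x := c.ν (genericPoint c.C.sch)
  choose s' hs' using fun Q => (ConcreteCategory.bijective_of_isIso (ι.stalkMap x)).2 (s Q)
  have hu (Q) : IsUnit (s' Q) :=
    (isUnit_map_iff (ι.stalkMap x).hom _).1 ((congrArg IsUnit (hs' Q)).mpr (hs Q).1)
  refine ⟨ψ, s', (isLocalEq_comp_map_iff ι hX hι).1 hψ, fun Q => ⟨hu Q, ?_⟩, ?_⟩
  · refine (isLocalEq_comp_map_iff ι hX hι (y := c.ν Q.1)).1 ?_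
    have h1 := pullHom_algebraMap hd x (s' Q)
    have h2 : pullFun ι (algebraMap _ X.K (s' Q) * ψ) = algebraMap _ U.K (s Q) * pullFun ι ψ := by
      rw [pullFun_eq hd, map_mul, h1, ← pullFun_eq hd]
      exact congrArg (fun t => algebraMap (U.sch.presheaf.stalk x) U.K t * _) (hs' Q)
    exact (congrArg (IsLocalEq _ _) h2).mpr (hs Q).2
  · rw [hn]
    refine finsum_congr fun Q => ?_
    have h3 : ((c.ν ≫ ι).stalkMap (genericPoint c.C.sch)).hom (s' Q) =
        (c.ν.stalkMap (genericPoint c.C.sch)).hom (s Q) := by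
      have h4 := Scheme.Hom.stalkMap_comp c.ν ι (genericPoint c.C.sch)
      refine (congrArg (fun f => f.hom (s' Q)) h4).trans ?_
      exact congrArg (c.ν.stalkMap (genericPoint c.C.sch)).hom (hs' Q)
    exact (congrArg (ordAt Q) h3).symm

theorem CurveTo.HasIntersection.map (hX : X.IsNormal) (hι : IsOverC ι) {c : CurveTo U}
    {D : PrimeDivisor X → ℝ} {t : ℝ} (h : c.HasIntersection (D ∘ PrimeDivisor.map ι) t) :
    (c.map ι hι).HasIntersection D t := by
  obtain ⟨V, m, r, A, n, hV, hA, hn, ht⟩ := h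
  choose A' hA' using fun i => exists_comp_map_eq ι (A i)
  refine ⟨ι ''ᵁ V, m, r, A', n, fun y => ⟨_, hV y, rfl⟩, (isCartierDecomp_comp_map_iff ι hX hι).1 ?_,
    fun i => HasDegree.map ι hX hι ?_, ht⟩
  · simpa only [hA'] using hA
  · rw [hA']; exact hn i

variable {Z' Z : Variety} {q : X.sch ⟶ Z.sch} {q' : U.sch ⟶ Z'.sch} {j : Z'.sch ⟶ Z.sch}
  [IsOpenImmersion j]

omit [IsOpenImmersion ι] in
theorem CurveTo.IsContractedIn.map (hι : IsOverC ι) (h : q' ≫ j = ι ≫ q) {c : CurveTo U}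
    {W' : Z'.sch.Opens} (hc : c.IsContractedIn q' W') :
    (c.map ι hι).IsContractedIn q (j ''ᵁ W') := by
  obtain ⟨z, hz, hc⟩ := hc
  refine ⟨j z, ⟨z, hz, rfl⟩, fun y => ?_⟩
  have h1 : q (ι (c.ν y)) = j (q' (c.ν y)) := by
    rw [← Scheme.Hom.comp_apply, ← h, Scheme.Hom.comp_apply]
  exact h1.trans (congrArg j (hc y))

theorem image_preimage_le (h : q' ≫ j = ι ≫ q) (W' : Z'.sch.Opens) :
    ι ''ᵁ (q' ⁻¹ᵁ W') ≤ q ⁻¹ᵁ (j ''ᵁ W') := by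
  rintro _ ⟨y, hy, rfl⟩
  refine ⟨q' y, hy, ?_⟩
  change (q' ≫ j) y = (ι ≫ q) y
  rw [h]

/-- A contracted curve of `U` is, by composition, a contracted curve of `X` with the same admissible
intersection numbers. Proper curves need no compactification here. -/
theorem IsNefOver.comp_map (hX : X.IsNormal) (hι : IsOverC ι) (h : q' ≫ j = ι ≫ q)
    {W' : Z'.sch.Opens} {D : PrimeDivisor X → ℝ} (hD : IsNefOver q (j ''ᵁ W') D) :
    IsNefOver q' W' (D ∘ PrimeDivisor.map ι) :=
  ⟨(isRCartierOn_comp_map_iff ι hX hι).2 (hD.1.mono (image_preimage_le ι h W')), fun _ hc _ ht =>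
    hD.2 _ (hc.map ι hι h) _ (ht.map ι hX hι)⟩

theorem IsNumTrivialOver.comp_map (hX : X.IsNormal) (hι : IsOverC ι) (h : q' ≫ j = ι ≫ q)
    {W' : Z'.sch.Opens} {D : PrimeDivisor X → ℝ} (hD : IsNumTrivialOver q (j ''ᵁ W') D) :
    IsNumTrivialOver q' W' (D ∘ PrimeDivisor.map ι) :=
  ⟨(isRCartierOn_comp_map_iff ι hX hι).2 (hD.1.mono (image_preimage_le ι h W')), fun _ hc _ ht =>
    hD.2 _ (hc.map ι hι h) _ (ht.map ι hX hι)⟩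

theorem IsBigOver.comp_map (hX : X.IsNormal) (hι : IsOverC ι) (hj : IsOverC j) (h : q' ≫ j = ι ≫ q)
    (hq : IsDom q) (hq' : IsDom q') {D : PrimeDivisor X → ℝ} (hD : IsBigOver q D) :
    IsBigOver q' (D ∘ PrimeDivisor.map ι) := by
  have hdι := isDom_of_isOpenImmersion ι
  have hdj := isDom_of_isOpenImmersion j
  obtain ⟨c, hc, hfr⟩ := hD
  refine ⟨c, hc, hfr.mono ?_⟩
  rintro m ⟨k, s, hk, hs, hb⟩
  refine ⟨k, fun i => pullFun ι (s i), ?_, fun i => ⟨pullFun_ne_zero hdι (hs i).1, fun P hP => ?_⟩,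
    fun b hsum => ?_⟩
  · rwa [dim_eq_of_isOpenImmersion ι hι, dim_eq_of_isOpenImmersion j hj]
  · rw [ordAt_pullFun_openImmersion ι hX hι]
    refine (hs i).2 (P.map ι) ?_
    have h1 : q (ι P.1) = j (q' P.1) := by
      rw [← Scheme.Hom.comp_apply, ← h, Scheme.Hom.comp_apply]
    refine h1.trans ?_
    rw [hP]
    exact hdj.eq
  · choose b' hb' using fun i => exists_pullFun_eq j (b i)
    have h2 (φ : Z.K) : pullFun q' (pullFun j φ) = pullFun ι (pullFun q φ) := by
      rw [pullFun_eq hdj, pullFun_eq hq', pullFun_eq hq, pullFun_eq hdι, ← pullHom_comp hq' hdj,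
        ← pullHom_comp hdι hq]
      exact pullHom_congr h _ _ φ
    have h3 : pullFun ι (∑ i, pullFun q (b' i) * s i) = 0 := by
      rw [← hsum, pullFun_eq hdι, map_sum]
      refine Finset.sum_congr rfl fun i _ => ?_
      rw [map_mul, ← pullFun_eq hdι, ← pullFun_eq hdι, ← hb', h2]
    have h4 := hb b' (by
      by_contra hne
      exact pullFun_ne_zero hdι hne h3)
    intro i
    rw [← hb', h4 i, pullFun_eq hdj, map_zero]

end

end

/-! ### Restriction of the data of a generalized pair over an open subset of the base -/

section

/-- Restriction of a divisor to an open subvariety. -/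
def RDivisor.comap {U X : Variety} (ι : U.sch ⟶ X.sch) [IsOpenImmersion ι] (D : RDivisor X) :
    RDivisor U :=
  Finsupp.comapDomain (PrimeDivisor.map ι) D (PrimeDivisor.map_injective ι).injOn

theorem RDivisor.comap_apply {U X : Variety} (ι : U.sch ⟶ X.sch) [IsOpenImmersion ι]
    (D : RDivisor X) (P : PrimeDivisor U) : D.comap ι P = D (P.map ι) := rfl

/-- Extension of a divisor by zero. -/
def RDivisor.extend {U X : Variety} (ι : U.sch ⟶ X.sch) [IsOpenImmersion ι] (D : RDivisor U) :
    RDivisor X :=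
  D.mapDomain (PrimeDivisor.map ι)

theorem RDivisor.extend_map {U X : Variety} (ι : U.sch ⟶ X.sch) [IsOpenImmersion ι]
    (D : RDivisor U) (P : PrimeDivisor U) : D.extend ι (P.map ι) = D P :=
  Finsupp.mapDomain_apply (PrimeDivisor.map_injective ι) _ _

theorem regularAt_comp_eq {Y Y' X W : Variety} {h : Y.sch ⟶ X.sch} {h' : Y'.sch ⟶ X.sch}
    {f : X.sch ⟶ W.sch} (hh : IsDom h) (hh' : IsDom h') (hf : IsDom f) {y : Y.sch} {y' : Y'.sch}
    (e : regularAt h y = regularAt h' y') : regularAt (h ≫ f) y = regularAt (h' ≫ f) y' := by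
  ext φ
  have h1 := SetLike.ext_iff.1 e (pullHom f hf φ)
  rw [regularAt_eq hh, regularAt_eq hh', Subring.mem_comap, Subring.mem_comap] at h1
  rw [regularAt_eq (hh.comp hf), regularAt_eq (hh'.comp hf), Subring.mem_comap, Subring.mem_comap,
    pullHom_comp hh hf, pullHom_comp hh' hf]
  exact h1

theorem canonicalCoeff_eq_map {U X : Variety} (ι : U.sch ⟶ X.sch) [IsOpenImmersion ι]
    (hX : X.IsNormal) (hι : IsOverC ι) {ω : TopForm X} {ω' : TopForm U}
    (h : ∀ E, formOrd (𝟙 U.sch) ω' E = formOrd (𝟙 U.sch ≫ ι) ω E) (P : PrimeDivisor U) :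
    canonicalCoeff ω' P = canonicalCoeff ω (P.map ι) := by
  have h1 := h P
  rw [Category.id_comp] at h1
  refine h1.trans (formOrd_eq_of_regularAt_eq (isWeakModel_of_isOpenImmersion ι hX hι)
    (IsWeakModel.id hX) ?_ _)
  have h2 := regularAt_openImmersion_comp ι (IsDom.id X) P.1
  rwa [Category.comp_id] at h2

namespace Data

theorem nefPart_apply (𝒟 : Data) (μ : Fin 𝒟.J → ℝ) (Q : PrimeDivisor 𝒟.X') :
    𝒟.nefPart μ Q = ∑ j, μ j * 𝒟.M' j Q := by
  simp [nefPart, Finsupp.finsetSum_apply]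

/-- Only the valuation ring and the center of `E` matter, so a log discrepancy may be computed on
any model where the valuation appears. The `ℝ`-Cartier hypotheses make the pull backs independent of
choices. -/
theorem logDiscrepancy_eq_of_regularAt_eq (𝒟 : Data) {B : RDivisor 𝒟.X} {μ : Fin 𝒟.J → ℝ}
    {Y Y' : Variety} {h : Y.sch ⟶ 𝒟.X'.sch} {h' : Y'.sch ⟶ 𝒟.X'.sch} (hh : IsWeakModel h)
    (hh' : IsWeakModel h') {E : PrimeDivisor Y} {E' : PrimeDivisor Y'}
    (e : regularAt h E.1 = regularAt h' E'.1) (hc : h E.1 = h' E'.1)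
    {V : 𝒟.X.sch.Opens} {V' : 𝒟.X'.sch.Opens} (hE : 𝒟.f (h E.1) ∈ V) (hE' : h E.1 ∈ V')
    (hN : IsRCartierOn V' (𝒟.nefPart μ)) (hA : IsRCartierOn V (𝒟.adjoint B μ)) :
    𝒟.logDiscrepancy B μ h E = 𝒟.logDiscrepancy B μ h' E' := by
  have hf := 𝒟.f_model.isWeakModel
  have e' := regularAt_comp_eq hh.dom hh'.dom hf.dom e
  obtain ⟨α, hα⟩ := hN.exists_isDivNear hE'
  obtain ⟨β, hβ⟩ := hA.exists_isDivNear hE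
  have hc' : (h ≫ 𝒟.f) E.1 = (h' ≫ 𝒟.f) E'.1 := by
    rw [Scheme.Hom.comp_apply, Scheme.Hom.comp_apply, hc]
  rw [logDiscrepancy, logDiscrepancy, formOrd_eq_of_regularAt_eq (hh.comp hf) (hh'.comp hf) e',
    pullCoeff_eq_of_regularAt_eq 𝒟.f_model.normal hh hh' e hc hα,
    pullCoeff_eq_of_regularAt_eq 𝒟.X_normal (hh.comp hf) (hh'.comp hf) e' hc' hβ]

section

variable (𝒟 : Data) {W : 𝒟.Z.sch.Opens} (hW : ((𝒟.πf ⁻¹ᵁ W : 𝒟.X'.sch.Opens) : Set 𝒟.X'.sch).Nonempty)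

include hW in
theorem nonempty_preimage : ((𝒟.π ⁻¹ᵁ W : 𝒟.X.sch.Opens) : Set 𝒟.X.sch).Nonempty :=
  ⟨𝒟.f hW.choose, hW.choose_spec⟩

include hW in
theorem nonempty_base : (W : Set 𝒟.Z.sch).Nonempty :=
  ⟨𝒟.πf hW.choose, hW.choose_spec⟩

/-- Restriction of the data over an open subset of `Z`. -/
def restrict : Data where
  Z := 𝒟.Z.restrict W (𝒟.nonempty_base hW)
  X := 𝒟.X.restrict (𝒟.π ⁻¹ᵁ W) (𝒟.nonempty_preimage hW)
  X' := 𝒟.X'.restrict (𝒟.πf ⁻¹ᵁ W) hW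
  π := restrictHom 𝒟.π W (𝒟.nonempty_base hW) (𝒟.nonempty_preimage hW)
  f := restrictHom 𝒟.f (𝒟.π ⁻¹ᵁ W) (𝒟.nonempty_preimage hW) hW
  X_normal := isNormal_of_isOpenImmersion (𝒟.X.incl _ _) 𝒟.X_normal
  π_over := 𝒟.π_over.restrictHom _ _
  π_projective := 𝒟.π_projective.restrictHom _ _
  f_model := 𝒟.f_model.restrictHom _ _
  f_projective := 𝒟.f_projective.restrictHom _ _
  J := 𝒟.J
  M' := fun j => (𝒟.M' j).comap (𝒟.X'.incl _ hW)
  ω := (exists_topForm_restrict (𝒟.X.incl _ (𝒟.nonempty_preimage hW)) 𝒟.X_normal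
    (isOverC_incl _ _ _) 𝒟.ω_ne_zero).choose
  ω_ne_zero := (exists_topForm_restrict (𝒟.X.incl _ (𝒟.nonempty_preimage hW)) 𝒟.X_normal
    (isOverC_incl _ _ _) 𝒟.ω_ne_zero).choose_spec.1

/-- The inclusion of the restricted base. -/
def inclZ : (𝒟.restrict hW).Z.sch ⟶ 𝒟.Z.sch := 𝒟.Z.incl W (𝒟.nonempty_base hW)

/-- The inclusion of the restricted variety. -/
def inclX : (𝒟.restrict hW).X.sch ⟶ 𝒟.X.sch := 𝒟.X.incl _ (𝒟.nonempty_preimage hW)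

/-- The inclusion of the restricted model. -/
def inclX' : (𝒟.restrict hW).X'.sch ⟶ 𝒟.X'.sch := 𝒟.X'.incl _ hW

instance : IsOpenImmersion (𝒟.inclZ hW) := inferInstanceAs (IsOpenImmersion (𝒟.Z.incl _ _))

instance : IsOpenImmersion (𝒟.inclX hW) := inferInstanceAs (IsOpenImmersion (𝒟.X.incl _ _))

instance : IsOpenImmersion (𝒟.inclX' hW) := inferInstanceAs (IsOpenImmersion (𝒟.X'.incl _ _))

theorem isOverC_inclX : IsOverC (𝒟.inclX hW) := isOverC_incl _ _ _

theorem isOverC_inclX' : IsOverC (𝒟.inclX' hW) := isOverC_incl _ _ _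

theorem mem_range_inclZ {z : 𝒟.Z.sch} (hz : z ∈ W) : ∃ z', 𝒟.inclZ hW z' = z := ⟨⟨z, hz⟩, rfl⟩

theorem restrict_π_comp : (𝒟.restrict hW).π ≫ 𝒟.inclZ hW = 𝒟.inclX hW ≫ 𝒟.π :=
  restrictHom_incl _ _

theorem restrict_f_comp : (𝒟.restrict hW).f ≫ 𝒟.inclX hW = 𝒟.inclX' hW ≫ 𝒟.f :=
  restrictHom_incl _ _

theorem restrict_πf_comp : (𝒟.restrict hW).πf ≫ 𝒟.inclZ hW = 𝒟.inclX' hW ≫ 𝒟.πf := by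
  rw [πf, Category.assoc, restrict_π_comp, ← Category.assoc, restrict_f_comp, Category.assoc, πf]

theorem mem_opensRange_inclX {x : 𝒟.X.sch} (h : 𝒟.π x ∈ W) : x ∈ (𝒟.inclX hW).opensRange :=
  ⟨⟨x, h⟩, rfl⟩

theorem mem_opensRange_inclX' {x : 𝒟.X'.sch} (h : 𝒟.πf x ∈ W) : x ∈ (𝒟.inclX' hW).opensRange :=
  ⟨⟨x, h⟩, rfl⟩

theorem inclZ_mem (z : (𝒟.restrict hW).Z.sch) : 𝒟.inclZ hW z ∈ W := z.2

theorem inclZ_π (x : (𝒟.restrict hW).X.sch) :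
    𝒟.inclZ hW ((𝒟.restrict hW).π x) = 𝒟.π (𝒟.inclX hW x) := by
  rw [← Scheme.Hom.comp_apply, restrict_π_comp, Scheme.Hom.comp_apply]

theorem inclZ_πf (x : (𝒟.restrict hW).X'.sch) :
    𝒟.inclZ hW ((𝒟.restrict hW).πf x) = 𝒟.πf (𝒟.inclX' hW x) := by
  rw [← Scheme.Hom.comp_apply, restrict_πf_comp, Scheme.Hom.comp_apply]

theorem formOrd_restrict {Y : Variety} {h : Y.sch ⟶ (𝒟.restrict hW).X.sch} (hh : IsWeakModel h)
    (E : PrimeDivisor Y) :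
    formOrd h (𝒟.restrict hW).ω E = formOrd (h ≫ 𝒟.inclX hW) 𝒟.ω E :=
  (exists_topForm_restrict (𝒟.X.incl _ (𝒟.nonempty_preimage hW)) 𝒟.X_normal
    (isOverC_incl _ _ _) 𝒟.ω_ne_zero).choose_spec.2 Y h hh E

theorem canonicalCoeff_restrict (P : PrimeDivisor (𝒟.restrict hW).X) :
    canonicalCoeff (𝒟.restrict hW).ω P = canonicalCoeff 𝒟.ω (P.map (𝒟.inclX hW)) :=
  canonicalCoeff_eq_map (𝒟.inclX hW) 𝒟.X_normal (𝒟.isOverC_inclX hW)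
    (𝒟.formOrd_restrict hW (IsWeakModel.id (𝒟.restrict hW).X_normal)) P

theorem nefPart_restrict (μ : Fin 𝒟.J → ℝ) :
    ((𝒟.restrict hW).nefPart μ : PrimeDivisor _ → ℝ) =
      𝒟.nefPart μ ∘ PrimeDivisor.map (𝒟.inclX' hW) := by
  funext Q
  exact ((𝒟.restrict hW).nefPart_apply μ Q).trans (𝒟.nefPart_apply μ (Q.map (𝒟.inclX' hW))).symm

variable {hW} {B : RDivisor 𝒟.X} {B' : RDivisor (𝒟.restrict hW).X}
  (hB : ∀ P, B' P = B (P.map (𝒟.inclX hW))) {μ : Fin 𝒟.J → ℝ}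

include hB

theorem adjoint_restrict : (𝒟.restrict hW).adjoint B' μ =
    𝒟.adjoint B μ ∘ PrimeDivisor.map (𝒟.inclX hW) := by
  funext P
  have h1 := pushCoeff_comp_map (𝒟.inclX' hW) (𝒟.inclX hW) (𝒟.restrict_f_comp hW)
    (fun y ⟨x, hx⟩ => 𝒟.mem_opensRange_inclX' hW (by
      change 𝒟.π (𝒟.f y) ∈ W
      rw [← hx]; exact x.2)) (congrFun (𝒟.nefPart_restrict hW μ)) P
  exact congrArg₂ (· + ·) (congrArg₂ (· + ·)
    (congrArg (fun m : ℤ => (m : ℝ)) (𝒟.canonicalCoeff_restrict hW P)) (hB P)) h1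

theorem logDiscrepancy_restrict {Y : Variety} {h : Y.sch ⟶ (𝒟.restrict hW).X'.sch}
    (hh : IsWeakModel h) {E : PrimeDivisor Y} {V : 𝒟.X.sch.Opens} {V' : 𝒟.X'.sch.Opens}
    (hE : 𝒟.f (𝒟.inclX' hW (h E.1)) ∈ V) (hE' : 𝒟.inclX' hW (h E.1) ∈ V')
    (hN : IsRCartierOn V' (𝒟.nefPart μ)) (hA : IsRCartierOn V (𝒟.adjoint B μ)) :
    (𝒟.restrict hW).logDiscrepancy B' μ h E = 𝒟.logDiscrepancy B μ (h ≫ 𝒟.inclX' hW) E := by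
  have hf := (𝒟.restrict hW).f_model.isWeakModel
  have e : (h ≫ (𝒟.restrict hW).f) ≫ 𝒟.inclX hW = (h ≫ 𝒟.inclX' hW) ≫ 𝒟.f := by
    rw [Category.assoc, restrict_f_comp, Category.assoc]
  obtain ⟨α, hα⟩ := hN.exists_isDivNear hE'
  obtain ⟨β, hβ⟩ := hA.exists_isDivNear hE
  have h1 := 𝒟.formOrd_restrict hW (hh.comp hf) E
  have h2 := pullCoeff_comp_openImmersion (𝒟.inclX' hW) 𝒟.f_model.normal (𝒟.isOverC_inclX' hW)
    hh.normal hh.dom hα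
  have h3 := pullCoeff_comp_openImmersion (𝒟.inclX hW) 𝒟.X_normal (𝒟.isOverC_inclX hW)
    hh.normal (hh.comp hf).dom (E := E) (D := 𝒟.adjoint B μ) (α := β) (by rw [e]; exact hβ)
  rw [e] at h1 h3
  refine congrArg₂ (· - ·) (congrArg₂ (· + ·) (congrArg (fun m : ℤ => 1 + (m : ℝ)) h1) ?_) ?_
  · exact (congrArg (pullCoeff h · E) (𝒟.nefPart_restrict hW μ)).trans h2.symm
  · exact (congrArg (pullCoeff _ · E) (𝒟.adjoint_restrict hB)).trans h3.symm

end

end Data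

end

/-! ### Restriction of Fano type pairs and of real complements -/

section

theorem IsDom.nonempty_preimage {Y X : Variety} {g : Y.sch ⟶ X.sch} (hg : IsDom g)
    {V : X.sch.Opens} (hV : (V : Set X.sch).Nonempty) :
    ((g ⁻¹ᵁ V : Y.sch.Opens) : Set Y.sch).Nonempty := by
  refine ⟨genericPoint Y.sch, ?_⟩
  change g (genericPoint Y.sch) ∈ V
  rw [hg.eq]
  exact (genericPoint_specializes hV.choose).mem_open V.isOpen hV.choose_spec

theorem pullCoeff_comp_map {Y X Y' X' : Variety} {g : Y.sch ⟶ X.sch} {g' : Y'.sch ⟶ X'.sch}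
    {ιY : Y'.sch ⟶ Y.sch} {ιX : X'.sch ⟶ X.sch} [IsOpenImmersion ιY] [IsOpenImmersion ιX]
    (hX : X.IsNormal) (hιX : IsOverC ιX) (hg : IsWeakModel g)
    (hg' : IsWeakModel g') (e : g' ≫ ιX = ιY ≫ g) {D : PrimeDivisor X → ℝ} {E : PrimeDivisor Y'}
    {α : X.Kˣ →₀ ℝ} (hα : IsDivNear D (g (ιY E.1)) α) :
    pullCoeff g' (D ∘ PrimeDivisor.map ιX) E = pullCoeff g D (E.map ιY) := by
  have h1 : g (ιY E.1) = (g' ≫ ιX) E.1 := by rw [e, Scheme.Hom.comp_apply]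
  rw [h1] at hα
  rw [← pullCoeff_comp_openImmersion ιX hX hιX hg'.normal hg'.dom hα]
  refine pullCoeff_eq_of_regularAt_eq hX
    (hg'.comp (isWeakModel_of_isOpenImmersion ιX hX hιX)) hg ?_ h1.symm hα
  rw [e]
  exact regularAt_openImmersion_comp ιY hg.dom E.1

theorem IsBCartierOn.restrict {X : Variety} (hX : X.IsNormal) {V : X.sch.Opens}
    (hV : (V : Set X.sch).Nonempty) {D : RDivisor X} (hD : IsBCartierOn ⊤ D) :
    IsBCartierOn ⊤ (D.comap (X.incl V hV)) := by
  have hιX := isOverC_incl X V hV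
  refine ⟨isQCartierOn_comp_map (X.incl V hV) hX hιX (hD.1.mono le_top), ?_⟩
  obtain ⟨Y, g, A, hg, hA, hAD⟩ := hD.2
  have hV' := hg.isWeakModel.dom.nonempty_preimage hV
  have hιY := isOverC_incl Y _ hV'
  refine ⟨_, GenPair.restrictHom g V hV hV', A ∘ PrimeDivisor.map (Y.incl _ hV'), hg.restrictHom hV hV',
    (isCartierOn_comp_map_iff (Y.incl _ hV') hg.normal hιY).2 fun y _ => hA y trivial,
    fun E _ => ?_⟩
  obtain ⟨α, hα⟩ := hD.1.isRCartierOn.exists_isDivNear (x := g (Y.incl _ hV' E.1)) trivial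
  exact (pullCoeff_comp_map hX hιX hg.isWeakModel (hg.restrictHom hV hV').isWeakModel
    (restrictHom_incl hV hV') hα).trans (hAD _ trivial)

theorem IsFanoType.restrictHom {X Z : Variety} {π : X.sch ⟶ Z.sch} (h : IsFanoType π)
    {W : Z.sch.Opens} (hW : (W : Set Z.sch).Nonempty)
    (hW' : ((π ⁻¹ᵁ W : X.sch.Opens) : Set X.sch).Nonempty) :
    IsFanoType (GenPair.restrictHom π W hW hW') := by
  obtain ⟨hπ, hX, ω, C, hω, hC, hR, hklt, hnef, hbig⟩ := h
  have hι := isOverC_incl X _ hW'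
  have hj := isOverC_incl Z _ hW
  have he := restrictHom_incl (g := π) hW hW'
  obtain ⟨ω', hω', hform⟩ := exists_topForm_restrict (X.incl _ hW') hX hι hω
  have hn := isNormal_of_isOpenImmersion (X.incl _ hW') hX
  have hK := canonicalCoeff_eq_map (X.incl _ hW') hX hι (hform _ _ (IsWeakModel.id hn))
  have hD : (fun P => (canonicalCoeff ω' P : ℝ) + C.comap (X.incl _ hW') P) =
      (fun P => (canonicalCoeff ω P : ℝ) + C P) ∘ PrimeDivisor.map (X.incl _ hW') := by
    funext P
    rw [hK]; rfl
  have hD' : (fun P => -((canonicalCoeff ω' P : ℝ) + C.comap (X.incl _ hW') P)) =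
      (fun P => -((canonicalCoeff ω P : ℝ) + C P)) ∘ PrimeDivisor.map (X.incl _ hW') := by
    funext P
    exact congrArg Neg.neg (congrFun hD P)
  refine ⟨hπ.restrictHom hW hW', hn, ω', C.comap (X.incl _ hW'), hω', fun P => hC _, ?_, ?_, ?_, ?_⟩
  · rw [hD]
    exact (isRCartierOn_comp_map_iff _ hX hι).2 (hR.mono le_top)
  · intro Y g hg E
    have hw := hg.isWeakModel
    have hw' := hw.comp (isWeakModel_of_isOpenImmersion (X.incl _ hW') hX hι)
    obtain ⟨α, hα⟩ := hR.exists_isDivNear (x := (g ≫ X.incl _ hW') E.1) trivial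
    -- A model of the open subvariety is not proper over `X`, so the klt condition cannot be applied
    -- to it directly; it is applied to a proper model with the same valuation.
    obtain ⟨N, k, E', hk, hreg, hc⟩ := exists_isModel_regularAt_eq hw' E
    have h1 := hklt N k hk E'
    rw [formOrd_eq_of_regularAt_eq hk.isWeakModel hw' hreg,
      pullCoeff_eq_of_regularAt_eq hX hk.isWeakModel hw' hreg hc (hc ▸ hα),
      pullCoeff_comp_openImmersion _ hX hι hw.normal hw.dom hα, ← hform _ _ hw] at h1
    rwa [hD]
  · rw [hD']
    exact IsNefOver.comp_map _ hX hι he (hnef.mono le_top)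
  · rw [hD']
    exact IsBigOver.comp_map _ hX hι hj he hπ.isDom (hπ.restrictHom hW hW').isDom hbig

namespace Data

section

variable (𝒟 : Data) {W : 𝒟.Z.sch.Opens}
  {hW : ((𝒟.πf ⁻¹ᵁ W : 𝒟.X'.sch.Opens) : Set 𝒟.X'.sch).Nonempty}
  {B : RDivisor 𝒟.X} {B' : RDivisor (𝒟.restrict hW).X}
  (hB : ∀ P, B' P = B (P.map (𝒟.inclX hW))) {μ : Fin 𝒟.J → ℝ}

theorem isRCartierOn_nefPart (h : 𝒟.HasBCartierNefParts) (μ : Fin 𝒟.J → ℝ) :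
    IsRCartierOn ⊤ (𝒟.nefPart μ) := by
  have h1 := IsRCartierOn.sum Finset.univ fun j (_ : j ∈ Finset.univ) =>
    (h j).1.1.isRCartierOn.smul (μ j)
  exact h1.congr fun P _ => (𝒟.nefPart_apply μ P).symm

theorem HasBCartierNefParts.restrict (h : 𝒟.HasBCartierNefParts) :
    (𝒟.restrict hW).HasBCartierNefParts := fun j =>
  ⟨(h j).1.restrict 𝒟.f_model.normal hW,
    IsNefOver.comp_map (𝒟.inclX' hW) (j := 𝒟.inclZ hW) 𝒟.f_model.normal (𝒟.isOverC_inclX' hW)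
      (𝒟.restrict_πf_comp hW) ((h j).2.mono le_top)⟩

include hB

theorem IsGenPairOver.restrict {W' : (𝒟.restrict hW).Z.sch.Opens}
    (h : 𝒟.IsGenPairOver (𝒟.inclZ hW ''ᵁ W') B μ) : (𝒟.restrict hW).IsGenPairOver W' B' μ := by
  refine ⟨fun P hP => ?_, h.2.1, ?_, ?_⟩
  · rw [hB]
    exact h.1 _ ⟨_, hP, 𝒟.inclZ_π hW P.1⟩
  · rw [nefPart_restrict]
    exact IsNefOver.comp_map (𝒟.inclX' hW) (j := 𝒟.inclZ hW) 𝒟.f_model.normal (𝒟.isOverC_inclX' hW)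
      (𝒟.restrict_πf_comp hW) h.2.2.1
  · rw [𝒟.adjoint_restrict hB]
    exact (isRCartierOn_comp_map_iff _ 𝒟.X_normal (𝒟.isOverC_inclX hW)).2
      (h.2.2.2.mono (image_preimage_le (𝒟.inclX hW) (𝒟.restrict_π_comp hW) W'))

theorem IsGenEpsLCOver.restrict {W' : (𝒟.restrict hW).Z.sch.Opens} {e : ℝ}
    (h : 𝒟.IsGenEpsLCOver (𝒟.inclZ hW ''ᵁ W') e B μ) :
    (𝒟.restrict hW).IsGenEpsLCOver W' e B' μ := by
  refine ⟨h.1.restrict 𝒟 hB, fun Y k hk E hE => ?_⟩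
  have hw := hk.isWeakModel
  have hw' := hw.comp (isWeakModel_of_isOpenImmersion (𝒟.inclX' hW) 𝒟.f_model.normal
    (𝒟.isOverC_inclX' hW))
  obtain ⟨N, l, E', hl, hreg, hc⟩ := exists_isModel_regularAt_eq hw' E
  have h1 : 𝒟.πf (𝒟.inclX' hW (k E.1)) ∈ 𝒟.inclZ hW ''ᵁ W' := ⟨_, hE, 𝒟.inclZ_πf hW (k E.1)⟩
  have h2 : l E'.1 = 𝒟.inclX' hW (k E.1) := hc.trans (Scheme.Hom.comp_apply _ _ _)
  rw [𝒟.logDiscrepancy_restrict hB hw (V := 𝒟.π ⁻¹ᵁ (𝒟.inclZ hW ''ᵁ W'))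
    (V' := 𝒟.πf ⁻¹ᵁ (𝒟.inclZ hW ''ᵁ W')) h1 h1 h.1.2.2.1.1 h.1.2.2.2,
    ← 𝒟.logDiscrepancy_eq_of_regularAt_eq hl.isWeakModel hw' hreg hc
      (V := 𝒟.π ⁻¹ᵁ (𝒟.inclZ hW ''ᵁ W')) (V' := 𝒟.πf ⁻¹ᵁ (𝒟.inclZ hW ''ᵁ W'))
      (by rw [h2]; exact h1) (by rw [h2]; exact h1) h.1.2.2.1.1 h.1.2.2.2]
  refine h.2 N l hl E' ?_
  rw [h2]; exact h1

end

theorem isFanoTypePair_restrict (𝒟 : Data) {W : 𝒟.Z.sch.Opens}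
    (hW : ((𝒟.πf ⁻¹ᵁ W : 𝒟.X'.sch.Opens) : Set 𝒟.X'.sch).Nonempty) {d : ℕ} {Γ : Set ℝ}
    {B : RDivisor 𝒟.X} {μ : Fin 𝒟.J → ℝ} (h : 𝒟.IsFanoTypePair d Γ B μ) :
    (𝒟.restrict hW).IsFanoTypePair d Γ (B.comap (𝒟.inclX hW)) μ := by
  obtain ⟨h1, h2, h3, h4, h5, h6⟩ := h
  refine ⟨?_, h2.restrictHom (𝒟.nonempty_base hW) (𝒟.nonempty_preimage hW), ?_, fun P => h4 _, h5.restrict 𝒟, h6⟩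
  · exact (topologicalKrullDim_eq_of_isOpenImmersion (𝒟.inclX hW) (𝒟.isOverC_inclX hW)).trans h1
  · refine IsGenPairOver.restrict 𝒟 (B := B) (fun _ => rfl) ?_
    exact ⟨fun P _ => h3.1 P trivial, h3.2.1, h3.2.2.1.mono le_top, h3.2.2.2.mono fun _ _ => trivial⟩

/-- A complement over `W` is a complement at every point of `W`, with all of `W` as the
neighbourhood. This turns complementarity at one point into complementarity at all points of the
restricted base. -/
theorem isRComplement_restrict (𝒟 : Data) {W : 𝒟.Z.sch.Opens}
    (hW : ((𝒟.πf ⁻¹ᵁ W : 𝒟.X'.sch.Opens) : Set 𝒟.X'.sch).Nonempty) {ε : ℝ}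
    {B Bp : RDivisor 𝒟.X} {μ μp : Fin 𝒟.J → ℝ} (h₀ : 𝒟.IsGenEpsLCOver W 0 Bp μp)
    (hε : 𝒟.IsGenEpsLCOver W ε Bp μp) (hBp : ∀ P : PrimeDivisor 𝒟.X, 𝒟.π P.1 ∈ W → B P ≤ Bp P)
    (hμ : ∀ j, μ j ≤ μp j) (hnum : IsNumTrivialOver 𝒟.π W (𝒟.adjoint Bp μp))
    (z : (𝒟.restrict hW).Z.sch) :
    (𝒟.restrict hW).IsRComplement z ε (B.comap (𝒟.inclX hW)) μ (Bp.comap (𝒟.inclX hW)) μp := by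
  have hT : 𝒟.inclZ hW ''ᵁ ⊤ = W := by
    ext x
    exact ⟨fun ⟨y, _, hy⟩ => hy ▸ 𝒟.inclZ_mem hW y, fun hx => ⟨⟨x, hx⟩, trivial, rfl⟩⟩
  refine ⟨⊤, trivial, IsGenEpsLCOver.restrict 𝒟 (B := Bp) (fun _ => rfl) (by rwa [hT]),
    IsGenEpsLCOver.restrict 𝒟 (B := Bp) (fun _ => rfl) (by rwa [hT]), fun P _ => ?_, hμ, ?_⟩
  · refine hBp _ ?_
    rw [show (P.map (𝒟.inclX hW)).1 = 𝒟.inclX hW P.1 from rfl, ← inclZ_π]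
    exact 𝒟.inclZ_mem hW _
  · rw [𝒟.adjoint_restrict (B := Bp) (fun _ => rfl)]
    exact IsNumTrivialOver.comp_map _ 𝒟.X_normal (𝒟.isOverC_inclX hW) (𝒟.restrict_π_comp hW)
      (by rwa [hT])

end Data

end

/-! ### Pre-complements -/

namespace Data

/-- The properties of an `(e, n)`-complement of itself that matter over an open subset `W` of `Z`
once the `M'_j` are known to be nef and b-Cartier. -/
structure IsPreComplement (𝒟 : Data) (W : 𝒟.Z.sch.Opens) (e : ℝ) (n : ℕ) (B : RDivisor 𝒟.X)
    (μ : Fin 𝒟.J → ℝ) : Prop where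
  nonneg : ∀ P : PrimeDivisor 𝒟.X, 𝒟.π P.1 ∈ W → 0 ≤ B P
  coeff_nonneg : ∀ j, 0 ≤ μ j
  principal : IsPrincipalOn (𝒟.π ⁻¹ᵁ W) (fun P => (n : ℝ) * 𝒟.adjoint B μ P)
  le_logDiscrepancy : ∀ (Y : Variety) (h : Y.sch ⟶ 𝒟.X'.sch), IsModel h → ∀ E : PrimeDivisor Y,
    𝒟.πf (h E.1) ∈ W → 0 ≤ 𝒟.logDiscrepancy B μ h E ∧ e ≤ 𝒟.logDiscrepancy B μ h E
  integral : ∀ (Y : Variety) (h : Y.sch ⟶ 𝒟.X'.sch), IsModel h → ∀ E : PrimeDivisor Y,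
    𝒟.πf (h E.1) ∈ W → ∃ m : ℤ, (n : ℝ) * pullCoeff h (𝒟.nefPart μ) E = m

theorem _root_.GenPair.IsPrincipalOn.isRCartierOn_of_mul {X : Variety} {V : X.sch.Opens} {n : ℕ} (hn : 0 < n)
    {D : PrimeDivisor X → ℝ} (h : IsPrincipalOn V (fun P => (n : ℝ) * D P)) :
    IsRCartierOn V D := by
  refine (h.isRCartierOn.smul ((n : ℝ)⁻¹)).congr fun P _ => ?_
  exact inv_mul_cancel_left₀ (Nat.cast_ne_zero.2 hn.ne') _

theorem IsNComplement.exists_isPreComplement {𝒟 : Data} {z : 𝒟.Z.sch} {e : ℝ} {n : ℕ}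
    {B : RDivisor 𝒟.X} {μ : Fin 𝒟.J → ℝ} (hM : 𝒟.HasBCartierNefParts)
    (h : 𝒟.IsNComplement z e n B μ B μ) :
    ∃ W : 𝒟.Z.sch.Opens, z ∈ W ∧ 𝒟.IsPreComplement W e n B μ := by
  obtain ⟨W, hz, h₀, he, hp, -, -, hb⟩ := h
  refine ⟨W, hz, h₀.1.1, h₀.1.2.1, hp, fun Y k hk E hE => ⟨h₀.2 Y k hk E hE, he.2 Y k hk E hE⟩,
    fun Y k hk E hE => ?_⟩
  obtain ⟨α, hα⟩ := (𝒟.isRCartierOn_nefPart hM μ).exists_isDivNear (x := k E.1) trivial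
  obtain ⟨m, hm⟩ := hb.exists_pullCoeff_eq 𝒟.f_model.normal hk.isWeakModel E hE
  refine ⟨m, hm ▸ (pullCoeff_smul 𝒟.f_model.normal hk.normal hk.isWeakModel.dom hα n).symm⟩

theorem IsPreComplement.mono {𝒟 : Data} {W W' : 𝒟.Z.sch.Opens} {e : ℝ} {n : ℕ} {B : RDivisor 𝒟.X}
    {μ : Fin 𝒟.J → ℝ} (h : 𝒟.IsPreComplement W e n B μ) (hW : W' ≤ W) :
    𝒟.IsPreComplement W' e n B μ where
  nonneg P hP := h.nonneg P (hW hP)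
  coeff_nonneg := h.coeff_nonneg
  principal := by
    obtain ⟨φ, hφ, h1⟩ := h.principal
    exact ⟨φ, hφ, fun P hP => h1 P (hW hP)⟩
  le_logDiscrepancy Y k hk E hE := h.le_logDiscrepancy Y k hk E (hW hE)
  integral Y k hk E hE := h.integral Y k hk E (hW hE)

/-- Models of `X'` are restricted to the open part, which keeps valuations and centers, and the
function with divisor `n (K + B + M)` is the same rational function. Nefness, which would not extend
so easily, is no part of a pre-complement: it is recovered from the `M' j` themselves. -/
theorem IsPreComplement.of_restrict (𝒟 : Data) {W : 𝒟.Z.sch.Opens}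
    {hW : ((𝒟.πf ⁻¹ᵁ W : 𝒟.X'.sch.Opens) : Set 𝒟.X'.sch).Nonempty}
    {B : RDivisor 𝒟.X} {B' : RDivisor (𝒟.restrict hW).X}
    (hB : ∀ P, B' P = B (P.map (𝒟.inclX hW))) {μ : Fin 𝒟.J → ℝ} (hM : 𝒟.HasBCartierNefParts)
    {W' : (𝒟.restrict hW).Z.sch.Opens} {e : ℝ} {n : ℕ} (hn : 0 < n)
    (h : (𝒟.restrict hW).IsPreComplement W' e n B' μ) :
    𝒟.IsPreComplement (𝒟.inclZ hW ''ᵁ W') e n B μ := by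
  have hWW' : 𝒟.inclZ hW ''ᵁ W' ≤ W := by
    rintro _ ⟨y, -, rfl⟩
    exact 𝒟.inclZ_mem hW y
  have hmem {x} (hx : 𝒟.inclZ hW x ∈ 𝒟.inclZ hW ''ᵁ W') : x ∈ W' := by
    obtain ⟨y, hy, hxy⟩ := hx
    rwa [← (𝒟.inclZ hW).isOpenEmbedding.injective hxy]
  have hp : IsPrincipalOn (𝒟.π ⁻¹ᵁ (𝒟.inclZ hW ''ᵁ W')) (fun P => (n : ℝ) * 𝒟.adjoint B μ P) := by
    obtain ⟨φ, hφ, h1⟩ := isPrincipalOn_of_comp_map (𝒟.inclX hW) 𝒟.X_normal (𝒟.isOverC_inclX hW)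
      (D := fun P => (n : ℝ) * 𝒟.adjoint B μ P) (V := (𝒟.restrict hW).π ⁻¹ᵁ W') (by
        have h2 := h.principal
        rwa [𝒟.adjoint_restrict hB] at h2)
    refine ⟨φ, hφ, fun P hP => h1 P ?_⟩
    obtain ⟨x, hx⟩ := 𝒟.mem_opensRange_inclX hW (hWW' hP)
    refine ⟨x, hmem ?_, hx⟩
    rw [inclZ_π, hx]
    exact hP
  have hA := hp.isRCartierOn_of_mul hn
  have hN := 𝒟.isRCartierOn_nefPart hM μ
  have key : ∀ (Y : Variety) (k : Y.sch ⟶ 𝒟.X'.sch), IsModel k → ∀ E : PrimeDivisor Y,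
      𝒟.πf (k E.1) ∈ 𝒟.inclZ hW ''ᵁ W' → ∃ (Y' : Variety) (k' : Y'.sch ⟶ (𝒟.restrict hW).X'.sch)
        (E' : PrimeDivisor Y'), IsModel k' ∧ (𝒟.restrict hW).πf (k' E'.1) ∈ W' ∧
        (𝒟.restrict hW).logDiscrepancy B' μ k' E' = 𝒟.logDiscrepancy B μ k E ∧
        pullCoeff k' ((𝒟.restrict hW).nefPart μ) E' = pullCoeff k (𝒟.nefPart μ) E := by
    intro Y k hk E hE
    have hV' : ((k ⁻¹ᵁ (𝒟.πf ⁻¹ᵁ W) : Y.sch.Opens) : Set Y.sch).Nonempty := ⟨E.1, hWW' hE⟩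
    obtain ⟨E', rfl⟩ := PrimeDivisor.exists_map_eq (Y.incl _ hV') (P := E) ⟨⟨E.1, hWW' hE⟩, rfl⟩
    obtain ⟨k', hk', e⟩ : ∃ k' : (Y.restrict _ hV').sch ⟶ (𝒟.restrict hW).X'.sch,
        IsModel k' ∧ k' ≫ 𝒟.inclX' hW = Y.incl _ hV' ≫ k :=
      ⟨restrictHom k (𝒟.πf ⁻¹ᵁ W) hW hV', hk.restrictHom hW hV', restrictHom_incl hW hV'⟩
    have hw' := hk'.isWeakModel
    have hc : 𝒟.inclX' hW (k' E'.1) = k ((Y.incl _ hV') E'.1) := by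
      rw [← Scheme.Hom.comp_apply, e, Scheme.Hom.comp_apply]
    refine ⟨_, k', E', hk', hmem ?_, ?_, ?_⟩
    · rw [inclZ_πf, hc]; exact hE
    · rw [𝒟.logDiscrepancy_restrict hB hw' (V := 𝒟.π ⁻¹ᵁ (𝒟.inclZ hW ''ᵁ W')) (V' := ⊤)
        (by rw [hc]; exact hE) trivial hN hA]
      refine 𝒟.logDiscrepancy_eq_of_regularAt_eq (hw'.comp (isWeakModel_of_isOpenImmersion
        (𝒟.inclX' hW) 𝒟.f_model.normal (𝒟.isOverC_inclX' hW))) hk.isWeakModel ?_ hc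
        (V := 𝒟.π ⁻¹ᵁ (𝒟.inclZ hW ''ᵁ W')) (V' := ⊤) ?_ trivial hN hA
      · rw [e]
        exact regularAt_openImmersion_comp (Y.incl _ hV') hk.isWeakModel.dom E'.1
      · rw [Scheme.Hom.comp_apply, hc]; exact hE
    · obtain ⟨α, hα⟩ := hN.exists_isDivNear (x := k ((Y.incl _ hV') E'.1)) trivial
      rw [nefPart_restrict]
      exact pullCoeff_comp_map 𝒟.f_model.normal (𝒟.isOverC_inclX' hW) hk.isWeakModel hw' e hα
  refine ⟨fun P hP => ?_, h.coeff_nonneg, hp, fun Y k hk E hE => ?_, fun Y k hk E hE => ?_⟩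
  · obtain ⟨E, rfl⟩ := PrimeDivisor.exists_map_eq _ (𝒟.mem_opensRange_inclX hW (hWW' hP))
    rw [← hB]
    refine h.nonneg E (hmem ?_)
    rw [inclZ_π]
    exact hP
  · obtain ⟨Y', k', E', hk', hE', h1, -⟩ := key Y k hk E hE
    rw [← h1]
    exact h.le_logDiscrepancy Y' k' hk' E' hE'
  · obtain ⟨Y', k', E', hk', hE', -, h1⟩ := key Y k hk E hE
    rw [← h1]
    exact h.integral Y' k' hk' E' hE'

end Data

/-! ### Convex combinations, and integrality for pre-complements -/

section

theorem pushCoeff_eq_linearCombination {Y X : Variety} (f : Y.sch ⟶ X.sch) (P : PrimeDivisor X)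
    (D : RDivisor Y) [DecidablePred fun Q : PrimeDivisor Y => f Q.1 = P.1] :
    pushCoeff f D P =
      Finsupp.linearCombination ℝ (fun Q : PrimeDivisor Y => if f Q.1 = P.1 then (1 : ℝ) else 0) D := by
  rw [pushCoeff, Finsupp.linearCombination_apply, Finsupp.sum,
    finsum_eq_sum_of_support_subset (s := D.support)]
  · refine Finset.sum_congr rfl fun Q _ => ?_
    by_cases h : f Q.1 = P.1 <;> simp [h]
  · intro Q hQ
    by_contra h
    rw [Finset.mem_coe, Finsupp.notMem_support_iff] at h
    exact hQ (by simp [h])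

theorem pushCoeff_sum {Y X : Variety} (f : Y.sch ⟶ X.sch) (P : PrimeDivisor X) {ι : Type*}
    (s : Finset ι) (c : ι → ℝ) (D : ι → RDivisor Y) :
    pushCoeff f (∑ i ∈ s, c i • D i) P = ∑ i ∈ s, c i * pushCoeff f (D i) P := by
  classical
  simp only [pushCoeff_eq_linearCombination, map_sum, map_smul, smul_eq_mul]

theorem IsPrincipalOn.sum {X : Variety} {V : X.sch.Opens} {ι : Type*} (s : Finset ι)
    {D : ι → PrimeDivisor X → ℝ} (h : ∀ i ∈ s, IsPrincipalOn V (D i)) (m : ι → ℕ) :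
    IsPrincipalOn V (fun P => ∑ i ∈ s, (m i : ℝ) * D i P) := by
  classical
  induction s using Finset.induction_on with
  | empty => exact ⟨1, one_ne_zero, fun P _ => by simp [ordAt_one]⟩
  | insert i s hi ih =>
    obtain ⟨φ, hφ, h1⟩ := ih fun j hj => h j (Finset.mem_insert_of_mem hj)
    obtain ⟨ψ, hψ, h2⟩ := h i (Finset.mem_insert_self i s)
    refine ⟨ψ ^ m i * φ, mul_ne_zero (pow_ne_zero _ hψ) hφ, fun P hP => ?_⟩
    have h3 : ordAt P (ψ ^ m i) = m i * ordAt P ψ := by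
      induction m i with
      | zero => simp [ordAt_one]
      | succ k ih => rw [pow_succ, ordAt_mul P (pow_ne_zero _ hψ) hψ, ih]; push_cast; ring
    refine (Finset.sum_insert hi).trans ?_
    rw [show ∑ j ∈ s, (m j : ℝ) * D j P = _ from h1 P hP, h2 P hP, ordAt_mul P (pow_ne_zero _ hψ) hφ, h3]
    push_cast
    ring

namespace Data

section

variable (𝒟 : Data) {k : ℕ} (b : Fin k → ℝ) (B : Fin k → RDivisor 𝒟.X)
  (μ : Fin k → Fin 𝒟.J → ℝ)

theorem nefPart_sum : 𝒟.nefPart (∑ i, b i • μ i) = ∑ i, b i • 𝒟.nefPart (μ i) := by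
  simp only [nefPart, Finset.sum_apply, Pi.smul_apply, smul_eq_mul, Finset.smul_sum, smul_smul,
    Finset.sum_smul]
  exact Finset.sum_comm

/-- The canonical divisor enters every summand with coefficient one, so the adjoint divisor is
affine in the data, and the weights must have sum one. -/
theorem adjoint_sum (hb : ∑ i, b i = 1) (P : PrimeDivisor 𝒟.X) :
    𝒟.adjoint (∑ i, b i • B i) (∑ i, b i • μ i) P = ∑ i, b i * 𝒟.adjoint (B i) (μ i) P := by
  have h1 : ∑ i, b i * (canonicalCoeff 𝒟.ω P : ℝ) = canonicalCoeff 𝒟.ω P := by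
    rw [← Finset.sum_mul, hb, one_mul]
  simp only [adjoint, nefPart_sum, pushCoeff_sum, Finsupp.finsetSum_apply, Finsupp.smul_apply,
    smul_eq_mul, mul_add, Finset.sum_add_distrib, h1]

theorem logDiscrepancy_sum (hb : ∑ i, b i = 1) {Y : Variety} {h : Y.sch ⟶ 𝒟.X'.sch}
    (hh : IsWeakModel h) {E : PrimeDivisor Y}
    {V : 𝒟.X.sch.Opens} {V' : 𝒟.X'.sch.Opens} (hE : 𝒟.f (h E.1) ∈ V) (hE' : h E.1 ∈ V')
    (hN : ∀ i, IsRCartierOn V' (𝒟.nefPart (μ i)))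
    (hA : ∀ i, IsRCartierOn V (𝒟.adjoint (B i) (μ i))) :
    𝒟.logDiscrepancy (∑ i, b i • B i) (∑ i, b i • μ i) h E =
      ∑ i, b i * 𝒟.logDiscrepancy (B i) (μ i) h E := by
  have hf := hh.comp 𝒟.f_model.isWeakModel
  choose α hα using fun i => (hN i).exists_isDivNear hE'
  choose γ hγ using fun i => (hA i).exists_isDivNear (x := (h ≫ 𝒟.f) E.1) (by
    rw [Scheme.Hom.comp_apply]; exact hE)
  have h1 := pullCoeff_sum 𝒟.f_model.normal hh.normal hh.dom Finset.univ (fun i _ => hα i) b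
  have h2 := pullCoeff_sum 𝒟.X_normal hh.normal hf.dom Finset.univ (fun i _ => hγ i) b
  have h3 : (𝒟.nefPart (∑ i, b i • μ i) : PrimeDivisor 𝒟.X' → ℝ) =
      fun P => ∑ i, b i * 𝒟.nefPart (μ i) P := by
    funext P
    simp [nefPart_sum, Finsupp.finsetSum_apply]
  have h4 : 𝒟.adjoint (∑ i, b i • B i) (∑ i, b i • μ i) =
      fun P => ∑ i, b i * 𝒟.adjoint (B i) (μ i) P := funext (𝒟.adjoint_sum b B μ hb)
  have h5 : ∑ i, b i * (1 + (formOrd (h ≫ 𝒟.f) 𝒟.ω E : ℝ)) = 1 + formOrd (h ≫ 𝒟.f) 𝒟.ω E := by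
    rw [← Finset.sum_mul, hb, one_mul]
  simp only [logDiscrepancy, h3, h4, h1, h2, mul_sub, mul_add (b _),
    Finset.sum_sub_distrib, Finset.sum_add_distrib] at h5 ⊢
  rw [h5]

end

section

variable {𝒟 : Data} {W : 𝒟.Z.sch.Opens} {e : ℝ} {n : ℕ} {B : RDivisor 𝒟.X} {μ : Fin 𝒟.J → ℝ}

/-- The pull back of `n (K + B + M)` has the order of a rational function as its coefficient at `E`.
The nef part contributes an integer after multiplication by `n`, and orders of forms are integers.
So `n` times the log discrepancy is an integer, and it is nonnegative. -/
theorem IsPreComplement.exists_nat_logDiscrepancy (h : 𝒟.IsPreComplement W e n B μ) (hn : 0 < n)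
    {Y : Variety} {k : Y.sch ⟶ 𝒟.X'.sch} (hk : IsModel k) {E : PrimeDivisor Y}
    (hE : 𝒟.πf (k E.1) ∈ W) : ∃ y : ℕ, (n : ℝ) * 𝒟.logDiscrepancy B μ k E = y := by
  have hf := hk.isWeakModel.comp 𝒟.f_model.isWeakModel
  obtain ⟨m, hm⟩ := h.integral Y k hk E hE
  obtain ⟨φ, hφ, h1⟩ := h.principal
  have hE' : (k ≫ 𝒟.f) E.1 ∈ 𝒟.π ⁻¹ᵁ W := by rw [Scheme.Hom.comp_apply]; exact hE
  obtain ⟨α, hα⟩ := (h.principal.isRCartierOn_of_mul hn).exists_isDivNear hE'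
  have h2 : (n : ℝ) * pullCoeff (k ≫ 𝒟.f) (𝒟.adjoint B μ) E = ordAt E (pullFun (k ≫ 𝒟.f) φ) := by
    rw [← pullCoeff_smul 𝒟.X_normal hk.normal hf.dom hα, pullCoeff_congr hE' h1]
    have h3 : IsLocalEq (fun P => ordAt P φ) ((k ≫ 𝒟.f) E.1) φ :=
      ⟨hφ, ⊤, trivial, fun _ _ => rfl⟩
    rw [pullCoeff_eq 𝒟.X_normal hk.normal hf.dom (isDivNear_single h3)]
    simp [pullDiv]
  have h4 : (n : ℝ) * 𝒟.logDiscrepancy B μ k E =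
      ((n + n * formOrd (k ≫ 𝒟.f) 𝒟.ω E + m - ordAt E (pullFun (k ≫ 𝒟.f) φ) : ℤ) : ℝ) := by
    rw [logDiscrepancy]
    push_cast
    linear_combination hm - h2
  have h5 : 0 ≤ (n : ℝ) * 𝒟.logDiscrepancy B μ k E :=
    mul_nonneg (Nat.cast_nonneg n) (h.le_logDiscrepancy Y k hk E hE).1
  rw [h4] at h5 ⊢
  obtain ⟨y, hy⟩ := Int.eq_ofNat_of_zero_le (Int.cast_nonneg_iff.1 h5)
  exact ⟨y, by rw [hy]; rfl⟩

theorem IsPreComplement.exists_int_nefPart (h : 𝒟.IsPreComplement W e n B μ)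
    (hM : 𝒟.HasBCartierNefParts) {Q : PrimeDivisor 𝒟.X'} (hQ : 𝒟.πf Q.1 ∈ W) :
    ∃ m : ℤ, (n : ℝ) * 𝒟.nefPart μ Q = m := by
  obtain ⟨m, hm⟩ := h.integral _ _ (isModel_id 𝒟.f_model.normal) Q hQ
  exact ⟨m, by rwa [pullCoeff_id 𝒟.f_model.normal (𝒟.isRCartierOn_nefPart hM μ) Q trivial] at hm⟩

/-- `n * B P` is the order of a function minus `n` times the coefficients of `K` and of the push
forward of `M'`; the latter is integral because `n * M'` has integral coefficients on `X'`. -/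
theorem IsPreComplement.exists_nat_coeff (h : 𝒟.IsPreComplement W e n B μ)
    (hM : 𝒟.HasBCartierNefParts) {P : PrimeDivisor 𝒟.X} (hP : 𝒟.π P.1 ∈ W) :
    ∃ y : ℕ, (n : ℝ) * B P = y := by
  classical
  obtain ⟨φ, hφ, h1⟩ := h.principal
  have h2 : ∃ m : ℤ, (n : ℝ) * pushCoeff 𝒟.f (𝒟.nefPart μ) P = m := by
    have h3 (Q : PrimeDivisor 𝒟.X') : ∃ m : ℤ, (n : ℝ) *
        (𝒟.nefPart μ Q * if 𝒟.f Q.1 = P.1 then (1 : ℝ) else 0) = m := by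
      by_cases hQ : 𝒟.f Q.1 = P.1
      · have h4 : 𝒟.πf Q.1 = 𝒟.π P.1 := by rw [πf, Scheme.Hom.comp_apply, hQ]
        obtain ⟨m, hm⟩ := h.exists_int_nefPart hM (Q := Q) (by rwa [h4])
        exact ⟨m, by rw [if_pos hQ, mul_one, hm]⟩
      · exact ⟨0, by simp [hQ]⟩
    choose m hm using h3
    refine ⟨∑ Q ∈ (𝒟.nefPart μ).support, m Q, ?_⟩
    rw [pushCoeff_eq_linearCombination, Finsupp.linearCombination_apply, Finsupp.sum,
      Finset.mul_sum, Int.cast_sum]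
    exact Finset.sum_congr rfl fun Q _ => by rw [← hm, smul_eq_mul]
  obtain ⟨m, hm⟩ := h2
  have h4 : (n : ℝ) * B P = ((ordAt P φ - n * canonicalCoeff 𝒟.ω P - m : ℤ) : ℝ) := by
    have h5 := h1 P hP
    change (n : ℝ) * (canonicalCoeff 𝒟.ω P + B P + pushCoeff 𝒟.f (𝒟.nefPart μ) P) = _ at h5
    push_cast
    linear_combination h5 - hm
  have h5 : 0 ≤ (n : ℝ) * B P := mul_nonneg (Nat.cast_nonneg n) (h.nonneg P hP)
  rw [h4] at h5 ⊢
  obtain ⟨y, hy⟩ := Int.eq_ofNat_of_zero_le (Int.cast_nonneg_iff.1 h5)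
  exact ⟨y, by rw [hy]; rfl⟩

end

end Data

end

/-! ### From pre-complements to a complement -/

namespace Data

/-- A convex combination, with suitable rational coefficients, of pre-complements is a
complement. -/
theorem exists_isNComplement_of_isPreComplement {𝒟 : Data} {d : ℕ} {Γ : Set ℝ} {B : RDivisor 𝒟.X}
    {μ : Fin 𝒟.J → ℝ} (hΓ : Γ ⊆ Set.Icc 0 1) (hp : 𝒟.IsFanoTypePair d Γ B μ) {ε : ℝ} (hε : 0 ≤ ε)
    {n n₀ : ℕ} (hn : 0 < n) (hn₀ : 0 < n₀) {z : 𝒟.Z.sch} {W : 𝒟.Z.sch.Opens} (hz : z ∈ W) {k : ℕ}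
    {a b e : Fin k → ℝ} {Bi : Fin k → RDivisor 𝒟.X} {μi : Fin k → Fin 𝒟.J → ℝ}
    (ha : ∀ i, 0 ≤ a i) (hb : ∀ i, 0 ≤ b i) (hbn : ∀ i, ∃ z : ℕ, n * b i = n₀ * z)
    (hb1 : ∑ i, b i = 1)
    (hab : ∀ x : Fin k → ℝ, (∀ i, ∃ y : ℕ, n₀ * x i = y) →
      (ε ≤ ∑ i, a i * x i → ε ≤ ∑ i, b i * x i) ∧
      (∀ c ∈ Set.Icc (0 : ℝ) 1, c ≤ ∑ i, a i * x i → CoeffIneq n c (∑ i, b i * x i)) ∧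
      (SpanCondition ε Γ → ∀ c, c ∈ Γ ∨ c = 0 → c ≤ ∑ i, a i * x i → c ≤ ∑ i, b i * x i))
    (hpre : ∀ i, 𝒟.IsPreComplement W (e i) n₀ (Bi i) (μi i))
    (hint : ∀ i j, ∃ y : ℤ, n₀ * μi i j = y) (he : ε ≤ ∑ i, a i * e i)
    (hB : ∀ P : PrimeDivisor 𝒟.X, 𝒟.π P.1 ∈ W → B P ≤ ∑ i, a i * Bi i P)
    (hμ : ∀ j, μ j ≤ ∑ i, a i * μi i j) :
    ∃ (Bp : RDivisor 𝒟.X) (μp : Fin 𝒟.J → ℝ), 𝒟.IsNComplement z ε n B μ Bp μp ∧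
      (SpanCondition ε Γ → 𝒟.IsMonotonic z B μ Bp μp) := by
  obtain ⟨-, -, hgp, hBΓ, hM, hμΓ⟩ := hp
  choose zi hzi using hbn
  have hX' := 𝒟.f_model.normal
  have hBapp (P) : (∑ i, b i • Bi i) P = ∑ i, b i * Bi i P := by
    simp [Finsupp.finsetSum_apply]
  have hμapp (j) : (∑ i, b i • μi i) j = ∑ i, b i * μi i j := by
    simp [Finset.sum_apply]
  have hμnat (i j) : ∃ y : ℕ, (n₀ : ℝ) * μi i j = y := by
    obtain ⟨y, hy⟩ := hint i j
    have h1 : 0 ≤ (n₀ : ℝ) * μi i j := mul_nonneg (Nat.cast_nonneg _) ((hpre i).coeff_nonneg j)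
    rw [hy] at h1
    obtain ⟨w, hw⟩ := Int.eq_ofNat_of_zero_le (Int.cast_nonneg_iff.1 h1)
    exact ⟨w, by rw [hy, hw]; rfl⟩
  have hBΓ' (P) : B P ∈ Γ ∨ B P = 0 := or_iff_not_imp_right.2 (hBΓ P)
  have hB01 (P) : B P ∈ Set.Icc (0 : ℝ) 1 := by
    rcases hBΓ' P with h | h
    · exact hΓ h
    · rw [h]; exact ⟨le_rfl, zero_le_one⟩
  have hprin : IsPrincipalOn (𝒟.π ⁻¹ᵁ W)
      (fun P => (n : ℝ) * 𝒟.adjoint (∑ i, b i • Bi i) (∑ i, b i • μi i) P) := by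
    -- As `n * b i = n₀ * zi i`, the product of the powers with exponents `zi i` of the functions
    -- attached to the pieces has divisor `n` times the new adjoint divisor.
    obtain ⟨φ, hφ, h1⟩ := IsPrincipalOn.sum Finset.univ (fun i _ => (hpre i).principal) zi
    refine ⟨φ, hφ, fun P hP => (Eq.trans ?_ (h1 P hP))⟩
    refine (congrArg ((n : ℝ) * ·) (𝒟.adjoint_sum b Bi μi hb1 P)).trans ?_
    refine (Finset.mul_sum _ _ _).trans ?_
    refine Finset.sum_congr rfl fun i _ => ?_
    linear_combination 𝒟.adjoint (Bi i) (μi i) P * hzi i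
  have hμ0 (j) : 0 ≤ (∑ i, b i • μi i) j := by
    rw [hμapp]
    exact Finset.sum_nonneg fun i _ => mul_nonneg (hb i) ((hpre i).coeff_nonneg j)
  have hgen : 𝒟.IsGenPairOver W (∑ i, b i • Bi i) (∑ i, b i • μi i) := by
    refine ⟨fun P hP => ?_, hμ0, ?_, hprin.isRCartierOn_of_mul hn⟩
    · rw [hBapp]
      exact Finset.sum_nonneg fun i _ => mul_nonneg (hb i) ((hpre i).nonneg P hP)
    -- Nefness does not come from the pieces: the new nef part is a nonnegative combination of the
    -- `M' j`, which are nef over all of `Z`.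
    · have h1 := (IsNefOver.sum hX' hgp.2.2.1 Finset.univ (fun j _ => (hM j).2)
        (fun j _ => hμ0 j)).mono (le_top : W ≤ ⊤)
      rwa [show (fun P => ∑ j, (∑ i, b i • μi i) j * 𝒟.M' j P) =
        (𝒟.nefPart (∑ i, b i • μi i) : PrimeDivisor 𝒟.X' → ℝ) from
          funext fun P => (𝒟.nefPart_apply _ P).symm] at h1
  have hld (Y : Variety) (h : Y.sch ⟶ 𝒟.X'.sch) (hh : IsModel h) (E : PrimeDivisor Y)
      (hE : 𝒟.πf (h E.1) ∈ W) :
      𝒟.logDiscrepancy (∑ i, b i • Bi i) (∑ i, b i • μi i) h E =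
        ∑ i, b i * 𝒟.logDiscrepancy (Bi i) (μi i) h E :=
    𝒟.logDiscrepancy_sum b Bi μi hb1 hh.isWeakModel (V := 𝒟.π ⁻¹ᵁ W) (V' := ⊤) hE trivial
      (fun i => 𝒟.isRCartierOn_nefPart hM _)
      (fun i => (hpre i).principal.isRCartierOn_of_mul hn₀)
  have hlc : 𝒟.IsGenEpsLCOver W ε (∑ i, b i • Bi i) (∑ i, b i • μi i) := by
    refine ⟨hgen, fun Y h hh E hE => ?_⟩
    rw [hld Y h hh E hE]
    -- The old weights give a log discrepancy of at least `∑ a i * e i ≥ ε`, and the new weights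
    -- were chosen to preserve this inequality for values of this arithmetic type.
    refine (hab _ fun i => (hpre i).exists_nat_logDiscrepancy hn₀ hh hE).1 (he.trans ?_)
    exact Finset.sum_le_sum fun i _ =>
      mul_le_mul_of_nonneg_left ((hpre i).le_logDiscrepancy Y h hh E hE).2 (ha i)
  refine ⟨∑ i, b i • Bi i, ∑ i, b i • μi i, ⟨W, hz,
    ⟨hgen, fun Y h hh E hE => hε.trans (hlc.2 Y h hh E hE)⟩, hlc, hprin, fun P hP => ?_,
    fun j => ?_, ?_⟩, fun hs => ⟨⟨W, hz, fun P hP => ?_⟩, fun j => ?_⟩⟩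
  · rw [hBapp]
    exact (hab _ fun i => (hpre i).exists_nat_coeff hM hP).2.1 _ (hB01 P) (hB P hP)
  · rw [hμapp]
    exact (hab _ fun i => hμnat i j).2.1 _ (hΓ (hμΓ j)) (hμ j)
  · choose y hy using hμnat
    -- Here integrality of `n₀ * μi i j` is indispensable: it makes `n` times the nef part a
    -- combination of b-Cartier divisors with natural coefficients.
    have h1 : (n : ℝ) • 𝒟.nefPart (∑ i, b i • μi i) =
        ∑ j, (∑ i, zi i * y i j) • 𝒟.M' j := by
      rw [nefPart, Finset.smul_sum]
      refine Finset.sum_congr rfl fun j _ => ?_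
      rw [smul_smul, hμapp, ← Nat.cast_smul_eq_nsmul ℝ, Finset.mul_sum, Nat.cast_sum]
      congr 1
      refine Finset.sum_congr rfl fun i _ => ?_
      rw [Nat.cast_mul, ← hy]
      linear_combination μi i j * hzi i
    rw [h1]
    exact (IsBCartierOn.sum (V := ⊤) hX' Finset.univ fun j _ => (hM j).1.nsmul hX' _).mono le_top
  · rw [hBapp]
    exact (hab _ fun i => (hpre i).exists_nat_coeff hM hP).2.2 hs _ (hBΓ' P) (hB P hP)
  · rw [hμapp]
    exact (hab _ fun i => hμnat i j).2.2 hs _ (Or.inl (hμΓ j)) (hμ j)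

end Data

/-! ### Conjecture A in a neighbourhood of a point -/

namespace Data

theorem IsFanoTypePair.isDom_πf {𝒟 : Data} {d : ℕ} {Γ : Set ℝ} {B : RDivisor 𝒟.X}
    {μ : Fin 𝒟.J → ℝ} (h : 𝒟.IsFanoTypePair d Γ B μ) : IsDom 𝒟.πf :=
  𝒟.f_model.isWeakModel.dom.comp h.2.1.1.isDom

/-- Applying the conjecture for decomposable complements in a neighbourhood of a point. -/
theorem exists_isPreComplement {d n₀ : ℕ} {Γ : Set ℝ} {ε : ℝ} {S Γ₀ : Finset ℝ} (hn₀ : 0 < n₀)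
    (H : ∀ (𝒟 : Data) (B : RDivisor 𝒟.X) (μ : Fin 𝒟.J → ℝ), 𝒟.IsFanoTypePair d Γ B μ →
      (∀ z, 𝒟.IsRComplementary z ε B μ) → ∀ z, ∃ (Bp : RDivisor 𝒟.X) (μp : Fin 𝒟.J → ℝ),
        𝒟.IsDecomposableRComplement z ε S n₀ Γ₀ B μ Bp μp)
    {𝒟 : Data} {B : RDivisor 𝒟.X} {μ : Fin 𝒟.J → ℝ} (hp : 𝒟.IsFanoTypePair d Γ B μ)
    {z : 𝒟.Z.sch} (hz : 𝒟.IsRComplementary z ε B μ) :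
    ∃ (W : 𝒟.Z.sch.Opens) (k : ℕ) (a e : Fin k → ℝ) (Bi : Fin k → RDivisor 𝒟.X)
      (μi : Fin k → Fin 𝒟.J → ℝ), z ∈ W ∧ (∀ i, a i ∈ Γ₀) ∧ ∑ i, a i = 1 ∧
      ε ≤ ∑ i, a i * e i ∧ (∀ i, 𝒟.IsPreComplement W (e i) n₀ (Bi i) (μi i)) ∧
      (∀ P : PrimeDivisor 𝒟.X, 𝒟.π P.1 ∈ W → B P ≤ ∑ i, a i * Bi i P) ∧
      ∀ j, μ j ≤ ∑ i, a i * μi i j := by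
  obtain ⟨Bp, μp, W, hzW, h₀, hε, hBp, hμp, hnum⟩ := hz
  have hW := hp.isDom_πf.nonempty_preimage (V := W) ⟨z, hzW⟩
  have hM := hp.2.2.2.2.1
  obtain ⟨z', rfl⟩ := 𝒟.mem_range_inclZ hW hzW
  -- The conjecture is applied over the neighbourhood `W` on which the given real complement lives.
  obtain ⟨Bq, μq, ⟨W₀, hzW₀, -, -, hBq, hμq, -⟩, k, a, e, Bi, μi, ha, -, hsum, he, -, hBs, hμs, hN⟩ :=
    H (𝒟.restrict hW) _ _ (𝒟.isFanoTypePair_restrict hW hp)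
      (fun z => ⟨_, _, 𝒟.isRComplement_restrict hW h₀ hε hBp hμp hnum z⟩) z'
  choose W₁ hzW₁ hpre using fun i => (hN i).exists_isPreComplement (hM.restrict 𝒟)
  let W' : (𝒟.restrict hW).Z.sch.Opens :=
    ⟨W₀ ∩ ⋂ i, W₁ i, W₀.isOpen.inter (isOpen_iInter_of_finite fun i => (W₁ i).isOpen)⟩
  -- The boundaries of the pieces live on the restricted variety. Extending them by zero is
  -- harmless, because all claims concern only a neighbourhood of `z`.
  refine ⟨𝒟.inclZ hW ''ᵁ W', k, a, e, fun i => (Bi i).extend (𝒟.inclX hW), μi,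
    ⟨z', ⟨hzW₀, Set.mem_iInter.2 hzW₁⟩, rfl⟩, ha, hsum, he, fun i => ?_, fun P hP => ?_, fun j => ?_⟩
  · exact IsPreComplement.of_restrict 𝒟 (fun P => (RDivisor.extend_map _ _ P).symm) hM hn₀
      ((hpre i).mono fun x hx => Set.mem_iInter.1 hx.2 i)
  · have hPW : 𝒟.π P.1 ∈ W := by
      obtain ⟨y, -, hy⟩ := hP
      rw [← hy]
      exact 𝒟.inclZ_mem hW y
    obtain ⟨E, rfl⟩ := PrimeDivisor.exists_map_eq _ (𝒟.mem_opensRange_inclX hW hPW)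
    have hE : (𝒟.restrict hW).π E.1 ∈ W₀ := by
      obtain ⟨y, hy, hyE⟩ := hP
      have h1 : 𝒟.inclZ hW y = 𝒟.inclZ hW ((𝒟.restrict hW).π E.1) :=
        hyE.trans (𝒟.inclZ_π hW E.1).symm
      rw [← (𝒟.inclZ hW).isOpenEmbedding.injective h1]
      exact hy.1
    have h2 := hBq E hE
    rw [hBs] at h2
    simpa [Finsupp.finsetSum_apply, RDivisor.comap_apply, RDivisor.extend_map] using h2
  · have h2 := hμq j
    rw [hμs] at h2
    exact h2.trans_eq (Finset.sum_apply j Finset.univ fun i => a i • μi i)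

end Data

/-! ### Rational functions with prescribed orders -/

section

theorem isDominant_SpecMap_of_injective {R S : CommRingCat.{0}} (f : R ⟶ S)
    (hf : Function.Injective f.hom) : IsDominant (Spec.map f) := by
  refine ⟨?_⟩
  refine (PrimeSpectrum.denseRange_comap_iff_ker_le_nilRadical f.hom).2 ?_
  rw [(RingHom.injective_iff_ker_eq_bot f.hom).1 hf]
  exact bot_le

/-- Inclusions between local rings of a separated variety come from specializations. -/
theorem specializes_of_localSubring_le {X : Variety} {x y : X.sch}
    (h : localSubring X x ≤ localSubring X y) : y ⤳ x := by
  let K := X.sch.presheaf.stalk (genericPoint X.sch)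
  let jx : X.sch.presheaf.stalk x ⟶ K := X.sch.presheaf.stalkSpecializes (genericPoint_specializes x)
  let jy : X.sch.presheaf.stalk y ⟶ K := X.sch.presheaf.stalkSpecializes (genericPoint_specializes y)
  have hy : Function.Injective jy.hom := IsFractionRing.injective (X.sch.presheaf.stalk y) X.K
  let ey := RingEquiv.ofBijective jy.hom.rangeRestrict
    ⟨fun a b hab => hy (Subtype.ext_iff.1 hab), jy.hom.rangeRestrict_surjective⟩
  let r : X.sch.presheaf.stalk x ⟶ X.sch.presheaf.stalk y := CommRingCat.ofHom
    (ey.symm.toRingHom.comp (jx.hom.codRestrict jy.hom.range fun a => h ⟨a, rfl⟩))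
  have hr : r ≫ jy = jx := by
    ext a
    exact congrArg Subtype.val (ey.apply_symm_apply (jx.hom.codRestrict jy.hom.range
      (fun a => h ⟨a, rfl⟩) a))
  have hdom : IsDominant (Spec.map jy) := isDominant_SpecMap_of_injective jy hy
  have h1 : Spec.map jy ≫ Spec.map r ≫ X.sch.fromSpecStalk x =
      Spec.map jy ≫ X.sch.fromSpecStalk y := by
    rw [← Category.assoc, ← Spec.map_comp, hr]
    exact (Scheme.SpecMap_stalkSpecializes_fromSpecStalk _).trans
      (Scheme.SpecMap_stalkSpecializes_fromSpecStalk _).symm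
  have h2 : (Spec.map r ≫ X.sch.fromSpecStalk x) ≫ X.str = X.sch.fromSpecStalk y ≫ X.str := by
    refine ext_of_isDominant (Spec.map jy) ?_
    rw [← Category.assoc, h1, Category.assoc]
  -- Two morphisms from the spectrum of the local ring at `y` to `X` agree at the generic point, so
  -- they agree by separatedness. Hence `y` is in the image of the spectrum of the local ring at
  -- `x`, which consists of the generalizations of `x`.
  have h3 := ext_of_isDominant_of_isSeparated X.str h2 (Spec.map jy) h1
  have h4 : y ∈ Set.range (X.sch.fromSpecStalk x) := by
    refine ⟨Spec.map r (IsLocalRing.closedPoint _), ?_⟩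
    have h4 := congrArg (fun f => f (IsLocalRing.closedPoint (X.sch.presheaf.stalk y) :
      Spec (X.sch.presheaf.stalk y))) h3
    exact (Scheme.Hom.comp_apply _ _ _).symm.trans (h4.trans Scheme.fromSpecStalk_closedPoint)
  rwa [Scheme.range_fromSpecStalk] at h4

theorem ordAt_neg {X : Variety} (P : PrimeDivisor X) (φ : X.K) : ordAt P (-φ) = ordAt P φ := by
  by_cases hφ : φ = 0
  · rw [hφ, neg_zero]
  have h0 : (-1 : X.K) ≠ 0 := neg_ne_zero.2 one_ne_zero
  have h1 := ordAt_mul P h0 h0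
  have h2 := ordAt_mul P h0 hφ
  rw [neg_one_mul, neg_neg, ordAt_one] at h1
  rw [neg_one_mul] at h2
  omega

open Classical in
/-- The absolute value of a prime divisor. -/
def PrimeDivisor.abs {X : Variety} (hX : X.IsNormal) (P : PrimeDivisor X) : AbsoluteValue X.K ℝ where
  toFun φ := if φ = 0 then 0 else (2 : ℝ) ^ (- ordAt P φ)
  map_mul' φ ψ := by
    by_cases hφ : φ = 0
    · simp [hφ]
    by_cases hψ : ψ = 0
    · simp [hψ]
    simp only [mul_eq_zero, hφ, hψ, or_self, if_false]
    rw [ordAt_mul P hφ hψ, neg_add, zpow_add₀ two_ne_zero]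
  nonneg' φ := by
    split_ifs
    · exact le_rfl
    · positivity
  eq_zero' φ := by
    split_ifs with h
    · exact iff_of_true rfl h
    · exact iff_of_false (zpow_ne_zero _ two_ne_zero) h
  add_le' φ ψ := by
    by_cases hφ : φ = 0
    · simp [hφ]
    by_cases hψ : ψ = 0
    · simp [hψ]
    by_cases h : φ + ψ = 0
    · rw [if_pos h]
      positivity
    · rw [if_neg h, if_neg hφ, if_neg hψ]
      rcases min_le_iff.1 (ordAt_add hX P h) with h1 | h1
      · exact (zpow_le_zpow_right₀ one_le_two (neg_le_neg h1)).trans (le_add_of_nonneg_right (by positivity))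
      · exact (zpow_le_zpow_right₀ one_le_two (neg_le_neg h1)).trans (le_add_of_nonneg_left (by positivity))

theorem PrimeDivisor.abs_apply {X : Variety} (hX : X.IsNormal) (P : PrimeDivisor X) {φ : X.K}
    (hφ : φ ≠ 0) : P.abs hX φ = (2 : ℝ) ^ (- ordAt P φ) := if_neg hφ

theorem PrimeDivisor.abs_le_one_iff {X : Variety} (hX : X.IsNormal) (P : PrimeDivisor X) (φ : X.K) :
    P.abs hX φ ≤ 1 ↔ φ ∈ localSubring X P.1 := by
  by_cases hφ : φ = 0
  · simp [hφ, zero_mem]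
  · rw [P.abs_apply hX hφ, ← ordAt_nonneg_iff hX P hφ, ← zpow_zero (2 : ℝ),
      zpow_le_zpow_iff_right₀ one_lt_two, neg_nonpos]

theorem PrimeDivisor.isNontrivial_abs {X : Variety} (hX : X.IsNormal) (P : PrimeDivisor X) :
    (P.abs hX).IsNontrivial := by
  obtain ⟨φ, hφ, h⟩ := exists_ordAt_eq_one hX P
  refine ⟨φ, hφ, ?_⟩
  rw [P.abs_apply hX hφ, h]
  norm_num

theorem PrimeDivisor.not_isEquiv_abs {X : Variety} (hX : X.IsNormal) {P Q : PrimeDivisor X}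
    (h : P ≠ Q) : ¬ (P.abs hX).IsEquiv (Q.abs hX) := by
  intro he
  refine h (PrimeDivisor.eq_of_specializes (specializes_of_localSubring_le fun φ hφ => ?_))
  rw [← PrimeDivisor.abs_le_one_iff hX] at hφ ⊢
  have h1 := he φ 1
  rw [map_one, map_one] at h1
  exact h1.2 hφ

/-- There are rational functions with prescribed orders along finitely many prime divisors. -/
theorem exists_forall_ordAt_eq {X : Variety} (hX : X.IsNormal) {ι : Type} [Finite ι]
    {P : ι → PrimeDivisor X} (hP : Function.Injective P) (c : ι → ℤ) :
    ∃ φ : X.K, φ ≠ 0 ∧ ∀ i, ordAt (P i) φ = c i := by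
  rcases isEmpty_or_nonempty ι with hι | ⟨⟨i₀⟩⟩
  · exact ⟨1, one_ne_zero, fun i => hι.elim i⟩
  have := Fintype.ofFinite ι
  have htarget (i) : ∃ t : X.K, t ≠ 0 ∧ ordAt (P i) t = c i := by
    obtain ⟨t, ht, h1⟩ := exists_ordAt_eq_one hX (P i)
    refine ⟨t ^ c i, zpow_ne_zero _ ht, ?_⟩
    have h2 := map_zpow (ordHom (P i)) (Units.mk0 t ht) (c i)
    have h3 := congrArg Multiplicative.toAdd h2
    simpa [ordHom, h1] using h3
  choose t ht htc using htarget
  obtain ⟨r, hr, hrt⟩ : ∃ r : ℝ, 0 < r ∧ ∀ i, r ≤ (P i).abs hX (t i) := by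
    have hne : (Finset.univ : Finset ι).Nonempty := ⟨i₀, Finset.mem_univ _⟩
    refine ⟨Finset.univ.inf' hne fun i => (P i).abs hX (t i), ?_,
      fun i => Finset.inf'_le _ (Finset.mem_univ i)⟩
    rw [Finset.lt_inf'_iff]
    exact fun i _ => ((P i).abs hX).pos (ht i)
  -- Weak approximation: distinct prime divisors give inequivalent absolute values. An `x` closer to
  -- each `t i` than the size of `t i` has the same order as `t i`, by the ultrametric inequality.
  have hd := AbsoluteValue.denseRange_algebraMap_pi (v := fun i => (P i).abs hX)
    (fun i => (P i).isNontrivial_abs hX)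
    fun i j hij => PrimeDivisor.not_isEquiv_abs hX fun h => hij (hP h)
  obtain ⟨x, hx⟩ := Metric.denseRange_iff.1 hd (fun i => WithAbs.toAbs _ (t i)) r hr
  have hx' (i) : (P i).abs hX (t i - x) < (P i).abs hX (t i) := by
    refine lt_of_lt_of_le ?_ (hrt i)
    have h1 := (dist_pi_lt_iff hr).1 hx i
    rwa [dist_eq_norm] at h1
  have hx0 : x ≠ 0 := by
    rintro rfl
    exact (hx' i₀).ne (by rw [sub_zero])
  refine ⟨x, hx0, fun i => ?_⟩
  by_cases he : t i - x = 0
  · rw [← sub_eq_zero.1 he, htc]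
  have h1 := hx' i
  rw [PrimeDivisor.abs_apply hX _ he, PrimeDivisor.abs_apply hX _ (ht i),
    zpow_lt_zpow_iff_right₀ one_lt_two, neg_lt_neg_iff, htc] at h1
  have h2 := ordAt_add hX (P i) (φ := x) (ψ := t i - x) (by rw [add_sub_cancel]; exact ht i)
  rw [add_sub_cancel, htc] at h2
  have h4 := ordAt_add hX (P i) (φ := t i) (ψ := -(t i - x)) (by
    rw [neg_sub, add_sub_cancel]; exact hx0)
  rw [ordAt_neg, neg_sub, add_sub_cancel, htc] at h4
  omega

end

/-! ### Strict transforms, and principal divisors on models -/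

section

theorem IsWeakModel.exists_stalk_hom {Y X : Variety} {g : Y.sch ⟶ X.sch} (hg : IsWeakModel g)
    (y : Y.sch) : ∃ j : Y.sch.presheaf.stalk y →+* X.K, Function.Injective j ∧
      j.range = regularAt g y := by
  let e := RingEquiv.ofBijective (pullHom g hg.dom) hg.bij
  let a : Y.sch.presheaf.stalk y →+* Y.K := algebraMap (Y.sch.presheaf.stalk y) Y.K
  refine ⟨e.symm.toRingHom.comp a, e.symm.injective.comp
    (IsFractionRing.injective (Y.sch.presheaf.stalk y) Y.K), ?_⟩
  ext φ
  rw [regularAt_eq hg.dom, Subring.mem_comap]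
  constructor
  · rintro ⟨t, rfl⟩
    exact ⟨t, (e.apply_symm_apply (a t)).symm⟩
  · rintro ⟨t, ht⟩
    exact ⟨t, (congrArg e.symm ht).trans (e.symm_apply_apply φ)⟩

theorem coheight_eq_of_regularAt_eq {Y Y' X : Variety} {g : Y.sch ⟶ X.sch} {g' : Y'.sch ⟶ X.sch}
    (hg : IsWeakModel g) (hg' : IsWeakModel g') {y : Y.sch} {y' : Y'.sch}
    (h : regularAt g y = regularAt g' y') : Order.coheight y = Order.coheight y' := by
  obtain ⟨j, hj, hjr⟩ := hg.exists_stalk_hom y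
  obtain ⟨j', hj', hjr'⟩ := hg'.exists_stalk_hom y'
  let e (A : Type) [CommRing A] (j : A →+* X.K) (hj : Function.Injective j) : A ≃+* j.range :=
    RingEquiv.ofBijective j.rangeRestrict
      ⟨fun a b hab => hj (Subtype.ext_iff.1 hab), j.rangeRestrict_surjective⟩
  have h1 := ringKrullDim_eq_of_ringEquiv (((e _ j hj).trans
    (RingEquiv.subringCongr (hjr.trans (h.trans hjr'.symm)))).trans (e _ j' hj').symm)
  rw [ringKrullDim_stalk_eq_coheight, ringKrullDim_stalk_eq_coheight] at h1
  exact_mod_cast h1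

theorem regularAt_id {X : Variety} (x : X.sch) : regularAt (𝟙 X.sch) x = localSubring X x :=
  regularAt_openImmersion (𝟙 X.sch) x

/-- A prime divisor of a normal variety has exactly one strict transform on a model. -/
theorem exists_strictTransform {Y X : Variety} {g : Y.sch ⟶ X.sch} (hg : IsModel g)
    (hX : X.IsNormal) (P : PrimeDivisor X) : ∃ Q : PrimeDivisor Y, g Q.1 = P.1 ∧
      regularAt g Q.1 = localSubring X P.1 ∧ ∀ Q' : PrimeDivisor Y, g Q'.1 = P.1 → Q' = Q := by
  have hw := hg.isWeakModel
  obtain ⟨y, hy, hle⟩ := exists_center hg (IsWeakModel.id hX) P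
  rw [regularAt_id] at hle
  have hy' : g y = P.1 := hy
  have hreg : regularAt g y = localSubring X P.1 := by
    refine le_antisymm hle ?_
    rw [← hy']
    exact localSubring_le_regularAt hw.dom y
  have hc := coheight_eq_of_regularAt_eq hw (IsWeakModel.id hX) (hreg.trans (regularAt_id P.1).symm)
  refine ⟨⟨y, hc.trans P.2⟩, hy', hreg, fun Q' hQ' => ?_⟩
  refine PrimeDivisor.eq_of_specializes (specializes_of_localSubring_le fun φ hφ => ?_)
  obtain ⟨ψ, rfl⟩ := hw.bij.2 φ
  have h1 : ψ ∈ regularAt g y := by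
    rw [regularAt_eq hw.dom]
    exact hφ
  rw [hreg, ← hQ'] at h1
  have h2 := localSubring_le_regularAt hw.dom Q'.1 h1
  rwa [regularAt_eq hw.dom] at h2

/-- The divisor of a rational function. -/
def divisor {X : Variety} (φ : X.K) : RDivisor X :=
  Finsupp.ofSupportFinite (fun P => (ordAt P φ : ℝ)) <|
    (finite_ordAt_ne_zero φ).subset fun _ hP h => hP (Int.cast_eq_zero.2 h)

theorem divisor_apply {X : Variety} (φ : X.K) (P : PrimeDivisor X) : divisor φ P = ordAt P φ := rfl

theorem pushCoeff_divisor {Y X : Variety} {g : Y.sch ⟶ X.sch} (hg : IsModel g) (hX : X.IsNormal)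
    (ψ : X.K) (P : PrimeDivisor X) : pushCoeff g (divisor (pullFun g ψ)) P = ordAt P ψ := by
  obtain ⟨Q, hQ, hreg, hu⟩ := exists_strictTransform hg hX P
  have h1 : {Q' : PrimeDivisor Y | g Q'.1 = P.1} = {Q} :=
    Set.ext fun Q' => ⟨hu Q', fun h => (congrArg (fun Q' : PrimeDivisor Y => g Q'.1) h).trans hQ⟩
  have h2 : pushCoeff g (divisor (pullFun g ψ)) P =
      ∑ᶠ Q' ∈ {Q' : PrimeDivisor Y | g Q'.1 = P.1}, divisor (pullFun g ψ) Q' := rfl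
  rw [h2, h1, finsum_mem_singleton, divisor_apply, ordAt_pullFun_eq_of_regularAt_eq
    hg.isWeakModel (IsWeakModel.id hX) (hreg.trans (regularAt_id P.1).symm), pullFun_id]

theorem isBCartierOn_divisor {X : Variety} (hX : X.IsNormal) (V : X.sch.Opens) {φ : X.K}
    (hφ : φ ≠ 0) : IsBCartierOn V (divisor φ) := by
  have h1 : IsQCartierOn V (divisor φ) :=
    ⟨1, fun P => ordAt P φ, one_pos, isCartierOn_ordAt V hφ, fun P _ => by
      rw [Nat.cast_one, one_mul, divisor_apply]⟩
  refine ⟨h1, X, 𝟙 X.sch, fun P => ordAt P φ, isModel_id hX, isCartierOn_ordAt _ hφ, fun E hE => ?_⟩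
  exact pullCoeff_id hX h1.isRCartierOn E hE

section

variable {X : Variety} {J : ℕ} {ψ : Fin J → X.K} (hψ : ∀ j, ψ j ≠ 0) (c : Fin J → ℝ)

include hψ

theorem isDivNear_sum_ordAt (x : X.sch) :
    IsDivNear (fun P => ∑ j, c j * ordAt P (ψ j)) x
      (∑ j, c j • Finsupp.single (Units.mk0 (ψ j) (hψ j)) 1) :=
  IsDivNear.sum _ fun j _ =>
    (isDivNear_single (A := fun P => ordAt P (ψ j)) ⟨hψ j, ⊤, trivial, fun _ _ => rfl⟩).smul (c j)

theorem isRCartierOn_sum_ordAt (V : X.sch.Opens) :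
    IsRCartierOn V (fun P => ∑ j, c j * (ordAt P (ψ j) : ℝ)) :=
  IsRCartierOn.sum _ fun j _ => IsRCartierOn.smul
    (IsPrincipalOn.isRCartierOn ⟨ψ j, hψ j, fun _ _ => rfl⟩) (c j)

theorem pullCoeff_sum_ordAt {Y : Variety} {g : Y.sch ⟶ X.sch} (hX : X.IsNormal) (hg : IsWeakModel g)
    (E : PrimeDivisor Y) : pullCoeff g (fun P => ∑ j, c j * (ordAt P (ψ j) : ℝ)) E =
      ∑ j, c j * (ordAt E (pullFun g (ψ j)) : ℝ) := by
  rw [pullCoeff_eq hX hg.normal hg.dom (isDivNear_sum_ordAt hψ c _)]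
  simp [pullDiv]

/-- A global equation with all transition units equal to `1` exhibits zero as an admissible value.
Uniqueness is not needed: subtracting this value turns any value for `D` plus such a divisor into
one for `D`, which is enough for nefness and numerical triviality. -/
theorem CurveTo.hasIntersection_sum_ordAt (C : CurveTo X) :
    C.HasIntersection (fun P => ∑ j, c j * (ordAt P (ψ j) : ℝ)) 0 := by
  have h1 (j) : C.HasIntersection (fun P => (ordAt P (ψ j) : ℝ)) 0 := by
    refine ⟨⊤, 1, fun _ => 1, fun _ P => ordAt P (ψ j), fun _ => 0, fun _ => trivial,
      ⟨fun _ => isCartierOn_ordAt _ (hψ j), fun P _ => by simp⟩, fun _ => ?_, by simp⟩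
    refine ⟨ψ j, fun _ => 1, ⟨hψ j, ⊤, trivial, fun _ _ => rfl⟩, fun Q => ⟨isUnit_one, ?_⟩, ?_⟩
    · rw [map_one, one_mul]
      exact ⟨hψ j, ⊤, trivial, fun _ _ => rfl⟩
    · refine (finsum_eq_zero_of_forall_eq_zero fun Q => ?_).symm
      refine (congrArg (ordAt Q) (map_one _)).trans (ordAt_one Q)
  have h2 := CurveTo.HasIntersection.sum Finset.univ fun j (_ : j ∈ Finset.univ) => (h1 j).smul (c j)
  simpa using h2

theorem CurveTo.HasIntersection.of_add_sum_ordAt {C : CurveTo X} {D : PrimeDivisor X → ℝ} {t : ℝ}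
    (h : C.HasIntersection (fun P => D P + ∑ j, c j * (ordAt P (ψ j) : ℝ)) t) :
    C.HasIntersection D t := by
  have h1 := h.add ((CurveTo.hasIntersection_sum_ordAt hψ c C).smul (-1))
  rw [mul_zero, add_zero] at h1
  convert h1 using 2
  ring

theorem IsNefOver.add_sum_ordAt {Z : Variety} {q : X.sch ⟶ Z.sch} {W : Z.sch.Opens}
    {D : PrimeDivisor X → ℝ} (h : IsNefOver q W D) :
    IsNefOver q W (fun P => D P + ∑ j, c j * (ordAt P (ψ j) : ℝ)) :=
  ⟨h.1.add (isRCartierOn_sum_ordAt hψ c _), fun C hC t ht => h.2 C hC t (ht.of_add_sum_ordAt hψ c)⟩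

theorem IsNumTrivialOver.add_sum_ordAt {Z : Variety} {q : X.sch ⟶ Z.sch} {W : Z.sch.Opens}
    {D : PrimeDivisor X → ℝ} (h : IsNumTrivialOver q W D) :
    IsNumTrivialOver q W (fun P => D P + ∑ j, c j * (ordAt P (ψ j) : ℝ)) :=
  ⟨h.1.add (isRCartierOn_sum_ordAt hψ c _), fun C hC t ht => h.2 C hC t (ht.of_add_sum_ordAt hψ c)⟩

end

end

/-! ### Twisting the nef parts by principal divisors -/

section

theorem ordAt_prod_zpow {X : Variety} (P : PrimeDivisor X) {ι : Type*} (s : Finset ι)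
    {ψ : ι → X.K} (hψ : ∀ j, ψ j ≠ 0) (y : ι → ℤ) :
    ordAt P (∏ j ∈ s, ψ j ^ y j) = ∑ j ∈ s, y j * ordAt P (ψ j) := by
  have h1 (j) : ordAt P (ψ j ^ y j) = y j * ordAt P (ψ j) := by
    have h2 := congrArg Multiplicative.toAdd (map_zpow (ordHom P) (Units.mk0 (ψ j) (hψ j)) (y j))
    simpa [ordHom] using h2
  classical
  induction s using Finset.induction_on with
  | empty => simp
  | insert i s hi ih =>
    rw [Finset.prod_insert hi, Finset.sum_insert hi, ordAt_mul P (zpow_ne_zero _ (hψ i))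
      (Finset.prod_ne_zero_iff.2 fun j _ => zpow_ne_zero _ (hψ j)), ih, h1]

namespace Data

/-- Replace every `M'_j` by the linearly equivalent divisor `M'_j + div(ψ_j)`. -/
abbrev twist (𝒟 : Data) (ψ : Fin 𝒟.J → 𝒟.X.K) : Data :=
  { 𝒟 with M' := fun j => 𝒟.M' j + divisor (pullFun 𝒟.f (ψ j)) }

section

variable (𝒟 : Data) {ψ : Fin 𝒟.J → 𝒟.X.K} (hψ : ∀ j, ψ j ≠ 0) (B : RDivisor 𝒟.X)
  (μ : Fin 𝒟.J → ℝ)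

theorem nefPart_twist (Q : PrimeDivisor 𝒟.X') : (𝒟.twist ψ).nefPart μ Q =
    𝒟.nefPart μ Q + ∑ j, μ j * (ordAt Q (pullFun 𝒟.f (ψ j)) : ℝ) := by
  rw [nefPart_apply, nefPart_apply, ← Finset.sum_add_distrib]
  refine Finset.sum_congr rfl fun j _ => ?_
  rw [Finsupp.add_apply, divisor_apply, mul_add]

theorem adjoint_twist (P : PrimeDivisor 𝒟.X) : (𝒟.twist ψ).adjoint B μ P =
    𝒟.adjoint B μ P + ∑ j, μ j * (ordAt P (ψ j) : ℝ) := by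
  have h1 : (𝒟.twist ψ).nefPart μ = 𝒟.nefPart μ + ∑ j, μ j • divisor (pullFun 𝒟.f (ψ j)) := by
    simp only [nefPart, smul_add, Finset.sum_add_distrib]
  have h2 : pushCoeff 𝒟.f ((𝒟.twist ψ).nefPart μ) P =
      pushCoeff 𝒟.f (𝒟.nefPart μ) P + ∑ j, μ j * (ordAt P (ψ j) : ℝ) := by
    classical
    have h3 := pushCoeff_sum 𝒟.f P Finset.univ μ fun j => divisor (pullFun 𝒟.f (ψ j))
    simp only [pushCoeff_divisor 𝒟.f_model 𝒟.X_normal] at h3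
    rw [h1, ← h3]
    simp only [pushCoeff_eq_linearCombination, map_add]
  refine (congrArg (_ + ·) h2).trans ?_
  exact (add_assoc _ _ _).symm

include hψ

theorem pullFun_ne_zero_of_twist (j : Fin 𝒟.J) : pullFun 𝒟.f (ψ j) ≠ 0 :=
  pullFun_ne_zero 𝒟.f_model.isWeakModel.dom (hψ j)

theorem pullCoeff_nefPart_twist {Y : Variety} {h : Y.sch ⟶ 𝒟.X'.sch} (hh : IsWeakModel h)
    {E : PrimeDivisor Y} {V' : 𝒟.X'.sch.Opens} (hE' : h E.1 ∈ V')
    (hN : IsRCartierOn V' (𝒟.nefPart μ)) :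
    pullCoeff h ((𝒟.twist ψ).nefPart μ) E = pullCoeff h (𝒟.nefPart μ) E +
      ∑ j, μ j * (ordAt E (pullFun (h ≫ 𝒟.f) (ψ j)) : ℝ) := by
  have hf := 𝒟.f_model.isWeakModel
  have hψ' := 𝒟.pullFun_ne_zero_of_twist hψ
  obtain ⟨α, hα⟩ := hN.exists_isDivNear hE'
  have h1 := pullCoeff_add hf.normal hh.normal hh.dom hα (isDivNear_sum_ordAt hψ' μ _)
  rw [pullCoeff_sum_ordAt hψ' μ hf.normal hh] at h1
  refine (congrArg (pullCoeff h · E) (funext (𝒟.nefPart_twist μ))).trans (h1.trans ?_)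
  refine congrArg _ (Finset.sum_congr rfl fun j _ => ?_)
  rw [pullFun_eq hf.dom, pullFun_eq hh.dom, pullFun_eq (hh.dom.comp hf.dom),
    pullHom_comp hh.dom hf.dom]

/-- The pull backs of the nef part and of the adjoint divisor change by the same number `∑ μ j *
ord_E (ψ j)`, and they enter with opposite signs. -/
theorem logDiscrepancy_twist {Y : Variety} {h : Y.sch ⟶ 𝒟.X'.sch} (hh : IsWeakModel h)
    {E : PrimeDivisor Y} {V : 𝒟.X.sch.Opens} {V' : 𝒟.X'.sch.Opens} (hE : 𝒟.f (h E.1) ∈ V)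
    (hE' : h E.1 ∈ V') (hN : IsRCartierOn V' (𝒟.nefPart μ))
    (hA : IsRCartierOn V (𝒟.adjoint B μ)) :
    (𝒟.twist ψ).logDiscrepancy B μ h E = 𝒟.logDiscrepancy B μ h E := by
  have hf := hh.comp 𝒟.f_model.isWeakModel
  obtain ⟨α, hα⟩ := hA.exists_isDivNear (x := (h ≫ 𝒟.f) E.1) (by
    rw [Scheme.Hom.comp_apply]; exact hE)
  have h1 := pullCoeff_add 𝒟.X_normal hh.normal hf.dom hα (isDivNear_sum_ordAt hψ μ _)
  rw [pullCoeff_sum_ordAt hψ μ 𝒟.X_normal hf] at h1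
  have h2 := (congrArg (pullCoeff (h ≫ 𝒟.f) · E) (funext (𝒟.adjoint_twist B μ (ψ := ψ)))).trans h1
  have h3 := 𝒟.pullCoeff_nefPart_twist hψ μ hh hE' hN
  simp only [logDiscrepancy]
  linear_combination h3 - h2

end

section

variable {𝒟 : Data} {ψ : Fin 𝒟.J → 𝒟.X.K} (hψ : ∀ j, ψ j ≠ 0) {B : RDivisor 𝒟.X}
  {μ : Fin 𝒟.J → ℝ} {W : 𝒟.Z.sch.Opens}

include hψ

theorem IsGenPairOver.twist (h : 𝒟.IsGenPairOver W B μ) : (𝒟.twist ψ).IsGenPairOver W B μ := by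
  refine ⟨h.1, h.2.1, ?_, ?_⟩
  · have h1 := h.2.2.1.add_sum_ordAt (𝒟.pullFun_ne_zero_of_twist hψ) μ
    rwa [← funext (𝒟.nefPart_twist μ)] at h1
  · have h1 := h.2.2.2.add (isRCartierOn_sum_ordAt hψ μ _)
    rwa [← funext (𝒟.adjoint_twist B μ)] at h1

theorem IsGenEpsLCOver.twist {e : ℝ} (h : 𝒟.IsGenEpsLCOver W e B μ) :
    (𝒟.twist ψ).IsGenEpsLCOver W e B μ := by
  refine ⟨h.1.twist hψ, fun Y k hk E hE => ?_⟩
  have h1 := 𝒟.logDiscrepancy_twist hψ B μ hk.isWeakModel (E := E) (V := 𝒟.π ⁻¹ᵁ W)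
    (V' := 𝒟.πf ⁻¹ᵁ W) hE hE h.1.2.2.1.1 h.1.2.2.2
  rw [h1]
  exact h.2 Y k hk E hE

theorem IsRComplement.twist {z : 𝒟.Z.sch} {ε : ℝ} {Bp : RDivisor 𝒟.X} {μp : Fin 𝒟.J → ℝ}
    (h : 𝒟.IsRComplement z ε B μ Bp μp) : (𝒟.twist ψ).IsRComplement z ε B μ Bp μp := by
  obtain ⟨W, hz, h₀, hε, hB, hμ, hn⟩ := h
  refine ⟨W, hz, h₀.twist hψ, hε.twist hψ, hB, hμ, ?_⟩
  have h1 := hn.add_sum_ordAt hψ μp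
  rwa [← funext (𝒟.adjoint_twist Bp μp)] at h1

theorem HasBCartierNefParts.twist (h : 𝒟.HasBCartierNefParts) :
    (𝒟.twist ψ).HasBCartierNefParts := by
  intro j
  have hψ' := 𝒟.pullFun_ne_zero_of_twist hψ
  refine ⟨(h j).1.add 𝒟.f_model.normal (isBCartierOn_divisor 𝒟.f_model.normal _ (hψ' j)), ?_⟩
  have h1 := (h j).2.add_sum_ordAt (fun _ : Fin 1 => hψ' j) (fun _ => 1)
  have h2 : (fun P => 𝒟.M' j P + ∑ _ : Fin 1, (1 : ℝ) * (ordAt P (pullFun 𝒟.f (ψ j)) : ℝ)) =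
      ((𝒟.twist ψ).M' j : PrimeDivisor 𝒟.X' → ℝ) := by
    funext P
    rw [Fin.sum_univ_one, one_mul, Finsupp.add_apply, divisor_apply]
  rwa [h2] at h1

theorem IsFanoTypePair.twist {d : ℕ} {Γ : Set ℝ} (h : 𝒟.IsFanoTypePair d Γ B μ) :
    (𝒟.twist ψ).IsFanoTypePair d Γ B μ := by
  obtain ⟨h1, h2, h3, h4, h5, h6⟩ := h
  exact ⟨h1, h2, h3.twist hψ, h4, h5.twist hψ, h6⟩

/-- Undoing the twist changes `n (K + B + M)` by `∑ n * μ j * div (ψ j)`. For integral `n * μ j`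
this is the divisor of a product of powers, so principality survives, as does integrality of the nef
part on every model. -/
theorem IsPreComplement.of_twist {e : ℝ} {n : ℕ} (hn : 0 < n) (hM : 𝒟.HasBCartierNefParts)
    (h : (𝒟.twist ψ).IsPreComplement W e n B μ) (hμ : ∀ j, ∃ y : ℤ, (n : ℝ) * μ j = y) :
    𝒟.IsPreComplement W e n B μ := by
  choose y hy using hμ
  have hN := 𝒟.isRCartierOn_nefPart hM μ
  have hp : IsPrincipalOn (𝒟.π ⁻¹ᵁ W) (fun P => (n : ℝ) * 𝒟.adjoint B μ P) := by
    obtain ⟨φ, hφ, h1⟩ := h.principal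
    refine ⟨φ * ∏ j, ψ j ^ (- y j), mul_ne_zero hφ (Finset.prod_ne_zero_iff.2 fun j _ =>
      zpow_ne_zero _ (hψ j)), fun P hP => ?_⟩
    have h2 : (n : ℝ) * (𝒟.adjoint B μ P + ∑ j, μ j * (ordAt P (ψ j) : ℝ)) = ordAt P φ :=
      (congrArg _ (𝒟.adjoint_twist B μ P)).symm.trans (h1 P hP)
    rw [ordAt_mul P hφ (Finset.prod_ne_zero_iff.2 fun j _ => zpow_ne_zero _ (hψ j)),
      ordAt_prod_zpow P _ hψ]
    push_cast
    rw [← h2, mul_add, Finset.mul_sum]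
    simp only [← mul_assoc, hy, neg_mul, Finset.sum_neg_distrib]
    ring
  have hA := hp.isRCartierOn_of_mul hn
  refine ⟨h.nonneg, h.coeff_nonneg, hp, fun Y k hk E hE => ?_, fun Y k hk E hE => ?_⟩
  · have h1 := 𝒟.logDiscrepancy_twist hψ B μ hk.isWeakModel (E := E) (V := 𝒟.π ⁻¹ᵁ W)
      (V' := ⊤) hE trivial hN hA
    rw [← h1]
    exact h.le_logDiscrepancy Y k hk E hE
  · obtain ⟨m, hm⟩ := h.integral Y k hk E hE
    have h1 := 𝒟.pullCoeff_nefPart_twist hψ μ hk.isWeakModel (E := E) (V' := ⊤) trivial hN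
    refine ⟨m - ∑ j, y j * ordAt E (pullFun (k ≫ 𝒟.f) (ψ j)), ?_⟩
    rw [h1, mul_add, Finset.mul_sum] at hm
    simp only [← mul_assoc, hy] at hm
    push_cast
    linear_combination hm

end

end Data

end

/-! ### Integrality of the nef coefficients after a twist -/

theorem pushCoeff_congr {Y X : Variety} {f : Y.sch ⟶ X.sch} {D D' : RDivisor Y}
    {P : PrimeDivisor X} (h : ∀ Q : PrimeDivisor Y, f Q.1 = P.1 → D Q = D' Q) :
    pushCoeff f D P = pushCoeff f D' P :=
  finsum_congr fun Q => finsum_congr fun hQ => h Q hQ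

namespace Data

theorem IsPreComplement.congr_nefPart {𝒟 : Data} {W : 𝒟.Z.sch.Opens} {e : ℝ} {n : ℕ}
    {B : RDivisor 𝒟.X} {μ μ' : Fin 𝒟.J → ℝ} (h : 𝒟.IsPreComplement W e n B μ)
    (hμ' : ∀ j, 0 ≤ μ' j)
    (hμ : ∀ Q : PrimeDivisor 𝒟.X', 𝒟.πf Q.1 ∈ W → 𝒟.nefPart μ Q = 𝒟.nefPart μ' Q) :
    𝒟.IsPreComplement W e n B μ' := by
  have h1 (P : PrimeDivisor 𝒟.X) (hP : 𝒟.π P.1 ∈ W) : 𝒟.adjoint B μ P = 𝒟.adjoint B μ' P := by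
    refine congrArg (_ + ·) (pushCoeff_congr fun Q hQ => hμ Q ?_)
    rwa [πf, Scheme.Hom.comp_apply, hQ]
  have h2 (Y : Variety) (k : Y.sch ⟶ 𝒟.X'.sch) (E : PrimeDivisor Y) (hE : 𝒟.πf (k E.1) ∈ W) :
      pullCoeff k (𝒟.nefPart μ) E = pullCoeff k (𝒟.nefPart μ') E :=
    pullCoeff_congr (V := 𝒟.πf ⁻¹ᵁ W) hE hμ
  refine ⟨h.nonneg, hμ', ?_, fun Y k hk E hE => ?_, fun Y k hk E hE => ?_⟩
  · obtain ⟨φ, hφ, h3⟩ := h.principal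
    exact ⟨φ, hφ, fun P hP => (congrArg ((n : ℝ) * ·) (h1 P hP).symm).trans (h3 P hP)⟩
  · have h3 : pullCoeff (k ≫ 𝒟.f) (𝒟.adjoint B μ) E = pullCoeff (k ≫ 𝒟.f) (𝒟.adjoint B μ') E :=
      pullCoeff_congr (V := 𝒟.π ⁻¹ᵁ W) (by rw [Scheme.Hom.comp_apply]; exact hE) h1
    have h4 : 𝒟.logDiscrepancy B μ k E = 𝒟.logDiscrepancy B μ' k E := by
      rw [logDiscrepancy, h2 Y k E hE, h3]; rfl
    rw [← h4]
    exact h.le_logDiscrepancy Y k hk E hE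
  · rw [← h2 Y k E hE]
    exact h.integral Y k hk E hE

theorem exists_forall_ordAt_pullFun_eq (𝒟 : Data) {ι : Type} [Finite ι]
    {P : ι → PrimeDivisor 𝒟.X'} (hP : Function.Injective P) (c : ι → ℤ) :
    ∃ ψ : 𝒟.X.K, ψ ≠ 0 ∧ ∀ i, ordAt (P i) (pullFun 𝒟.f ψ) = c i := by
  obtain ⟨φ, hφ, h⟩ := exists_forall_ordAt_eq 𝒟.f_model.normal hP c
  obtain ⟨ψ, rfl⟩ := 𝒟.f_model.isWeakModel.bij.2 φ
  refine ⟨ψ, fun h0 => hφ (by rw [h0, map_zero]), fun i => ?_⟩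
  rw [pullFun_eq 𝒟.f_model.isWeakModel.dom]
  exact h i

/-- After a suitable twist, either the coefficients of the nef part of a pre-complement are
integral up to the index, or these coefficients do not matter. -/
theorem exists_twist (𝒟 : Data) (hM : 𝒟.HasBCartierNefParts) (z : 𝒟.Z.sch) :
    ∃ ψ : Fin 𝒟.J → 𝒟.X.K, (∀ j, ψ j ≠ 0) ∧
      ((∀ (W : 𝒟.Z.sch.Opens) (e : ℝ) (n : ℕ) (B : RDivisor 𝒟.X) (μ : Fin 𝒟.J → ℝ), z ∈ W →
        (𝒟.twist ψ).IsPreComplement W e n B μ → ∀ j, ∃ y : ℤ, (n : ℝ) * μ j = y) ∨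
      ∃ W₀ : 𝒟.Z.sch.Opens, z ∈ W₀ ∧ ∀ (W : 𝒟.Z.sch.Opens) (e : ℝ) (n : ℕ) (B : RDivisor 𝒟.X)
        (μ : Fin 𝒟.J → ℝ), W ≤ W₀ → (𝒟.twist ψ).IsPreComplement W e n B μ →
          (𝒟.twist ψ).IsPreComplement W e n B 1) := by
  classical
  have hint (j) (Q : PrimeDivisor 𝒟.X') : ∃ m : ℤ, 𝒟.M' j Q = m := by
    obtain ⟨m, hm⟩ := (hM j).1.exists_pullCoeff_eq 𝒟.f_model.normal
      (IsWeakModel.id 𝒟.f_model.normal) Q trivial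
    exact ⟨m, by rwa [pullCoeff_id 𝒟.f_model.normal (hM j).1.1.isRCartierOn Q trivial] at hm⟩
  choose m hm using hint
  -- The prime divisors of `X'` that lie over every neighbourhood of `z`.
  let T : Set (PrimeDivisor 𝒟.X') := {Q | 𝒟.πf Q.1 ⤳ z}
  by_cases hT : ∃ P : Fin 𝒟.J → T, Function.Injective P
  · obtain ⟨P, hP⟩ := hT
    -- The orders are chosen so that the twisted `M' j` has coefficient `1` at `P j` and `0` at the
    -- other `P l`. Then `n * μ l` is the coefficient of `n * M'` at `P l`, which is integral for a
    -- pre-complement.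
    choose ψ hψ h1 using fun j => 𝒟.exists_forall_ordAt_pullFun_eq
      (Subtype.val_injective.comp hP) fun l => (if j = l then 1 else 0) - m j (P l).1
    refine ⟨ψ, hψ, Or.inl fun W e n B μ hz h l => ?_⟩
    obtain ⟨y, hy⟩ := h.exists_int_nefPart (hM.twist hψ) (Q := (P l).1) ((P l).2.mem_open W.isOpen hz)
    refine ⟨y, ?_⟩
    rw [← hy]
    congr 1
    rw [nefPart_apply]
    have h2 (j) : (𝒟.twist ψ).M' j (P l).1 = if j = l then 1 else 0 := by
      have h3 : ordAt (P l).1 (pullFun 𝒟.f (ψ j)) = (if j = l then 1 else 0) - m j (P l).1 := h1 j l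
      rw [Finsupp.add_apply, divisor_apply, h3, hm]
      push_cast
      ring
    simp only [h2, mul_ite, mul_one, mul_zero, Finset.sum_ite_eq', Finset.mem_univ, if_true]
  -- With fewer than `J` prime divisors available, `T` is finite, so each `M' j` can be twisted to
  -- vanish along all of `T`.
  · have hfin : Finite T := by
      by_contra h
      have : Infinite T := not_finite_iff_infinite.1 h
      exact hT ⟨fun j => Infinite.natEmbedding T j,
        (Infinite.natEmbedding T).injective.comp Fin.val_injective⟩
    choose ψ hψ h1 using fun j => 𝒟.exists_forall_ordAt_pullFun_eq
      (Subtype.val_injective (p := (· ∈ T))) fun Q => - m j Q.1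
    have h2 (j) (Q : PrimeDivisor 𝒟.X') (hQ : 𝒟.πf Q.1 ⤳ z) : (𝒟.twist ψ).M' j Q = 0 := by
      rw [Finsupp.add_apply, divisor_apply, h1 j ⟨Q, hQ⟩, hm]
      push_cast
      ring
    -- The remaining finitely many components of the twisted divisors do not lie over
    -- generalizations of `z`, so a neighbourhood of `z` avoids them. Over it the nef part is zero
    -- for every `μ`.
    have h3 (Q : PrimeDivisor 𝒟.X') : ∃ U : 𝒟.Z.sch.Opens, z ∈ U ∧
        ∀ j, (𝒟.twist ψ).M' j Q ≠ 0 → 𝒟.πf Q.1 ∉ U := by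
      by_cases hQ : 𝒟.πf Q.1 ⤳ z
      · exact ⟨⊤, trivial, fun j hj => (hj (h2 j Q hQ)).elim⟩
      · rw [specializes_iff_forall_open] at hQ
        push Not at hQ
        obtain ⟨U, hU, hz, hQU⟩ := hQ
        exact ⟨⟨U, hU⟩, hz, fun _ _ => hQU⟩
    choose U hU hQU using h3
    let s := Finset.univ.biUnion fun j => ((𝒟.twist ψ).M' j).support
    refine ⟨ψ, hψ, Or.inr ⟨⟨⋂ Q ∈ s, U Q, isOpen_biInter_finset fun Q _ => (U Q).isOpen⟩,
      Set.mem_iInter₂.2 fun Q _ => hU Q, fun W e n B μ hW h => ?_⟩⟩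
    have h4 (j) (Q : PrimeDivisor 𝒟.X') (hQ : 𝒟.πf Q.1 ∈ W) : (𝒟.twist ψ).M' j Q = 0 := by
      by_contra hne
      refine hQU Q j hne (Set.mem_iInter₂.1 (hW hQ) Q ?_)
      exact Finset.mem_biUnion.2 ⟨j, Finset.mem_univ j, Finsupp.mem_support_iff.2 hne⟩
    refine h.congr_nefPart (fun _ => zero_le_one) fun Q hQ => ?_
    rw [nefPart_apply, nefPart_apply]
    exact Finset.sum_congr rfl fun j _ => by rw [h4 j Q hQ, mul_zero, mul_zero]

end Data

/-! ### The implication between the conjectures -/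

theorem complementConjecture_of_decomposableComplementConjecture {d : ℕ} {ε : ℝ} (hε : 0 ≤ ε)
    {Γ : Set ℝ} (hΓ : Γ ⊆ Set.Icc 0 1) (h : DecomposableComplementConjecture d ε Γ) {p : ℕ}
    (hp : 0 < p) : ComplementConjecture d p ε Γ := by
  obtain ⟨n₀, S, Γ₀, hn₀, -, hΓ₀, -, H⟩ := h
  obtain ⟨n, β, hn, hpn, -, hβ, hβ'⟩ := exists_coefficients ε hε Γ hΓ Γ₀ hΓ₀ hn₀ hp
  refine ⟨n, hn, hpn, fun 𝒟 B μ hD z hz => ?_⟩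
  have hM := hD.2.2.2.2.1
  obtain ⟨ψ, hψ, hcase⟩ := 𝒟.exists_twist hM z
  have hz' : (𝒟.twist ψ).IsRComplementary z ε B μ := by
    obtain ⟨Bp, μp, h1⟩ := hz
    exact ⟨Bp, μp, h1.twist hψ⟩
  obtain ⟨W, k, a, e, Bi, μi, hzW, ha, hsum, he, hpre, hB, hμ⟩ :=
    Data.exists_isPreComplement (S := S) (Γ₀ := Γ₀) hn₀ (fun 𝒟 B μ h1 h2 z => by
      obtain ⟨Bp, μp, h3, -⟩ := H 𝒟 B μ h1 h2 z
      exact ⟨Bp, μp, h3⟩) (hD.twist hψ) hz'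
  obtain ⟨hβ1, hab⟩ := hβ' a ha hsum
  rcases hcase with hint | ⟨W₀, hzW₀, hone⟩
  · have hint' (i) := hint W (e i) n₀ (Bi i) (μi i) hzW (hpre i)
    exact Data.exists_isNComplement_of_isPreComplement hΓ hD hε hn hn₀ hzW
      (fun i => (hΓ₀ _ (ha i)).1.le) (fun i => (hβ _ (ha i)).1) (fun i => (hβ _ (ha i)).2) hβ1 hab
      (fun i => (hpre i).of_twist hψ hn₀ hM (hint' i)) hint' he hB hμ
  -- The nef coefficients of the pieces do not matter here, and all are replaced by `1`. This value
  -- is integral, and it is at least every `μ j`, since `Γ` lies in the unit interval.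
  · have hint' (i : Fin k) (j : Fin 𝒟.J) : ∃ y : ℤ, (n₀ : ℝ) * (1 : Fin 𝒟.J → ℝ) j = y :=
      ⟨n₀, by simp⟩
    refine Data.exists_isNComplement_of_isPreComplement (W := W ⊓ W₀) hΓ hD hε hn hn₀ ⟨hzW, hzW₀⟩
      (fun i => (hΓ₀ _ (ha i)).1.le) (fun i => (hβ _ (ha i)).1) (fun i => (hβ _ (ha i)).2) hβ1 hab
      (fun i => (hone (W ⊓ W₀) (e i) n₀ (Bi i) (μi i) inf_le_right
        ((hpre i).mono inf_le_left)).of_twist hψ hn₀ hM (hint' i)) hint' he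
      (fun P hP => hB P hP.1) fun j => ?_
    simp only [Pi.one_apply, mul_one, hsum]
    exact (hΓ (hD.2.2.2.2.2 j)).2

end GenPair

end

theorem mainTheorem8 (d : ℕ) (hd : 0 < d) (ε : ℝ) (hε : 0 ≤ ε) (Γ : Set ℝ)
    (hΓ : Γ ⊆ Set.Icc 0 1) (hDCC : Γ.IsWF)
    (h : GenPair.DecomposableComplementConjecture d ε Γ) (p : ℕ) (hp : 0 < p) :
    GenPair.ComplementConjecture d p ε Γ := by
  exact GenPair.complementConjecture_of_decomposableComplementConjecture hε hΓ h hp
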